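/- **Setting.** Let $n\ge 1$, $0<A<B$, $D>0$, $\Omega=\{\mathbf x\in\mathbb R^n: A<x_1<B,\ |x_j|<D,\ j=2,\dots,n\}$, $\Gamma_0=\{x_1=B,\ |x_j|<D,\ j\ge 2\}\subset\partial\Omega$, $m_n=[n/2]+2$. Let $\varepsilon>0$, $k\ge 3$, $h>0$, $t_i=\varepsilon+ih$ $(0\le i\le k)$, $T=t_k$, and $$w(\mathbf x,\varepsilon)=-\frac{|\mathbf x|^2}{4\varepsilon}-\ln\left(2\sqrt{\pi\varepsilon}\right)^n .$$ For $y=(y_0,\dots,y_k)$ put $\partial_t^h y_i=(y_{i+1}-y_i)/h$ for $i\le k-1$ and $\partial^h_t y_k=(3y_k-y_{k-1}-y_{k-2}-y_{k-3})/(6h)$. For a vector function $V=(v_0,\dots,v_k)$ on $\Omega$ let $$L_0(V)=\Delta v_0+2\nabla v_0\cdot\nabla w(\cdot,\varepsilon)-\partial_t^h v_0,$$ $$L_i(V)=\Delta v_i+2\nabla v_i\cdot\nabla w(\cdot,\varepsilon)+2h\nabla v_i\cdot\sum_{j=0}^i\nabla v_j-\partial_t^h v_i,\quad 1\le i\le k.$$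 The norm of $H^m_{k+1}(\Omega)$ is $\|V\|_{H^m_{k+1}(\Omega)}=\left(\sum_{i=0}^k\|v_i\|^2_{H^m(\Omega)}\right)^{1/2}$. Given boundary data $g_0(\mathbf x,t_i)$, $g_1(\mathbf x,t_i)$ and $R>0$, let $B(R)$ be the set of all $V\in H^{m_n}_{k+1}(\Omega)$ such that for all $i$ $$\|v_i\|_{H^{m_n}(\Omega)}<R,\qquad v_i=\partial_t^h g_0(\cdot,t_i)\ \text{on }\partial\Omega,\qquad \partial_{x_1}v_i=\partial_t^h g_1(\cdot,t_i)\ \text{on }\Gamma_0$$ (boundary values are those of the $C^1(\overline\Omega)$ representative), and let $\overline{B(R)}$ be its closure in $H^{m_n}_{k+1}(\Omega)$. For $c>0$, $\lambda\geq 1$, $\alpha\in(0,1)$ define on $\overline{B(R)}$ $$J_{\lambda,\alpha}(V)=e^{-2\lambda c}\sum_{i=0}^{k}\int_\Omega [L_i(V)]^2e^{2\lambda x_1^2}\,d\mathbf x+\alpha\|V\|^2_{H^{m_n}_{k+1}(\Omega)} .$$ To $V$ associate $w_V(\mathbf x,t_i)=h\sum_{j=0}^i v_j(\mathbf x)+w(\mathbf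 x,\varepsilon)$ and the reconstructed coefficient $$a_V(\mathbf x)=\frac{w_V(\mathbf x,t_k)-w(\mathbf x,\varepsilon)}{T-\varepsilon}-\frac1{T-\varepsilon}\sum_{i=0}^k\left(\Delta w_V(\mathbf x,t_i)+|\nabla w_V(\mathbf x,t_i)|^2\right).$$ **Theorem 5.3.** Fix $\Omega$ and $\varepsilon$ as above. For all $R>0$, $\alpha\in(0,1)$, $h>0$, $k\ge3$ there are numbers $\lambda_1=\lambda_1(R,\alpha,h,k)\ge 1$ and $C_1=C_1(R,\alpha,h,k)>0$ such that the following holds for all $c>0$ and all (noiseless) boundary data $g_0,g_1$. Suppose that $V^*\in B(R)$ satisfies $L_i(V^*)=0$ a.e. in $\Omega$ for $i=0,\dots,k$, and let $a^*=a_{V^*}$. Then for every $\lambda\ge\lambda_1$ the functional $J_{\lambda,\alpha}$ has a unique minimizer $V_{\min,\lambda}$ on $\overline{B(R)}$, and $$\|V_{\min,\lambda}-V^*\|_{H^2_{k+1}(\Omega)}\le C_1\sqrt{\lambda\alpha}\,e^{-\lambda(A^2-c)},$$ $$\|a_{V_{\min,\lambda}}-a^*\|_{L_2(\Omega)}\le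 C_1\sqrt{\lambda\alpha}\,e^{-\lambda(A^2-c)},$$ where in particular $a_{V_{\min,\lambda}}-a^*\in L_2(\Omega)$. -/

import Mathlib

open MeasureTheory Set
open scoped ContDiff

noncomputable section

namespace Cip

/-- The ambient Euclidean space. The coordinate called `x₁` on paper is `x 0` here. -/
abbrev Pt (n : ℕ) := EuclideanSpace ℝ (Fin n)

section Sobolev

variable {n : ℕ}

/-- Classical partial derivative in the `i`-th coordinate. -/
def pderiv (i : Fin n) (φ : Pt n → ℝ) : Pt n → ℝ :=
  fun x => fderiv ℝ φ x (EuclideanSpace.single i 1)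

/-- Classical mixed derivative of multi-index `β`: `β i` derivatives in the `i`-th coordinate. -/
def multiDeriv (β : Fin n → ℕ) (φ : Pt n → ℝ) : Pt n → ℝ :=
  (List.finRange n).foldr (fun i ψ => (pderiv i)^[β i] ψ) φ

/-- Test functions: smooth, with compact support inside `Ω`. -/
structure IsTest (Ω : Set (Pt n)) (φ : Pt n → ℝ) : Prop where
  smooth : ContDiff ℝ ∞ φ
  compact : HasCompactSupport φ
  supp : tsupport φ ⊆ Ω

/-- `g` is a square integrable weak derivative of `f` on `Ω`, of multi-index `β`. -/
def IsWeakDeriv (Ω : Set (Pt n)) (β : Fin n → ℕ) (f g : Pt n → ℝ) : Prop :=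
  MemLp g 2 (volume.restrict Ω) ∧
    ∀ φ : Pt n → ℝ, IsTest Ω φ →
      ∫ x in Ω, f x * multiDeriv β φ x = (-1) ^ (∑ i, β i) * ∫ x in Ω, g x * φ x

open Classical in
/-- The weak derivative of `f` of multi-index `β` (unique almost everywhere on an open `Ω`),
with value `0` if there is none in `L²(Ω)`. -/
def weakDeriv (Ω : Set (Pt n)) (β : Fin n → ℕ) (f : Pt n → ℝ) : Pt n → ℝ :=
  if hex : ∃ g, IsWeakDeriv Ω β f g then hex.choose else 0

/-- First order weak derivative in the `i`-th coordinate. -/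
def wpd (Ω : Set (Pt n)) (i : Fin n) (f : Pt n → ℝ) : Pt n → ℝ :=
  weakDeriv Ω (Pi.single i 1) f

/-- The weak Laplacian. -/
def wlap (Ω : Set (Pt n)) (f : Pt n → ℝ) : Pt n → ℝ :=
  fun x => ∑ i, weakDeriv Ω (Pi.single i 2) f x

/-- Membership in the Sobolev space `H^m(Ω)`. -/
def MemSobolev (Ω : Set (Pt n)) (m : ℕ) (f : Pt n → ℝ) : Prop :=
  MemLp f 2 (volume.restrict Ω) ∧ ∀ β : Fin n → ℕ, ∑ i, β i ≤ m → ∃ g, IsWeakDeriv Ω β f g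

/-- The square of the norm of `H^m(Ω)`: the sum over all multi-indices `β` of order at most `m`
of the squared `L²` norms of the weak derivatives. -/
def sobolevNormSq (Ω : Set (Pt n)) (m : ℕ) (f : Pt n → ℝ) : ℝ :=
  ∑ j ∈ Finset.range (m + 1), ∑ β ∈ Finset.piAntidiag (Finset.univ : Finset (Fin n)) j,
    ∫ x in Ω, (weakDeriv Ω β f x) ^ 2

/-- The norm of `H^m(Ω)`. -/
def sobolevNorm (Ω : Set (Pt n)) (m : ℕ) (f : Pt n → ℝ) : ℝ :=
  Real.sqrt (sobolevNormSq Ω m f)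

/-- The norm of `H^m_{k+1}(Ω)`, the space of vector functions with `k + 1` components
in `H^m(Ω)`. -/
def vecSobolevNorm (Ω : Set (Pt n)) (m : ℕ) {k : ℕ} (V : Fin (k + 1) → Pt n → ℝ) : ℝ :=
  Real.sqrt (∑ i, sobolevNorm Ω m (V i) ^ 2)

/-- The norm of `L²(Ω)`. -/
def l2Norm (Ω : Set (Pt n)) (f : Pt n → ℝ) : ℝ :=
  Real.sqrt (∫ x in Ω, (f x) ^ 2)

/-- `f` restricted to `S` equals `b`, in the sense of the (unique) representative of `f` that is
continuous up to the boundary of `Ω`. -/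
def HasTrace (Ω S : Set (Pt n)) (f b : Pt n → ℝ) : Prop :=
  ∃ u : Pt n → ℝ, ContinuousOn u (closure Ω) ∧ f =ᵐ[volume.restrict Ω] u ∧ ∀ x ∈ S, u x = b x

/-- The smoothness index `m_n = [n/2] + 2`, for which `H^{m_n}` embeds in `C¹` up to the
boundary. -/
def mInd (n : ℕ) : ℕ := n / 2 + 2

end Sobolev

section Domain

variable {n : ℕ} [NeZero n]

/-- The rectangular prism `A < x₁ < B`, `|x_j| < D` for the other coordinates. -/
def prism (n : ℕ) [NeZero n] (A B D : ℝ) : Set (Pt n) :=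
  {x | x 0 ∈ Ioo A B ∧ ∀ j, j ≠ 0 → |x j| < D}

/-- The face `Γ₀` of the prism on which `x₁ = B`. -/
def face (n : ℕ) [NeZero n] (B D : ℝ) : Set (Pt n) :=
  {x | x 0 = B ∧ ∀ j, j ≠ 0 → |x j| < D}

end Domain

section Model

/-- The finite difference time derivative on the grid `t₀ < ⋯ < t_k` of step `h`:
forward differences at `t₀, …, t_{k-1}`, and
`(3 y_k - y_{k-1} - y_{k-2} - y_{k-3}) / (6 h)` at `t_k` (used for `k ≥ 3`). -/
def dt {k : ℕ} (h : ℝ) (y : Fin (k + 1) → ℝ) (i : Fin (k + 1)) : ℝ :=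
  if hi : i.val < k then (y ⟨i.val + 1, by omega⟩ - y i) / h
  else (3 * y ⟨k, by omega⟩ - y ⟨k - 1, by omega⟩ - y ⟨k - 2, by omega⟩ - y ⟨k - 3, by omega⟩)
    / (6 * h)

variable {n : ℕ}

/-- The logarithm of the heat kernel at time `ε`. -/
def wEps (ε : ℝ) (x : Pt n) : ℝ :=
  -(‖x‖ ^ 2 / (4 * ε)) - Real.log ((2 * Real.sqrt (Real.pi * ε)) ^ n)

/-- The nonlinear operators `L₀, …, L_k`. -/
def Lop (Ω : Set (Pt n)) (ε h : ℝ) {k : ℕ} (V : Fin (k + 1) → Pt n → ℝ) (i : Fin (k + 1))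
    (x : Pt n) : ℝ :=
  wlap Ω (V i) x + 2 * ∑ l, wpd Ω l (V i) x * pderiv l (wEps ε) x
    + (if i = 0 then 0
        else 2 * h * ∑ l, wpd Ω l (V i) x * ∑ j ∈ Finset.Iic i, wpd Ω l (V j) x)
    - dt h (fun j => V j x) i

/-- The set `B(R)`: vector functions whose components have `H^{m_n}` norm less than `R` and have
the Dirichlet data (on the whole boundary) and Neumann data (on `Γ₀`) generated by
`g₀(x, t_i)`, `g₁(x, t_i)`. -/
def ballB [NeZero n] (A B D h : ℝ) {k : ℕ} (g₀ g₁ : Fin (k + 1) → Pt n → ℝ) (R : ℝ) :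
    Set (Fin (k + 1) → Pt n → ℝ) :=
  {V | ∀ i, MemSobolev (prism n A B D) (mInd n) (V i) ∧
    sobolevNorm (prism n A B D) (mInd n) (V i) < R ∧
    HasTrace (prism n A B D) (frontier (prism n A B D)) (V i)
      (fun x => dt h (fun j => g₀ j x) i) ∧
    HasTrace (prism n A B D) (face n B D) (wpd (prism n A B D) 0 (V i))
      (fun x => dt h (fun j => g₁ j x) i)}

/-- The closure of a set of vector functions in the norm of `H^m_{k+1}(Ω)`. -/
def sobolevClosure (Ω : Set (Pt n)) (m : ℕ) {k : ℕ} (S : Set (Fin (k + 1) → Pt n → ℝ)) :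
    Set (Fin (k + 1) → Pt n → ℝ) :=
  {V | (∀ i, MemSobolev Ω m (V i)) ∧
    ∀ δ : ℝ, 0 < δ → ∃ W ∈ S, vecSobolevNorm Ω m (fun i x => V i x - W i x) < δ}

/-- The weighted Tikhonov-like functional `J_{lam, α}` with the Carleman weight
`exp (2 lam x₁²)`. -/
def Jfun [NeZero n] (A B D ε h c lam α : ℝ) {k : ℕ} (V : Fin (k + 1) → Pt n → ℝ) : ℝ :=
  Real.exp (-2 * lam * c) * (∑ i, ∫ x in prism n A B D,
      (Lop (prism n A B D) ε h V i x) ^ 2 * Real.exp (2 * lam * (x 0) ^ 2))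
    + α * vecSobolevNorm (prism n A B D) (mInd n) V ^ 2

/-- `V` is a minimizer of `J_{lam, α}` on the closure of `B(R)`. -/
def IsMinimizer [NeZero n] (A B D ε h c lam α : ℝ) {k : ℕ} (g₀ g₁ : Fin (k + 1) → Pt n → ℝ)
    (R : ℝ) (V : Fin (k + 1) → Pt n → ℝ) : Prop :=
  V ∈ sobolevClosure (prism n A B D) (mInd n) (ballB A B D h g₀ g₁ R) ∧
    ∀ W ∈ sobolevClosure (prism n A B D) (mInd n) (ballB A B D h g₀ g₁ R),
      Jfun A B D ε h c lam α V ≤ Jfun A B D ε h c lam α W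

/-- The functions `w(x, t_i)` reconstructed from `V`. -/
def wRec (ε h : ℝ) {k : ℕ} (V : Fin (k + 1) → Pt n → ℝ) (i : Fin (k + 1)) (x : Pt n) : ℝ :=
  h * ∑ j ∈ Finset.Iic i, V j x + wEps ε x

/-- The coefficient `a(x)` reconstructed from `V`. -/
def aRec (Ω : Set (Pt n)) (ε T h : ℝ) {k : ℕ} (V : Fin (k + 1) → Pt n → ℝ) (x : Pt n) : ℝ :=
  1 / (T - ε) * (wRec ε h V (Fin.last k) x - wEps ε x)
    - 1 / (T - ε) * ∑ i, (wlap Ω (wRec ε h V i) x + ∑ l, (wpd Ω l (wRec ε h V i) x) ^ 2)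

end Model

end Cip

end

/-! For large `lam` the functional is uniformly convex in the midpoint sense on the closure of B(R),
and everything follows from that. Writing M and U for the midpoint and the difference of V and W,
the quadratic structure of the operators gives the exact identity of `opV_midpoint`: the mean of
L(V)² and L(W)² is (L(M) + b(U,U)/4)² + (L'(M)U)²/4, with b the bilinear gradient term. The second
square yields a multiple of (ΔU)²; every other U-dependent term that may be negative must be
absorbed by it.

The absorption is done by a Carleman estimate (`AdmN.carleman_zero`, `exists_carleman`). U has zero
Dirichlet data and zero normal derivative on Γ₀, so the weighted norm of ΔU controls `lam ^ 3` times
U², `lam` times |∇U|² and `1 / lam` times |D²U|². Terms with bounded coefficients are then harmless,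
since `exists_sup_bound` bounds V and ∇V through H^{m_n}. The delicate term is |ΔM| |∇U|²: ΔM is
only in H^{[n/2]} and may be unbounded. A Morrey bound on dyadic averages shows that such functions
are small relative to the Dirichlet form (`exists_form_bound_dyadic`). At the scale 2^J comparable
to `lam`, the Carleman estimate bounds this term by a constant over the square root of `lam` times
the main term (`exists_weighted_form_bound`). The result is `exists_resF_midpoint_le`.

The Tikhonov term adds, by the parallelogram law, a gain of `α / 4` times the squared distance of V
and W. A minimizing sequence is therefore Cauchy in H^{m_n}, its limit is a minimizer, and two
minimizers agree (`Feasible.exists_minimizer`, `Feasible.minimizer_unique`); no weak compactness is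
used.

For the error estimate, V* is a competitor with zero residual, so the residual of the minimizer is
at most a constant times α e^{2 lam c}. The same absorption argument turns the residual into a bound
of the weighted norm of Δ(V − V*) (`exists_lapF_le`). The Carleman estimate loses one factor `lam`
for second derivatives, and the weight is at least e^{2 lam A²} on the prism. This gives
`exists_jet_stability`; the coefficient is a Lipschitz function of the derivatives of order at most
two (`exists_aRec_sub_le`).

Traces are handled weakly. `Adm` and `AdmN` encode the boundary conditions by integral identities,
which survive L² limits and hence hold on the closure of B(R). The integrations by parts behind the
Carleman estimate are checked on products of sines and transferred by density: the jets of the sines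
span a dense subspace of the jets satisfying `Adm` (`Adm.sum_integral_eq_zero`). -/

namespace Cip

/-! ### Weak derivatives: uniqueness, linearity, and reduction to first order. -/

section WeakCalculus

variable {n : ℕ}

theorem contDiff_pderiv {φ : Pt n → ℝ} (h : ContDiff ℝ ∞ φ) (i : Fin n) :
    ContDiff ℝ ∞ (pderiv i φ) :=
  (h.fderiv_right (m := ∞) (by simp)).clm_apply contDiff_const

theorem pderiv_comm {φ : Pt n → ℝ} (h : ContDiff ℝ ∞ φ) (i j : Fin n) :
    pderiv i (pderiv j φ) = pderiv j (pderiv i φ) := by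
  have hd : Differentiable ℝ (fderiv ℝ φ) :=
    (h.fderiv_right (m := ∞) (by simp)).differentiable (by simp)
  have key : ∀ (i j : Fin n) (x : Pt n), pderiv i (pderiv j φ) x =
      fderiv ℝ (fderiv ℝ φ) x (EuclideanSpace.single i 1) (EuclideanSpace.single j 1) := by
    intro i j x
    have : pderiv j φ = fun y => fderiv ℝ φ y (EuclideanSpace.single j 1) := rfl
    rw [pderiv, this, fderiv_clm_apply (hd x) (by fun_prop)]
    simp
  ext x
  rw [key, key]
  exact ((contDiff_infty.1 h 2).contDiffAt.isSymmSndFDerivAt (x := x)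
    (by rw [minSmoothness_of_isRCLikeNormedField]; exact le_rfl)) _ _

theorem pderiv_add {f g : Pt n → ℝ} (hf : ContDiff ℝ ∞ f) (hg : ContDiff ℝ ∞ g) (i : Fin n)
    (x : Pt n) : pderiv i (fun y => f y + g y) x = pderiv i f x + pderiv i g x := by
  have h1 := (hf.differentiable (by simp)) x
  have h2 := (hg.differentiable (by simp)) x
  simp only [pderiv]
  rw [fderiv_fun_add h1 h2]; simp

theorem pderiv_mul {f g : Pt n → ℝ} (hf : ContDiff ℝ ∞ f) (hg : ContDiff ℝ ∞ g) (i : Fin n)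
    (x : Pt n) : pderiv i (fun y => f y * g y) x = pderiv i f x * g x + f x * pderiv i g x := by
  have h1 := (hf.differentiable (by simp)) x
  have h2 := (hg.differentiable (by simp)) x
  simp only [pderiv]
  rw [fderiv_fun_mul h1 h2]; simp; ring

theorem IsTest.pderiv {Ω : Set (Pt n)} {φ : Pt n → ℝ} (h : IsTest Ω φ) (i : Fin n) :
    IsTest Ω (pderiv i φ) :=
  ⟨contDiff_pderiv h.smooth i, h.compact.fderiv_apply ℝ _,
    (tsupport_fderiv_apply_subset ℝ _).trans h.supp⟩

theorem IsTest.mul_smooth {Ω : Set (Pt n)} {φ ψ : Pt n → ℝ} (h : IsTest Ω φ)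
    (hψ : ContDiff ℝ ∞ ψ) : IsTest Ω (fun x => ψ x * φ x) :=
  ⟨hψ.mul h.smooth, h.compact.mul_left, (tsupport_mul_subset_right).trans h.supp⟩

theorem IsTest.mono {Ω Ω' : Set (Pt n)} {φ : Pt n → ℝ} (h : IsTest Ω φ) (hs : Ω ⊆ Ω') :
    IsTest Ω' φ := ⟨h.smooth, h.compact, h.supp.trans hs⟩

theorem IsTest.memLp {Ω : Set (Pt n)} {φ : Pt n → ℝ} (h : IsTest Ω φ) :
    MemLp φ 2 (volume.restrict Ω) :=
  (h.smooth.continuous.memLp_of_hasCompactSupport h.compact)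

theorem contDiff_pderiv_iterate {φ : Pt n → ℝ} (h : ContDiff ℝ ∞ φ) (i : Fin n) (m : ℕ) :
    ContDiff ℝ ∞ ((pderiv i)^[m] φ) := by
  induction m with
  | zero => exact h
  | succ m ih => rw [Function.iterate_succ_apply']; exact contDiff_pderiv ih i

theorem pderiv_iterate_comm {φ : Pt n → ℝ} (h : ContDiff ℝ ∞ φ) (i j : Fin n) (m : ℕ) :
    (pderiv i)^[m] (pderiv j φ) = pderiv j ((pderiv i)^[m] φ) := by
  induction m with
  | zero => rfl
  | succ m ih =>
    rw [Function.iterate_succ_apply', ih, Function.iterate_succ_apply',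
      pderiv_comm (contDiff_pderiv_iterate h i m)]

/-- The mixed derivative along a list of coordinates. -/
noncomputable def listDeriv (L : List (Fin n)) (β : Fin n → ℕ) (φ : Pt n → ℝ) : Pt n → ℝ :=
  L.foldr (fun i ψ => (pderiv i)^[β i] ψ) φ

theorem contDiff_listDeriv (L : List (Fin n)) (β : Fin n → ℕ) {φ : Pt n → ℝ}
    (h : ContDiff ℝ ∞ φ) : ContDiff ℝ ∞ (listDeriv L β φ) := by
  induction L with
  | nil => exact h
  | cons i L ih => exact contDiff_pderiv_iterate ih i _

theorem listDeriv_pderiv (L : List (Fin n)) (β : Fin n → ℕ) {φ : Pt n → ℝ}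
    (h : ContDiff ℝ ∞ φ) (j : Fin n) :
    listDeriv L β (pderiv j φ) = pderiv j (listDeriv L β φ) := by
  induction L with
  | nil => rfl
  | cons i L ih =>
    change (pderiv i)^[β i] (listDeriv L β (pderiv j φ)) =
      pderiv j ((pderiv i)^[β i] (listDeriv L β φ))
    rw [ih, pderiv_iterate_comm (contDiff_listDeriv L β h)]

theorem listDeriv_add_single_of_notMem (L : List (Fin n)) (β : Fin n → ℕ) (φ : Pt n → ℝ)
    (j : Fin n) (hj : j ∉ L) : listDeriv L (β + Pi.single j 1) φ = listDeriv L β φ := by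
  induction L with
  | nil => rfl
  | cons i L ih =>
    simp only [List.mem_cons, not_or] at hj
    change (pderiv i)^[(β + Pi.single j 1 : Fin n → ℕ) i] (listDeriv L (β + Pi.single j 1) φ) =
      (pderiv i)^[β i] (listDeriv L β φ)
    rw [ih hj.2]
    simp [Ne.symm hj.1]

/-- `multiDeriv` differentiates in a fixed order of the coordinates. The extra ∂_j joins the block
of j in the list and is then commuted outwards by the symmetry of second derivatives; `Nodup`
ensures that it is counted once. -/
theorem listDeriv_add_single (L : List (Fin n)) (hL : L.Nodup) (β : Fin n → ℕ) {φ : Pt n → ℝ}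
    (h : ContDiff ℝ ∞ φ) (j : Fin n) (hj : j ∈ L) :
    listDeriv L (β + Pi.single j 1) φ = pderiv j (listDeriv L β φ) := by
  induction L with
  | nil => simp at hj
  | cons i L ih =>
    change (pderiv i)^[(β + Pi.single j 1 : Fin n → ℕ) i] (listDeriv L (β + Pi.single j 1) φ) =
      pderiv j ((pderiv i)^[β i] (listDeriv L β φ))
    rw [List.nodup_cons] at hL
    by_cases hij : j = i
    · subst hij
      rw [listDeriv_add_single_of_notMem L β φ j hL.1]
      simp [Function.iterate_succ_apply']
    · have hjL : j ∈ L := by simpa [hij] using hj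
      rw [ih hL.2 hjL]
      have : (β + Pi.single j 1 : Fin n → ℕ) i = β i := by simp [Ne.symm hij]
      rw [this, pderiv_iterate_comm (contDiff_listDeriv L β h)]

theorem multiDeriv_zero (φ : Pt n → ℝ) : multiDeriv 0 φ = φ := by
  have : ∀ L : List (Fin n), listDeriv L 0 φ = φ := by
    intro L
    induction L with
    | nil => rfl
    | cons i L ih =>
      change (pderiv i)^[0] (listDeriv L 0 φ) = φ
      simpa using ih
  exact this _

theorem multiDeriv_add_single (β : Fin n → ℕ) {φ : Pt n → ℝ} (h : ContDiff ℝ ∞ φ) (j : Fin n) :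
    multiDeriv (β + Pi.single j 1) φ = multiDeriv β (pderiv j φ) := by
  have h1 := listDeriv_add_single (List.finRange n) (List.nodup_finRange n) β h j
    (List.mem_finRange j)
  have h2 := listDeriv_pderiv (List.finRange n) β h j
  exact h1.trans h2.symm

theorem IsTest.multiDeriv {Ω : Set (Pt n)} {φ : Pt n → ℝ} (h : IsTest Ω φ) (β : Fin n → ℕ) :
    IsTest Ω (multiDeriv β φ) := by
  have : ∀ L : List (Fin n), IsTest Ω (listDeriv L β φ) := by
    intro L
    induction L with
    | nil => exact h
    | cons i L ih =>
      change IsTest Ω ((Cip.pderiv i)^[β i] (listDeriv L β φ))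
      generalize β i = m
      induction m with
      | zero => exact ih
      | succ m ih2 => rw [Function.iterate_succ_apply']; exact ih2.pderiv i
  exact this _

theorem integrable_mul_of_memLp {Ω : Set (Pt n)} {f g : Pt n → ℝ}
    (hf : MemLp f 2 (volume.restrict Ω)) (hg : MemLp g 2 (volume.restrict Ω)) :
    Integrable (fun x => f x * g x) (volume.restrict Ω) := hf.integrable_mul hg

/-- The fundamental lemma of the calculus of variations, applied to `f - g`. -/
theorem ae_eq_of_forall_test {Ω : Set (Pt n)} (hΩ : IsOpen Ω) {f g : Pt n → ℝ}
    (hf : MemLp f 2 (volume.restrict Ω)) (hg : MemLp g 2 (volume.restrict Ω))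
    (h : ∀ φ, IsTest Ω φ → ∫ x in Ω, f x * φ x = ∫ x in Ω, g x * φ x) :
    f =ᵐ[volume.restrict Ω] g := by
  have hfg := hf.sub hg
  have key := hΩ.ae_eq_zero_of_integral_contDiff_smul_eq_zero (μ := volume.restrict Ω)
    (f := f - g) ((hfg.locallyIntegrable (by norm_num)).locallyIntegrableOn Ω) (by
      intro φ h1 h2 h3
      have ht : IsTest Ω φ := ⟨h1, h2, h3⟩
      have := h φ ht
      have e : (fun x => φ x • (f - g) x) = fun x => f x * φ x - g x * φ x := by
        ext x; simp; ring
      rw [e, integral_sub (integrable_mul_of_memLp hf ht.memLp)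
        (integrable_mul_of_memLp hg ht.memLp), this, sub_self])
  filter_upwards [key, ae_restrict_mem hΩ.measurableSet] with x h1 h2
  have := h1 h2
  simp at this
  linarith

theorem IsWeakDeriv.ae_unique {Ω : Set (Pt n)} (hΩ : IsOpen Ω) {β : Fin n → ℕ} {f g g' : Pt n → ℝ}
    (h : IsWeakDeriv Ω β f g) (h' : IsWeakDeriv Ω β f g') : g =ᵐ[volume.restrict Ω] g' := by
  refine ae_eq_of_forall_test hΩ h.1 h'.1 fun φ hφ => ?_
  have h1 := (h.2 φ hφ).symm.trans (h'.2 φ hφ)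
  exact mul_left_cancel₀ (pow_ne_zero _ (by norm_num)) h1

theorem weakDeriv_spec {Ω : Set (Pt n)} {β : Fin n → ℕ} {f : Pt n → ℝ}
    (h : ∃ g, IsWeakDeriv Ω β f g) : IsWeakDeriv Ω β f (weakDeriv Ω β f) := by
  unfold weakDeriv
  rw [dif_pos h]; exact h.choose_spec

theorem IsWeakDeriv.weakDeriv_ae {Ω : Set (Pt n)} (hΩ : IsOpen Ω) {β : Fin n → ℕ}
    {f g : Pt n → ℝ} (h : IsWeakDeriv Ω β f g) : weakDeriv Ω β f =ᵐ[volume.restrict Ω] g :=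
  (weakDeriv_spec ⟨g, h⟩).ae_unique hΩ h

theorem IsWeakDeriv.comb {Ω : Set (Pt n)} {β : Fin n → ℕ} {f f' g g' : Pt n → ℝ}
    (h : IsWeakDeriv Ω β f g) (h' : IsWeakDeriv Ω β f' g')
    (hf : MemLp f 2 (volume.restrict Ω)) (hf' : MemLp f' 2 (volume.restrict Ω)) (r s : ℝ) :
    IsWeakDeriv Ω β (fun x => r * f x + s * f' x) (fun x => r * g x + s * g' x) := by
  refine ⟨(h.1.const_mul r).add (h'.1.const_mul s), fun φ hφ => ?_⟩
  have aux : ∀ {F G ψ : Pt n → ℝ}, MemLp F 2 (volume.restrict Ω) →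
      MemLp G 2 (volume.restrict Ω) → MemLp ψ 2 (volume.restrict Ω) →
      ∫ x in Ω, (r * F x + s * G x) * ψ x =
        r * (∫ x in Ω, F x * ψ x) + s * (∫ x in Ω, G x * ψ x) := by
    intro F G ψ hF hG hψ
    simp_rw [add_mul, mul_assoc]
    rw [integral_add ((integrable_mul_of_memLp hF hψ).const_mul r)
      ((integrable_mul_of_memLp hG hψ).const_mul s), integral_const_mul, integral_const_mul]
  have e1 := aux hf hf' (hφ.multiDeriv β).memLp
  have e2 := aux h.1 h'.1 hφ.memLp
  rw [e1, e2, h.2 φ hφ, h'.2 φ hφ]; ring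

theorem isWeakDeriv_zero {Ω : Set (Pt n)} {f : Pt n → ℝ} (hf : MemLp f 2 (volume.restrict Ω)) :
    IsWeakDeriv Ω 0 f f := ⟨hf, fun φ _ => by rw [multiDeriv_zero]; simp⟩

/-- `g` is the weak derivative of `f` in the `i`-th coordinate, both square integrable. -/
structure HasWD (Ω : Set (Pt n)) (i : Fin n) (f g : Pt n → ℝ) : Prop where
  memf : MemLp f 2 (volume.restrict Ω)
  memg : MemLp g 2 (volume.restrict Ω)
  ibp : ∀ φ : Pt n → ℝ, IsTest Ω φ → ∫ x in Ω, f x * pderiv i φ x = -∫ x in Ω, g x * φ x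

theorem sum_add_single (β : Fin n → ℕ) (i : Fin n) :
    ∑ l, (β + Pi.single i 1 : Fin n → ℕ) l = ∑ l, β l + 1 := by
  simp [Finset.sum_add_distrib, Pi.single_apply]

/-- Testing the lower derivative against ∂_i φ produces the higher one. This turns multi-index
identities into first order ones, so that every later integration by parts concerns a single
coordinate. -/
theorem HasWD.of_isWeakDeriv {Ω : Set (Pt n)} {β : Fin n → ℕ} {i : Fin n} {f g g' : Pt n → ℝ}
    (h : IsWeakDeriv Ω β f g) (h' : IsWeakDeriv Ω (β + Pi.single i 1) f g') :
    HasWD Ω i g g' := by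
  refine ⟨h.1, h'.1, fun φ hφ => ?_⟩
  have h1 := h.2 _ (hφ.pderiv i)
  have h2 := h'.2 φ hφ
  rw [multiDeriv_add_single β hφ.smooth, sum_add_single, h1, pow_succ, mul_assoc] at h2
  have := mul_left_cancel₀ (pow_ne_zero _ (by norm_num)) h2
  linarith

theorem IsWeakDeriv.succ {Ω : Set (Pt n)} {β : Fin n → ℕ} {i : Fin n} {f g g' : Pt n → ℝ}
    (h : IsWeakDeriv Ω β f g) (h' : HasWD Ω i g g') :
    IsWeakDeriv Ω (β + Pi.single i 1) f g' := by
  refine ⟨h'.memg, fun φ hφ => ?_⟩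
  rw [multiDeriv_add_single β hφ.smooth, sum_add_single, h.2 _ (hφ.pderiv i), h'.ibp φ hφ]
  ring

theorem HasWD.isWeakDeriv {Ω : Set (Pt n)} {i : Fin n} {f g : Pt n → ℝ} (h : HasWD Ω i f g) :
    IsWeakDeriv Ω (Pi.single i 1) f g := by
  simpa using (isWeakDeriv_zero h.memf).succ h

theorem IsWeakDeriv.hasWD {Ω : Set (Pt n)} {i : Fin n} {f g : Pt n → ℝ}
    (hf : MemLp f 2 (volume.restrict Ω)) (h : IsWeakDeriv Ω (Pi.single i 1) f g) :
    HasWD Ω i f g :=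
  HasWD.of_isWeakDeriv (β := 0) (isWeakDeriv_zero hf) (by simpa using h)

theorem setIntegral_mul_test {Ω : Set (Pt n)} {F ψ : Pt n → ℝ} (hψ : IsTest Ω ψ) :
    ∫ x in Ω, F x * ψ x = ∫ x, F x * ψ x := by
  refine setIntegral_eq_integral_of_forall_compl_eq_zero fun x hx => ?_
  rw [image_eq_zero_of_notMem_tsupport (fun h => hx (hψ.supp h)), mul_zero]

theorem HasWD.mono {Ω Ω' : Set (Pt n)} (hs : Ω ⊆ Ω') {i : Fin n} {f g : Pt n → ℝ}
    (h : HasWD Ω' i f g) : HasWD Ω i f g := by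
  refine ⟨h.memf.mono_measure (Measure.restrict_mono hs le_rfl),
    h.memg.mono_measure (Measure.restrict_mono hs le_rfl), fun φ hφ => ?_⟩
  rw [setIntegral_mul_test (hφ.pderiv i), setIntegral_mul_test hφ]
  have := h.ibp φ (hφ.mono hs)
  rwa [setIntegral_mul_test ((hφ.mono hs).pderiv i), setIntegral_mul_test (hφ.mono hs)] at this

/-- A continuous function is bounded on a bounded set. -/
theorem exists_bound_of_continuous {Ω : Set (Pt n)} (hb : Bornology.IsBounded Ω) {ψ : Pt n → ℝ}
    (hψ : Continuous ψ) : ∃ C : ℝ, 0 ≤ C ∧ ∀ x ∈ Ω, |ψ x| ≤ C := by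
  obtain ⟨C, hC⟩ := (hb.isCompact_closure.exists_bound_of_continuousOn hψ.continuousOn)
  refine ⟨max C 0, le_max_right _ _, fun x hx => ?_⟩
  have := hC x (subset_closure hx)
  rw [Real.norm_eq_abs] at this
  exact this.trans (le_max_left _ _)

theorem memLp_smooth_mul {Ω : Set (Pt n)} (hΩ : IsOpen Ω) (hb : Bornology.IsBounded Ω)
    {f ψ : Pt n → ℝ} (hf : MemLp f 2 (volume.restrict Ω)) (hψ : Continuous ψ) :
    MemLp (fun x => ψ x * f x) 2 (volume.restrict Ω) := by
  obtain ⟨C, -, hC⟩ := exists_bound_of_continuous hb hψ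
  refine MemLp.of_le_mul (c := C) hf (hψ.aestronglyMeasurable.mul hf.1) ?_
  filter_upwards [ae_restrict_mem hΩ.measurableSet] with x hx
  rw [norm_mul, Real.norm_eq_abs]
  exact mul_le_mul_of_nonneg_right (hC x hx) (norm_nonneg _)

theorem memLp_continuous {Ω : Set (Pt n)} (hΩ : IsOpen Ω) (hb : Bornology.IsBounded Ω)
    {ψ : Pt n → ℝ} (hψ : Continuous ψ) : MemLp ψ 2 (volume.restrict Ω) := by
  have : IsFiniteMeasure (volume.restrict Ω) := ⟨by simpa using hb.measure_lt_top⟩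
  simpa using memLp_smooth_mul hΩ hb (memLp_const (1 : ℝ)) hψ

theorem HasWD.mul_smooth {Ω : Set (Pt n)} (hΩ : IsOpen Ω) (hb : Bornology.IsBounded Ω)
    {i : Fin n} {f g ψ : Pt n → ℝ} (h : HasWD Ω i f g) (hψ : ContDiff ℝ ∞ ψ) :
    HasWD Ω i (fun x => ψ x * f x) (fun x => ψ x * g x + pderiv i ψ x * f x) := by
  have m1 := memLp_smooth_mul hΩ hb h.memf hψ.continuous
  have m2 := memLp_smooth_mul hΩ hb h.memg hψ.continuous
  have m3 := memLp_smooth_mul hΩ hb h.memf (contDiff_pderiv hψ i).continuous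
  refine ⟨m1, m2.add m3, fun φ hφ => ?_⟩
  have h1 := h.ibp _ (hφ.mul_smooth hψ)
  have e : ∀ x, f x * Cip.pderiv i (fun x => ψ x * φ x) x =
      f x * pderiv i ψ x * φ x + ψ x * f x * pderiv i φ x := by
    intro x; rw [pderiv_mul hψ hφ.smooth]; ring
  have i1 := integrable_mul_of_memLp m3 hφ.memLp
  have i2 := integrable_mul_of_memLp m1 (hφ.pderiv i).memLp
  have i3 := integrable_mul_of_memLp m2 hφ.memLp
  simp_rw [e] at h1
  rw [integral_add (by convert i1 using 2; ring) i2] at h1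
  simp_rw [add_mul]
  rw [integral_add i3 i1]
  have e3 : ∫ x in Ω, g x * (ψ x * φ x) = ∫ x in Ω, ψ x * g x * φ x := by
    congr 1; ext x; ring
  have e4 : ∫ x in Ω, f x * pderiv i ψ x * φ x = ∫ x in Ω, pderiv i ψ x * f x * φ x := by
    congr 1; ext x; ring
  rw [e3, e4] at h1
  linarith

/-- The test function is supported in Ω, so both integrals extend to the whole space, where
integration by parts has no boundary terms. -/
theorem hasWD_smooth {Ω : Set (Pt n)} (hΩ : IsOpen Ω) (hb : Bornology.IsBounded Ω)
    (i : Fin n) {ψ : Pt n → ℝ} (hψ : ContDiff ℝ ∞ ψ) : HasWD Ω i ψ (pderiv i ψ) := by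
  refine ⟨memLp_continuous hΩ hb hψ.continuous,
    memLp_continuous hΩ hb (contDiff_pderiv hψ i).continuous, fun φ hφ => ?_⟩
  rw [setIntegral_mul_test (hφ.pderiv i), setIntegral_mul_test hφ]
  have cs : ∀ {F G : Pt n → ℝ}, Continuous F → IsTest Ω G → Integrable (fun x => F x * G x) :=
    fun hF hG => (hF.mul hG.smooth.continuous).integrable_of_hasCompactSupport hG.compact.mul_left
  exact integral_mul_fderiv_eq_neg_fderiv_mul_of_integrable (v := EuclideanSpace.single i 1)
    (cs (contDiff_pderiv hψ i).continuous hφ)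
    (cs hψ.continuous (hφ.pderiv i)) (cs hψ.continuous hφ)
    (fun x _ => hψ.differentiable (by simp) x) (fun x _ => hφ.smooth.differentiable (by simp) x)

end WeakCalculus


/-! ### One-dimensional cutoffs with shrinking transition layers. -/

section Cutoff

theorem exists_deriv_smoothTransition_bound :
    ∃ C : ℝ, 0 < C ∧ ∀ t, |deriv Real.smoothTransition t| ≤ C := by
  have hc : Continuous (deriv Real.smoothTransition) :=
    (Real.smoothTransition.contDiff (n := 1)).continuous_deriv (by simp)
  obtain ⟨C, hC⟩ := isCompact_Icc.exists_bound_of_continuousOn (s := Icc (0 : ℝ) 1) hc.continuousOn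
  refine ⟨max C 1, lt_of_lt_of_le one_pos (le_max_right _ _), fun t => ?_⟩
  by_cases ht : t ∈ Icc (0 : ℝ) 1
  · exact (hC t ht).trans (le_max_left _ _)
  · have : deriv Real.smoothTransition t = 0 := by
      rw [mem_Icc, not_and_or, not_le, not_le] at ht
      rcases ht with ht | ht
      · have : Real.smoothTransition =ᶠ[nhds t] fun _ => 0 := by
          filter_upwards [Iio_mem_nhds ht] with s hs
          exact Real.smoothTransition.zero_of_nonpos (le_of_lt hs)
        rw [this.deriv_eq]; simp
      · have : Real.smoothTransition =ᶠ[nhds t] fun _ => 1 := by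
          filter_upwards [Ioi_mem_nhds ht] with s hs
          exact Real.smoothTransition.one_of_one_le (le_of_lt hs)
        rw [this.deriv_eq]; simp
    rw [this]; simp

/-- A smooth cutoff on the interval `(a, b)`, with transition layers of width `η`. -/
noncomputable def cut (a b η : ℝ) (t : ℝ) : ℝ :=
  Real.smoothTransition ((t - a) / η - 1) * Real.smoothTransition ((b - t) / η - 1)

variable {a b η : ℝ}

theorem contDiff_cut (a b η : ℝ) : ContDiff ℝ ∞ (cut a b η) := by
  unfold cut
  refine (Real.smoothTransition.contDiff.comp ?_).mul (Real.smoothTransition.contDiff.comp ?_) <;>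
  fun_prop

theorem cut_nonneg (a b η t : ℝ) : 0 ≤ cut a b η t :=
  mul_nonneg (Real.smoothTransition.nonneg _) (Real.smoothTransition.nonneg _)

theorem cut_le_one (a b η t : ℝ) : cut a b η t ≤ 1 :=
  mul_le_one₀ (Real.smoothTransition.le_one _) (Real.smoothTransition.nonneg _)
    (Real.smoothTransition.le_one _)

theorem cut_eq_zero (hη : 0 < η) {t : ℝ} (ht : t ≤ a + η ∨ b - η ≤ t) : cut a b η t = 0 := by
  rcases ht with ht | ht
  · have : (t - a) / η - 1 ≤ 0 := by rw [sub_nonpos, div_le_one hη]; linarith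
    simp [cut, Real.smoothTransition.zero_of_nonpos this]
  · have : (b - t) / η - 1 ≤ 0 := by rw [sub_nonpos, div_le_one hη]; linarith
    simp [cut, Real.smoothTransition.zero_of_nonpos this]

theorem cut_eq_one (hη : 0 < η) {t : ℝ} (h1 : a + 2 * η ≤ t) (h2 : t ≤ b - 2 * η) :
    cut a b η t = 1 := by
  have e1 : 1 ≤ (t - a) / η - 1 := by rw [le_sub_iff_add_le, le_div_iff₀ hη]; linarith
  have e2 : 1 ≤ (b - t) / η - 1 := by rw [le_sub_iff_add_le, le_div_iff₀ hη]; linarith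
  simp [cut, Real.smoothTransition.one_of_one_le e1, Real.smoothTransition.one_of_one_le e2]

theorem deriv_cut_eq_zero (hη : 0 < η) {t : ℝ} (h1 : a + 2 * η < t) (h2 : t < b - 2 * η) :
    deriv (cut a b η) t = 0 := by
  have : cut a b η =ᶠ[nhds t] fun _ => 1 := by
    filter_upwards [Ioo_mem_nhds h1 h2] with s hs
    exact cut_eq_one hη hs.1.le hs.2.le
  rw [this.deriv_eq]; simp

/-- By the chain rule the constant comes from `Real.smoothTransition` alone, uniformly in the
interval and in `η`. The derivative is of size 1/η on layers of width η, the balance on which all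
boundary limits below rest. -/
theorem exists_deriv_cut_bound :
    ∃ C : ℝ, 0 < C ∧ ∀ a b η t : ℝ, 0 < η → |deriv (cut a b η) t| ≤ C / η := by
  obtain ⟨C, hC, h⟩ := exists_deriv_smoothTransition_bound
  refine ⟨2 * C, by positivity, fun a b η t hη => ?_⟩
  have hd : Differentiable ℝ Real.smoothTransition :=
    (Real.smoothTransition.contDiff (n := 1)).differentiable (by simp)
  have d1 : HasDerivAt (fun t => Real.smoothTransition ((t - a) / η - 1))
      (deriv Real.smoothTransition ((t - a) / η - 1) * (1 / η)) t := by
    refine (hd _).hasDerivAt.comp t ?_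
    exact (((hasDerivAt_id t).sub_const a).div_const η).sub_const 1
  have d2 : HasDerivAt (fun t => Real.smoothTransition ((b - t) / η - 1))
      (deriv Real.smoothTransition ((b - t) / η - 1) * (-1 / η)) t := by
    refine (hd _).hasDerivAt.comp t ?_
    exact (((hasDerivAt_id t).const_sub b).div_const η).sub_const 1
  have e := (d1.mul d2).deriv
  have e' : deriv (cut a b η) t = _ := e
  rw [e']
  have b1 := h ((t - a) / η - 1)
  have b2 := h ((b - t) / η - 1)
  have n1 := Real.smoothTransition.nonneg ((t - a) / η - 1)
  have n2 := Real.smoothTransition.nonneg ((b - t) / η - 1)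
  have o1 := Real.smoothTransition.le_one ((t - a) / η - 1)
  have o2 := Real.smoothTransition.le_one ((b - t) / η - 1)
  refine (abs_add_le _ _).trans ?_
  have k1 : |deriv Real.smoothTransition ((t - a) / η - 1) * (1 / η) *
      Real.smoothTransition ((b - t) / η - 1)| ≤ C * (1 / η) * 1 := by
    rw [abs_mul, abs_mul, abs_of_nonneg n2, abs_of_pos (by positivity : 0 < 1 / η)]
    gcongr
  have k2 : |Real.smoothTransition ((t - a) / η - 1) *
      (deriv Real.smoothTransition ((b - t) / η - 1) * (-1 / η))| ≤ 1 * (C * (1 / η)) := by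
    rw [abs_mul, abs_mul, abs_of_nonneg n1, neg_div, abs_neg,
      abs_of_pos (by positivity : 0 < 1 / η)]
    gcongr
  calc _ ≤ C * (1 / η) * 1 + 1 * (C * (1 / η)) := add_le_add k1 k2
    _ = _ := by ring

/-- The widths `1 / (m + 1)` of the transition layers. -/
noncomputable def wid (m : ℕ) : ℝ := 1 / ((m : ℝ) + 1)

theorem wid_pos (m : ℕ) : 0 < wid m := by unfold wid; positivity

theorem tendsto_wid : Filter.Tendsto wid Filter.atTop (nhds 0) :=
  tendsto_one_div_add_atTop_nhds_zero_nat

theorem eventually_wid_lt {η : ℝ} (hη : 0 < η) : ∀ᶠ m in Filter.atTop, wid m < η :=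
  tendsto_wid.eventually (Iio_mem_nhds hη)

theorem eventually_cut_eq_one {t : ℝ} (ht : t ∈ Ioo a b) :
    ∀ᶠ m in Filter.atTop, cut a b (wid m) t = 1 := by
  filter_upwards [eventually_wid_lt (η := (t - a) / 2) (by linarith [ht.1]),
    eventually_wid_lt (η := (b - t) / 2) (by linarith [ht.2])] with m h1 h2
  exact cut_eq_one (wid_pos m) (by linarith) (by linarith)

theorem eventually_deriv_cut_eq_zero {t : ℝ} (ht : t ∈ Ioo a b) :
    ∀ᶠ m in Filter.atTop, deriv (cut a b (wid m)) t = 0 := by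
  filter_upwards [eventually_wid_lt (η := (t - a) / 2) (by linarith [ht.1]),
    eventually_wid_lt (η := (b - t) / 2) (by linarith [ht.2])] with m h1 h2
  exact deriv_cut_eq_zero (wid_pos m) (by linarith) (by linarith)

end Cutoff

/-! ### Integration by parts on a box under boundary conditions on opposite faces. -/

section Box

variable {n : ℕ}

/-- The open box with corners `a` and `b`. -/
def box (a b : Fin n → ℝ) : Set (Pt n) := {x | ∀ i, x i ∈ Ioo (a i) (b i)}

theorem box_eq_preimage (a b : Fin n → ℝ) :
    box a b = (WithLp.ofLp : Pt n → (Fin n → ℝ)) ⁻¹' (univ.pi fun i => Ioo (a i) (b i)) := by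
  ext x; simp [box]

theorem isOpen_box (a b : Fin n → ℝ) : IsOpen (box a b) := by
  rw [box_eq_preimage]
  exact (isOpen_set_pi finite_univ fun i _ => isOpen_Ioo).preimage (PiLp.continuous_ofLp 2 _)

theorem measurableSet_box (a b : Fin n → ℝ) : MeasurableSet (box a b) := (isOpen_box a b).measurableSet

theorem volume_box (a b : Fin n → ℝ) :
    volume (box a b) = ∏ i, ENNReal.ofReal (b i - a i) := by
  rw [box_eq_preimage, (PiLp.volume_preserving_ofLp (Fin n)).measure_preimage
    (MeasurableSet.univ_pi fun i => measurableSet_Ioo).nullMeasurableSet, Real.volume_pi_Ioo]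

theorem isBounded_box (a b : Fin n → ℝ) : Bornology.IsBounded (box a b) := by
  have h : Bornology.IsBounded (univ.pi fun i => Ioo (a i) (b i)) :=
    Bornology.IsBounded.pi fun i => Metric.isBounded_Ioo _ _
  rw [box_eq_preimage]
  have := (PiLp.antilipschitzWith_ofLp 2 (fun _ : Fin n => ℝ)).isBounded_preimage h
  exact this

theorem isCompact_closedBox (a b : Fin n → ℝ) :
    IsCompact {x : Pt n | ∀ i, x i ∈ Icc (a i) (b i)} := by
  have h : Bornology.IsBounded (univ.pi fun i => Icc (a i) (b i)) :=
    Bornology.IsBounded.pi fun i => Metric.isBounded_Icc _ _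
  have e : {x : Pt n | ∀ i, x i ∈ Icc (a i) (b i)} =
    (WithLp.ofLp : Pt n → (Fin n → ℝ)) ⁻¹' (univ.pi fun i => Icc (a i) (b i)) := by
    ext x; exact ⟨fun h i _ => h i, fun h i => h i trivial⟩
  rw [e]
  refine Metric.isCompact_of_isClosed_isBounded ?_
    ((PiLp.antilipschitzWith_ofLp 2 (fun _ : Fin n => ℝ)).isBounded_preimage h)
  exact (isClosed_set_pi fun i _ => isClosed_Icc).preimage (PiLp.continuous_ofLp 2 _)

theorem contDiff_coord {θ : ℝ → ℝ} (hθ : ContDiff ℝ ∞ θ) (l : Fin n) :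
    ContDiff ℝ ∞ (fun x : Pt n => θ (x l)) := by
  refine hθ.comp ?_
  exact (EuclideanSpace.proj (𝕜 := ℝ) l).contDiff

theorem pderiv_coord {θ : ℝ → ℝ} (hθ : ContDiff ℝ ∞ θ) (i l : Fin n) (x : Pt n) :
    pderiv i (fun x : Pt n => θ (x l)) x = if l = i then deriv θ (x l) else 0 := by
  have h1 : HasFDerivAt (fun x : Pt n => x l) (EuclideanSpace.proj (𝕜 := ℝ) l : Pt n →L[ℝ] ℝ) x :=
    (EuclideanSpace.proj (𝕜 := ℝ) l).hasFDerivAt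
  have h2 := ((hθ.differentiable (by simp)) (x l)).hasDerivAt
  have h3 := h2.comp_hasFDerivAt x h1
  have h4 : fderiv ℝ (fun x : Pt n => θ (x l)) x = _ := h3.fderiv
  rw [pderiv, h4]
  by_cases h : l = i <;> simp [h]

/-- The product of the cutoffs in all coordinates other than `i`. -/
noncomputable def cutOthers (a b : Fin n → ℝ) (i : Fin n) (m : ℕ) (x : Pt n) : ℝ :=
  ∏ l ∈ Finset.univ.erase i, cut (a l) (b l) (wid m) (x l)

theorem contDiff_cutOthers (a b : Fin n → ℝ) (i : Fin n) (m : ℕ) :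
    ContDiff ℝ ∞ (cutOthers a b i m) :=
  contDiff_prod fun l _ => contDiff_coord (contDiff_cut _ _ _) l

theorem pderiv_cutOthers (a b : Fin n → ℝ) (i : Fin n) (m : ℕ) (x : Pt n) :
    pderiv i (cutOthers a b i m) x = 0 := by
  have : ∀ s : Finset (Fin n), i ∉ s →
      pderiv i (fun x : Pt n => ∏ l ∈ s, cut (a l) (b l) (wid m) (x l)) x = 0 := by
    intro s
    induction s using Finset.induction_on with
    | empty => intro _; simp [pderiv]
    | insert l s hl ih =>
      intro hi
      rw [Finset.mem_insert, not_or] at hi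
      have e : (fun x : Pt n => ∏ l ∈ insert l s, cut (a l) (b l) (wid m) (x l)) =
          fun x => cut (a l) (b l) (wid m) (x l) * ∏ l ∈ s, cut (a l) (b l) (wid m) (x l) := by
        ext x; rw [Finset.prod_insert hl]
      rw [e, pderiv_mul (contDiff_coord (contDiff_cut _ _ _) l)
        (contDiff_prod fun l _ => contDiff_coord (contDiff_cut _ _ _) l), ih hi.2,
        pderiv_coord (contDiff_cut _ _ _), if_neg (Ne.symm hi.1)]
      simp
  exact this _ (by simp)

theorem cutOthers_nonneg (a b : Fin n → ℝ) (i : Fin n) (m : ℕ) (x : Pt n) :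
    0 ≤ cutOthers a b i m x := Finset.prod_nonneg fun _ _ => cut_nonneg _ _ _ _

theorem cutOthers_le_one (a b : Fin n → ℝ) (i : Fin n) (m : ℕ) (x : Pt n) :
    cutOthers a b i m x ≤ 1 :=
  Finset.prod_le_one (fun _ _ => cut_nonneg _ _ _ _) (fun _ _ => cut_le_one _ _ _ _)

theorem eventually_cutOthers_eq_one {a b : Fin n → ℝ} {x : Pt n} (hx : x ∈ box a b) (i : Fin n) :
    ∀ᶠ m in Filter.atTop, cutOthers a b i m x = 1 := by
  have : ∀ᶠ m in Filter.atTop, ∀ l, cut (a l) (b l) (wid m) (x l) = 1 :=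
    Filter.eventually_all.2 fun l => eventually_cut_eq_one (hx l)
  filter_upwards [this] with m hm
  exact Finset.prod_eq_one fun l _ => hm l

theorem isTest_cutOthers_mul {a b : Fin n → ℝ} {i : Fin n} {Ψ : Pt n → ℝ} (hΨ : ContDiff ℝ ∞ Ψ)
    {η : ℝ} (hη : 0 < η) (h0 : ∀ x : Pt n, (x i ≤ a i + η ∨ b i - η ≤ x i) → Ψ x = 0) (m : ℕ) :
    IsTest (box a b) (fun x => cutOthers a b i m x * Ψ x) := by
  set ρ := min η (wid m) with hρ
  have hρ0 : 0 < ρ := lt_min hη (wid_pos m)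
  have hK := isCompact_closedBox (fun l => a l + ρ) (fun l => b l - ρ)
  have hsub : Function.support (fun x => cutOthers a b i m x * Ψ x) ⊆
      {x : Pt n | ∀ l, x l ∈ Icc (a l + ρ) (b l - ρ)} := by
    intro x hx l
    by_contra hl
    refine hx ?_
    rw [mem_Icc, not_and_or, not_le, not_le] at hl
    by_cases hli : l = i
    · subst hli
      have : Ψ x = 0 := h0 x (by
        rcases hl with hl | hl
        · exact Or.inl (by linarith [min_le_left η (wid m)])
        · exact Or.inr (by linarith [min_le_left η (wid m)]))
      simp [this]
    · have : cut (a l) (b l) (wid m) (x l) = 0 := cut_eq_zero (wid_pos m) (by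
        rcases hl with hl | hl
        · exact Or.inl (by linarith [min_le_right η (wid m)])
        · exact Or.inr (by linarith [min_le_right η (wid m)]))
      have : cutOthers a b i m x = 0 :=
        Finset.prod_eq_zero (i := l) (by simp [hli]) this
      simp [this]
  have hts : tsupport (fun x => cutOthers a b i m x * Ψ x) ⊆
      {x : Pt n | ∀ l, x l ∈ Icc (a l + ρ) (b l - ρ)} := closure_minimal hsub hK.isClosed
  refine ⟨(contDiff_cutOthers a b i m).mul hΨ, HasCompactSupport.of_support_subset_isCompact hK hsub,
    hts.trans fun x hx l => ?_⟩
  have := hx l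
  exact ⟨by linarith [this.1], by linarith [this.2]⟩

instance (a b : Fin n → ℝ) : IsFiniteMeasure (volume.restrict (box a b)) :=
  ⟨by simpa using (isBounded_box a b).measure_lt_top⟩

theorem integrable_of_memLp {a b : Fin n → ℝ} {f : Pt n → ℝ}
    (hf : MemLp f 2 (volume.restrict (box a b))) : Integrable f (volume.restrict (box a b)) :=
  hf.integrable (by norm_num)

theorem integrable_mul_continuous {a b : Fin n → ℝ} {f Φ : Pt n → ℝ}
    (hf : MemLp f 2 (volume.restrict (box a b))) (hΦ : Continuous Φ) :
    Integrable (fun x => f x * Φ x) (volume.restrict (box a b)) :=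
  integrable_mul_of_memLp hf (memLp_continuous (isOpen_box a b) (isBounded_box a b) hΦ)

theorem tendsto_integral_mul_cut {a b : Fin n → ℝ} {f : Pt n → ℝ}
    (hf : Integrable f (volume.restrict (box a b))) {χ : ℕ → Pt n → ℝ}
    (hχ : ∀ m, Continuous (χ m)) {C : ℝ} (hχb : ∀ m x, |χ m x| ≤ C) {r : ℝ}
    (hχ1 : ∀ x ∈ box a b, ∀ᶠ m in Filter.atTop, χ m x = r) :
    Filter.Tendsto (fun m => ∫ x in box a b, χ m x * f x) Filter.atTop
      (nhds (∫ x in box a b, r * f x)) := by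
  refine tendsto_integral_of_dominated_convergence (fun x => C * ‖f x‖)
    (fun m => (hχ m).aestronglyMeasurable.mul hf.1) (hf.norm.const_mul _) ?_ ?_
  · intro m
    filter_upwards with x
    rw [norm_mul, Real.norm_eq_abs]
    exact mul_le_mul_of_nonneg_right (hχb m x) (norm_nonneg _)
  · filter_upwards [ae_restrict_mem (measurableSet_box a b)] with x hx
    refine tendsto_const_nhds.congr' ?_
    filter_upwards [hχ1 x hx] with m hm
    rw [hm]

/-- Cutting off in all coordinates except the i-th makes Ψ a test function, and this cutoff has zero
i-th derivative, so it passes to the limit without error. Hence integration by parts in direction i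
only sees the two i-faces. -/
theorem HasWD.ibp_of_vanish_near {a b : Fin n → ℝ} {i : Fin n} {f g : Pt n → ℝ}
    (h : HasWD (box a b) i f g) {Ψ : Pt n → ℝ} (hΨ : ContDiff ℝ ∞ Ψ)
    {η : ℝ} (hη : 0 < η) (h0 : ∀ x : Pt n, (x i ≤ a i + η ∨ b i - η ≤ x i) → Ψ x = 0) :
    ∫ x in box a b, f x * pderiv i Ψ x = -∫ x in box a b, g x * Ψ x := by
  have e : ∀ m, ∫ x in box a b, cutOthers a b i m x * (f x * pderiv i Ψ x) =
      -∫ x in box a b, cutOthers a b i m x * (g x * Ψ x) := by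
    intro m
    have := h.ibp _ (isTest_cutOthers_mul hΨ hη h0 m)
    simp_rw [pderiv_mul (contDiff_cutOthers a b i m) hΨ, pderiv_cutOthers] at this
    have e1 : ∀ x, cutOthers a b i m x * (f x * pderiv i Ψ x) =
      f x * (0 * Ψ x + cutOthers a b i m x * pderiv i Ψ x) := fun x => by ring
    have e2 : ∀ x, cutOthers a b i m x * (g x * Ψ x) =
      g x * (cutOthers a b i m x * Ψ x) := fun x => by ring
    simp_rw [e1, e2]
    exact this
  have hb : ∀ m x, |cutOthers a b i m x| ≤ 1 := fun m x => by
    rw [abs_of_nonneg (cutOthers_nonneg _ _ _ _ _)]; exact cutOthers_le_one _ _ _ _ _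
  have t1 := tendsto_integral_mul_cut
    (integrable_mul_continuous h.memf (contDiff_pderiv hΨ i).continuous)
    (fun m => (contDiff_cutOthers a b i m).continuous) hb
    (fun x hx => eventually_cutOthers_eq_one hx i)
  have t2 := tendsto_integral_mul_cut
    (integrable_mul_continuous h.memg hΨ.continuous)
    (fun m => (contDiff_cutOthers a b i m).continuous) hb
    (fun x hx => eventually_cutOthers_eq_one hx i)
  simp_rw [e] at t1
  simpa using tendsto_nhds_unique t1 t2.neg

theorem abs_cut_le (a b η t : ℝ) : |cut a b η t| ≤ 1 := by
  rw [abs_of_nonneg (cut_nonneg _ _ _ _)]; exact cut_le_one _ _ _ _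

/-- Here Φ is also cut off near the i-faces. The only trace of that cutoff is the commutator with
its derivative, and `ht` is exactly the statement that this disappears. -/
theorem HasWD.ibp_of_tendsto {a b : Fin n → ℝ} {i : Fin n} {f g : Pt n → ℝ}
    (h : HasWD (box a b) i f g) {Φ : Pt n → ℝ} (hΦ : ContDiff ℝ ∞ Φ)
    (ht : Filter.Tendsto (fun m => ∫ x in box a b,
      f x * (deriv (cut (a i) (b i) (wid m)) (x i) * Φ x)) Filter.atTop (nhds 0)) :
    ∫ x in box a b, f x * pderiv i Φ x = -∫ x in box a b, g x * Φ x := by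
  have cc : ∀ m, ContDiff ℝ ∞ (fun x : Pt n => cut (a i) (b i) (wid m) (x i)) :=
    fun m => contDiff_coord (contDiff_cut _ _ _) i
  have e : ∀ m, ∫ x in box a b, f x * (deriv (cut (a i) (b i) (wid m)) (x i) * Φ x) =
      -(∫ x in box a b, cut (a i) (b i) (wid m) (x i) * (g x * Φ x)) -
      ∫ x in box a b, cut (a i) (b i) (wid m) (x i) * (f x * pderiv i Φ x) := by
    intro m
    have := h.ibp_of_vanish_near ((cc m).mul hΦ) (wid_pos m)
      (fun x hx => by rw [cut_eq_zero (wid_pos m) hx, zero_mul])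
    simp_rw [pderiv_mul (cc m) hΦ, pderiv_coord (contDiff_cut _ _ _), if_true, mul_add] at this
    rw [integral_add] at this
    · have e1 : ∀ x, f x * (cut (a i) (b i) (wid m) (x i) * pderiv i Φ x) =
        cut (a i) (b i) (wid m) (x i) * (f x * pderiv i Φ x) := fun x => by ring
      have e2 : ∀ x, g x * (cut (a i) (b i) (wid m) (x i) * Φ x) =
        cut (a i) (b i) (wid m) (x i) * (g x * Φ x) := fun x => by ring
      simp_rw [e1, e2] at this
      linarith
    · refine integrable_mul_continuous h.memf ?_
      have := (contDiff_cut (a i) (b i) (wid m)).continuous_deriv (by simp)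
      exact (this.comp (EuclideanSpace.proj (𝕜 := ℝ) i).continuous).mul hΦ.continuous
    · exact integrable_mul_continuous h.memf
        ((cc m).continuous.mul (contDiff_pderiv hΦ i).continuous)
  have t1 := tendsto_integral_mul_cut
    (integrable_mul_continuous h.memf (contDiff_pderiv hΦ i).continuous)
    (fun m => (cc m).continuous) (fun m x => abs_cut_le _ _ _ _)
    (fun x hx => eventually_cut_eq_one (hx i))
  have t2 := tendsto_integral_mul_cut
    (integrable_mul_continuous h.memg hΦ.continuous)
    (fun m => (cc m).continuous) (fun m x => abs_cut_le _ _ _ _)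
    (fun x hx => eventually_cut_eq_one (hx i))
  have t3 := t2.neg.sub t1
  simp_rw [e] at ht
  have := tendsto_nhds_unique ht t3
  simp only [one_mul] at this
  linarith

theorem continuous_deriv_cut_coord (a b η : ℝ) (i : Fin n) :
    Continuous fun x : Pt n => deriv (cut a b η) (x i) :=
  ((contDiff_cut a b η).continuous_deriv (by simp)).comp (EuclideanSpace.proj (𝕜 := ℝ) i).continuous

/-- `F` tends to zero uniformly at the two faces of the box that are orthogonal to the `i`-th
coordinate axis. -/
def FaceZero (a b : Fin n → ℝ) (i : Fin n) (F : Pt n → ℝ) : Prop :=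
  ∀ δ : ℝ, 0 < δ → ∃ η : ℝ, 0 < η ∧ ∀ᵐ x ∂(volume.restrict (box a b)),
    (x i < a i + η ∨ b i - η < x i) → |F x| ≤ δ

theorem FaceZero.mul {a b : Fin n → ℝ} {i : Fin n} {F Φ : Pt n → ℝ} (h : FaceZero a b i F)
    (hΦ : Continuous Φ) : FaceZero a b i (fun x => F x * Φ x) := by
  obtain ⟨C, hC0, hC⟩ := exists_bound_of_continuous (isBounded_box a b) hΦ
  intro δ hδ
  obtain ⟨η, hη, h1⟩ := h (δ / (C + 1)) (by positivity)
  refine ⟨η, hη, ?_⟩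
  filter_upwards [h1, ae_restrict_mem (measurableSet_box a b)] with x hx hxb hxi
  rw [abs_mul]
  calc |F x| * |Φ x| ≤ δ / (C + 1) * (C + 1) :=
        mul_le_mul (hx hxi) ((hC x hxb).trans (by linarith)) (abs_nonneg _) (by positivity)
    _ = δ := by field_simp

/-- The part of the box within distance `η` of its two `i`-faces. -/
def strip (a b : Fin n → ℝ) (i : Fin n) (η : ℝ) : Set (Pt n) :=
  box a b ∩ {x | x i < a i + η ∨ b i - η < x i}

theorem exists_volume_strip_le (a b : Fin n → ℝ) (i : Fin n) :
    ∃ C : ℝ, 0 ≤ C ∧ ∀ η : ℝ, 0 < η → volume (strip a b i η) ≤ ENNReal.ofReal (C * η) := by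
  -- The maximum with 0 is needed because no order of the corners is assumed.
  set P : ℝ := ∏ l ∈ Finset.univ.erase i, max (b l - a l) 0 with hP
  have hP0 : 0 ≤ P := Finset.prod_nonneg fun _ _ => le_max_right _ _
  have key : ∀ (a' b' : ℝ) (η : ℝ), 0 < η → b' - a' = η →
      volume (box (Function.update a i a') (Function.update b i b')) ≤ ENNReal.ofReal (P * η) := by
    intro a' b' η hη hab
    rw [volume_box, ← Finset.prod_erase_mul _ _ (Finset.mem_univ i)]
    simp only [Function.update_self, hab]
    rw [ENNReal.ofReal_mul hP0, hP, ENNReal.ofReal_prod_of_nonneg (fun _ _ => le_max_right _ _)]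
    gcongr with l hl
    rw [Function.update_of_ne (Finset.ne_of_mem_erase hl),
      Function.update_of_ne (Finset.ne_of_mem_erase hl)]
    exact le_max_left _ _
  refine ⟨2 * P, by positivity, fun η hη => ?_⟩
  have hsub : strip a b i η ⊆
      box (Function.update a i (a i)) (Function.update b i (a i + η)) ∪
      box (Function.update a i (b i - η)) (Function.update b i (b i)) := by
    rintro x ⟨hx, hxi | hxi⟩
    · left; intro l
      by_cases hl : l = i
      · subst hl; simpa using ⟨(hx l).1, hxi⟩
      · simpa [Function.update_of_ne hl] using hx l
    · right; intro l
      by_cases hl : l = i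
      · subst hl; simp only [Function.update_self]; exact ⟨hxi, (hx l).2⟩
      · rw [Function.update_of_ne hl, Function.update_of_ne hl]; exact hx l
  refine (measure_mono hsub).trans ((measure_union_le _ _).trans ?_)
  refine (add_le_add (key _ _ η hη (by ring)) (key _ _ η hη (by ring))).trans ?_
  rw [← ENNReal.ofReal_add (by positivity) (by positivity)]
  exact ENNReal.ofReal_le_ofReal (by linarith)

/-- The derivative of the cutoff is of size 1/η on a set of volume of order η, so its integral
against F is bounded by the supremum of |F| there, which tends to zero. -/
theorem tendsto_integral_deriv_cut {a b : Fin n → ℝ} {i : Fin n} {F : Pt n → ℝ}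
    (hF : FaceZero a b i F) :
    Filter.Tendsto (fun m => ∫ x in box a b, deriv (cut (a i) (b i) (wid m)) (x i) * F x)
      Filter.atTop (nhds 0) := by
  obtain ⟨C, hC, hCb⟩ := exists_deriv_cut_bound
  obtain ⟨S, hS, hSb⟩ := exists_volume_strip_le a b i
  rw [Metric.tendsto_atTop]
  intro ε hε
  obtain ⟨η, hη, h1⟩ := hF (ε / (2 * (C * (S * 3) + 1))) (by positivity)
  obtain ⟨N, hN⟩ := Filter.eventually_atTop.1 (eventually_wid_lt (η := η / 3) (by positivity))
  refine ⟨N, fun m hm => ?_⟩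
  have hw := hN m hm
  have hwp := wid_pos m
  rw [dist_zero_right]
  set δ := ε / (2 * (C * (S * 3) + 1)) with hδ
  have hδ0 : 0 < δ := by positivity
  -- `deriv_cut_eq_zero` needs points strictly deeper than two widths; a strip of three widths
  -- leaves that room.
  have hms : MeasurableSet (strip a b i (3 * wid m)) := by
    refine (measurableSet_box a b).inter ?_
    have hm : Measurable fun x : Pt n => x i := (EuclideanSpace.proj (𝕜 := ℝ) i).continuous.measurable
    exact (measurableSet_lt hm measurable_const).union (measurableSet_lt measurable_const hm)
  have hfin : volume (strip a b i (3 * wid m)) < ⊤ :=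
    (hSb _ (by positivity)).trans_lt ENNReal.ofReal_lt_top
  have e : ∫ x in box a b, deriv (cut (a i) (b i) (wid m)) (x i) * F x =
      ∫ x in strip a b i (3 * wid m), deriv (cut (a i) (b i) (wid m)) (x i) * F x := by
    refine setIntegral_eq_of_subset_of_forall_sdiff_eq_zero (measurableSet_box a b)
      inter_subset_left ?_
    rintro x ⟨hx, hx2⟩
    have : ¬ (x i < a i + 3 * wid m ∨ b i - 3 * wid m < x i) := fun h => hx2 ⟨hx, h⟩
    rw [not_or, not_lt, not_lt] at this
    rw [deriv_cut_eq_zero hwp (by linarith) (by linarith), zero_mul]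
  rw [e]
  have hb : ∀ᵐ x ∂(volume.restrict (strip a b i (3 * wid m))),
      ‖deriv (cut (a i) (b i) (wid m)) (x i) * F x‖ ≤ C / wid m * δ := by
    have h1' := ae_restrict_of_ae_restrict_of_subset (s := strip a b i (3 * wid m))
      inter_subset_left h1
    filter_upwards [h1', ae_restrict_mem hms] with x hx hxs
    rw [norm_mul]
    refine mul_le_mul (hCb _ _ _ _ hwp) (hx ?_) (norm_nonneg _) (by positivity)
    rcases hxs.2 with h | h
    · left; linarith
    · right; linarith
  have := norm_setIntegral_le_of_norm_le_const_ae hfin hb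
  refine this.trans_lt ?_
  have hreal : volume.real (strip a b i (3 * wid m)) ≤ S * (3 * wid m) :=
    ENNReal.toReal_le_of_le_ofReal (by positivity) (hSb _ (by positivity))
  calc C / wid m * δ * volume.real (strip a b i (3 * wid m))
      ≤ C / wid m * δ * (S * (3 * wid m)) := by gcongr
    _ = C * (S * 3) * δ := by field_simp
    _ < (2 * (C * (S * 3) + 1)) * δ := by
        apply mul_lt_mul_of_pos_right _ hδ0
        have : 0 ≤ C * (S * 3) := by positivity
        linarith
    _ = ε := by rw [hδ]; field_simp

theorem HasWD.ibp_of_faceZero {a b : Fin n → ℝ} {i : Fin n} {f g : Pt n → ℝ}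
    (h : HasWD (box a b) i f g) {Φ : Pt n → ℝ} (hΦ : ContDiff ℝ ∞ Φ)
    (h0 : FaceZero a b i (fun x => f x * Φ x)) :
    ∫ x in box a b, f x * pderiv i Φ x = -∫ x in box a b, g x * Φ x := by
  refine h.ibp_of_tendsto hΦ ?_
  convert tendsto_integral_deriv_cut h0 using 4 with m x
  ring

/-- Integration by parts against the mixed second derivative of a function vanishing at the
boundary. -/
theorem ibp_mixed {a b : Fin n → ℝ} {i j : Fin n} (hij : i ≠ j) {u ui uij : Pt n → ℝ}
    (h1 : HasWD (box a b) i u ui) (h2 : HasWD (box a b) j ui uij)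
    (h0 : ∀ l, FaceZero a b l u) {Φ : Pt n → ℝ} (hΦ : ContDiff ℝ ∞ Φ) :
    ∫ x in box a b, u x * pderiv i (pderiv j Φ) x = ∫ x in box a b, uij x * Φ x := by
  have cc : ∀ m, ContDiff ℝ ∞ (fun x : Pt n => cut (a j) (b j) (wid m) (x j)) :=
    fun m => contDiff_coord (contDiff_cut _ _ _) j
  have cd : ∀ m, ContDiff ℝ ∞ (deriv (cut (a j) (b j) (wid m))) := fun m =>
    ContDiff.deriv' (contDiff_cut _ _ _)
  have cc' : ∀ m, ContDiff ℝ ∞ (fun x : Pt n => deriv (cut (a j) (b j) (wid m)) (x j)) :=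
    fun m => contDiff_coord (cd m) j
  have e : ∀ m, (∫ x in box a b, cut (a j) (b j) (wid m) (x j) * (u x * pderiv i (pderiv j Φ) x)) +
      (∫ x in box a b, deriv (cut (a j) (b j) (wid m)) (x j) * (u x * pderiv i Φ x)) =
      ∫ x in box a b, cut (a j) (b j) (wid m) (x j) * (uij x * Φ x) := by
    intro m
    -- Nothing is known about `ui` near the faces, so the derivative in j is moved while Φ is cut
    -- off there. The cutoff is removed only after the derivative in i has been moved as well: its
    -- commutator is then multiplied by `u`, which vanishes on the j-faces.
    have k1 := h2.ibp_of_vanish_near ((cc m).mul hΦ) (wid_pos m)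
      (fun x hx => by rw [cut_eq_zero (wid_pos m) hx, zero_mul])
    have cp := contDiff_pderiv ((cc m).mul hΦ) j
    have k2 := h1.ibp_of_faceZero cp ((h0 i).mul cp.continuous)
    have k3 : ∀ x, pderiv i (pderiv j (fun x => cut (a j) (b j) (wid m) (x j) * Φ x)) x =
        cut (a j) (b j) (wid m) (x j) * pderiv i (pderiv j Φ) x +
        deriv (cut (a j) (b j) (wid m)) (x j) * pderiv i Φ x := by
      intro x
      have : pderiv j (fun x => cut (a j) (b j) (wid m) (x j) * Φ x) =
        fun x => deriv (cut (a j) (b j) (wid m)) (x j) * Φ x +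
          cut (a j) (b j) (wid m) (x j) * pderiv j Φ x := by
        ext x
        rw [pderiv_mul (cc m) hΦ, pderiv_coord (contDiff_cut _ _ _), if_pos rfl]
      rw [this, pderiv_add ((cc' m).mul hΦ) ((cc m).mul (contDiff_pderiv hΦ j)),
        pderiv_mul (cc' m) hΦ, pderiv_mul (cc m) (contDiff_pderiv hΦ j),
        pderiv_coord (contDiff_cut _ _ _), pderiv_coord (cd m), if_neg (Ne.symm hij), if_neg (Ne.symm hij)]
      ring
    rw [k1] at k2
    simp_rw [k3, mul_add] at k2
    rw [integral_add] at k2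
    · have e1 : ∀ x, u x * (cut (a j) (b j) (wid m) (x j) * pderiv i (pderiv j Φ) x) =
        cut (a j) (b j) (wid m) (x j) * (u x * pderiv i (pderiv j Φ) x) := fun x => by ring
      have e2 : ∀ x, uij x * (cut (a j) (b j) (wid m) (x j) * Φ x) =
        cut (a j) (b j) (wid m) (x j) * (uij x * Φ x) := fun x => by ring
      have e3 : ∀ x, u x * (deriv (cut (a j) (b j) (wid m)) (x j) * pderiv i Φ x) =
        deriv (cut (a j) (b j) (wid m)) (x j) * (u x * pderiv i Φ x) := fun x => by ring
      simp_rw [e1, e2, e3] at k2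
      linarith
    · exact integrable_mul_continuous h1.memf
        ((cc m).continuous.mul (contDiff_pderiv (contDiff_pderiv hΦ j) i).continuous)
    · exact integrable_mul_continuous h1.memf
        ((cc' m).continuous.mul (contDiff_pderiv hΦ i).continuous)
  have t1 := tendsto_integral_mul_cut
    (integrable_mul_continuous h1.memf (contDiff_pderiv (contDiff_pderiv hΦ j) i).continuous)
    (fun m => (cc m).continuous) (fun m x => abs_cut_le _ _ _ _)
    (fun x hx => eventually_cut_eq_one (hx j))
  have t2 := tendsto_integral_mul_cut
    (integrable_mul_continuous h2.memg hΦ.continuous)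
    (fun m => (cc m).continuous) (fun m x => abs_cut_le _ _ _ _)
    (fun x hx => eventually_cut_eq_one (hx j))
  have t3 := tendsto_integral_deriv_cut ((h0 j).mul (contDiff_pderiv hΦ i).continuous)
  have t4 := t1.add t3
  simp_rw [e] at t4
  have := tendsto_nhds_unique t2 t4
  simp only [one_mul, add_zero] at this
  exact this.symm

/-- A smooth function vanishing on the `i`-faces is bounded by the distance to them. -/
theorem exists_abs_le_dist_face {a b : Fin n → ℝ} {i : Fin n} {Φ : Pt n → ℝ}
    (hΦ : ContDiff ℝ ∞ Φ) (h0 : ∀ x : Pt n, (x i = a i ∨ x i = b i) → Φ x = 0) :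
    ∃ L : ℝ, 0 ≤ L ∧ ∀ x ∈ box a b, |Φ x| ≤ L * (x i - a i) ∧ |Φ x| ≤ L * (b i - x i) := by
  obtain ⟨C, hC⟩ := (isCompact_closedBox a b).exists_bound_of_continuousOn
    (contDiff_pderiv hΦ i).continuous.continuousOn
  have hseg : ∀ x ∈ box a b, ∀ s ∈ Icc (a i) (b i), ∀ t ∈ Icc (a i) (b i), s ≤ t →
      |Φ (x + (t - x i) • EuclideanSpace.single i 1) -
        Φ (x + (s - x i) • EuclideanSpace.single i 1)| ≤ max C 0 * (t - s) := by
    intro x hx s hs t ht hst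
    set γ : ℝ → Pt n := fun r => x + (r - x i) • EuclideanSpace.single i 1 with hγ
    have hγd : ∀ r, HasDerivAt γ (EuclideanSpace.single i 1 : Pt n) r := by
      intro r
      have := (((hasDerivAt_id r).sub_const (x i)).smul_const
        (EuclideanSpace.single i 1 : Pt n)).const_add x
      rw [one_smul] at this
      exact this
    have hd : ∀ r, HasDerivAt (fun r => Φ (γ r)) (pderiv i Φ (γ r)) r := by
      intro r
      exact ((hΦ.differentiable (by simp)) (γ r)).hasFDerivAt.comp_hasDerivAt r (hγd r)
    have hin : ∀ r ∈ Icc (a i) (b i), γ r ∈ {x : Pt n | ∀ l, x l ∈ Icc (a l) (b l)} := by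
      intro r hr l
      by_cases hl : l = i
      · subst hl; simpa [hγ] using hr
      · simpa [hγ, hl] using ⟨(hx l).1.le, (hx l).2.le⟩
    have := (convex_Icc (a i) (b i)).norm_image_sub_le_of_norm_hasDerivWithin_le
      (f := fun r => Φ (γ r)) (C := max C 0)
      (fun r _ => (hd r).hasDerivWithinAt)
      (fun r hr => (hC _ (hin r hr)).trans (le_max_left _ _)) hs ht
    rw [Real.norm_eq_abs, Real.norm_eq_abs, abs_of_nonneg (by linarith : 0 ≤ t - s)] at this
    exact this
  refine ⟨max C 0, le_max_right _ _, fun x hx => ?_⟩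
  have hxi := hx i
  have hxI : x i ∈ Icc (a i) (b i) := ⟨hxi.1.le, hxi.2.le⟩
  have hab : a i ≤ b i := (hxi.1.trans hxi.2).le
  have ex : x + (x i - x i) • (EuclideanSpace.single i 1 : Pt n) = x := by simp
  have ea : Φ (x + (a i - x i) • EuclideanSpace.single i 1) = 0 := h0 _ (Or.inl (by simp))
  have eb : Φ (x + (b i - x i) • EuclideanSpace.single i 1) = 0 := h0 _ (Or.inr (by simp))
  constructor
  · have := hseg x hx (a i) ⟨le_rfl, hab⟩ (x i) hxI hxi.1.le
    rwa [ex, ea, sub_zero] at this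
  · have := hseg x hx (x i) hxI (b i) ⟨hab, le_rfl⟩ hxi.2.le
    rwa [ex, eb, zero_sub, abs_neg] at this

/-- The roles are exchanged with respect to `HasWD.ibp_of_faceZero`: the smooth factor vanishes on
the faces and `f` is arbitrary. Since Φ is bounded by the distance to the faces, its product with
the derivative of the cutoff stays bounded, and dominated convergence replaces the uniform
smallness. -/
theorem HasWD.ibp_of_vanish_faces {a b : Fin n → ℝ} {i : Fin n} {f g : Pt n → ℝ}
    (h : HasWD (box a b) i f g) {Φ : Pt n → ℝ} (hΦ : ContDiff ℝ ∞ Φ)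
    (h0 : ∀ x : Pt n, (x i = a i ∨ x i = b i) → Φ x = 0) :
    ∫ x in box a b, f x * pderiv i Φ x = -∫ x in box a b, g x * Φ x := by
  refine h.ibp_of_tendsto hΦ ?_
  obtain ⟨C, hC, hCb⟩ := exists_deriv_cut_bound
  obtain ⟨L, hL, hLb⟩ := exists_abs_le_dist_face hΦ h0
  have hz : ∫ x in box a b, (0 : ℝ) = 0 := by simp
  rw [← hz]
  refine tendsto_integral_of_dominated_convergence (fun x => ‖f x‖ * (C * (2 * L)))
    (fun m => ?_) ((integrable_of_memLp h.memf).norm.mul_const _) ?_ ?_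
  · exact h.memf.1.mul ((continuous_deriv_cut_coord _ _ _ i).mul hΦ.continuous).aestronglyMeasurable
  · intro m
    filter_upwards [ae_restrict_mem (measurableSet_box a b)] with x hx
    rw [norm_mul]
    refine mul_le_mul_of_nonneg_left ?_ (norm_nonneg _)
    rw [norm_mul, Real.norm_eq_abs, Real.norm_eq_abs]
    have hw := wid_pos m
    have h1 := hCb (a i) (b i) (wid m) (x i) hw
    by_cases hz : deriv (cut (a i) (b i) (wid m)) (x i) = 0
    · rw [hz]; simp; positivity
    -- Where the derivative of the cutoff is nonzero, the point is within two widths of one of the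
    -- faces.
    · have h2 : |Φ x| ≤ 2 * L * wid m := by
        by_contra hcon
        rw [not_le] at hcon
        refine hz (deriv_cut_eq_zero hw ?_ ?_)
        · by_contra h3
          have := (hLb x hx).1
          nlinarith
        · by_contra h3
          have := (hLb x hx).2
          nlinarith
      calc _ ≤ C / wid m * (2 * L * wid m) := mul_le_mul h1 h2 (abs_nonneg _) (by positivity)
        _ = _ := by field_simp
  · filter_upwards [ae_restrict_mem (measurableSet_box a b)] with x hx
    refine tendsto_const_nhds.congr' ?_
    filter_upwards [eventually_deriv_cut_eq_zero (hx i)] with m hm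
    rw [hm]; simp

end Box


/-! ### Comparison of the integrals over the two halves of a box. -/

section HalfBox

variable {n : ℕ}

/-- A smooth function of one variable, supported away from the end points of `(u, v)`, whose
derivative approximates `1` on the left half of the interval and `-1` on the right half. -/
theorem exists_tent {u v : ℝ} (huv : u < v) (m : ℕ) :
    ∃ τ : ℝ → ℝ, ContDiff ℝ ∞ τ ∧
      (∀ t, deriv τ t = cut u ((u + v) / 2) (wid m) t - cut u ((u + v) / 2) (wid m) (u + v - t)) ∧
      (∀ t, t ≤ u + wid m ∨ v - wid m ≤ t → τ t = 0) ∧ ∀ t, |τ t| ≤ (v - u) / 2 := by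
  set κ := cut u ((u + v) / 2) (wid m) with hκ
  have hκc : Continuous κ := (contDiff_cut _ _ _).continuous
  -- This function is odd about the midpoint, so its primitive from `u` is even about it and
  -- vanishes near both ends.
  set ρ : ℝ → ℝ := fun t => κ t - κ (u + v - t) with hρ
  have hρs : ContDiff ℝ ∞ ρ := (contDiff_cut _ _ _).sub ((contDiff_cut _ _ _).comp (by fun_prop))
  have hw := wid_pos m
  have hκ0 : ∀ t, t ≤ u + wid m ∨ (u + v) / 2 - wid m ≤ t → κ t = 0 := fun t ht => cut_eq_zero hw ht
  set τ : ℝ → ℝ := fun t => ∫ s in u..t, ρ s with hτ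
  have hd : ∀ t, HasDerivAt τ (ρ t) t := fun t => hρs.continuous.integral_hasStrictDerivAt u t |>.hasDerivAt
  have hder : deriv τ = ρ := funext fun t => (hd t).deriv
  have hii : ∀ c d : ℝ, IntervalIntegrable ρ volume c d := fun c d => hρs.continuous.intervalIntegrable c d
  have hρsymm : ∀ t, ρ (u + v - t) = -ρ t := by
    intro t; simp only [hρ]; rw [sub_sub_cancel]; ring
  have hτsymm : ∀ t, τ (u + v - t) = τ t := by
    intro t
    have h0 : τ v = 0 := by
      have h1 : ∫ s in u..v, ρ (u + v - s) = ∫ s in (u + v - v)..(u + v - u), ρ s :=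
        intervalIntegral.integral_comp_sub_left _ _
      simp_rw [hρsymm, intervalIntegral.integral_neg] at h1
      rw [show u + v - v = u by ring, show u + v - u = v by ring] at h1
      simp only [hτ]; linarith
    have h1 : ∫ s in t..v, ρ (u + v - s) = ∫ s in (u + v - v)..(u + v - t), ρ s :=
      intervalIntegral.integral_comp_sub_left _ _
    simp_rw [hρsymm, intervalIntegral.integral_neg] at h1
    rw [show u + v - v = u by ring] at h1
    have h2 : τ t + ∫ s in t..v, ρ s = τ v :=
      intervalIntegral.integral_add_adjacent_intervals (hii _ _) (hii _ _)
    have : τ (u + v - t) = - ∫ s in t..v, ρ s := h1.symm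
    linarith
  have hleft : ∀ t, t ≤ u + wid m → t ≤ (u + v) / 2 → τ t = 0 := by
    intro t ht ht2
    have : ∀ s ∈ uIcc u t, ρ s = 0 := by
      intro s hs
      have hs1 : s ≤ u + wid m := by
        rcases le_total u t with h | h
        · rw [uIcc_of_le h] at hs; linarith [hs.2]
        · rw [uIcc_of_ge h] at hs; linarith [hs.2]
      have hs2 : s ≤ (u + v) / 2 := by
        rcases le_total u t with h | h
        · rw [uIcc_of_le h] at hs; linarith [hs.2]
        · rw [uIcc_of_ge h] at hs; linarith [hs.2]
      simp only [hρ]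
      rw [hκ0 s (Or.inl hs1), hκ0 (u + v - s) (Or.inr (by linarith))]; ring
    simp only [hτ]
    rw [intervalIntegral.integral_congr (g := fun _ => 0) this]; simp
  have hbound : ∀ t, u ≤ t → t ≤ (u + v) / 2 → |τ t| ≤ (v - u) / 2 := by
    intro t h1 h2
    have : ‖∫ s in u..t, ρ s‖ ≤ 1 * |t - u| := by
      refine intervalIntegral.norm_integral_le_of_norm_le_const fun s _ => ?_
      rw [Real.norm_eq_abs, abs_le]
      have a1 := cut_nonneg u ((u + v) / 2) (wid m) s
      have a2 := cut_le_one u ((u + v) / 2) (wid m) s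
      have a3 := cut_nonneg u ((u + v) / 2) (wid m) (u + v - s)
      have a4 := cut_le_one u ((u + v) / 2) (wid m) (u + v - s)
      simp only [hρ, hκ]
      constructor <;> linarith
    rw [abs_of_nonneg (by linarith : 0 ≤ t - u)] at this
    calc |τ t| ≤ 1 * (t - u) := this
      _ ≤ _ := by linarith
  have hsmooth : ContDiff ℝ ∞ τ := by
    rw [contDiff_infty_iff_deriv]
    exact ⟨fun t => (hd t).differentiableAt, by rw [hder]; exact hρs⟩
  refine ⟨τ, hsmooth, fun t => by rw [hder], ?_, ?_⟩
  · intro t ht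
    rcases le_total t ((u + v) / 2) with h | h
    · rcases ht with ht | ht
      · exact hleft t ht h
      · refine hleft t ?_ h
        linarith
    · rw [← hτsymm]
      rcases ht with ht | ht
      · exact hleft _ (by linarith) (by linarith)
      · exact hleft _ (by linarith) (by linarith)
  · intro t
    rcases le_total t ((u + v) / 2) with h | h
    · rcases le_total u t with h1 | h1
      · exact hbound t h1 h
      · rw [hleft t (by linarith) h]; simp; linarith
    · rw [← hτsymm]
      rcases le_total t v with h1 | h1
      · exact hbound _ (by linarith) (by linarith)
      · rw [hleft _ (by linarith) (by linarith)]; simp; linarith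

/-- The difference is the integral of `f` against the sign of the half. That sign is a limit of
derivatives of tent functions, which vanish near the i-faces and are bounded by half the side
length, so one integration by parts gives the bound. -/
theorem HasWD.abs_integral_half_sub_le {a b : Fin n → ℝ} {i : Fin n} {f g : Pt n → ℝ}
    (hab : a i < b i) (h : HasWD (box a b) i f g) :
    |(∫ x in box a b ∩ {x | x i < (a i + b i) / 2}, f x) -
      ∫ x in box a b ∩ {x | (a i + b i) / 2 < x i}, f x| ≤
      (b i - a i) / 2 * ∫ x in box a b, |g x| := by
  choose τ hτs hτd hτ0 hτb using exists_tent hab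
  set mid := (a i + b i) / 2 with hmid
  have hm : Measurable fun x : Pt n => x i := (EuclideanSpace.proj (𝕜 := ℝ) i).continuous.measurable
  have mL : MeasurableSet {x : Pt n | x i < mid} := measurableSet_lt hm measurable_const
  have mR : MeasurableSet {x : Pt n | mid < x i} := measurableSet_lt measurable_const hm
  have e : ∀ m, ∫ x in box a b, f x * deriv (τ m) (x i) =
      -∫ x in box a b, g x * τ m (x i) := by
    intro m
    have := h.ibp_of_vanish_near (contDiff_coord (hτs m) i) (wid_pos m) (fun x hx => hτ0 m _ hx)
    simpa only [pderiv_coord (hτs m), if_true] using this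
  have hint := integrable_of_memLp h.memf
  have hgint := integrable_of_memLp h.memg
  have hbd : ∀ m, |∫ x in box a b, f x * deriv (τ m) (x i)| ≤
      (b i - a i) / 2 * ∫ x in box a b, |g x| := by
    intro m
    rw [e m, abs_neg, ← integral_const_mul]
    refine (abs_integral_le_integral_abs).trans (integral_mono_of_nonneg ?_ ?_ ?_)
    · filter_upwards with x using abs_nonneg _
    · exact hgint.abs.const_mul _
    · filter_upwards with x
      rw [abs_mul, mul_comm]
      exact mul_le_mul_of_nonneg_right (hτb m _) (abs_nonneg _)
  set sg : Pt n → ℝ := fun x => if x i < mid then 1 else if mid < x i then -1 else 0 with hsg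
  have hlim : Filter.Tendsto (fun m => ∫ x in box a b, f x * deriv (τ m) (x i)) Filter.atTop
      (nhds (∫ x in box a b, f x * sg x)) := by
    refine tendsto_integral_of_dominated_convergence (fun x => ‖f x‖ * 1) (fun m => ?_)
      (hint.norm.mul_const _) ?_ ?_
    · exact h.memf.1.mul (((hτs m).continuous_deriv (by simp)).comp
        (EuclideanSpace.proj (𝕜 := ℝ) i).continuous).aestronglyMeasurable
    · intro m
      filter_upwards with x
      rw [norm_mul]
      refine mul_le_mul_of_nonneg_left ?_ (norm_nonneg _)
      rw [Real.norm_eq_abs, hτd, abs_le]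
      have a1 := cut_nonneg (a i) mid (wid m) (x i)
      have a2 := cut_le_one (a i) mid (wid m) (x i)
      have a3 := cut_nonneg (a i) mid (wid m) (a i + b i - x i)
      have a4 := cut_le_one (a i) mid (wid m) (a i + b i - x i)
      constructor <;> linarith
    · filter_upwards [ae_restrict_mem (measurableSet_box a b)] with x hx
      have hxi := hx i
      refine Filter.Tendsto.mul tendsto_const_nhds ?_
      simp_rw [hτd]
      rcases lt_trichotomy (x i) mid with hlt | heq | hgt
      · have : sg x = 1 := by simp [hsg, hlt]
        rw [this]
        refine tendsto_const_nhds.congr' ?_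
        filter_upwards [eventually_cut_eq_one (a := a i) (b := mid) ⟨hxi.1, hlt⟩] with m hm
        rw [hm, cut_eq_zero (wid_pos m) (Or.inr (by linarith [wid_pos m]))]; ring
      · have : sg x = 0 := by simp [hsg, heq]
        rw [this]
        refine tendsto_const_nhds.congr fun m => ?_
        rw [show a i + b i - x i = x i by rw [heq, hmid]; ring]; ring
      · have : sg x = -1 := by simp [hsg, hgt, not_lt.2 hgt.le]
        rw [this]
        refine tendsto_const_nhds.congr' ?_
        filter_upwards [eventually_cut_eq_one (a := a i) (b := mid) (t := a i + b i - x i)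
          ⟨by linarith [hxi.2], by linarith⟩] with m hm
        rw [hm, cut_eq_zero (wid_pos m) (Or.inr (by linarith [wid_pos m]))]; ring
  have hval : ∫ x in box a b, f x * sg x = (∫ x in box a b ∩ {x | x i < mid}, f x) -
      ∫ x in box a b ∩ {x | mid < x i}, f x := by
    rw [inter_comm, inter_comm (box a b), ← Measure.restrict_restrict mL,
      ← Measure.restrict_restrict mR, ← integral_indicator mL, ← integral_indicator mR,
      ← integral_sub (hint.indicator mL) (hint.indicator mR)]
    congr 1
    ext x
    rcases lt_trichotomy (x i) mid with hlt | heq | hgt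
    · simp [hsg, indicator, hlt, not_lt.2 hlt.le]
    · simp [hsg, indicator, heq]
    · simp [hsg, indicator, hgt, not_lt.2 hgt.le]
  rw [← hval]
  exact le_of_tendsto hlim.abs (Filter.Eventually.of_forall hbd)

end HalfBox

/-! ### Dyadic cells, refined one coordinate at a time. -/

section Cells

variable {n : ℕ}

/-- Index of the dyadic cell of generation `q` that contains `x`. -/
noncomputable def idx (a b : Fin n → ℝ) (q : Fin n → ℕ) (x : Pt n) : Fin n → ℤ :=
  fun l => ⌊2 ^ q l * ((x l - a l) / (b l - a l))⌋

/-- A (half-open) dyadic cell. -/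
def cell (a b : Fin n → ℝ) (q : Fin n → ℕ) (z : Fin n → ℤ) : Set (Pt n) := {x | idx a b q x = z}

/-- Corners of the dyadic cells. -/
noncomputable def corner (a b : Fin n → ℝ) (q : Fin n → ℕ) (z : Fin n → ℤ) : Fin n → ℝ :=
  fun l => a l + (b l - a l) * (z l / 2 ^ q l)

/-- The reciprocal of the volume of the cells. -/
noncomputable def dens (a b : Fin n → ℝ) (q : Fin n → ℕ) : ℝ := ∏ l, 2 ^ q l / (b l - a l)

variable {a b : Fin n → ℝ} (hab : ∀ l, a l < b l)
include hab

theorem dens_pos (q : Fin n → ℕ) : 0 < dens a b q :=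
  Finset.prod_pos fun l _ => div_pos (by positivity) (sub_pos.2 (hab l))

theorem mem_cell_iff (q : Fin n → ℕ) (z : Fin n → ℤ) (x : Pt n) :
    x ∈ cell a b q z ↔ ∀ l, x l ∈ Ico (corner a b q z l) (corner a b q (z + 1) l) := by
  have : x ∈ cell a b q z ↔ ∀ l, idx a b q x l = z l := funext_iff
  rw [this]
  refine forall_congr' fun l => ?_
  have hl := sub_pos.2 (hab l)
  have h2 : (0 : ℝ) < 2 ^ q l := by positivity
  simp only [idx, corner, Int.floor_eq_iff, mem_Ico, Pi.add_apply, Pi.one_apply]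
  push_cast
  have e1 : (z l : ℝ) ≤ 2 ^ q l * ((x l - a l) / (b l - a l)) ↔
      a l + (b l - a l) * (z l / 2 ^ q l) ≤ x l := by
    rw [← div_le_iff₀' h2, le_div_iff₀ hl]
    constructor <;> intro h <;> linarith
  have e2 : 2 ^ q l * ((x l - a l) / (b l - a l)) < (z l : ℝ) + 1 ↔
      x l < a l + (b l - a l) * ((z l + 1) / 2 ^ q l) := by
    rw [← lt_div_iff₀' h2, div_lt_iff₀ hl]
    constructor <;> intro h <;> linarith
  rw [e1, e2]

/-- Half-open cells partition the space, while weak derivatives restrict to open sets; passing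
between the two costs a null set. -/
theorem cell_ae_eq_box (q : Fin n → ℕ) (z : Fin n → ℤ) :
    cell a b q z =ᵐ[volume] box (corner a b q z) (corner a b q (z + 1)) := by
  have e : cell a b q z = (WithLp.ofLp : Pt n → (Fin n → ℝ)) ⁻¹'
      (univ.pi fun i => Ico (corner a b q z i) (corner a b q (z + 1) i)) := by
    ext x; rw [mem_cell_iff hab]; exact ⟨fun h i _ => h i, fun h i => h i trivial⟩
  rw [e, box_eq_preimage]
  refine (PiLp.volume_preserving_ofLp (Fin n)).quasiMeasurePreserving.preimage_ae_eq ?_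
  exact Measure.univ_pi_Ico_ae_eq_Icc.trans Measure.univ_pi_Ioo_ae_eq_Icc.symm

omit hab in
theorem measurable_idx (q : Fin n → ℕ) : Measurable (idx a b q) := by
  refine measurable_pi_lambda _ fun l => ?_
  refine Int.measurable_floor.comp ?_
  have hm : Measurable fun x : Pt n => x l := (EuclideanSpace.proj (𝕜 := ℝ) l).continuous.measurable
  exact ((hm.sub_const _).div_const _).const_mul _

omit hab in
theorem measurableSet_cell (q : Fin n → ℕ) (z : Fin n → ℤ) : MeasurableSet (cell a b q z) :=
  measurable_idx q (measurableSet_singleton z)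

theorem idx_bounds (q : Fin n → ℕ) {x : Pt n} (hx : x ∈ box a b) (l : Fin n) :
    0 ≤ idx a b q x l ∧ idx a b q x l + 1 ≤ 2 ^ q l := by
  have hl := sub_pos.2 (hab l)
  have h2 : (0 : ℝ) < 2 ^ q l := by positivity
  have hx1 := hx l
  have p1 : 0 ≤ (x l - a l) / (b l - a l) := div_nonneg (by linarith [hx1.1]) hl.le
  have p2 : (x l - a l) / (b l - a l) < 1 := by rw [div_lt_one hl]; linarith [hx1.2]
  refine ⟨Int.floor_nonneg.2 (by positivity), ?_⟩
  rw [Int.add_one_le_iff, idx, Int.floor_lt]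
  push_cast
  nlinarith

theorem cellBox_subset (q : Fin n → ℕ) {x : Pt n} (hx : x ∈ box a b) :
    box (corner a b q (idx a b q x)) (corner a b q (idx a b q x + 1)) ⊆ box a b := by
  intro y hy l
  have hl := sub_pos.2 (hab l)
  have h2 : (0 : ℝ) < 2 ^ q l := by positivity
  obtain ⟨h1, h3⟩ := idx_bounds hab q hx l
  have hyl := hy l
  simp only [corner, Pi.add_apply, Pi.one_apply] at hyl
  have c1 : (0 : ℝ) ≤ (idx a b q x l : ℝ) / 2 ^ q l := by
    have : (0 : ℝ) ≤ (idx a b q x l : ℝ) := by exact_mod_cast h1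
    positivity
  have c2 : ((idx a b q x l + 1 : ℤ) : ℝ) / 2 ^ q l ≤ 1 := by
    rw [div_le_one h2]; exact_mod_cast h3
  constructor
  · nlinarith [hyl.1]
  · nlinarith [hyl.2]

theorem restrict_cell (q : Fin n → ℕ) {x : Pt n} (hx : x ∈ box a b) :
    (volume.restrict (box a b)).restrict (cell a b q (idx a b q x)) =
      volume.restrict (box (corner a b q (idx a b q x)) (corner a b q (idx a b q x + 1))) := by
  rw [Measure.restrict_restrict (measurableSet_cell q _)]
  refine Measure.restrict_congr_set ?_
  have h1 := (cell_ae_eq_box hab q (idx a b q x)).inter (ae_eq_refl (box a b))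
  rwa [inter_eq_self_of_subset_left (cellBox_subset hab q hx)] at h1

theorem volume_cellBox (q : Fin n → ℕ) (z : Fin n → ℤ) :
    volume (box (corner a b q z) (corner a b q (z + 1))) = ENNReal.ofReal (dens a b q)⁻¹ := by
  rw [volume_box, dens, ← Finset.prod_inv_distrib, ENNReal.ofReal_prod_of_nonneg]
  · refine Finset.prod_congr rfl fun l _ => ?_
    congr 1
    simp only [corner, Pi.add_apply, Pi.one_apply]
    push_cast
    rw [inv_div]; ring
  · intro l _
    have := sub_pos.2 (hab l)
    positivity

theorem measure_cell (q : Fin n → ℕ) {x : Pt n} (hx : x ∈ box a b) :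
    (volume.restrict (box a b)) (cell a b q (idx a b q x)) = (ENNReal.ofReal (dens a b q))⁻¹ := by
  have h := restrict_cell hab q hx
  have h2 : (volume.restrict (box a b)) (cell a b q (idx a b q x)) =
    ((volume.restrict (box a b)).restrict (cell a b q (idx a b q x))) univ := by simp
  rw [h2, h, Measure.restrict_apply_univ, volume_cellBox hab,
    ENNReal.ofReal_inv_of_pos (dens_pos hab q)]

omit hab in
theorem idx_succ_of_ne (q : Fin n → ℕ) {l l' : Fin n} (h : l' ≠ l) (x : Pt n) :
    idx a b (q + Pi.single l 1) x l' = idx a b q x l' := by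
  simp [idx, h]

omit hab in
theorem idx_succ_self (q : Fin n → ℕ) (l : Fin n) (x : Pt n) :
    idx a b (q + Pi.single l 1) x l = 2 * idx a b q x l ∨
    idx a b (q + Pi.single l 1) x l = 2 * idx a b q x l + 1 := by
  simp only [idx, Pi.add_apply, Pi.single_eq_same, pow_succ]
  set t := (2 : ℝ) ^ q l * ((x l - a l) / (b l - a l)) with ht
  rw [show (2 : ℝ) ^ q l * 2 * ((x l - a l) / (b l - a l)) = 2 * t by rw [ht]; ring]
  have h1 := Int.floor_le t
  have h2 := Int.lt_floor_add_one t
  have h3 := Int.floor_le (2 * t)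
  have h4 := Int.lt_floor_add_one (2 * t)
  have h5 : 2 * ⌊t⌋ ≤ ⌊2 * t⌋ := Int.le_floor.2 (by push_cast; linarith)
  have h6 : ⌊2 * t⌋ < 2 * ⌊t⌋ + 2 := Int.floor_lt.2 (by push_cast; linarith)
  omega

omit hab in
-- The generation is a vector of exponents, so a single coordinate can be bisected; this matches the
-- one-directional comparison of the two halves of a box.
theorem cell_succ (q : Fin n → ℕ) (l : Fin n) (z : Fin n → ℤ) :
    cell a b q z = cell a b (q + Pi.single l 1) (Function.update z l (2 * z l)) ∪
      cell a b (q + Pi.single l 1) (Function.update z l (2 * z l + 1)) := by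
  ext x
  simp only [cell, mem_ofPred_eq, mem_union]
  constructor
  · rintro rfl
    rcases idx_succ_self (a := a) (b := b) q l x with h | h
    · left; ext l'
      by_cases hl : l' = l
      · subst hl; rw [h, Function.update_self]
      · rw [idx_succ_of_ne q hl, Function.update_of_ne hl]
    · right; ext l'
      by_cases hl : l' = l
      · subst hl; rw [h, Function.update_self]
      · rw [idx_succ_of_ne q hl, Function.update_of_ne hl]
  · intro h
    ext l'
    by_cases hl : l' = l
    · subst hl
      have h3 := idx_succ_self (a := a) (b := b) q l' x
      rcases h with h | h
      · have := congrFun h l'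
        rw [Function.update_self] at this
        omega
      · have := congrFun h l'
        rw [Function.update_self] at this
        omega
    · rcases h with h | h
      · have := congrFun h l'
        rwa [Function.update_of_ne hl, idx_succ_of_ne q hl] at this
      · have := congrFun h l'
        rwa [Function.update_of_ne hl, idx_succ_of_ne q hl] at this

omit hab in
theorem disjoint_cell (q : Fin n → ℕ) {z z' : Fin n → ℤ} (h : z ≠ z') :
    Disjoint (cell a b q z) (cell a b q z') :=
  disjoint_left.2 fun _ hx hx' => h (hx.symm.trans hx')

omit hab in
theorem dens_succ (q : Fin n → ℕ) (l : Fin n) : dens a b (q + Pi.single l 1) = 2 * dens a b q := by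
  unfold dens
  rw [← Finset.mul_prod_erase _ _ (Finset.mem_univ l),
    ← Finset.mul_prod_erase _ (fun l => 2 ^ q l / (b l - a l)) (Finset.mem_univ l)]
  have : ∏ x ∈ Finset.univ.erase l, 2 ^ (q + Pi.single l 1 : Fin n → ℕ) x / (b x - a x) =
      ∏ x ∈ Finset.univ.erase l, 2 ^ q x / (b x - a x) :=
    Finset.prod_congr rfl fun x hx => by simp [Finset.ne_of_mem_erase hx]
  rw [this]
  simp [pow_succ]
  ring

end Cells


/-! ### Averages over dyadic cells. -/

section Averages

open scoped ENNReal

variable {n : ℕ}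

/-- The average of a real function over the dyadic cell containing `x`. -/
noncomputable def avg (a b : Fin n → ℝ) (q : Fin n → ℕ) (f : Pt n → ℝ) (x : Pt n) : ℝ :=
  dens a b q * ∫ y in cell a b q (idx a b q x), f y ∂(volume.restrict (box a b))

/-- The average of an extended nonnegative function over the dyadic cell containing `x`. -/
noncomputable def lavg (a b : Fin n → ℝ) (q : Fin n → ℕ) (F : Pt n → ℝ≥0∞) (x : Pt n) : ℝ≥0∞ :=
  ENNReal.ofReal (dens a b q) * ∫⁻ y in cell a b q (idx a b q x), F y ∂(volume.restrict (box a b))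

variable {a b : Fin n → ℝ}

theorem lavg_congr_idx (q : Fin n → ℕ) (F : Pt n → ℝ≥0∞) {x y : Pt n}
    (h : idx a b q x = idx a b q y) : lavg a b q F x = lavg a b q F y := by
  unfold lavg; rw [h]

theorem avg_congr_idx (q : Fin n → ℕ) (f : Pt n → ℝ) {x y : Pt n}
    (h : idx a b q x = idx a b q y) : avg a b q f x = avg a b q f y := by
  unfold avg; rw [h]

theorem measurable_lavg (q : Fin n → ℕ) (F : Pt n → ℝ≥0∞) : Measurable (lavg a b q F) := by
  have : lavg a b q F = (fun z => ENNReal.ofReal (dens a b q) *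
      ∫⁻ y in cell a b q z, F y ∂(volume.restrict (box a b))) ∘ idx a b q := rfl
  rw [this]
  exact (measurable_of_countable _).comp (measurable_idx q)

theorem measurable_avg (q : Fin n → ℕ) (f : Pt n → ℝ) : Measurable (avg a b q f) := by
  have : avg a b q f = (fun z => dens a b q *
      ∫ y in cell a b q z, f y ∂(volume.restrict (box a b))) ∘ idx a b q := rfl
  rw [this]
  exact (measurable_of_countable _).comp (measurable_idx q)

theorem lavg_mono (q : Fin n → ℕ) {F G : Pt n → ℝ≥0∞} (h : ∀ᵐ x ∂(volume.restrict (box a b)), F x ≤ G x)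
    (x : Pt n) : lavg a b q F x ≤ lavg a b q G x := by
  unfold lavg
  gcongr 1
  exact lintegral_mono_ae (ae_restrict_of_ae h)

/-- A half cell has half the volume, so its average is at most twice that of the full cell. -/
theorem lavg_succ_le (q : Fin n → ℕ) (l : Fin n) (F : Pt n → ℝ≥0∞) (x : Pt n) :
    lavg a b (q + Pi.single l 1) F x ≤ 2 * lavg a b q F x := by
  unfold lavg
  rw [dens_succ, ENNReal.ofReal_mul (by norm_num), ENNReal.ofReal_ofNat, mul_assoc]
  gcongr 2
  refine lintegral_mono_set ?_
  rw [cell_succ q l]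
  rcases idx_succ_self (a := a) (b := b) q l x with h | h
  · refine subset_union_of_subset_left (fun y hy => ?_) _
    refine hy.trans ?_
    ext l'
    by_cases hl : l' = l
    · subst hl; rw [h, Function.update_self]
    · rw [idx_succ_of_ne q hl, Function.update_of_ne hl]
  · refine subset_union_of_subset_right (fun y hy => ?_) _
    refine hy.trans ?_
    ext l'
    by_cases hl : l' = l
    · subst hl; rw [h, Function.update_self]
    · rw [idx_succ_of_ne q hl, Function.update_of_ne hl]

section

variable (hab : ∀ l, a l < b l)
include hab

theorem lavg_const (q : Fin n → ℕ) (c : ℝ≥0∞) {x : Pt n} (hx : x ∈ box a b) :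
    lavg a b q (fun _ => c) x = c := by
  unfold lavg
  rw [lintegral_const, Measure.restrict_apply_univ, measure_cell hab q hx, mul_comm, mul_assoc,
    ENNReal.inv_mul_cancel, mul_one]
  · simpa using dens_pos hab q
  · exact ENNReal.ofReal_ne_top

omit hab in
theorem lavg_const_mul (q : Fin n → ℕ) (c : ℝ≥0∞) {F : Pt n → ℝ≥0∞}
    (hF : AEMeasurable F (volume.restrict (box a b))) (x : Pt n) :
    lavg a b q (fun y => c * F y) x = c * lavg a b q F x := by
  unfold lavg
  rw [lintegral_const_mul'' _ (hF.mono_measure Measure.restrict_le_self), mul_left_comm]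

omit hab in
theorem lavg_add (q : Fin n → ℕ) {F G : Pt n → ℝ≥0∞}
    (hF : AEMeasurable F (volume.restrict (box a b))) (x : Pt n) :
    lavg a b q (fun y => F y + G y) x = lavg a b q F x + lavg a b q G x := by
  unfold lavg
  rw [lintegral_add_left' (hF.mono_measure Measure.restrict_le_self), mul_add]

omit hab in
theorem lavg_tsum (q : Fin n → ℕ) {F : ℕ → Pt n → ℝ≥0∞}
    (hF : ∀ i, AEMeasurable (F i) (volume.restrict (box a b))) (x : Pt n) :
    lavg a b q (fun y => ∑' i, F i y) x = ∑' i, lavg a b q (F i) x := by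
  unfold lavg
  rw [lintegral_tsum fun i => (hF i).mono_measure Measure.restrict_le_self, ENNReal.tsum_mul_left]

/-- Over a cell, the averages over smaller cells integrate to the same value. -/
theorem setLIntegral_cell_lavg (q p : Fin n → ℕ) (F : Pt n → ℝ≥0∞) (z : Fin n → ℤ) :
    ∫⁻ x in cell a b q z, lavg a b (q + p) F x ∂(volume.restrict (box a b)) =
      ∫⁻ x in cell a b q z, F x ∂(volume.restrict (box a b)) := by
  -- The induction is on the total number of bisections: one of them is transferred from `p` to `q`,
  -- which splits the cell into two halves.
  induction hk : ∑ l, p l generalizing q p z with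
  | zero =>
    have hp : p = 0 := by
      ext l
      simpa using (Finset.sum_eq_zero_iff.1 hk) l (Finset.mem_univ l)
    subst hp
    rw [add_zero]
    by_cases hz : ∃ x ∈ box a b, idx a b q x = z
    · obtain ⟨x, hx, rfl⟩ := hz
      have : ∫⁻ y in cell a b q (idx a b q x), lavg a b q F y ∂(volume.restrict (box a b)) =
          ∫⁻ y in cell a b q (idx a b q x), lavg a b q F x ∂(volume.restrict (box a b)) :=
        setLIntegral_congr_fun (measurableSet_cell q _) fun y hy => lavg_congr_idx q F hy
      rw [this, lintegral_const, Measure.restrict_apply_univ, measure_cell hab q hx, lavg,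
        mul_comm, ← mul_assoc, ENNReal.inv_mul_cancel, one_mul]
      · simpa using dens_pos hab q
      · exact ENNReal.ofReal_ne_top
    -- Indices of cells that do not meet the box occur among the `z`; both integrals then vanish.
    · have : (volume.restrict (box a b)) (cell a b q z) = 0 := by
        rw [Measure.restrict_apply (measurableSet_cell q z)]
        convert measure_empty (μ := volume)
        ext x
        simp only [mem_inter_iff, mem_empty_iff_false, iff_false, not_and]
        exact fun h1 h2 => hz ⟨x, h2, h1⟩
      rw [Measure.restrict_eq_zero.2 this]; simp
  | succ k ih =>
    obtain ⟨l, hl⟩ : ∃ l, p l ≠ 0 := by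
      by_contra h
      push Not at h
      simp [h] at hk
    set p' : Fin n → ℕ := fun l' => if l' = l then p l - 1 else p l' with hp'
    have hpp : p = Pi.single l 1 + p' := by
      ext l'
      by_cases h : l' = l
      · subst h; simp [hp']; omega
      · simp [hp', h]
    have hsum : ∑ l, p' l = k := by
      have : ∑ l', p l' = ∑ l', (Pi.single l 1 + p' : Fin n → ℕ) l' := by rw [← hpp]
      rw [hk] at this
      simp only [Pi.add_apply, Finset.sum_add_distrib] at this
      simp at this
      omega
    rw [cell_succ q l z]
    have hdis : Disjoint (cell a b (q + Pi.single l 1) (Function.update z l (2 * z l)))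
        (cell a b (q + Pi.single l 1) (Function.update z l (2 * z l + 1))) := by
      refine disjoint_cell _ fun h => ?_
      have := congrFun h l
      simp at this
    rw [lintegral_union (measurableSet_cell _ _) hdis, lintegral_union (measurableSet_cell _ _) hdis,
      hpp, ← add_assoc, ih _ _ _ hsum, ih _ _ _ hsum]

theorem lavg_lavg (q p : Fin n → ℕ) (F : Pt n → ℝ≥0∞) (x : Pt n) :
    lavg a b q (lavg a b (q + p) F) x = lavg a b q F x := by
  unfold lavg
  congr 1
  exact setLIntegral_cell_lavg hab q p F _

theorem cell_zero_ae : ∀ᵐ x ∂(volume.restrict (box a b)), x ∈ cell a b 0 0 := by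
  filter_upwards [ae_restrict_mem (measurableSet_box a b)] with x hx
  change idx a b 0 x = 0
  ext l
  have := idx_bounds hab 0 hx l
  simp only [Pi.zero_apply, pow_zero] at this ⊢
  omega

theorem lintegral_lavg (q : Fin n → ℕ) (F : Pt n → ℝ≥0∞) :
    ∫⁻ x in box a b, lavg a b q F x = ∫⁻ x in box a b, F x := by
  have h := setLIntegral_cell_lavg hab 0 q F 0
  rw [zero_add] at h
  have e : (volume.restrict (box a b)).restrict (cell a b 0 0) = volume.restrict (box a b) :=
    Measure.restrict_eq_self_of_ae_mem (cell_zero_ae hab)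
  rwa [e] at h

omit hab in
-- A factor that depends only on the cell comes out of the average.
theorem lavg_mul_const_on_cells (q : Fin n → ℕ) (F H : Pt n → ℝ≥0∞)
    (hF : AEMeasurable F (volume.restrict (box a b)))
    (hH : ∀ x y, idx a b q x = idx a b q y → H x = H y) (x : Pt n) :
    lavg a b q (fun y => F y * H y) x = lavg a b q F x * H x := by
  unfold lavg
  have : ∫⁻ y in cell a b q (idx a b q x), F y * H y ∂(volume.restrict (box a b)) =
      ∫⁻ y in cell a b q (idx a b q x), F y * H x ∂(volume.restrict (box a b)) :=
    setLIntegral_congr_fun (measurableSet_cell q _) fun y hy => by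
      rw [hH y x hy]
  rw [this, lintegral_mul_const'' _ (hF.mono_measure Measure.restrict_le_self), mul_assoc]

omit hab in
theorem sq_lintegral_le {α : Type*} [MeasurableSpace α] (μ : Measure α) {F : α → ℝ≥0∞}
    (hF : AEMeasurable F μ) : (∫⁻ x, F x ∂μ) ^ 2 ≤ μ univ * ∫⁻ x, F x ^ 2 ∂μ := by
  have h := ENNReal.lintegral_mul_le_Lp_mul_Lq μ Real.HolderConjugate.two_two hF
    (aemeasurable_const (b := (1 : ℝ≥0∞)))
  simp only [Pi.mul_apply, mul_one, ENNReal.one_rpow, lintegral_const, one_mul] at h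
  calc (∫⁻ x, F x ∂μ) ^ 2 ≤ ((∫⁻ x, F x ^ (2 : ℝ) ∂μ) ^ (1 / 2 : ℝ) * (μ univ) ^ (1 / 2 : ℝ)) ^ 2 := by
        gcongr
    _ = _ := by
        rw [mul_pow, ← ENNReal.rpow_mul_natCast, ← ENNReal.rpow_mul_natCast]
        norm_num
        rw [mul_comm]

/-- Cauchy–Schwarz on the cell, whose measure is exactly the reciprocal of `dens`, so that no
constant appears. -/
theorem sq_lavg_le (q : Fin n → ℕ) {F : Pt n → ℝ≥0∞} (hF : AEMeasurable F (volume.restrict (box a b)))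
    {x : Pt n} (hx : x ∈ box a b) : lavg a b q F x ^ 2 ≤ lavg a b q (fun y => F y ^ 2) x := by
  unfold lavg
  have hd0 : ENNReal.ofReal (dens a b q) ≠ 0 := by simpa using dens_pos hab q
  have h := sq_lintegral_le ((volume.restrict (box a b)).restrict (cell a b q (idx a b q x)))
    (hF.mono_measure Measure.restrict_le_self)
  rw [Measure.restrict_apply_univ, measure_cell hab q hx] at h
  rw [mul_pow]
  calc _ ≤ ENNReal.ofReal (dens a b q) ^ 2 * ((ENNReal.ofReal (dens a b q))⁻¹ *
        ∫⁻ y in cell a b q (idx a b q x), F y ^ 2 ∂(volume.restrict (box a b))) := by gcongr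
    _ = _ := by
        rw [pow_two, mul_assoc, ← mul_assoc _ _⁻¹, ENNReal.mul_inv_cancel hd0 ENNReal.ofReal_ne_top,
          one_mul]

omit hab in
-- Cauchy–Schwarz for the counting measure after splitting each weight into two square roots.
theorem sq_tsum_le (w F : ℕ → ℝ≥0∞) :
    (∑' i, w i * F i) ^ 2 ≤ (∑' i, w i) * ∑' i, w i * F i ^ 2 := by
  have hm : Measurable F := measurable_of_countable _
  have hw : Measurable w := measurable_of_countable _
  have h := ENNReal.lintegral_mul_le_Lp_mul_Lq (Measure.count : Measure ℕ)
    Real.HolderConjugate.two_two (f := fun i => w i ^ (1 / 2 : ℝ))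
    (g := fun i => w i ^ (1 / 2 : ℝ) * F i)
    (measurable_of_countable _).aemeasurable (measurable_of_countable _).aemeasurable
  simp only [lintegral_count, Pi.mul_apply] at h
  have e1 : ∀ i, w i ^ (1 / 2 : ℝ) * (w i ^ (1 / 2 : ℝ) * F i) = w i * F i := by
    intro i
    rw [← mul_assoc, ← ENNReal.rpow_add_of_nonneg _ _ (by norm_num) (by norm_num)]; norm_num
  have e2 : ∀ i, (w i ^ (1 / 2 : ℝ)) ^ (2 : ℝ) = w i := by
    intro i; rw [← ENNReal.rpow_mul]; norm_num
  have e3 : ∀ i, (w i ^ (1 / 2 : ℝ) * F i) ^ (2 : ℝ) = w i * F i ^ 2 := by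
    intro i
    rw [ENNReal.mul_rpow_of_nonneg _ _ (by norm_num), e2]; norm_num
  simp_rw [e1, e2, e3] at h
  calc _ ≤ ((∑' i, w i) ^ (1 / 2 : ℝ) * (∑' i, w i * F i ^ 2) ^ (1 / 2 : ℝ)) ^ 2 := by gcongr
    _ = _ := by
        rw [mul_pow, ← ENNReal.rpow_mul_natCast, ← ENNReal.rpow_mul_natCast]
        norm_num

theorem enorm_avg_le (q : Fin n → ℕ) (f : Pt n → ℝ) (x : Pt n) :
    ‖avg a b q f x‖ₑ ≤ lavg a b q (fun y => ‖f y‖ₑ) x := by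
  unfold avg lavg
  rw [enorm_mul, Real.enorm_of_nonneg (dens_pos hab q).le]
  gcongr
  exact enorm_integral_le_lintegral_enorm _

/-- Passing to a cell of half the size in one direction changes the average by at most the size
of the cell times the average of the derivative. -/
theorem HasWD.enorm_avg_succ_sub_le {l : Fin n} {f g : Pt n → ℝ} (h : HasWD (box a b) l f g)
    (q : Fin n → ℕ) {x : Pt n} (hx : x ∈ box a b) :
    ‖avg a b (q + Pi.single l 1) f x - avg a b q f x‖ₑ ≤
      ENNReal.ofReal ((b l - a l) / 2 ^ q l) * lavg a b q (fun y => ‖g y‖ₑ) x := by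
  set z := idx a b q x with hz
  set zL := Function.update z l (2 * z l) with hzL
  set zR := Function.update z l (2 * z l + 1) with hzR
  set μ := volume.restrict (box a b) with hμ
  set a' := corner a b q z with ha'
  set b' := corner a b q (z + 1) with hb'
  have hd := dens_pos hab q
  have hl := sub_pos.2 (hab l)
  have h2 : (0 : ℝ) < 2 ^ q l := by positivity
  have hside : b' l - a' l = (b l - a l) / 2 ^ q l := by
    simp only [ha', hb', corner, Pi.add_apply, Pi.one_apply]; push_cast; ring
  have hab' : a' l < b' l := by
    have : 0 < b' l - a' l := by rw [hside]; positivity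
    linarith
  have hsub : box a' b' ⊆ box a b := cellBox_subset hab q hx
  have hr : μ.restrict (cell a b q z) = volume.restrict (box a' b') := restrict_cell hab q hx
  have hhalf := (h.mono hsub).abs_integral_half_sub_le hab'
  have hm : Measurable fun x : Pt n => x l := (EuclideanSpace.proj (𝕜 := ℝ) l).continuous.measurable
  have hmid : (a' l + b' l) / 2 = a l + (b l - a l) * ((2 * z l + 1 : ℤ) / 2 ^ (q l + 1)) := by
    simp only [ha', hb', corner, Pi.add_apply, Pi.one_apply, pow_succ]; push_cast; field_simp; ring
  have hcellU : cell a b q z = cell a b (q + Pi.single l 1) zL ∪ cell a b (q + Pi.single l 1) zR :=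
    cell_succ q l z
  -- the two halves
  have hLset : ∀ y ∈ cell a b q z, (y ∈ cell a b (q + Pi.single l 1) zL ↔ y l < (a' l + b' l) / 2) := by
    intro y hy
    constructor
    · intro hyL
      have := ((mem_cell_iff hab _ _ y).1 hyL l).2
      rw [hmid]
      simpa [corner, hzL] using this
    · intro hlt
      rw [hcellU] at hy
      rcases hy with hy | hy
      · exact hy
      · exfalso
        have := ((mem_cell_iff hab _ _ y).1 hy l).1
        rw [hmid] at hlt
        simp only [corner, hzR, Function.update_self, Pi.add_apply, Pi.single_eq_same] at this
        linarith
  have hdis : Disjoint (cell a b (q + Pi.single l 1) zL) (cell a b (q + Pi.single l 1) zR) := by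
    refine disjoint_cell _ fun h => ?_
    have := congrFun h l
    simp [hzL, hzR] at this
  -- The dividing hyperplane belongs to the right half-open cell but to neither open half box; it is
  -- null.
  have hnull : ∀ᵐ y ∂μ, y l ≠ (a' l + b' l) / 2 := by
    have hv : volume {y : Pt n | y l = (a' l + b' l) / 2} = 0 := by
      have hp := (PiLp.volume_preserving_ofLp (Fin n)).measure_preimage
        (s := {v : Fin n → ℝ | v l = (a' l + b' l) / 2})
        (measurableSet_eq_fun (measurable_pi_apply l) measurable_const).nullMeasurableSet
      refine hp.trans ?_
      exact Measure.pi_hyperplane _ l _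
    exact ae_restrict_of_ae (measure_eq_zero_iff_ae_notMem.1 hv)
  have eL : ∫ y in cell a b (q + Pi.single l 1) zL, f y ∂μ =
      ∫ y in box a' b' ∩ {y | y l < (a' l + b' l) / 2}, f y := by
    have mS : MeasurableSet {y : Pt n | y l < (a' l + b' l) / 2} := measurableSet_lt hm measurable_const
    rw [inter_comm, ← Measure.restrict_restrict mS, ← hr, Measure.restrict_restrict mS]
    congr 2
    ext y
    constructor
    · intro hy
      have hyc : y ∈ cell a b q z := by rw [hcellU]; exact Or.inl hy
      exact ⟨(hLset y hyc).1 hy, hyc⟩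
    · rintro ⟨h1, h2⟩
      exact (hLset y h2).2 h1
  have eR : ∫ y in cell a b (q + Pi.single l 1) zR, f y ∂μ =
      ∫ y in box a' b' ∩ {y | (a' l + b' l) / 2 < y l}, f y := by
    have mS : MeasurableSet {y : Pt n | (a' l + b' l) / 2 < y l} := measurableSet_lt measurable_const hm
    rw [inter_comm, ← Measure.restrict_restrict mS, ← hr, Measure.restrict_restrict mS]
    refine setIntegral_congr_set ?_
    filter_upwards [hnull] with y hy
    apply propext
    constructor
    · intro hyR
      have hyc : y ∈ cell a b q z := by rw [hcellU]; exact Or.inr hyR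
      have : ¬ y l < (a' l + b' l) / 2 := fun hlt =>
        disjoint_left.1 hdis ((hLset y hyc).2 hlt) hyR
      exact ⟨lt_of_le_of_ne (not_lt.1 this) (Ne.symm hy), hyc⟩
    · rintro ⟨h1, h2⟩
      have h3 := h2
      rw [hcellU] at h3
      rcases h3 with h3 | h3
      · exact absurd ((hLset y h2).1 h3) (not_lt.2 (le_of_lt h1))
      · exact h3
  rw [← eL, ← eR] at hhalf
  have hfi := integrable_of_memLp h.memf
  have hsplit : ∫ y in cell a b q z, f y ∂μ = (∫ y in cell a b (q + Pi.single l 1) zL, f y ∂μ) +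
      ∫ y in cell a b (q + Pi.single l 1) zR, f y ∂μ := by
    rw [hcellU]
    exact setIntegral_union hdis (measurableSet_cell _ _) hfi.integrableOn hfi.integrableOn
  -- The density doubles under bisection, so the difference is the density times 2∫_L − (∫_L + ∫_R),
  -- or the same with the halves exchanged: up to sign the difference of the two half integrals.
  have hdiff : |avg a b (q + Pi.single l 1) f x - avg a b q f x| =
      dens a b q * |(∫ y in cell a b (q + Pi.single l 1) zL, f y ∂μ) -
        ∫ y in cell a b (q + Pi.single l 1) zR, f y ∂μ| := by
    have hz' : idx a b (q + Pi.single l 1) x = zL ∨ idx a b (q + Pi.single l 1) x = zR := by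
      have : x ∈ cell a b q z := rfl
      rw [hcellU] at this
      exact this
    unfold avg
    rw [← hz, hsplit, dens_succ]
    rcases hz' with h' | h' <;> rw [h']
    · rw [← abs_of_pos hd, ← abs_mul, abs_of_pos hd]; congr 1; ring
    · rw [← abs_of_pos hd, ← abs_mul, abs_of_pos hd, ← abs_neg]; congr 1; ring
  have hgi : Integrable g (volume.restrict (box a' b')) := integrable_of_memLp (h.mono hsub).memg
  rw [Real.enorm_eq_ofReal_abs, hdiff]
  have hfin : dens a b q * |(∫ y in cell a b (q + Pi.single l 1) zL, f y ∂μ) -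
        ∫ y in cell a b (q + Pi.single l 1) zR, f y ∂μ| ≤
      (b l - a l) / 2 ^ q l * (dens a b q * ∫ y in box a' b', |g y|) := by
    have h0 : 0 ≤ ∫ y in box a' b', |g y| := integral_nonneg fun _ => abs_nonneg _
    calc _ ≤ dens a b q * ((b' l - a' l) / 2 * ∫ y in box a' b', |g y|) := by gcongr
      _ ≤ dens a b q * ((b' l - a' l) * ∫ y in box a' b', |g y|) := by
          gcongr; linarith
      _ = _ := by rw [hside]; ring
  refine (ENNReal.ofReal_le_ofReal hfin).trans ?_
  rw [ENNReal.ofReal_mul (by positivity), ENNReal.ofReal_mul hd.le]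
  unfold lavg
  rw [hr, ofReal_integral_eq_lintegral_ofReal hgi.abs (Filter.Eventually.of_forall fun _ => abs_nonneg _)]
  simp_rw [Real.enorm_eq_ofReal_abs]
  exact le_rfl

end

end Averages


/-! ### Telescoping over dyadic levels, Lebesgue differentiation and the Poincaré inequality. -/

section Levels

open scoped ENNReal

variable {n : ℕ}

/-- The constant generation vector. -/
def lvl (n m : ℕ) : Fin n → ℕ := fun _ => m

theorem lvl_add (m m' : ℕ) : lvl n (m + m') = lvl n m + lvl n m' := rfl

/-- The constant in the comparison of averages of consecutive levels. -/
noncomputable def stepK (a b : Fin n → ℝ) : ℝ≥0∞ := 2 ^ n * ∑ l, ENNReal.ofReal (b l - a l)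

theorem stepK_ne_top (a b : Fin n → ℝ) : stepK a b ≠ ⊤ := by
  refine ENNReal.mul_ne_top (by finiteness) ?_
  exact ENNReal.sum_ne_top.2 fun _ _ => ENNReal.ofReal_ne_top

variable {a b : Fin n → ℝ}

theorem lavg_add_sum_single_le (q : Fin n → ℕ) (s : Finset (Fin n)) (F : Pt n → ℝ≥0∞) (x : Pt n) :
    lavg a b (q + ∑ l ∈ s, Pi.single l 1) F x ≤ 2 ^ s.card * lavg a b q F x := by
  induction s using Finset.induction_on with
  | empty => simp
  | insert l s hl ih =>
    rw [Finset.sum_insert hl, Finset.card_insert_of_notMem hl, add_comm (Pi.single l 1), ← add_assoc]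
    refine (lavg_succ_le _ l F x).trans ?_
    rw [pow_succ', mul_assoc]
    gcongr

theorem sum_single_eq_lvl : ∑ l : Fin n, (Pi.single l 1 : Fin n → ℕ) = lvl n 1 := by
  ext l
  simp [lvl, Finset.sum_apply, Pi.single_apply]

theorem enorm_avg_level_succ_sub_le (hab : ∀ l, a l < b l) {f : Pt n → ℝ} {g : Fin n → Pt n → ℝ}
    (h : ∀ l, HasWD (box a b) l f (g l)) (m : ℕ) {x : Pt n} (hx : x ∈ box a b) :
    ‖avg a b (lvl n (m + 1)) f x - avg a b (lvl n m) f x‖ₑ ≤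
      stepK a b * (2⁻¹) ^ m * lavg a b (lvl n m) (fun y => ∑ l, ‖g l y‖ₑ) x := by
  set G : Pt n → ℝ≥0∞ := fun y => ∑ l, ‖g l y‖ₑ with hG
  -- One level is refined coordinate by coordinate. Averages over the intermediate cells are
  -- compared with the coarse cell at the price of a factor two per bisected coordinate, whence the
  -- 2^n in `stepK`.
  have key : ∀ s : Finset (Fin n),
      ‖avg a b (lvl n m + ∑ l ∈ s, Pi.single l 1) f x - avg a b (lvl n m) f x‖ₑ ≤
      (2 ^ n * ∑ l ∈ s, ENNReal.ofReal (b l - a l)) * (2⁻¹) ^ m * lavg a b (lvl n m) G x := by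
    intro s
    induction s using Finset.induction_on with
    | empty => simp
    | insert l s hl ih =>
      rw [Finset.sum_insert hl, Finset.sum_insert hl, add_comm (Pi.single l 1), ← add_assoc]
      have h1 := (h l).enorm_avg_succ_sub_le hab (lvl n m + ∑ l ∈ s, Pi.single l 1) hx
      have hql : (lvl n m + ∑ l ∈ s, (Pi.single l 1 : Fin n → ℕ)) l = m := by
        have : ∑ c ∈ s, (Pi.single c 1 : Fin n → ℕ) l = 0 :=
          Finset.sum_eq_zero fun c hc => by
            rw [Pi.single_eq_of_ne]; rintro rfl; exact hl hc
        simp [lvl, Finset.sum_apply, this]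
      rw [hql] at h1
      have h2 : lavg a b (lvl n m + ∑ l ∈ s, Pi.single l 1) (fun y => ‖g l y‖ₑ) x ≤
          2 ^ n * lavg a b (lvl n m) G x := by
        refine (lavg_add_sum_single_le _ s _ x).trans ?_
        gcongr
        · exact one_le_two
        · simpa using s.card_le_univ
        · refine lavg_mono _ (Filter.Eventually.of_forall fun y => ?_) x
          exact Finset.single_le_sum (f := fun l => ‖g l y‖ₑ) (fun _ _ => zero_le) (Finset.mem_univ l)
      have h3 : ENNReal.ofReal ((b l - a l) / 2 ^ m) = ENNReal.ofReal (b l - a l) * (2⁻¹) ^ m := by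
        rw [div_eq_mul_inv, ENNReal.ofReal_mul (sub_pos.2 (hab l)).le,
          ENNReal.ofReal_inv_of_pos (by positivity), ENNReal.ofReal_pow (by norm_num), ENNReal.inv_pow]
        simp
      rw [h3] at h1
      have h4 : avg a b (lvl n m + ∑ l ∈ s, Pi.single l 1 + Pi.single l 1) f x - avg a b (lvl n m) f x =
          (avg a b (lvl n m + ∑ l ∈ s, Pi.single l 1 + Pi.single l 1) f x -
            avg a b (lvl n m + ∑ l ∈ s, Pi.single l 1) f x) +
          (avg a b (lvl n m + ∑ l ∈ s, Pi.single l 1) f x - avg a b (lvl n m) f x) := by ring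
      rw [h4]
      refine (enorm_add_le _ _).trans ?_
      calc _ ≤ ENNReal.ofReal (b l - a l) * (2⁻¹) ^ m * (2 ^ n * lavg a b (lvl n m) G x) +
            (2 ^ n * ∑ l ∈ s, ENNReal.ofReal (b l - a l)) * (2⁻¹) ^ m * lavg a b (lvl n m) G x := by
            gcongr
            exact h1.trans (by gcongr)
        _ = _ := by ring
  have := key Finset.univ
  rw [sum_single_eq_lvl, ← lvl_add] at this
  exact this

/-- Lebesgue differentiation along dyadic cells. -/
theorem ae_tendsto_avg (hab : ∀ l, a l < b l) {f : Pt n → ℝ}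
    (hf : MemLp f 2 (volume.restrict (box a b))) :
    ∀ᵐ x ∂(volume.restrict (box a b)),
      Filter.Tendsto (fun m => avg a b (lvl n m) f x) Filter.atTop (nhds (f x)) := by
  set F : Pt n → ℝ := (box a b).indicator f with hF
  have hFi : Integrable F := (integrable_indicator_iff (measurableSet_box a b)).2 (integrable_of_memLp hf)
  have hleb := IsUnifLocDoublingMeasure.ae_tendsto_average_norm_sub (volume : Measure (Pt n))
    hFi.locallyIntegrable 1
  -- This dominates the diameter of the box; the added 1 keeps the radii positive in every
  -- dimension, including zero.
  set d : ℝ := ∑ l, (b l - a l) + 1 with hd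
  have hd0 : 0 < d := by
    have : 0 ≤ ∑ l, (b l - a l) := Finset.sum_nonneg fun l _ => (sub_pos.2 (hab l)).le
    linarith
  filter_upwards [ae_restrict_of_ae hleb, ae_restrict_mem (measurableSet_box a b)] with x hx hxb
  have hδ : Filter.Tendsto (fun m : ℕ => d * (1 / 2) ^ m) Filter.atTop (nhdsWithin 0 (Ioi 0)) := by
    rw [tendsto_nhdsWithin_iff]
    constructor
    · have := (tendsto_pow_atTop_nhds_zero_of_lt_one (r := (1 / 2 : ℝ)) (by norm_num) (by norm_num)).const_mul d
      simpa using this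
    · exact Filter.Eventually.of_forall fun m => by simp only [mem_Ioi]; positivity
  have hlim := hx (fun _ : ℕ => x) (fun m : ℕ => d * (1 / 2) ^ m) hδ
    (Filter.Eventually.of_forall fun m => Metric.mem_closedBall_self (by positivity))
  set V := volume.real (Metric.ball (0 : Pt n) 1) with hV
  set P : ℝ := ∏ l, (1 / (b l - a l)) with hP
  have hP0 : 0 ≤ P := Finset.prod_nonneg fun l _ => by
    have := sub_pos.2 (hab l); positivity
  have hdens : ∀ m, dens a b (lvl n m) = 2 ^ (m * n) * P := by
    intro m
    simp only [dens, lvl, hP]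
    have : ((2 : ℝ) ^ m) ^ n = ∏ _l : Fin n, (2 : ℝ) ^ m := by simp
    rw [pow_mul, this, ← Finset.prod_mul_distrib]
    exact Finset.prod_congr rfl fun l _ => by rw [mul_one_div]
  have hball : ∀ m : ℕ, volume.real (Metric.closedBall x (d * (1 / 2) ^ m)) = (d * (1 / 2) ^ m) ^ n * V := by
    intro m
    rw [Measure.addHaar_real_closedBall _ _ (by positivity), finrank_euclideanSpace_fin]
  -- The cells shrink nicely: each lies in the ball of radius d 2^{-m} about x, and the ratio of the
  -- volumes does not depend on m. Convergence of averages over balls therefore passes to the cells.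
  have hbound : ∀ m, |avg a b (lvl n m) f x - f x| ≤
      P * d ^ n * V * ⨍ y in Metric.closedBall x (d * (1 / 2) ^ m), ‖F y - F x‖ := by
    intro m
    set z := idx a b (lvl n m) x with hz
    set a' := corner a b (lvl n m) z with ha'
    set b' := corner a b (lvl n m) (z + 1) with hb'
    have hr : (volume.restrict (box a b)).restrict (cell a b (lvl n m) z) = volume.restrict (box a' b') :=
      restrict_cell hab _ hxb
    have hsub : box a' b' ⊆ box a b := cellBox_subset hab _ hxb
    have hvol : volume.real (box a' b') = (dens a b (lvl n m))⁻¹ := by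
      rw [Measure.real, volume_cellBox hab, ENNReal.toReal_ofReal (inv_nonneg.2 (dens_pos hab _).le)]
    have hinball : box a' b' ⊆ Metric.closedBall x (d * (1 / 2) ^ m) := by
      intro y hy
      rw [Metric.mem_closedBall, EuclideanSpace.dist_eq]
      have hcell := (mem_cell_iff hab (lvl n m) z x).1 rfl
      have hc : ∀ l, |y l - x l| ≤ (b l - a l) * (1 / 2) ^ m := by
        intro l
        have h1 := hy l
        have h2 := hcell l
        have h3 : b' l - a' l = (b l - a l) * (1 / 2) ^ m := by
          simp only [ha', hb', corner, Pi.add_apply, Pi.one_apply, lvl]; push_cast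
          rw [one_div, inv_pow]; ring
        rw [← h3, abs_le]
        constructor <;> linarith [h1.1, h1.2, h2.1, h2.2]
      rw [Real.sqrt_le_left (by positivity)]
      have h1 : ∑ l, dist (y l) (x l) ^ 2 ≤ (∑ l, dist (y l) (x l)) ^ 2 :=
        Finset.sum_sq_le_sq_sum_of_nonneg fun l _ => dist_nonneg
      refine h1.trans ?_
      have h2 : ∑ l, dist (y l) (x l) ≤ d * (1 / 2) ^ m := by
        calc _ ≤ ∑ l, (b l - a l) * (1 / 2) ^ m := Finset.sum_le_sum fun l _ => by
              rw [Real.dist_eq]; exact hc l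
          _ = (∑ l, (b l - a l)) * (1 / 2) ^ m := by rw [Finset.sum_mul]
          _ ≤ _ := by gcongr; linarith
      exact pow_le_pow_left₀ (Finset.sum_nonneg fun l _ => dist_nonneg) h2 2
    have hfi : Integrable f (volume.restrict (box a' b')) :=
      (integrable_of_memLp hf).mono_measure (Measure.restrict_mono hsub le_rfl)
    have hfin : volume (box a' b') ≠ ⊤ := (isBounded_box a' b').measure_lt_top.ne
    have e1 : avg a b (lvl n m) f x - f x = dens a b (lvl n m) * ∫ y in box a' b', (F y - F x) := by
      have hFx : F x = f x := indicator_of_mem hxb f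
      have e2 : ∫ y in box a' b', (F y - F x) = ∫ y in box a' b', (f y - f x) := by
        refine setIntegral_congr_fun (measurableSet_box a' b') fun y hy => ?_
        rw [hFx, hF, indicator_of_mem (hsub hy)]
      rw [e2, integral_sub hfi (integrable_const _), setIntegral_const, hvol]
      unfold avg
      rw [← hz, hr, mul_sub, smul_eq_mul, ← mul_assoc, mul_inv_cancel₀ (dens_pos hab _).ne', one_mul]
    have hFx : Integrable (fun y => ‖F y - F x‖)
        (volume.restrict (Metric.closedBall x (d * (1 / 2) ^ m))) := by
      have hfb : IsFiniteMeasure (volume.restrict (Metric.closedBall x (d * (1 / 2) ^ m))) :=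
        ⟨by rw [Measure.restrict_apply_univ]; exact measure_closedBall_lt_top⟩
      exact (hFi.restrict.sub (integrable_const _)).norm
    rw [e1, abs_mul, abs_of_pos (dens_pos hab _)]
    have h5 : |∫ y in box a' b', (F y - F x)| ≤
        ∫ y in Metric.closedBall x (d * (1 / 2) ^ m), ‖F y - F x‖ := by
      rw [← Real.norm_eq_abs]
      refine (norm_integral_le_integral_norm _).trans ?_
      exact setIntegral_mono_set hFx (Filter.Eventually.of_forall fun _ => norm_nonneg _)
        (Filter.Eventually.of_forall hinball)
    have h6 : ∫ y in Metric.closedBall x (d * (1 / 2) ^ m), ‖F y - F x‖ =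
        (d * (1 / 2) ^ m) ^ n * V * ⨍ y in Metric.closedBall x (d * (1 / 2) ^ m), ‖F y - F x‖ := by
      have hpos : 0 < volume.real (Metric.closedBall x (d * (1 / 2) ^ m)) :=
        ENNReal.toReal_pos (Metric.measure_closedBall_pos _ _ (by positivity)).ne'
          measure_closedBall_lt_top.ne
      rw [setAverage_eq, ← hball, smul_eq_mul, ← mul_assoc, mul_inv_cancel₀ hpos.ne', one_mul]
    calc _ ≤ dens a b (lvl n m) * ((d * (1 / 2) ^ m) ^ n * V *
          ⨍ y in Metric.closedBall x (d * (1 / 2) ^ m), ‖F y - F x‖) := by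
          rw [← h6]
          exact mul_le_mul_of_nonneg_left h5 (dens_pos hab _).le
      _ = _ := by
          rw [hdens, mul_pow, ← pow_mul, one_div, inv_pow]
          field_simp
  rw [tendsto_iff_dist_tendsto_zero]
  refine squeeze_zero (fun _ => dist_nonneg) (fun m => (Real.dist_eq _ _).trans_le (hbound m)) ?_
  have := hlim.const_mul (P * d ^ n * V)
  rwa [mul_zero] at this

theorem tsum_two_inv_pow_add (j : ℕ) : ∑' i : ℕ, (2⁻¹ : ℝ≥0∞) ^ (j + i) = 2 * 2⁻¹ ^ j := by
  simp_rw [pow_add]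
  rw [ENNReal.tsum_mul_left, ENNReal.tsum_geometric, mul_comm]
  congr 1
  rw [ENNReal.one_sub_inv_two, inv_inv]

/-- A function differs from its average on dyadic cells by a multiscale sum of averages of its
gradient. -/
theorem ae_enorm_sub_avg_le (hab : ∀ l, a l < b l) {f : Pt n → ℝ} {g : Fin n → Pt n → ℝ}
    (hf : MemLp f 2 (volume.restrict (box a b)))
    (h : ∀ l, HasWD (box a b) l f (g l)) (j : ℕ) :
    ∀ᵐ x ∂(volume.restrict (box a b)), ‖f x - avg a b (lvl n j) f x‖ₑ ≤
      stepK a b * ∑' i : ℕ, (2⁻¹) ^ (j + i) * lavg a b (lvl n (j + i)) (fun y => ∑ l, ‖g l y‖ₑ) x := by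
  filter_upwards [ae_tendsto_avg hab hf, ae_restrict_mem (measurableSet_box a b)] with x hx hxb
  have := edist_le_tsum_of_edist_le_of_tendsto
    (fun m => stepK a b * (2⁻¹) ^ m * lavg a b (lvl n m) (fun y => ∑ l, ‖g l y‖ₑ) x)
    (f := fun m => avg a b (lvl n m) f x) (fun m => by
      rw [edist_comm, edist_eq_enorm_sub]
      exact enorm_avg_level_succ_sub_le hab h m hxb) hx j
  rw [edist_comm, edist_eq_enorm_sub] at this
  refine this.trans_eq ?_
  rw [← ENNReal.tsum_mul_left]
  simp_rw [mul_assoc]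

/-- Cauchy–Schwarz with the geometric weights themselves, whose total mass is 2 · 2^{-j}; this keeps
the sum over scales linear in squared averages. -/
theorem ae_enorm_sub_avg_sq_le (hab : ∀ l, a l < b l) {f : Pt n → ℝ} {g : Fin n → Pt n → ℝ}
    (hf : MemLp f 2 (volume.restrict (box a b)))
    (h : ∀ l, HasWD (box a b) l f (g l)) (j : ℕ) :
    ∀ᵐ x ∂(volume.restrict (box a b)), ‖f x - avg a b (lvl n j) f x‖ₑ ^ 2 ≤
      stepK a b ^ 2 * (2 * 2⁻¹ ^ j) *
        ∑' i : ℕ, (2⁻¹) ^ (j + i) * lavg a b (lvl n (j + i)) (fun y => ∑ l, ‖g l y‖ₑ) x ^ 2 := by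
  filter_upwards [ae_enorm_sub_avg_le hab hf h j] with x hx
  calc _ ≤ (stepK a b * ∑' i : ℕ, (2⁻¹) ^ (j + i) *
        lavg a b (lvl n (j + i)) (fun y => ∑ l, ‖g l y‖ₑ) x) ^ 2 := by gcongr
    _ ≤ _ := by
        rw [mul_pow, mul_assoc]
        gcongr
        rw [← tsum_two_inv_pow_add]
        exact sq_tsum_le _ _

theorem aemeasurable_gradSum {g : Fin n → Pt n → ℝ}
    (hg : ∀ l, MemLp (g l) 2 (volume.restrict (box a b))) :
    AEMeasurable (fun y => ∑ l, ‖g l y‖ₑ) (volume.restrict (box a b)) :=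
  Finset.aemeasurable_fun_sum _ fun l _ => (hg l).1.enorm

/-- Poincaré inequality on dyadic cells. -/
theorem lavg_enorm_sub_avg_sq_le (hab : ∀ l, a l < b l) {f : Pt n → ℝ} {g : Fin n → Pt n → ℝ}
    (hf : MemLp f 2 (volume.restrict (box a b)))
    (h : ∀ l, HasWD (box a b) l f (g l)) (j : ℕ) (x : Pt n) :
    lavg a b (lvl n j) (fun y => ‖f y - avg a b (lvl n j) f y‖ₑ ^ 2) x ≤
      4 * stepK a b ^ 2 * (4⁻¹) ^ j * lavg a b (lvl n j) (fun y => (∑ l, ‖g l y‖ₑ) ^ 2) x := by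
  set G : Pt n → ℝ≥0∞ := fun y => ∑ l, ‖g l y‖ₑ with hG
  have hGm : AEMeasurable G (volume.restrict (box a b)) := aemeasurable_gradSum fun l => (h l).memg
  have h1 : ∀ᵐ y ∂(volume.restrict (box a b)), ‖f y - avg a b (lvl n j) f y‖ₑ ^ 2 ≤
      stepK a b ^ 2 * (2 * 2⁻¹ ^ j) *
        ∑' i : ℕ, (2⁻¹) ^ (j + i) * lavg a b (lvl n (j + i)) (fun y => G y ^ 2) y := by
    filter_upwards [ae_enorm_sub_avg_sq_le hab hf h j, ae_restrict_mem (measurableSet_box a b)] with y hy hyb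
    refine hy.trans ?_
    gcongr with i
    exact sq_lavg_le hab _ hGm hyb
  refine (lavg_mono _ h1 x).trans ?_
  have hm : ∀ i : ℕ, Measurable fun y => (2⁻¹ : ℝ≥0∞) ^ (j + i) * lavg a b (lvl n (j + i)) (fun y => G y ^ 2) y :=
    fun i => (measurable_lavg _ _).const_mul _
  have e : lavg a b (lvl n j) (fun y => stepK a b ^ 2 * (2 * 2⁻¹ ^ j) *
        ∑' i : ℕ, (2⁻¹) ^ (j + i) * lavg a b (lvl n (j + i)) (fun y => G y ^ 2) y) x =
      stepK a b ^ 2 * (2 * 2⁻¹ ^ j) *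
        ∑' i : ℕ, (2⁻¹) ^ (j + i) * lavg a b (lvl n j) (lavg a b (lvl n (j + i)) (fun y => G y ^ 2)) x := by
    rw [lavg_const_mul _ _ (Measurable.tsum hm).aemeasurable,
      lavg_tsum _ fun i => (hm i).aemeasurable]
    simp_rw [lavg_const_mul _ _ (measurable_lavg _ _).aemeasurable]
  rw [e]
  -- Averaging over the coarse cell undoes the finer averages, so every scale contributes the same
  -- quantity. What remains is the geometric sum 2 · 2^{-j}, which occurs twice and gives 4 ·
  -- 4^{-j}.
  simp_rw [lvl_add, lavg_lavg hab]
  rw [ENNReal.tsum_mul_right, tsum_two_inv_pow_add]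
  apply le_of_eq
  have : (4⁻¹ : ℝ≥0∞) = 2⁻¹ * 2⁻¹ := by
    rw [← ENNReal.mul_inv (by simp) (by simp)]; norm_num
  rw [this, mul_pow]
  ring

end Levels


/-! ### Sobolev embedding and form bounds from Morrey growth of dyadic averages. -/

section Morrey

open scoped ENNReal NNReal

variable {n : ℕ}

/-- `f` is in `H^k(Ω)` and all its weak derivatives of order at most `k` have `L²` norm at most
`N`. -/
def HK (Ω : Set (Pt n)) : ℕ → (Pt n → ℝ) → ℝ≥0 → Prop
  | 0, f, N => MemLp f 2 (volume.restrict Ω) ∧ ∫⁻ x in Ω, ‖f x‖ₑ ^ 2 ≤ (N : ℝ≥0∞) ^ 2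
  | k + 1, f, N => (MemLp f 2 (volume.restrict Ω) ∧ ∫⁻ x in Ω, ‖f x‖ₑ ^ 2 ≤ (N : ℝ≥0∞) ^ 2) ∧
      ∀ l, ∃ g, HasWD Ω l f g ∧ HK Ω k g N

theorem HK.base {Ω : Set (Pt n)} {k : ℕ} {f : Pt n → ℝ} {N : ℝ≥0} (h : HK Ω k f N) :
    MemLp f 2 (volume.restrict Ω) ∧ ∫⁻ x in Ω, ‖f x‖ₑ ^ 2 ≤ (N : ℝ≥0∞) ^ 2 := by
  cases k with
  | zero => exact h
  | succ k => exact h.1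

/-- The square root of `2` as an extended nonnegative real. -/
noncomputable def rt2 : ℝ≥0∞ := ENNReal.ofReal (Real.sqrt 2)

theorem rt2_sq : rt2 ^ 2 = 2 := by
  rw [rt2, ← ENNReal.ofReal_pow (Real.sqrt_nonneg _), Real.sq_sqrt (by norm_num)]; simp

theorem one_le_rt2 : 1 ≤ rt2 := by
  rw [rt2, ENNReal.one_le_ofReal]; exact Real.one_le_sqrt.2 (by norm_num)

/-- The numerical fact that closes the induction in `enorm_avg_le_of_gradient`, where 4 + 1 has to
be at most four times one further factor √2. -/
theorem five_le_rt2 : 5 ≤ 4 * rt2 := by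
  have : (5 : ℝ) ≤ 4 * Real.sqrt 2 := by
    have : (5 / 4 : ℝ) ≤ Real.sqrt 2 := Real.le_sqrt_of_sq_le (by norm_num)
    linarith
  have h := ENNReal.ofReal_le_ofReal this
  rw [ENNReal.ofReal_mul (by norm_num)] at h
  simpa [rt2] using h

theorem half_rt2_lt_one : 2⁻¹ * rt2 < 1 := by
  have : (2⁻¹ : ℝ) * Real.sqrt 2 < 1 := by
    have : Real.sqrt 2 < 2 := by rw [Real.sqrt_lt' (by norm_num)]; norm_num
    linarith
  have h := (ENNReal.ofReal_lt_one).2 this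
  rw [ENNReal.ofReal_mul (by norm_num), ENNReal.ofReal_inv_of_pos (by norm_num)] at h
  simpa [rt2] using h

/-- The side length 2^{-m} of the cells gained from one derivative pays for lowering the growth
exponent of the squared averages by two. -/
theorem two_inv_pow_mul_rt2_pow_le {t t' : ℕ} (h : t ≤ t' + 2) (m : ℕ) :
    (2⁻¹ : ℝ≥0∞) ^ m * rt2 ^ (m * t) ≤ rt2 ^ (m * t') := by
  calc (2⁻¹ : ℝ≥0∞) ^ m * rt2 ^ (m * t) ≤ (2⁻¹ : ℝ≥0∞) ^ m * rt2 ^ (m * (t' + 2)) := by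
        gcongr; exact one_le_rt2
    _ = (2⁻¹ * rt2 ^ 2) ^ m * rt2 ^ (m * t') := by rw [mul_pow, ← pow_mul, mul_add, pow_add]; ring
    _ = rt2 ^ (m * t') := by
        rw [rt2_sq, ENNReal.inv_mul_cancel (by norm_num) (by norm_num), one_pow, one_mul]

theorem le_of_sq_le_sq_ennreal {x y : ℝ≥0∞} (h : x ^ 2 ≤ y ^ 2) : x ≤ y :=
  (ENNReal.pow_right_strictMono two_ne_zero).le_iff_le.1 h

theorem sq_sum_enorm_le {ι : Type*} [Fintype ι] (F : ι → ℝ≥0∞) :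
    (∑ l, F l) ^ 2 ≤ Fintype.card ι * ∑ l, F l ^ 2 := by
  let _ : MeasurableSpace ι := ⊤
  have h := sq_lintegral_le (Measure.count : Measure ι) (F := F) (measurable_from_top).aemeasurable
  rw [lintegral_count, lintegral_count, tsum_fintype, tsum_fintype, Measure.count_univ] at h
  simpa using h

theorem sq_add_le_ennreal (x y : ℝ≥0∞) : (x + y) ^ 2 ≤ 2 * x ^ 2 + 2 * y ^ 2 := by
  have := sq_sum_enorm_le (ι := Fin 2) ![x, y]
  simpa [Fin.sum_univ_two, mul_add] using this

variable {a b : Fin n → ℝ}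

theorem lavg_gradSum_sq_le {g : Fin n → Pt n → ℝ} {q : Fin n → ℕ} {x : Pt n} {M : ℝ≥0∞}
    (hg : ∀ l, MemLp (g l) 2 (volume.restrict (box a b)))
    (h : ∀ l, lavg a b q (fun y => ‖g l y‖ₑ ^ 2) x ≤ M) :
    lavg a b q (fun y => (∑ l, ‖g l y‖ₑ) ^ 2) x ≤ n ^ 2 * M := by
  have hm : ∀ l, AEMeasurable (fun y => ‖g l y‖ₑ ^ 2) (volume.restrict (box a b)) :=
    fun l => (hg l).1.enorm.pow_const 2
  have h1 : lavg a b q (fun y => (∑ l, ‖g l y‖ₑ) ^ 2) x ≤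
      lavg a b q (fun y => n * ∑ l, ‖g l y‖ₑ ^ 2) x :=
    lavg_mono q (Filter.Eventually.of_forall fun y => by
      simpa using sq_sum_enorm_le (fun l => ‖g l y‖ₑ)) x
  have h2 : ∀ s : Finset (Fin n), lavg a b q (fun y => ∑ l ∈ s, ‖g l y‖ₑ ^ 2) x =
      ∑ l ∈ s, lavg a b q (fun y => ‖g l y‖ₑ ^ 2) x := by
    intro s
    induction s using Finset.induction_on with
    | empty => simp [lavg]
    | insert l s hl ih =>
      simp_rw [Finset.sum_insert hl]
      rw [lavg_add _ (hm l), ih]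
  refine h1.trans ?_
  rw [lavg_const_mul _ _ (Finset.aemeasurable_fun_sum _ fun l _ => hm l), h2, pow_two, mul_assoc]
  gcongr
  calc _ ≤ ∑ _l : Fin n, M := Finset.sum_le_sum fun l _ => h l
    _ = n * M := by simp

/-- The growth exponent of the averages of squares of functions in `H^k`. -/
def mexp (n k : ℕ) : ℕ := max (n - 2 * k) 1

theorem lavg_le_of_sq (hab : ∀ l, a l < b l) {F : Pt n → ℝ≥0∞}
    (hF : AEMeasurable F (volume.restrict (box a b))) {C N : ℝ≥0} {j t : ℕ} {x : Pt n}
    (hx : x ∈ box a b) (h : lavg a b (lvl n j) (fun y => F y ^ 2) x ≤ C * N ^ 2 * 2 ^ (j * t)) :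
    lavg a b (lvl n j) F x ≤ NNReal.sqrt C * N * rt2 ^ (j * t) := by
  refine le_of_sq_le_sq_ennreal ((sq_lavg_le hab _ hF hx).trans (h.trans_eq ?_))
  rw [mul_pow, mul_pow, ← pow_mul rt2, mul_comm (j * t) 2, pow_mul rt2, rt2_sq]
  congr 2
  rw [← ENNReal.coe_pow, NNReal.sq_sqrt]

/-- Each level changes the average by at most a constant times (√2)^{j t'}. Because `t'` is at least
1, these increments grow geometrically and their sum is comparable with the last one. -/
theorem enorm_avg_le_of_gradient (hab : ∀ l, a l < b l) {f : Pt n → ℝ} {g : Fin n → Pt n → ℝ}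
    (h : ∀ l, HasWD (box a b) l f (g l)) {E N : ℝ≥0} {t t' : ℕ} (htt : t ≤ t' + 2) (ht' : 1 ≤ t')
    {x : Pt n} (hx : x ∈ box a b)
    (hg : ∀ i, lavg a b (lvl n i) (fun y => ∑ l, ‖g l y‖ₑ) x ≤ E * N * rt2 ^ (i * t)) (j : ℕ) :
    ‖avg a b (lvl n j) f x‖ₑ ≤ ‖avg a b (lvl n 0) f x‖ₑ +
      4 * (stepK a b * (E * N)) * rt2 ^ (j * t') := by
  induction j with
  | zero => exact le_self_add
  | succ j ih =>
    have h1 := enorm_avg_level_succ_sub_le hab h j hx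
    have h2 : ‖avg a b (lvl n (j + 1)) f x - avg a b (lvl n j) f x‖ₑ ≤
        stepK a b * (E * N) * rt2 ^ (j * t') := by
      refine h1.trans ?_
      calc _ ≤ stepK a b * 2⁻¹ ^ j * (E * N * rt2 ^ (j * t)) := by gcongr; exact hg j
        _ = stepK a b * (E * N) * (2⁻¹ ^ j * rt2 ^ (j * t)) := by ring
        _ ≤ _ := by gcongr; exact two_inv_pow_mul_rt2_pow_le htt j
    have h3 : avg a b (lvl n (j + 1)) f x = avg a b (lvl n j) f x +
      (avg a b (lvl n (j + 1)) f x - avg a b (lvl n j) f x) := by ring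
    rw [h3]
    refine (enorm_add_le _ _).trans ((add_le_add ih h2).trans ?_)
    rw [add_assoc]
    gcongr
    set X := stepK a b * (E * N)
    calc 4 * X * rt2 ^ (j * t') + X * rt2 ^ (j * t') = X * rt2 ^ (j * t') * 5 := by ring
      _ ≤ X * rt2 ^ (j * t') * (4 * rt2 ^ t') := by
          gcongr
          refine five_le_rt2.trans ?_
          gcongr
          exact le_self_pow one_le_rt2 (by omega)
      _ = 4 * X * rt2 ^ ((j + 1) * t') := by rw [add_mul, pow_add, one_mul]; ring

/-- Functions in `H^k` satisfy a Morrey condition on the dyadic cells. -/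
theorem exists_morrey_bound (hab : ∀ l, a l < b l) (k : ℕ) :
    ∃ C : ℝ≥0, ∀ (f : Pt n → ℝ) (N : ℝ≥0), HK (box a b) k f N → ∀ j, ∀ x ∈ box a b,
      lavg a b (lvl n j) (fun y => ‖f y‖ₑ ^ 2) x ≤ C * N ^ 2 * 2 ^ (j * mexp n k) := by
  have hlvl : ∀ j, ENNReal.ofReal (dens a b (lvl n j)) =
      ENNReal.ofReal (dens a b (lvl n 0)) * 2 ^ (j * n) := by
    intro j
    have : dens a b (lvl n j) = dens a b (lvl n 0) * 2 ^ (j * n) := by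
      simp only [dens, lvl, pow_zero]
      have : (2 : ℝ) ^ (j * n) = ∏ _l : Fin n, (2 : ℝ) ^ j := by simp [pow_mul]
      rw [this, ← Finset.prod_mul_distrib]
      exact Finset.prod_congr rfl fun l _ => by ring
    rw [this, ENNReal.ofReal_mul (dens_pos hab _).le, ENNReal.ofReal_pow (by norm_num)]
    simp
  have hbase : ∀ (f : Pt n → ℝ) (N : ℝ≥0), ∫⁻ x in box a b, ‖f x‖ₑ ^ 2 ≤ (N : ℝ≥0∞) ^ 2 →
      ∀ j x, lavg a b (lvl n j) (fun y => ‖f y‖ₑ ^ 2) x ≤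
        Real.toNNReal (dens a b (lvl n 0)) * N ^ 2 * 2 ^ (j * n) := by
    intro f N hf j x
    unfold lavg
    rw [hlvl]
    calc _ ≤ ENNReal.ofReal (dens a b (lvl n 0)) * 2 ^ (j * n) * (N : ℝ≥0∞) ^ 2 := by
          gcongr
          exact (lintegral_mono' Measure.restrict_le_self le_rfl).trans hf
      _ = _ := by rw [ENNReal.ofReal]; ring
  induction k with
  | zero =>
    -- Without derivatives, the integral over a cell is bounded by the total one, and dividing by
    -- the volume of the cell gives 2^{jn}.
    refine ⟨Real.toNNReal (dens a b (lvl n 0)), fun f N hf j x hx => ?_⟩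
    refine (hbase f N hf.2 j x).trans ?_
    gcongr
    · exact one_le_two
    · simp [mexp]
  | succ k ih =>
    obtain ⟨C, hC⟩ := ih
    set t := mexp n k with ht
    set t' := mexp n (k + 1) with ht'
    -- A derivative improves the exponent by two. It is truncated at 1 and not at 0, which avoids
    -- the logarithm that the critical exponent would produce.
    have htt : t ≤ t' + 2 := by simp only [ht, ht', mexp]; omega
    have ht1 : 1 ≤ t' := le_max_right _ _
    set D : ℝ≥0 := n ^ 2 * C with hD
    set E := NNReal.sqrt D with hE
    set E0 := NNReal.sqrt (Real.toNNReal (dens a b (lvl n 0))) with hE0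
    set K : ℝ≥0 := (stepK a b).toNNReal with hK
    have hKc : (K : ℝ≥0∞) = stepK a b := ENNReal.coe_toNNReal (stepK_ne_top a b)
    -- The first term comes from the oscillation on the cell, by the Poincaré inequality and the
    -- induction hypothesis for the gradient. The second comes from the cell average, by telescoping
    -- from the coarsest level.
    refine ⟨2 * (4 * K ^ 2 * D) + 2 * (E0 + 4 * K * E) ^ 2, fun f N hf j x hx => ?_⟩
    have hfb := hf.base
    choose g hg hgk using hf.2
    have hG : ∀ i, lavg a b (lvl n i) (fun y => (∑ l, ‖g l y‖ₑ) ^ 2) x ≤ D * N ^ 2 * 2 ^ (i * t) := by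
      intro i
      refine (lavg_gradSum_sq_le (fun l => (hg l).memg) fun l => hC (g l) N (hgk l) i x hx).trans_eq ?_
      rw [hD]; push_cast; ring
    have hGm := aemeasurable_gradSum (a := a) (b := b) fun l => (hg l).memg
    have hG1 : ∀ i, lavg a b (lvl n i) (fun y => ∑ l, ‖g l y‖ₑ) x ≤ E * N * rt2 ^ (i * t) :=
      fun i => lavg_le_of_sq hab hGm hx (hG i)
    have hav : ‖avg a b (lvl n j) f x‖ₑ ≤ (E0 + 4 * K * E) * N * rt2 ^ (j * t') := by
      refine (enorm_avg_le_of_gradient hab hg htt ht1 hx hG1 j).trans ?_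
      have h0 : ‖avg a b (lvl n 0) f x‖ₑ ≤ E0 * N := by
        refine (enorm_avg_le hab _ f x).trans ?_
        have := lavg_le_of_sq hab hfb.1.1.enorm hx (j := 0) (t := n) (hbase f N hfb.2 0 x)
        simpa using this
      calc _ ≤ E0 * N * rt2 ^ (j * t') + 4 * (stepK a b * (E * N)) * rt2 ^ (j * t') := by
            gcongr
            exact h0.trans (le_mul_of_one_le_right zero_le (one_le_pow₀ one_le_rt2))
        _ = _ := by rw [hKc]; ring
    have hpt : ∀ y, ‖f y‖ₑ ^ 2 ≤ 2 * ‖f y - avg a b (lvl n j) f y‖ₑ ^ 2 +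
        2 * ‖avg a b (lvl n j) f y‖ₑ ^ 2 := by
      intro y
      refine le_trans ?_ (sq_add_le_ennreal _ _)
      gcongr
      calc ‖f y‖ₑ = ‖(f y - avg a b (lvl n j) f y) + avg a b (lvl n j) f y‖ₑ := by rw [sub_add_cancel]
        _ ≤ _ := enorm_add_le _ _
    have hm1 : AEMeasurable (fun y => ‖f y - avg a b (lvl n j) f y‖ₑ ^ 2) (volume.restrict (box a b)) :=
      ((hfb.1.1.sub (measurable_avg _ f).aestronglyMeasurable).enorm).pow_const 2
    have hav2 : lavg a b (lvl n j) (fun y => ‖avg a b (lvl n j) f y‖ₑ ^ 2) x = ‖avg a b (lvl n j) f x‖ₑ ^ 2 := by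
      have := lavg_mul_const_on_cells (a := a) (b := b) (lvl n j) (fun _ => 1)
        (fun y => ‖avg a b (lvl n j) f y‖ₑ ^ 2) aemeasurable_const
        (fun y z hyz => by rw [avg_congr_idx _ f hyz]) x
      simpa [lavg_const hab _ _ hx] using this
    have h4 : (4⁻¹ : ℝ≥0∞) ^ j * 2 ^ (j * t) ≤ 2 ^ (j * t') := by
      have h5 := two_inv_pow_mul_rt2_pow_le htt j
      have h6 : ((2⁻¹ : ℝ≥0∞) ^ j * rt2 ^ (j * t)) ^ 2 ≤ (rt2 ^ (j * t')) ^ 2 := by gcongr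
      have e1 : (rt2 ^ (j * t)) ^ 2 = 2 ^ (j * t) := by
        rw [← pow_mul, mul_comm (j * t) 2, pow_mul, rt2_sq]
      have e2 : (rt2 ^ (j * t')) ^ 2 = 2 ^ (j * t') := by
        rw [← pow_mul, mul_comm (j * t') 2, pow_mul, rt2_sq]
      have e3 : ((2⁻¹ : ℝ≥0∞) ^ j) ^ 2 = 4⁻¹ ^ j := by
        rw [← pow_mul, mul_comm j 2, pow_mul, ← ENNReal.inv_pow]; norm_num
      rwa [mul_pow, e1, e2, e3] at h6
    calc lavg a b (lvl n j) (fun y => ‖f y‖ₑ ^ 2) x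
        ≤ lavg a b (lvl n j) (fun y => 2 * ‖f y - avg a b (lvl n j) f y‖ₑ ^ 2 +
          2 * ‖avg a b (lvl n j) f y‖ₑ ^ 2) x := lavg_mono _ (Filter.Eventually.of_forall hpt) x
      _ = 2 * lavg a b (lvl n j) (fun y => ‖f y - avg a b (lvl n j) f y‖ₑ ^ 2) x +
          2 * ‖avg a b (lvl n j) f x‖ₑ ^ 2 := by
          rw [lavg_add _ (hm1.const_mul _), lavg_const_mul _ _ hm1, lavg_const_mul _ _
            ((measurable_avg _ f).enorm.pow_const 2).aemeasurable, hav2]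
      _ ≤ 2 * (4 * K ^ 2 * (4⁻¹) ^ j * (D * N ^ 2 * 2 ^ (j * t))) +
          2 * ((E0 + 4 * K * E) * N * rt2 ^ (j * t')) ^ 2 := by
          gcongr
          refine (lavg_enorm_sub_avg_sq_le hab hfb.1 hg j x).trans ?_
          rw [hKc]
          gcongr
          exact hG j
      _ = 2 * (4 * K ^ 2 * D) * N ^ 2 * ((4⁻¹) ^ j * 2 ^ (j * t)) +
          2 * (E0 + 4 * K * E) ^ 2 * N ^ 2 * 2 ^ (j * t') := by
          rw [mul_pow _ (rt2 ^ _), ← pow_mul rt2, mul_comm (j * t') 2, pow_mul rt2, rt2_sq]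
          ring
      _ ≤ 2 * (4 * K ^ 2 * D) * N ^ 2 * 2 ^ (j * t') +
          2 * (E0 + 4 * K * E) ^ 2 * N ^ 2 * 2 ^ (j * t') := by gcongr
      _ = _ := by push_cast; ring

theorem mexp_eq_one {k : ℕ} (hk : n ≤ 2 * k + 1) : mexp n k = 1 := by
  simp only [mexp]; omega

theorem tsum_half_rt2_ne_top : (1 - 2⁻¹ * rt2)⁻¹ ≠ ⊤ := by
  rw [ENNReal.inv_ne_top]
  exact (tsub_pos_of_lt half_rt2_lt_one).ne'

theorem tsum_half_rt2_add (J : ℕ) : ∑' i : ℕ, (2⁻¹ : ℝ≥0∞) ^ (J + i) * rt2 ^ (J + i) =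
    (2⁻¹ * rt2) ^ J * (1 - 2⁻¹ * rt2)⁻¹ := by
  simp_rw [← mul_pow, pow_add]
  rw [ENNReal.tsum_mul_left, ENNReal.tsum_geometric]

/-- Sobolev embedding into bounded functions. -/
theorem exists_sup_bound (hab : ∀ l, a l < b l) {k : ℕ} (hk : n ≤ 2 * k + 1) :
    ∃ C : ℝ≥0, ∀ (f : Pt n → ℝ) (N : ℝ≥0), HK (box a b) (k + 1) f N →
      ∀ᵐ x ∂(volume.restrict (box a b)), ‖f x‖ₑ ≤ C * N := by
  obtain ⟨C, hC⟩ := exists_morrey_bound hab k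
  obtain ⟨C', hC'⟩ := exists_morrey_bound hab (k + 1)
  set D : ℝ≥0 := n ^ 2 * C with hD
  set E := NNReal.sqrt D with hE
  set K : ℝ≥0 := (stepK a b).toNNReal with hK
  have hKc : (K : ℝ≥0∞) = stepK a b := ENNReal.coe_toNNReal (stepK_ne_top a b)
  set S : ℝ≥0 := ((1 - 2⁻¹ * rt2)⁻¹).toNNReal with hS
  have hSc : (S : ℝ≥0∞) = (1 - 2⁻¹ * rt2)⁻¹ := ENNReal.coe_toNNReal tsum_half_rt2_ne_top
  refine ⟨K * E * S + NNReal.sqrt C', fun f N hf => ?_⟩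
  have hfb := hf.base
  choose g hg hgk using hf.2
  have hGm := aemeasurable_gradSum (a := a) (b := b) fun l => (hg l).memg
  filter_upwards [ae_enorm_sub_avg_le hab hfb.1 hg 0, ae_restrict_mem (measurableSet_box a b)]
    with x hx hxb
  -- The condition on `n` makes the Morrey exponent of the gradient equal to 1. Its averages grow
  -- only like (√2)^i, so the multiscale sum with weights 2^{-i} converges geometrically.
  have hG1 : ∀ i, lavg a b (lvl n i) (fun y => ∑ l, ‖g l y‖ₑ) x ≤ E * N * rt2 ^ i := by
    intro i
    have := lavg_le_of_sq hab hGm hxb (j := i) (t := 1) (C := D) (N := N) (by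
      refine (lavg_gradSum_sq_le (fun l => (hg l).memg)
        fun l => hC (g l) N (hgk l) i x hxb).trans_eq ?_
      rw [hD, mexp_eq_one hk]; push_cast; ring)
    simpa using this
  have h0 : ‖avg a b (lvl n 0) f x‖ₑ ≤ NNReal.sqrt C' * N := by
    refine (enorm_avg_le hab _ f x).trans ?_
    have := lavg_le_of_sq hab hfb.1.1.enorm hxb (j := 0) (hC' f N hf 0 x hxb)
    simpa using this
  calc ‖f x‖ₑ = ‖(f x - avg a b (lvl n 0) f x) + avg a b (lvl n 0) f x‖ₑ := by rw [sub_add_cancel]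
    _ ≤ ‖f x - avg a b (lvl n 0) f x‖ₑ + ‖avg a b (lvl n 0) f x‖ₑ := enorm_add_le _ _
    _ ≤ stepK a b * (∑' i : ℕ, (2⁻¹) ^ (0 + i) * (E * N * rt2 ^ (0 + i))) + NNReal.sqrt C' * N := by
        refine add_le_add (hx.trans ?_) h0
        gcongr with i
        exact hG1 _
    _ = K * E * S * N + NNReal.sqrt C' * N := by
        simp_rw [mul_left_comm _ ((E : ℝ≥0∞) * N)]
        rw [ENNReal.tsum_mul_left, tsum_half_rt2_add, hKc, hSc]
        ring
    _ = _ := by push_cast; ring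

/-- The squared average of V is constant on cells, so F may be replaced by its own cell average;
Jensen's inequality then removes the average of V. -/
theorem lintegral_mul_lavg_sq_le (hab : ∀ l, a l < b l) {F V : Pt n → ℝ≥0∞} {m : ℕ} {M : ℝ≥0∞}
    (hF : AEMeasurable F (volume.restrict (box a b)))
    (hV : AEMeasurable V (volume.restrict (box a b)))
    (hM : ∀ x ∈ box a b, lavg a b (lvl n m) F x ≤ M) :
    ∫⁻ x in box a b, F x * lavg a b (lvl n m) V x ^ 2 ≤ M * ∫⁻ x in box a b, V x ^ 2 := by
  rw [← lintegral_lavg hab (lvl n m)]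
  have e : ∀ x, lavg a b (lvl n m) (fun y => F y * lavg a b (lvl n m) V y ^ 2) x =
      lavg a b (lvl n m) F x * lavg a b (lvl n m) V x ^ 2 := fun x =>
    lavg_mul_const_on_cells (lvl n m) F (fun y => lavg a b (lvl n m) V y ^ 2) hF
      (fun y z hyz => by rw [lavg_congr_idx _ V hyz]) x
  simp_rw [e]
  calc _ ≤ ∫⁻ x in box a b, M * lavg a b (lvl n m) (fun y => V y ^ 2) x := by
        refine setLIntegral_mono_ae' (measurableSet_box a b) (Filter.Eventually.of_forall fun x hx => ?_)
        gcongr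
        · exact hM x hx
        · exact sq_lavg_le hab _ hV hx
    _ = _ := by rw [lintegral_const_mul _ (measurable_lavg _ _), lintegral_lavg hab]

/-- Functions in `H^{[n/2]}` are small form perturbations of the Dirichlet form. -/
theorem exists_form_bound_dyadic (hab : ∀ l, a l < b l) {k : ℕ} (hk : n ≤ 2 * k + 1) :
    ∃ C : ℝ≥0, ∀ (f : Pt n → ℝ) (N : ℝ≥0), HK (box a b) k f N →
      ∀ (w : Pt n → ℝ) (g : Fin n → Pt n → ℝ), MemLp w 2 (volume.restrict (box a b)) →
      (∀ l, HasWD (box a b) l w (g l)) → ∀ J : ℕ,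
      ∫⁻ x in box a b, ‖f x‖ₑ * ‖w x‖ₑ ^ 2 ≤ C * N * (rt2 ^ J * (∫⁻ x in box a b, ‖w x‖ₑ ^ 2) +
        2⁻¹ ^ J * (2⁻¹ * rt2) ^ J * ∫⁻ x in box a b, (∑ l, ‖g l x‖ₑ) ^ 2) := by
  obtain ⟨C, hC⟩ := exists_morrey_bound hab k
  set K : ℝ≥0 := (stepK a b).toNNReal with hK
  have hKc : (K : ℝ≥0∞) = stepK a b := ENNReal.coe_toNNReal (stepK_ne_top a b)
  set S : ℝ≥0 := ((1 - 2⁻¹ * rt2)⁻¹).toNNReal with hS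
  have hSc : (S : ℝ≥0∞) = (1 - 2⁻¹ * rt2)⁻¹ := ENNReal.coe_toNNReal tsum_half_rt2_ne_top
  set E := NNReal.sqrt C with hE
  refine ⟨2 * E + 4 * K ^ 2 * E * S, fun f N hf w g hw hg J => ?_⟩
  have hfb := hf.base
  have hGm := aemeasurable_gradSum (a := a) (b := b) fun l => (hg l).memg
  have hfm : AEMeasurable (fun x => ‖f x‖ₑ) (volume.restrict (box a b)) := hfb.1.1.enorm
  have hM : ∀ m, ∀ x ∈ box a b, lavg a b (lvl n m) (fun y => ‖f y‖ₑ) x ≤ E * N * rt2 ^ m := by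
    intro m x hx
    have := lavg_le_of_sq hab hfb.1.1.enorm hx (hC f N hf m x hx)
    rwa [mexp_eq_one hk, mul_one] at this
  set G : Pt n → ℝ≥0∞ := fun y => ∑ l, ‖g l y‖ₑ with hG
  set W := ∫⁻ x in box a b, ‖w x‖ₑ ^ 2 with hW
  set Γ := ∫⁻ x in box a b, G x ^ 2 with hΓ
  -- Here `w` is split at level J into its cell average and a multiscale sum of averages of its
  -- gradient. All these factors are constant on cells, so against them `f` enters only through its
  -- averages, of size (√2)^m at level m. The gradient part is multiplied by 2^{-J} and by the tail
  -- of a geometric series of ratio 1/√2.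
  have hpt : ∀ᵐ x ∂(volume.restrict (box a b)), ‖f x‖ₑ * ‖w x‖ₑ ^ 2 ≤
      2 * (‖f x‖ₑ * lavg a b (lvl n J) (fun y => ‖w y‖ₑ) x ^ 2) +
      2 * K ^ 2 * (2 * 2⁻¹ ^ J) * ∑' i : ℕ, (2⁻¹) ^ (J + i) * (‖f x‖ₑ * lavg a b (lvl n (J + i)) G x ^ 2) := by
    filter_upwards [ae_enorm_sub_avg_sq_le hab hw hg J] with x hx
    have h1 : ‖w x‖ₑ ^ 2 ≤ 2 * ‖w x - avg a b (lvl n J) w x‖ₑ ^ 2 + 2 * ‖avg a b (lvl n J) w x‖ₑ ^ 2 := by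
      refine le_trans ?_ (sq_add_le_ennreal _ _)
      gcongr
      calc ‖w x‖ₑ = ‖(w x - avg a b (lvl n J) w x) + avg a b (lvl n J) w x‖ₑ := by rw [sub_add_cancel]
        _ ≤ _ := enorm_add_le _ _
    calc ‖f x‖ₑ * ‖w x‖ₑ ^ 2 ≤ ‖f x‖ₑ * (2 * (K ^ 2 * (2 * 2⁻¹ ^ J) *
          ∑' i : ℕ, (2⁻¹) ^ (J + i) * lavg a b (lvl n (J + i)) G x ^ 2) +
          2 * lavg a b (lvl n J) (fun y => ‖w y‖ₑ) x ^ 2) := by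
          refine mul_le_mul_right (h1.trans (add_le_add ?_ ?_)) _
          · rw [hKc]; gcongr
          · gcongr; exact enorm_avg_le hab _ w x
      _ = _ := by
          simp_rw [mul_left_comm _ (‖f x‖ₑ)]
          rw [ENNReal.tsum_mul_left]
          ring
  have hmm : ∀ i : ℕ, AEMeasurable (fun x => (2⁻¹ : ℝ≥0∞) ^ (J + i) *
      (‖f x‖ₑ * lavg a b (lvl n (J + i)) G x ^ 2)) (volume.restrict (box a b)) := fun i =>
    (hfm.mul ((measurable_lavg _ _).pow_const 2).aemeasurable).const_mul _
  have hmw : AEMeasurable (fun x => ‖f x‖ₑ * lavg a b (lvl n J) (fun y => ‖w y‖ₑ) x ^ 2)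
      (volume.restrict (box a b)) := hfm.mul ((measurable_lavg _ _).pow_const 2).aemeasurable
  calc _ ≤ ∫⁻ x in box a b, (2 * (‖f x‖ₑ * lavg a b (lvl n J) (fun y => ‖w y‖ₑ) x ^ 2) +
        2 * K ^ 2 * (2 * 2⁻¹ ^ J) * ∑' i : ℕ, (2⁻¹) ^ (J + i) *
          (‖f x‖ₑ * lavg a b (lvl n (J + i)) G x ^ 2)) := lintegral_mono_ae hpt
    _ = 2 * (∫⁻ x in box a b, ‖f x‖ₑ * lavg a b (lvl n J) (fun y => ‖w y‖ₑ) x ^ 2) +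
        2 * K ^ 2 * (2 * 2⁻¹ ^ J) * ∑' i : ℕ, (2⁻¹) ^ (J + i) *
          ∫⁻ x in box a b, ‖f x‖ₑ * lavg a b (lvl n (J + i)) G x ^ 2 := by
        rw [lintegral_add_left' (hmw.const_mul _), lintegral_const_mul'' _ hmw,
          lintegral_const_mul'' _ (AEMeasurable.tsum hmm), lintegral_tsum hmm]
        congr 3
        ext i
        have hi : AEMeasurable (fun x => ‖f x‖ₑ * lavg a b (lvl n (J + i)) G x ^ 2)
          (volume.restrict (box a b)) := hfm.mul ((measurable_lavg _ _).pow_const 2).aemeasurable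
        rw [lintegral_const_mul'' _ hi]
    _ ≤ 2 * (E * N * rt2 ^ J * W) +
        2 * K ^ 2 * (2 * 2⁻¹ ^ J) * ∑' i : ℕ, (2⁻¹) ^ (J + i) * (E * N * rt2 ^ (J + i) * Γ) := by
        gcongr with i
        · exact lintegral_mul_lavg_sq_le hab hfm hw.1.enorm (hM J)
        · exact lintegral_mul_lavg_sq_le hab hfm hGm (hM _)
    _ = 2 * (E * N * rt2 ^ J * W) +
        2 * K ^ 2 * (2 * 2⁻¹ ^ J) * ((2⁻¹ * rt2) ^ J * S * (E * N * Γ)) := by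
        have : ∀ i : ℕ, (2⁻¹ : ℝ≥0∞) ^ (J + i) * (E * N * rt2 ^ (J + i) * Γ) =
          (2⁻¹ : ℝ≥0∞) ^ (J + i) * rt2 ^ (J + i) * (E * N * Γ) := fun i => by ring
        simp_rw [this]
        rw [ENNReal.tsum_mul_right, tsum_half_rt2_add, hSc]
    _ = 2 * E * N * (rt2 ^ J * W) + 4 * K ^ 2 * E * S * N * (2⁻¹ ^ J * (2⁻¹ * rt2) ^ J * Γ) := by ring
    _ ≤ (2 * E + 4 * K ^ 2 * E * S) * N * (rt2 ^ J * W) +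
        (2 * E + 4 * K ^ 2 * E * S) * N * (2⁻¹ ^ J * (2⁻¹ * rt2) ^ J * Γ) := by
        gcongr
        · exact le_self_add
        · exact le_add_self
    _ = _ := by push_cast; ring

end Morrey


/-! ### Products of sines and their completeness in L² of the box. -/

section Sines

variable {n : ℕ}

/-- A product of functions of one coordinate each. -/
def prodFn (F : Fin n → ℝ → ℝ) (x : Pt n) : ℝ := ∏ l, F l (x l)

theorem contDiff_prodFn {F : Fin n → ℝ → ℝ} (hF : ∀ l, ContDiff ℝ ∞ (F l)) :
    ContDiff ℝ ∞ (prodFn F) := contDiff_prod fun l _ => contDiff_coord (hF l) l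

theorem prodFn_eq_mul_erase (F : Fin n → ℝ → ℝ) (i : Fin n) (x : Pt n) :
    prodFn F x = F i (x i) * ∏ l ∈ Finset.univ.erase i, F l (x l) :=
  (Finset.mul_prod_erase _ _ (Finset.mem_univ i)).symm

theorem prodFn_update (F : Fin n → ℝ → ℝ) (i : Fin n) (θ : ℝ → ℝ) (x : Pt n) :
    prodFn (Function.update F i θ) x = θ (x i) * ∏ l ∈ Finset.univ.erase i, F l (x l) := by
  rw [prodFn_eq_mul_erase _ i, Function.update_self]
  congr 1
  exact Finset.prod_congr rfl fun l hl => by rw [Function.update_of_ne (Finset.ne_of_mem_erase hl)]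

theorem pderiv_prodFn {F : Fin n → ℝ → ℝ} (hF : ∀ l, ContDiff ℝ ∞ (F l)) (i : Fin n) :
    pderiv i (prodFn F) = prodFn (Function.update F i (deriv (F i))) := by
  ext x
  have e : prodFn F = fun x => F i (x i) * ∏ l ∈ Finset.univ.erase i, F l (x l) :=
    funext (prodFn_eq_mul_erase F i)
  have hs : ∀ s : Finset (Fin n), i ∉ s →
      pderiv i (fun x : Pt n => ∏ l ∈ s, F l (x l)) x = 0 := by
    intro s
    induction s using Finset.induction_on with
    | empty => intro _; simp [pderiv]
    | insert l s hl ih =>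
      intro hi
      rw [Finset.mem_insert, not_or] at hi
      have e : (fun x : Pt n => ∏ l ∈ insert l s, F l (x l)) =
          fun x => F l (x l) * ∏ l ∈ s, F l (x l) := by
        ext x; rw [Finset.prod_insert hl]
      rw [e, pderiv_mul (contDiff_coord (hF l) l) (contDiff_prod fun l _ => contDiff_coord (hF l) l),
        ih hi.2, pderiv_coord (hF l), if_neg (Ne.symm hi.1)]
      simp
  rw [e, pderiv_mul (contDiff_coord (hF i) i) (contDiff_prod fun l _ => contDiff_coord (hF l) l),
    hs _ (by simp), pderiv_coord (hF i), if_pos rfl, prodFn_update]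
  simp

/-- The frequencies of the sine functions on a box. -/
noncomputable def freq (a b : Fin n → ℝ) (k : Fin n → ℕ) (l : Fin n) : ℝ :=
  k l * (Real.pi / (b l - a l))

/-- The factors of the Dirichlet eigenfunctions of a box. -/
noncomputable def sinFactor (a b : Fin n → ℝ) (k : Fin n → ℕ) (l : Fin n) (t : ℝ) : ℝ :=
  Real.sin (freq a b k l * (t - a l))

/-- The Dirichlet eigenfunctions of a box. -/
noncomputable def sn (a b : Fin n → ℝ) (k : Fin n → ℕ) : Pt n → ℝ := prodFn (sinFactor a b k)

variable {a b : Fin n → ℝ}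

theorem contDiff_sinFactor (k : Fin n → ℕ) (l : Fin n) : ContDiff ℝ ∞ (sinFactor a b k l) := by
  unfold sinFactor; fun_prop

theorem contDiff_sn (k : Fin n → ℕ) : ContDiff ℝ ∞ (sn a b k) :=
  contDiff_prodFn fun l => contDiff_sinFactor k l

theorem deriv_sinFactor (k : Fin n → ℕ) (l : Fin n) :
    deriv (sinFactor a b k l) = fun t => freq a b k l * Real.cos (freq a b k l * (t - a l)) := by
  ext t
  have h : HasDerivAt (fun t => freq a b k l * (t - a l)) (freq a b k l) t := by
    simpa using ((hasDerivAt_id t).sub_const (a l)).const_mul (freq a b k l)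
  have h2 : deriv (sinFactor a b k l) t = _ := h.sin.deriv
  rw [h2]; ring

theorem deriv_deriv_sinFactor (k : Fin n → ℕ) (l : Fin n) :
    deriv (deriv (sinFactor a b k l)) = fun t => -freq a b k l ^ 2 * sinFactor a b k l t := by
  rw [deriv_sinFactor]
  ext t
  have h : HasDerivAt (fun t => freq a b k l * (t - a l)) (freq a b k l) t := by
    simpa using ((hasDerivAt_id t).sub_const (a l)).const_mul (freq a b k l)
  rw [(h.cos.const_mul (freq a b k l)).deriv, sinFactor]; ring

theorem contDiff_deriv_sinFactor (k : Fin n → ℕ) (i l : Fin n) :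
    ContDiff ℝ ∞ (Function.update (sinFactor a b k) i (deriv (sinFactor a b k i)) l) := by
  by_cases h : l = i
  · subst h; rw [Function.update_self]; exact (contDiff_sinFactor k l).deriv'
  · rw [Function.update_of_ne h]; exact contDiff_sinFactor k l

theorem pderiv_pderiv_sn (k : Fin n → ℕ) (i : Fin n) :
    pderiv i (pderiv i (sn a b k)) = fun x => -freq a b k i ^ 2 * sn a b k x := by
  rw [sn, pderiv_prodFn (contDiff_sinFactor k), pderiv_prodFn (contDiff_deriv_sinFactor k i),
    Function.update_self, Function.update_idem, deriv_deriv_sinFactor]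
  ext x
  rw [prodFn_update, prodFn_eq_mul_erase _ i]; ring

theorem sinFactor_eq_zero (hab : ∀ l, a l < b l) (k : Fin n → ℕ) {l : Fin n} {t : ℝ}
    (ht : t = a l ∨ t = b l) : sinFactor a b k l t = 0 := by
  rcases ht with rfl | rfl
  · simp [sinFactor]
  · have : freq a b k l * (b l - a l) = k l * Real.pi := by
      have := sub_pos.2 (hab l)
      rw [freq]; field_simp
    rw [sinFactor, this, Real.sin_nat_mul_pi]

theorem sn_eq_zero (hab : ∀ l, a l < b l) (k : Fin n → ℕ) {l : Fin n} {x : Pt n}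
    (hx : x l = a l ∨ x l = b l) : sn a b k x = 0 :=
  Finset.prod_eq_zero (Finset.mem_univ l) (sinFactor_eq_zero hab k hx)

theorem pderiv_sn_eq_zero (hab : ∀ l, a l < b l) (k : Fin n → ℕ) {i l : Fin n} (hil : i ≠ l) {x : Pt n}
    (hx : x l = a l ∨ x l = b l) : pderiv i (sn a b k) x = 0 := by
  rw [sn, pderiv_prodFn (contDiff_sinFactor k)]
  refine Finset.prod_eq_zero (Finset.mem_univ l) ?_
  rw [Function.update_of_ne hil.symm]
  exact sinFactor_eq_zero hab k hx

/-- The product-to-sum formula in one coordinate. The coefficient must vanish when `k l = 0`: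
truncated subtraction leaves frequency 0, and the raised frequency would contribute a spurious sine.
-/
theorem cos_mul_sn (k : Fin n → ℕ) (l : Fin n) (x : Pt n) :
    Real.cos (Real.pi / (b l - a l) * (x l - a l)) * sn a b k x =
      (if k l = 0 then 0 else 1 / 2) * (sn a b (k + Pi.single l 1) x + sn a b (k - Pi.single l 1) x) := by
  set θ := Real.pi / (b l - a l) * (x l - a l) with hθ
  have hfac : ∀ k' : Fin n → ℕ, sinFactor a b k' l (x l) = Real.sin (k' l * θ) := by
    intro k'; rw [sinFactor, freq, hθ]; ring_nf
  have hsn : ∀ k' : Fin n → ℕ, (∀ l', l' ≠ l → k' l' = k l') → sn a b k' x =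
      Real.sin (k' l * θ) * ∏ l' ∈ Finset.univ.erase l, sinFactor a b k l' (x l') := by
    intro k' hk'
    rw [sn, prodFn_eq_mul_erase _ l, hfac]
    congr 1
    refine Finset.prod_congr rfl fun l' hl' => ?_
    rw [sinFactor, sinFactor, freq, freq, hk' l' (Finset.ne_of_mem_erase hl')]
  rw [hsn k fun _ _ => rfl, hsn (k + Pi.single l 1) fun l' h => by simp [h],
    hsn (k - Pi.single l 1) fun l' h => by simp [h]]
  by_cases hk : k l = 0
  · simp [hk]
  · rw [if_neg hk]
    obtain ⟨m, hm⟩ := Nat.exists_eq_succ_of_ne_zero hk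
    simp only [Pi.add_apply, Pi.single_eq_same, Pi.sub_apply, hm, Nat.succ_eq_add_one,
      Nat.add_sub_cancel]
    push_cast
    have e1 : ((m : ℝ) + 1 + 1) * θ = (m + 1) * θ + θ := by ring
    have e2 : (m : ℝ) * θ = (m + 1) * θ - θ := by ring
    rw [e1, e2, Real.sin_add, Real.sin_sub]; ring

/-- The sines form a complete system in `L²` of the box. -/
theorem ae_eq_zero_of_forall_sn (hab : ∀ l, a l < b l) {f : Pt n → ℝ}
    (hf : MemLp f 2 (volume.restrict (box a b)))
    (h : ∀ k, ∫ x in box a b, f x * sn a b k x = 0) : f =ᵐ[volume.restrict (box a b)] 0 := by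
  set K : Set (Pt n) := {x | ∀ i, x i ∈ Icc (a i) (b i)} with hK
  have hKc : IsCompact K := isCompact_closedBox a b
  have : CompactSpace K := isCompact_iff_compactSpace.1 hKc
  set M : Submodule ℝ (Pt n → ℝ) := Submodule.span ℝ (range (sn a b)) with hM
  have hMint : ∀ m ∈ M, Continuous m ∧ ∫ x in box a b, f x * m x = 0 := by
    intro m hm
    induction hm using Submodule.span_induction with
    | mem m hm => obtain ⟨k, rfl⟩ := hm; exact ⟨(contDiff_sn k).continuous, h k⟩
    | zero => exact ⟨continuous_const, by simp⟩
    | add m m' _ _ h1 h2 =>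
      refine ⟨h1.1.add h2.1, ?_⟩
      simp_rw [Pi.add_apply, mul_add]
      rw [integral_add (integrable_mul_continuous hf h1.1) (integrable_mul_continuous hf h2.1),
        h1.2, h2.2, add_zero]
    | smul r m _ h1 =>
      refine ⟨h1.1.const_smul r, ?_⟩
      simp_rw [Pi.smul_apply, smul_eq_mul, mul_left_comm]
      rw [integral_const_mul, h1.2, mul_zero]
  -- The span of the sines is a module over the algebra generated by these cosines. The cosines
  -- separate the points of the closed box, so by Stone–Weierstrass that algebra is dense in the
  -- continuous functions.
  have hcosM : ∀ l, ∀ m ∈ M, (fun x : Pt n => Real.cos (Real.pi / (b l - a l) * (x l - a l)) * m x) ∈ M := by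
    intro l m hm
    induction hm using Submodule.span_induction with
    | mem m hm =>
      obtain ⟨k, rfl⟩ := hm
      have e : (fun x : Pt n => Real.cos (Real.pi / (b l - a l) * (x l - a l)) * sn a b k x) =
          (if k l = 0 then (0 : ℝ) else 1 / 2) • sn a b (k + Pi.single l 1) +
            (if k l = 0 then (0 : ℝ) else 1 / 2) • sn a b (k - Pi.single l 1) := by
        ext x
        rw [cos_mul_sn]
        simp only [Pi.add_apply, Pi.smul_apply, smul_eq_mul]; ring
      rw [e]
      exact M.add_mem (M.smul_mem _ (Submodule.subset_span ⟨_, rfl⟩))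
        (M.smul_mem _ (Submodule.subset_span ⟨_, rfl⟩))
    | zero => simp only [Pi.zero_apply, mul_zero]; exact M.zero_mem
    | add m m' _ _ h1 h2 =>
      convert M.add_mem h1 h2 using 1
      ext x; simp [mul_add]
    | smul r m _ h1 =>
      convert M.smul_mem r h1 using 1
      ext x; simp only [Pi.smul_apply, smul_eq_mul]; ring
  set c : Fin n → C(K, ℝ) := fun l =>
    ⟨fun x => Real.cos (Real.pi / (b l - a l) * (x.1 l - a l)), by fun_prop⟩ with hc
  set A : Subalgebra ℝ C(K, ℝ) := Algebra.adjoin ℝ (range c) with hA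
  have hAM : ∀ g ∈ A, ∃ G : Pt n → ℝ, (∀ x : K, g x = G x) ∧ ∀ m ∈ M, (fun x => G x * m x) ∈ M := by
    intro g hg
    induction hg using Algebra.adjoin_induction with
    | mem g hg => obtain ⟨l, rfl⟩ := hg; exact ⟨_, fun x => rfl, hcosM l⟩
    | algebraMap r =>
      refine ⟨fun _ => r, fun x => rfl, fun m hm => ?_⟩
      exact M.smul_mem r hm
    | add g g' _ _ h1 h2 =>
      obtain ⟨G, hG, hGM⟩ := h1
      obtain ⟨G', hG', hGM'⟩ := h2
      refine ⟨fun x => G x + G' x, fun x => by simp [hG, hG'], fun m hm => ?_⟩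
      convert M.add_mem (hGM m hm) (hGM' m hm) using 1
      ext x; simp [add_mul]
    | mul g g' _ _ h1 h2 =>
      obtain ⟨G, hG, hGM⟩ := h1
      obtain ⟨G', hG', hGM'⟩ := h2
      refine ⟨fun x => G x * G' x, fun x => by simp [hG, hG'], fun m hm => ?_⟩
      convert hGM _ (hGM' m hm) using 1
      ext x; ring
  have hsep : A.SeparatesPoints := by
    intro x y hxy
    have : ∃ l, x.1 l ≠ y.1 l := by
      by_contra hcon
      push Not at hcon
      exact hxy (Subtype.ext (PiLp.ext hcon))
    obtain ⟨l, hl⟩ := this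
    refine ⟨c l, ⟨c l, Algebra.subset_adjoin ⟨l, rfl⟩, rfl⟩, fun heq => hl ?_⟩
    have hbl := sub_pos.2 (hab l)
    have hin : ∀ z : K, Real.pi / (b l - a l) * (z.1 l - a l) ∈ Icc 0 Real.pi := by
      intro z
      have hz := z.2 l
      constructor
      · exact mul_nonneg (by positivity) (by linarith [hz.1])
      · rw [div_mul_eq_mul_div, div_le_iff₀ hbl]
        exact mul_le_mul_of_nonneg_left (by linarith [hz.2]) Real.pi_pos.le
    have := Real.injOn_cos (hin x) (hin y) heq
    have hne : Real.pi / (b l - a l) ≠ 0 := by positivity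
    have := mul_left_cancel₀ hne this
    linarith
  have htop := ContinuousMap.subalgebra_topologicalClosure_eq_top_of_separatesPoints A hsep
  -- The module acts on this first eigenfunction: `f * s1` is orthogonal to all continuous functions
  -- and hence zero. Since `s1` is positive inside the box, `f` vanishes too.
  set s1 := sn a b (fun _ => 1) with hs1
  have hs1c : Continuous s1 := (contDiff_sn _).continuous
  have hs1b : ∀ x, |s1 x| ≤ 1 := by
    intro x
    rw [hs1, sn, prodFn, Finset.abs_prod]
    exact Finset.prod_le_one (fun _ _ => abs_nonneg _) fun l _ => Real.abs_sin_le_one _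
  have hfs : MemLp (fun x => f x * s1 x) 2 (volume.restrict (box a b)) := by
    have := memLp_smooth_mul (isOpen_box a b) (isBounded_box a b) hf hs1c
    convert this using 2; ring
  have hfint := integrable_of_memLp hf
  have hz : ∀ Φ : Pt n → ℝ, Continuous Φ → ∫ x in box a b, f x * s1 x * Φ x = 0 := by
    intro Φ hΦ
    have hI0 : 0 ≤ ∫ x in box a b, |f x| := integral_nonneg fun _ => abs_nonneg _
    have hle : ∀ δ : ℝ, 0 < δ → |∫ x in box a b, f x * s1 x * Φ x| ≤ δ * ∫ x in box a b, |f x| := by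
      intro δ hδ
      set φ : C(K, ℝ) := ⟨fun x => Φ x, hΦ.comp continuous_subtype_val⟩ with hφ
      have hmem : φ ∈ A.topologicalClosure := by rw [htop]; trivial
      obtain ⟨g, hgA, hg⟩ := Metric.mem_closure_iff.1 hmem δ hδ
      obtain ⟨G, hG, hGM⟩ := hAM g hgA
      have hm := hMint _ (hGM s1 (Submodule.subset_span ⟨_, rfl⟩))
      have e : ∫ x in box a b, f x * s1 x * Φ x =
          ∫ x in box a b, (f x * s1 x * Φ x - f x * (G x * s1 x)) := by
        rw [integral_sub (integrable_mul_continuous hfs hΦ) (integrable_mul_continuous hf hm.1), hm.2,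
          sub_zero]
      rw [e, ← integral_const_mul]
      refine abs_integral_le_integral_abs.trans (integral_mono_of_nonneg
        (Filter.Eventually.of_forall fun _ => abs_nonneg _) (hfint.abs.const_mul _) ?_)
      filter_upwards [ae_restrict_mem (measurableSet_box a b)] with x hx
      have hxK : x ∈ K := fun i => ⟨(hx i).1.le, (hx i).2.le⟩
      have hd : |Φ x - G x| ≤ δ := by
        have h1 := ContinuousMap.dist_apply_le_dist (f := φ) (g := g) ⟨x, hxK⟩
        rw [Real.dist_eq, hG] at h1
        exact h1.trans hg.le
      calc |f x * s1 x * Φ x - f x * (G x * s1 x)| = |Φ x - G x| * |f x| * |s1 x| := by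
            rw [← abs_mul, ← abs_mul]; congr 1; ring
        _ ≤ δ * |f x| * 1 := by gcongr; exact hs1b x
        _ = _ := by ring
    have : |∫ x in box a b, f x * s1 x * Φ x| ≤ 0 := by
      refine le_of_forall_pos_le_add fun ε hε => ?_
      have := hle (ε / ((∫ x in box a b, |f x|) + 1)) (by positivity)
      refine this.trans ?_
      rw [zero_add, div_mul_eq_mul_div, div_le_iff₀ (by positivity)]
      nlinarith
    exact abs_nonpos_iff.1 this
  have hae := ae_eq_of_forall_test (isOpen_box a b) hfs
    (g := fun _ => (0 : ℝ)) (memLp_const 0) (fun φ hφ => by simpa using hz φ hφ.smooth.continuous)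
  filter_upwards [hae, ae_restrict_mem (measurableSet_box a b)] with x hx hxb
  have hpos : 0 < s1 x := by
    change 0 < ∏ l, sinFactor a b (fun _ => 1) l (x l)
    refine Finset.prod_pos fun l _ => ?_
    have hbl := sub_pos.2 (hab l)
    have hxl := hxb l
    simp only [sinFactor, freq, Nat.cast_one, one_mul]
    refine Real.sin_pos_of_pos_of_lt_pi (mul_pos (by positivity) (by linarith [hxl.1])) ?_
    rw [div_mul_eq_mul_div, div_lt_iff₀ hbl]
    exact mul_lt_mul_of_pos_left (by linarith [hxl.2]) Real.pi_pos
  have hx' : f x * s1 x = 0 := hx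
  rcases mul_eq_zero.1 hx' with h0 | h0
  · exact h0
  · exact absurd h0 hpos.ne'

end Sines


/-! ### Jets of order two with weak boundary conditions, and density of the sine jets. -/

section Jets

variable {n : ℕ}

/-- Indices of the derivatives of order at most two. -/
abbrev JIdx (n : ℕ) := Option (Fin n ⊕ Fin n × Fin n)

/-- Families `(u, ∂ᵢu, ∂ⱼ∂ᵢu)` satisfying in a weak sense the boundary condition `u = 0` on the
boundary of the box. -/
structure Adm (a b : Fin n → ℝ) (U : JIdx n → Pt n → ℝ) : Prop where
  mem : ∀ ι, MemLp (U ι) 2 (volume.restrict (box a b))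
  first : ∀ (i : Fin n) (Φ : Pt n → ℝ), ContDiff ℝ ∞ Φ →
    ∫ x in box a b, U none x * pderiv i Φ x = -∫ x in box a b, U (some (.inl i)) x * Φ x
  mixed : ∀ (i j : Fin n), i ≠ j → ∀ (Φ : Pt n → ℝ), ContDiff ℝ ∞ Φ →
    ∫ x in box a b, U none x * pderiv i (pderiv j Φ) x = ∫ x in box a b, U (some (.inr (i, j))) x * Φ x
  second : ∀ (i : Fin n) (Φ : Pt n → ℝ), ContDiff ℝ ∞ Φ →
    (∀ x : Pt n, (x i = a i ∨ x i = b i) → Φ x = 0) →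
    ∫ x in box a b, U (some (.inl i)) x * pderiv i Φ x =
      -∫ x in box a b, U (some (.inr (i, i))) x * Φ x

variable {a b : Fin n → ℝ}

/-- Vanishing of u on the boundary removes all boundary terms in `first` and, through the tangential
derivatives, in `mixed`. The normal derivative ∂_i u is free on the i-faces, so in `second` it is
the smooth factor that has to vanish there. -/
theorem Adm.of_hasWD {U : JIdx n → Pt n → ℝ}
    (h1 : ∀ i, HasWD (box a b) i (U none) (U (some (.inl i))))
    (h2 : ∀ i j, HasWD (box a b) j (U (some (.inl i))) (U (some (.inr (i, j)))))
    (hf : ∀ l, FaceZero a b l (U none)) (hm : MemLp (U none) 2 (volume.restrict (box a b))) :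
    Adm a b U where
  mem := by
    rintro (_ | i | ⟨i, j⟩)
    · exact hm
    · exact (h1 i).memg
    · exact (h2 i j).memg
  first i Φ hΦ := (h1 i).ibp_of_faceZero hΦ ((hf i).mul hΦ.continuous)
  mixed i j hij Φ hΦ := ibp_mixed hij (h1 i) (h2 i j) hf hΦ
  second i Φ hΦ hz := (h2 i i).ibp_of_vanish_faces hΦ hz

/-- The derivatives of order at most two of a smooth function. -/
noncomputable def smoothJet (Φ : Pt n → ℝ) : JIdx n → Pt n → ℝ
  | none => Φ
  | some (.inl i) => pderiv i Φ
  | some (.inr (i, j)) => pderiv j (pderiv i Φ)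

theorem contDiff_smoothJet {Φ : Pt n → ℝ} (hΦ : ContDiff ℝ ∞ Φ) (ι : JIdx n) :
    ContDiff ℝ ∞ (smoothJet Φ ι) := by
  rcases ι with _ | i | ⟨i, j⟩
  · exact hΦ
  · exact contDiff_pderiv hΦ i
  · exact contDiff_pderiv (contDiff_pderiv hΦ i) j

theorem memLp_of_contDiff {Φ : Pt n → ℝ} (hΦ : ContDiff ℝ ∞ Φ) :
    MemLp Φ 2 (volume.restrict (box a b)) :=
  memLp_continuous (isOpen_box a b) (isBounded_box a b) hΦ.continuous

theorem FaceZero.of_vanish {i : Fin n} {Φ : Pt n → ℝ} (hΦ : ContDiff ℝ ∞ Φ)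
    (h0 : ∀ x : Pt n, (x i = a i ∨ x i = b i) → Φ x = 0) : FaceZero a b i Φ := by
  obtain ⟨L, hL, h⟩ := exists_abs_le_dist_face hΦ h0
  intro δ hδ
  refine ⟨δ / (L + 1), by positivity, ?_⟩
  filter_upwards [ae_restrict_mem (measurableSet_box a b)] with x hx hxi
  have h1 := h x hx
  have e : (L + 1) * (δ / (L + 1)) = δ := by field_simp
  have hxi' := hx i
  rcases hxi with hxi | hxi
  · refine h1.1.trans ?_
    calc L * (x i - a i) ≤ (L + 1) * (δ / (L + 1)) := by
          apply mul_le_mul <;> linarith [hxi'.1]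
      _ = δ := e
  · refine h1.2.trans ?_
    calc L * (b i - x i) ≤ (L + 1) * (δ / (L + 1)) := by
          apply mul_le_mul <;> linarith [hxi'.2]
      _ = δ := e

theorem adm_sn (hab : ∀ l, a l < b l) (k : Fin n → ℕ) : Adm a b (smoothJet (sn a b k)) :=
  Adm.of_hasWD
    (fun i => hasWD_smooth (isOpen_box a b) (isBounded_box a b) i (contDiff_sn k))
    (fun i j => hasWD_smooth (isOpen_box a b) (isBounded_box a b) j (contDiff_pderiv (contDiff_sn k) i))
    (fun _ => FaceZero.of_vanish (contDiff_sn k) fun _ hx => sn_eq_zero hab k hx)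
    (memLp_of_contDiff (contDiff_sn k))

/-- Moving all derivatives onto the sine produces even powers of the frequencies. Hence the inner
product with a full sine jet is the Fourier coefficient of `U none` times a number that is at least
1, and orthogonality to the jet forces the coefficient to vanish. -/
theorem Adm.pairing_sn (hab : ∀ l, a l < b l) {U : JIdx n → Pt n → ℝ} (hU : Adm a b U)
    (k : Fin n → ℕ) (ι : JIdx n) : ∃ c : ℝ, (ι = none → c = 1) ∧ 0 ≤ c ∧
      ∫ x in box a b, U ι x * smoothJet (sn a b k) ι x = c * ∫ x in box a b, U none x * sn a b k x := by
  have hs := contDiff_sn (a := a) (b := b) k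
  have hpull : ∀ (F : Pt n → ℝ) (r : ℝ), ∫ x in box a b, F x * (r * sn a b k x) =
      r * ∫ x in box a b, F x * sn a b k x := by
    intro F r; rw [← integral_const_mul]; congr 1; ext x; ring
  rcases ι with _ | i | ⟨i, j⟩
  · exact ⟨1, fun _ => rfl, zero_le_one, by rw [one_mul]; rfl⟩
  · refine ⟨freq a b k i ^ 2, by simp, by positivity, ?_⟩
    have := hU.first i _ (contDiff_pderiv hs i)
    rw [pderiv_pderiv_sn] at this
    change ∫ x in box a b, U (some (.inl i)) x * pderiv i (sn a b k) x = _
    rw [hpull] at this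
    linarith
  · by_cases hij : i = j
    · subst hij
      refine ⟨freq a b k i ^ 2 * freq a b k i ^ 2, by simp, by positivity, ?_⟩
      have h1 := hU.first i _ (contDiff_pderiv hs i)
      have h2 := hU.second i _ hs fun x hx => sn_eq_zero hab k hx
      rw [pderiv_pderiv_sn, hpull] at h1
      change ∫ x in box a b, U (some (.inr (i, i))) x * pderiv i (pderiv i (sn a b k)) x = _
      rw [pderiv_pderiv_sn, hpull]
      linear_combination freq a b k i ^ 2 * h1 - freq a b k i ^ 2 * h2
    · refine ⟨freq a b k i ^ 2 * freq a b k j ^ 2, by simp, by positivity, ?_⟩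
      have h1 := hU.mixed i j hij _ (contDiff_pderiv (contDiff_pderiv hs i) j)
      change ∫ x in box a b, U (some (.inr (i, j))) x * pderiv j (pderiv i (sn a b k)) x = _
      have hsm : ∀ (l : Fin n) (r : ℝ), pderiv l (fun x => r * sn a b k x) =
          fun x => r * pderiv l (sn a b k) x := by
        intro l r; ext x
        rw [pderiv_mul contDiff_const hs]; simp [pderiv]
      have hsm2 : ∀ (l : Fin n) (r : ℝ), pderiv l (fun x => r * pderiv l (sn a b k) x) =
          fun x => r * pderiv l (pderiv l (sn a b k)) x := by
        intro l r; ext x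
        rw [pderiv_mul contDiff_const (contDiff_pderiv hs l)]; simp [pderiv]
      have e : pderiv i (pderiv j (pderiv j (pderiv i (sn a b k)))) =
          fun x => (freq a b k i ^ 2 * freq a b k j ^ 2) * sn a b k x := by
        rw [show pderiv j (pderiv i (sn a b k)) = pderiv i (pderiv j (sn a b k)) from pderiv_comm hs j i,
          show pderiv j (pderiv i (pderiv j (sn a b k))) = pderiv i (pderiv j (pderiv j (sn a b k))) from
            pderiv_comm (contDiff_pderiv hs j) j i, pderiv_pderiv_sn, hsm, hsm2, pderiv_pderiv_sn]
        ext x; ring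
      rw [← h1, e, hpull]

theorem ae_eq_zero_of_forall_integral {f : Pt n → ℝ} (hf : MemLp f 2 (volume.restrict (box a b)))
    (h : ∀ φ, IsTest (box a b) φ → ∫ x in box a b, f x * φ x = 0) :
    f =ᵐ[volume.restrict (box a b)] 0 :=
  ae_eq_of_forall_test (isOpen_box a b) hf MemLp.zero fun φ hφ => by simpa using h φ hφ

/-- The identities of `Adm` contain the defining identities of the weak derivatives, so the whole
jet is determined by its zeroth component. -/
theorem Adm.ae_eq_zero {U : JIdx n → Pt n → ℝ} (hU : Adm a b U)
    (h0 : U none =ᵐ[volume.restrict (box a b)] 0) (ι : JIdx n) :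
    U ι =ᵐ[volume.restrict (box a b)] 0 := by
  have hz : ∀ Ψ : Pt n → ℝ, ∫ x in box a b, U none x * Ψ x = 0 := by
    intro Ψ
    rw [← integral_zero (Pt n) ℝ (μ := volume.restrict (box a b))]
    apply integral_congr_ae
    filter_upwards [h0] with x hx
    simp [hx]
  have hfirst : ∀ i, U (some (.inl i)) =ᵐ[volume.restrict (box a b)] 0 := by
    intro i
    refine ae_eq_zero_of_forall_integral (hU.mem _) fun φ hφ => ?_
    have := hU.first i φ hφ.smooth
    rw [hz] at this; linarith
  rcases ι with _ | i | ⟨i, j⟩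
  · exact h0
  · exact hfirst i
  · refine ae_eq_zero_of_forall_integral (hU.mem _) fun φ hφ => ?_
    by_cases hij : i = j
    · subst hij
      have h1 := hU.second i φ hφ.smooth fun x hx => by
        by_contra hne
        have := hφ.supp (subset_tsupport _ hne) i
        rcases hx with hx | hx <;> rw [hx] at this <;> exact absurd this (by simp)
      have h2 : ∫ x in box a b, U (some (.inl i)) x * pderiv i φ x = 0 := by
        rw [← integral_zero (Pt n) ℝ (μ := volume.restrict (box a b))]
        apply integral_congr_ae
        filter_upwards [hfirst i] with x hx
        simp [hx]
      linarith
    · have := hU.mixed i j hij φ hφ.smooth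
      rw [hz] at this; exact this.symm

/-- The Hilbert space containing the jets of order two. -/
abbrev JetSp (a b : Fin n → ℝ) := PiLp 2 fun _ : JIdx n => Lp ℝ 2 (volume.restrict (box a b))

/-- The element of `JetSp` with given components. -/
noncomputable def toJet (U : JIdx n → Pt n → ℝ) (h : ∀ ι, MemLp (U ι) 2 (volume.restrict (box a b))) :
    JetSp a b := WithLp.toLp 2 fun ι => (h ι).toLp (U ι)

/-- Pairing of one component with a square integrable function. -/
noncomputable def pairL (ι : JIdx n) (Ψ : Pt n → ℝ) (h : MemLp Ψ 2 (volume.restrict (box a b))) :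
    JetSp a b →L[ℝ] ℝ :=
  (innerSL ℝ (h.toLp Ψ)).comp (PiLp.proj 2 (fun _ : JIdx n => Lp ℝ 2 (volume.restrict (box a b))) ι)

theorem pairL_apply (ι : JIdx n) (Ψ : Pt n → ℝ) (h : MemLp Ψ 2 (volume.restrict (box a b)))
    (w : JetSp a b) : pairL ι Ψ h w = ∫ x in box a b, w ι x * Ψ x := by
  change inner ℝ (h.toLp Ψ) (w ι) = _
  rw [L2.inner_def]
  apply integral_congr_ae
  filter_upwards [h.coeFn_toLp] with x hx
  simp [hx]

theorem pairL_toJet (ι : JIdx n) (Ψ : Pt n → ℝ) (h : MemLp Ψ 2 (volume.restrict (box a b)))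
    (U : JIdx n → Pt n → ℝ) (hU : ∀ ι, MemLp (U ι) 2 (volume.restrict (box a b))) :
    pairL ι Ψ h (toJet U hU) = ∫ x in box a b, U ι x * Ψ x := by
  rw [pairL_apply]
  apply integral_congr_ae
  filter_upwards [(hU ι).coeFn_toLp] with x hx
  rw [show (toJet U hU) ι = (hU ι).toLp (U ι) from rfl, hx]

theorem inner_toJet (U : JIdx n → Pt n → ℝ) (hU : ∀ ι, MemLp (U ι) 2 (volume.restrict (box a b)))
    (w : JetSp a b) : inner ℝ (toJet U hU) w = ∑ ι, pairL ι (U ι) (hU ι) w := by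
  rw [PiLp.inner_apply]; rfl

/-- A functional vanishing on the jets of all the products of sines vanishes on admissible jets. -/
theorem Adm.sum_integral_eq_zero (hab : ∀ l, a l < b l) {U : JIdx n → Pt n → ℝ} (hU : Adm a b U)
    (f : JIdx n → Pt n → ℝ) (hf : ∀ ι, MemLp (f ι) 2 (volume.restrict (box a b)))
    (h : ∀ k, ∑ ι, ∫ x in box a b, smoothJet (sn a b k) ι x * f ι x = 0) :
    ∑ ι, ∫ x in box a b, U ι x * f ι x = 0 := by
  have hJ : ∀ k ι, MemLp (smoothJet (sn a b k) ι) 2 (volume.restrict (box a b)) :=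
    fun k ι => (adm_sn hab k).mem ι
  let S : Submodule ℝ (JetSp a b) :=
    (Submodule.span ℝ (Set.range fun k => toJet (smoothJet (sn a b k)) (hJ k))).topologicalClosure
  have hSc : IsClosed (S : Set (JetSp a b)) := Submodule.isClosed_topologicalClosure _
  have : CompleteSpace S := hSc.completeSpace_coe
  have hker : ∀ L : JetSp a b →L[ℝ] ℝ, (∀ k, L (toJet (smoothJet (sn a b k)) (hJ k)) = 0) →
      ∀ w ∈ S, L w = 0 := by
    intro L hL w hw
    have : S ≤ LinearMap.ker (L : JetSp a b →ₗ[ℝ] ℝ) := by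
      refine Submodule.topologicalClosure_minimal _ ?_ L.isClosed_ker
      rw [Submodule.span_le]
      rintro _ ⟨k, rfl⟩
      exact hL k
    exact this hw
  let e := toJet U hU.mem
  -- It suffices that this component of the jet orthogonal to the closed span S of the sine jets is
  -- zero.
  let w : JetSp a b := e - S.starProjection e
  have hPS : S.starProjection e ∈ S := S.starProjection_apply_mem e
  have hrel : ∀ L : JetSp a b →L[ℝ] ℝ, (∀ k, L (toJet (smoothJet (sn a b k)) (hJ k)) = 0) →
      L e = 0 → L w = 0 := by
    intro L hL he
    rw [show w = e - S.starProjection e from rfl, map_sub, he, hker L hL _ hPS, sub_zero]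
  -- Each condition of `Adm` is the vanishing of a continuous linear functional. It holds for `e`
  -- and for the sine jets, hence on S and for the difference.
  have hw : Adm a b (fun ι => (w ι : Pt n → ℝ)) := by
    refine ⟨fun ι => Lp.memLp _, fun i Φ hΦ => ?_, fun i j hij Φ hΦ => ?_, fun i Φ hΦ h0 => ?_⟩
    · have := hrel (pairL none (pderiv i Φ) (memLp_of_contDiff (contDiff_pderiv hΦ i)) +
        pairL (some (.inl i)) Φ (memLp_of_contDiff hΦ)) (fun k => by
          rw [add_apply, pairL_toJet, pairL_toJet,
            (adm_sn hab k).first i Φ hΦ]; ring) (by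
          rw [add_apply, pairL_toJet, pairL_toJet, hU.first i Φ hΦ]; ring)
      rw [add_apply, pairL_apply, pairL_apply] at this
      linarith
    · have := hrel (pairL none (pderiv i (pderiv j Φ))
        (memLp_of_contDiff (contDiff_pderiv (contDiff_pderiv hΦ j) i)) -
        pairL (some (.inr (i, j))) Φ (memLp_of_contDiff hΦ)) (fun k => by
          rw [sub_apply, pairL_toJet, pairL_toJet,
            (adm_sn hab k).mixed i j hij Φ hΦ]; ring) (by
          rw [sub_apply, pairL_toJet, pairL_toJet, hU.mixed i j hij Φ hΦ]; ring)
      rw [sub_apply, pairL_apply, pairL_apply] at this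
      linarith
    · have := hrel (pairL (some (.inl i)) (pderiv i Φ) (memLp_of_contDiff (contDiff_pderiv hΦ i)) +
        pairL (some (.inr (i, i))) Φ (memLp_of_contDiff hΦ)) (fun k => by
          rw [add_apply, pairL_toJet, pairL_toJet,
            (adm_sn hab k).second i Φ hΦ h0]; ring) (by
          rw [add_apply, pairL_toJet, pairL_toJet, hU.second i Φ hΦ h0]; ring)
      rw [add_apply, pairL_apply, pairL_apply] at this
      linarith
  -- Orthogonality to the sine jets kills all Fourier coefficients of the zeroth component, by
  -- `Adm.pairing_sn`.
  have hnone : (w none : Pt n → ℝ) =ᵐ[volume.restrict (box a b)] 0 := by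
    refine ae_eq_zero_of_forall_sn hab (Lp.memLp _) fun k => ?_
    have horth : inner ℝ (toJet (smoothJet (sn a b k)) (hJ k)) w = 0 := by
      have : w ∈ Sᗮ := S.sub_starProjection_mem_orthogonal e
      exact (Submodule.mem_orthogonal _ _).1 this _
        (Submodule.le_topologicalClosure _ (Submodule.subset_span ⟨k, rfl⟩))
    choose c hc1 hc0 hc using fun ι => hw.pairing_sn hab k ι
    rw [inner_toJet] at horth
    simp_rw [pairL_apply, hc] at horth
    rw [← Finset.sum_mul] at horth
    have : 1 ≤ ∑ ι, c ι := by
      rw [← hc1 none rfl]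
      exact Finset.single_le_sum (fun ι _ => hc0 ι) (Finset.mem_univ none)
    exact (mul_eq_zero.1 horth).resolve_left (by linarith)
  have hw0 : w = 0 := by
    ext1 ι
    exact (Lp.eq_zero_iff_ae_eq_zero).2 (hw.ae_eq_zero hnone ι)
  have heS : e ∈ S := by
    have : e = S.starProjection e := by rw [← sub_eq_zero]; exact hw0
    rw [this]; exact hPS
  have := hker (∑ ι, pairL ι (f ι) (hf ι)) (fun k => by
    rw [sum_apply, ← h k]
    exact Finset.sum_congr rfl fun ι _ => pairL_toJet _ _ _ _ _) e heS
  rw [sum_apply] at this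
  rw [← this]
  exact Finset.sum_congr rfl fun ι _ => (pairL_toJet _ _ _ _ _).symm

end Jets


/-! ### Weighted energy identities for jets with weak boundary conditions. -/

section Energy

variable {n : ℕ} {a b : Fin n → ℝ}

theorem sum_integral_ite {V : JIdx n → Pt n → ℝ} (hV : ∀ ι, MemLp (V ι) 2 (volume.restrict (box a b)))
    (ι₁ ι₂ ι₃ : JIdx n) {f₁ f₂ f₃ : Pt n → ℝ} (h₁ : MemLp f₁ 2 (volume.restrict (box a b)))
    (h₂ : MemLp f₂ 2 (volume.restrict (box a b))) (h₃ : MemLp f₃ 2 (volume.restrict (box a b))) :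
    ∑ ι, ∫ x in box a b, V ι x * ((if ι = ι₁ then f₁ x else 0) + (if ι = ι₂ then f₂ x else 0) +
      (if ι = ι₃ then f₃ x else 0)) = (∫ x in box a b, V ι₁ x * f₁ x) +
      (∫ x in box a b, V ι₂ x * f₂ x) + ∫ x in box a b, V ι₃ x * f₃ x := by
  have key : ∀ (ι κ : JIdx n) (f : Pt n → ℝ), MemLp f 2 (volume.restrict (box a b)) →
      Integrable (fun x => V ι x * (if ι = κ then f x else 0)) (volume.restrict (box a b)) ∧
      ∫ x in box a b, V ι x * (if ι = κ then f x else 0) =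
        if ι = κ then ∫ x in box a b, V ι x * f x else 0 := by
    intro ι κ f hf
    by_cases h : ι = κ
    · simp only [h, if_true, and_true]; exact integrable_mul_of_memLp (hV κ) hf
    · simp [h]
  have : ∀ ι, ∫ x in box a b, V ι x * ((if ι = ι₁ then f₁ x else 0) + (if ι = ι₂ then f₂ x else 0) +
      (if ι = ι₃ then f₃ x else 0)) = (if ι = ι₁ then ∫ x in box a b, V ι x * f₁ x else 0) +
      (if ι = ι₂ then ∫ x in box a b, V ι x * f₂ x else 0) +
      (if ι = ι₃ then ∫ x in box a b, V ι x * f₃ x else 0) := by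
    intro ι
    have h12 := (key ι ι₁ f₁ h₁).1.add (key ι ι₂ f₂ h₂).1
    rw [← (key ι ι₁ f₁ h₁).2, ← (key ι ι₂ f₂ h₂).2, ← (key ι ι₃ f₃ h₃).2,
      ← integral_add (key ι ι₁ f₁ h₁).1 (key ι ι₂ f₂ h₂).1]
    refine Eq.trans ?_ (integral_add h12 (key ι ι₃ f₃ h₃).1)
    congr 1; ext x; ring
  simp_rw [this, Finset.sum_add_distrib, Finset.sum_ite_eq', Finset.mem_univ, if_true]

/-- The case of `Adm.sum_integral_eq_zero` needed here. The functional is written with indicators so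
that the three indices may coincide. -/
theorem Adm.three_term (hab : ∀ l, a l < b l) {U : JIdx n → Pt n → ℝ} (hU : Adm a b U)
    (ι₁ ι₂ ι₃ : JIdx n) {f₁ f₂ f₃ : Pt n → ℝ} (h₁ : MemLp f₁ 2 (volume.restrict (box a b)))
    (h₂ : MemLp f₂ 2 (volume.restrict (box a b))) (h₃ : MemLp f₃ 2 (volume.restrict (box a b)))
    (h : ∀ k, (∫ x in box a b, smoothJet (sn a b k) ι₁ x * f₁ x) +
      (∫ x in box a b, smoothJet (sn a b k) ι₂ x * f₂ x) +
      ∫ x in box a b, smoothJet (sn a b k) ι₃ x * f₃ x = 0) :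
    (∫ x in box a b, U ι₁ x * f₁ x) + (∫ x in box a b, U ι₂ x * f₂ x) +
      ∫ x in box a b, U ι₃ x * f₃ x = 0 := by
  rw [← sum_integral_ite hU.mem ι₁ ι₂ ι₃ h₁ h₂ h₃]
  refine hU.sum_integral_eq_zero hab _ (fun ι => ?_) fun k => ?_
  · have key : ∀ (κ : JIdx n) (f : Pt n → ℝ), MemLp f 2 (volume.restrict (box a b)) →
        MemLp (fun x => if ι = κ then f x else 0) 2 (volume.restrict (box a b)) := by
      intro κ f hf
      by_cases h : ι = κ <;> simp [h, hf]
    exact ((key _ _ h₁).add (key _ _ h₂)).add (key _ _ h₃)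
  · rw [sum_integral_ite (adm_sn hab k).mem ι₁ ι₂ ι₃ h₁ h₂ h₃]; exact h k

variable [NeZero n]

/-- Weighted integral of the product of two functions. -/
noncomputable def wint (a b : Fin n → ℝ) (u v : Pt n → ℝ) (θ : ℝ → ℝ) : ℝ :=
  ∫ x in box a b, u x * v x * θ (x 0)

theorem wint_comm (u v : Pt n → ℝ) (θ : ℝ → ℝ) : wint a b u v θ = wint a b v u θ := by
  unfold wint; congr 1; ext x; ring

theorem continuous_coord {θ : ℝ → ℝ} (hθ : Continuous θ) : Continuous fun x : Pt n => θ (x 0) :=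
  hθ.comp (by fun_prop)

theorem memLp_mul_coord {u : Pt n → ℝ} (hu : MemLp u 2 (volume.restrict (box a b))) {θ : ℝ → ℝ}
    (hθ : Continuous θ) : MemLp (fun x => u x * θ (x 0)) 2 (volume.restrict (box a b)) := by
  simpa only [mul_comm] using
    memLp_smooth_mul (isOpen_box a b) (isBounded_box a b) hu (continuous_coord hθ)

theorem pderiv_mul_coord {p : Pt n → ℝ} (hp : ContDiff ℝ ∞ p) {θ : ℝ → ℝ} (hθ : ContDiff ℝ ∞ θ)
    (i : Fin n) : pderiv i (fun x => p x * θ (x 0)) =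
      fun x => pderiv i p x * θ (x 0) + p x * (if 0 = i then deriv θ (x 0) else 0) := by
  ext x
  rw [pderiv_mul hp (contDiff_coord hθ 0), pderiv_coord hθ]

theorem contDiff_deriv_of {θ : ℝ → ℝ} (hθ : ContDiff ℝ ∞ θ) : ContDiff ℝ ∞ (deriv θ) :=
  ((contDiff_infty_iff_deriv).1 hθ).2

theorem integrable_wint {u v : Pt n → ℝ} (hu : MemLp u 2 (volume.restrict (box a b)))
    (hv : MemLp v 2 (volume.restrict (box a b))) {θ : ℝ → ℝ} (hθ : Continuous θ) :
    Integrable (fun x => u x * v x * θ (x 0)) (volume.restrict (box a b)) := by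
  simpa only [mul_assoc] using integrable_mul_of_memLp hu (memLp_mul_coord hv hθ)

/-- Only the second factor is replaced by sines; the first one stays the given jet. Each quadratic
identity thus reduces to the conditions of `Adm` with a smooth test function, and no product of two
nonsmooth functions is integrated by parts. -/
theorem Adm.wint_three_term (hab : ∀ l, a l < b l) {U : JIdx n → Pt n → ℝ} (hU : Adm a b U)
    (ι₁ ι₂ ι₃ κ₁ κ₂ κ₃ : JIdx n) {θ₁ θ₂ θ₃ : ℝ → ℝ} (h₁ : Continuous θ₁) (h₂ : Continuous θ₂)
    (h₃ : Continuous θ₃)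
    (h : ∀ k, wint a b (U κ₁) (smoothJet (sn a b k) ι₁) θ₁ +
      wint a b (U κ₂) (smoothJet (sn a b k) ι₂) θ₂ + wint a b (U κ₃) (smoothJet (sn a b k) ι₃) θ₃ = 0) :
    wint a b (U κ₁) (U ι₁) θ₁ + wint a b (U κ₂) (U ι₂) θ₂ + wint a b (U κ₃) (U ι₃) θ₃ = 0 := by
  have e : ∀ (u v : Pt n → ℝ) (θ : ℝ → ℝ), wint a b u v θ = ∫ x in box a b, v x * (u x * θ (x 0)) := by
    intro u v θ; unfold wint; congr 1; ext x; ring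
  simp only [e] at h ⊢
  exact hU.three_term hab ι₁ ι₂ ι₃ (memLp_mul_coord (hU.mem _) h₁) (memLp_mul_coord (hU.mem _) h₂)
    (memLp_mul_coord (hU.mem _) h₃) h

theorem integral_mul_pderiv_mul_coord {u G : Pt n → ℝ} (hu : MemLp u 2 (volume.restrict (box a b)))
    (hG : ContDiff ℝ ∞ G) {θ : ℝ → ℝ} (hθ : ContDiff ℝ ∞ θ) (i : Fin n) :
    ∫ x in box a b, u x * pderiv i (fun x => G x * θ (x 0)) x =
      wint a b u (pderiv i G) θ + if 0 = i then wint a b u G (deriv θ) else 0 := by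
  have hG' := memLp_of_contDiff (a := a) (b := b) hG
  have hGi := memLp_of_contDiff (a := a) (b := b) (contDiff_pderiv hG i)
  rw [pderiv_mul_coord hG hθ]
  by_cases hi : 0 = i
  · simp only [hi, if_true]
    unfold wint
    rw [← integral_add]
    · subst hi; congr 1; ext x; ring
    · exact integrable_wint hu hGi hθ.continuous
    · exact integrable_wint hu hG' (contDiff_deriv_of hθ).continuous
  · simp only [hi, if_false, mul_zero, add_zero]
    unfold wint; congr 1; ext x; ring

theorem integral_mul_mul_coord (u G : Pt n → ℝ) (θ : ℝ → ℝ) :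
    ∫ x in box a b, u x * (G x * θ (x 0)) = wint a b u G θ := by
  unfold wint; congr 1; ext x; ring

theorem Adm.wint_first {U : JIdx n → Pt n → ℝ} (hU : Adm a b U) {G : Pt n → ℝ} (hG : ContDiff ℝ ∞ G)
    {θ : ℝ → ℝ} (hθ : ContDiff ℝ ∞ θ) (i : Fin n) :
    wint a b (U none) (pderiv i G) θ + (if 0 = i then wint a b (U none) G (deriv θ) else 0) +
      wint a b (U (some (.inl i))) G θ = 0 := by
  have := hU.first i _ (hG.mul (contDiff_coord hθ 0))
  rw [integral_mul_mul_coord] at this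
  have h2 := integral_mul_pderiv_mul_coord (hU.mem none) hG hθ i
  have h3 : ∫ x in box a b, U none x * pderiv i (fun x => G x * θ (x 0)) x =
    - wint a b (U (some (.inl i))) G θ := this
  linarith

theorem Adm.wint_second {U : JIdx n → Pt n → ℝ} (hU : Adm a b U) {G : Pt n → ℝ} (hG : ContDiff ℝ ∞ G)
    {θ : ℝ → ℝ} (hθ : ContDiff ℝ ∞ θ) (i : Fin n) (h0 : ∀ x : Pt n, (x i = a i ∨ x i = b i) → G x = 0) :
    wint a b (U (some (.inl i))) (pderiv i G) θ +
      (if 0 = i then wint a b (U (some (.inl i))) G (deriv θ) else 0) +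
      wint a b (U (some (.inr (i, i)))) G θ = 0 := by
  have := hU.second i _ (hG.mul (contDiff_coord hθ 0)) fun x hx => by simp [h0 x hx]
  rw [integral_mul_mul_coord] at this
  have h2 := integral_mul_pderiv_mul_coord (hU.mem (some (.inl i))) hG hθ i
  have h3 : ∫ x in box a b, U (some (.inl i)) x * pderiv i (fun x => G x * θ (x 0)) x =
    - wint a b (U (some (.inr (i, i)))) G θ := this
  linarith

theorem Adm.wint_mixed {U : JIdx n → Pt n → ℝ} (hU : Adm a b U) {G : Pt n → ℝ} (hG : ContDiff ℝ ∞ G)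
    {θ : ℝ → ℝ} (hθ : ContDiff ℝ ∞ θ) {i j : Fin n} (hij : i ≠ j) :
    wint a b (U (some (.inl i))) (pderiv j G) θ +
      (if 0 = j then wint a b (U (some (.inl i))) G (deriv θ) else 0) +
      wint a b (U (some (.inr (i, j)))) G θ = 0 := by
  have hs : ContDiff ℝ ∞ (fun x => G x * θ (x 0)) := hG.mul (contDiff_coord hθ 0)
  have h1 := hU.mixed i j hij _ hs
  have h2 := hU.first i _ (contDiff_pderiv hs j)
  have h3 := integral_mul_pderiv_mul_coord (hU.mem (some (.inl i))) hG hθ j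
  rw [integral_mul_mul_coord] at h1
  linarith

omit [NeZero n] in
-- Both mixed components are tested against the same smooth second derivative.
theorem Adm.mixed_symm {U : JIdx n → Pt n → ℝ} (hU : Adm a b U) {i j : Fin n} (hij : i ≠ j) :
    U (some (.inr (i, j))) =ᵐ[volume.restrict (box a b)] U (some (.inr (j, i))) := by
  refine ae_eq_of_forall_test (isOpen_box a b) (hU.mem _) (hU.mem _) fun φ hφ => ?_
  rw [← hU.mixed i j hij φ hφ.smooth, ← hU.mixed j i hij.symm φ hφ.smooth, pderiv_comm hφ.smooth i j]

theorem wint_congr_left {u v w : Pt n → ℝ} (h : u =ᵐ[volume.restrict (box a b)] v) (θ : ℝ → ℝ) :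
    wint a b u w θ = wint a b v w θ := by
  apply integral_congr_ae
  filter_upwards [h] with x hx
  rw [hx]

variable (hab : ∀ l, a l < b l)
include hab

theorem Adm.wint_first_zero {U : JIdx n → Pt n → ℝ} (hU : Adm a b U)
    {θ : ℝ → ℝ} (hθ : ContDiff ℝ ∞ θ) :
    2 * wint a b (U (some (.inl 0))) (U none) θ = -wint a b (U none) (U none) (deriv θ) := by
  have := hU.wint_three_term hab (some (.inl 0)) none none none none (some (.inl 0)) hθ.continuous
    (contDiff_deriv_of hθ).continuous hθ.continuous fun k => by
      have := hU.wint_first (contDiff_sn (a := a) (b := b) k) hθ 0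
      simpa [smoothJet] using this
  rw [wint_comm (U none) (U (some (.inl 0)))] at this
  linarith

theorem Adm.wint_second_none {U : JIdx n → Pt n → ℝ} (hU : Adm a b U)
    {θ : ℝ → ℝ} (hθ : ContDiff ℝ ∞ θ) (i : Fin n) :
    wint a b (U (some (.inr (i, i)))) (U none) θ = -wint a b (U (some (.inl i))) (U (some (.inl i))) θ -
      if 0 = i then wint a b (U (some (.inl i))) (U none) (deriv θ) else 0 := by
  by_cases hi : 0 = i
  · simp only [hi, if_true]
    have := hU.wint_three_term hab (some (.inl i)) none none (some (.inl i)) (some (.inl i))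
      (some (.inr (i, i))) hθ.continuous
      (contDiff_deriv_of hθ).continuous hθ.continuous fun k => by
        have := hU.wint_second (contDiff_sn (a := a) (b := b) k) hθ i fun x hx => sn_eq_zero hab k hx
        simpa [hi, smoothJet] using this
    linarith
  · simp only [hi, if_false]
    have := hU.wint_three_term hab (some (.inl i)) none none (some (.inl i)) (some (.inl i))
      (some (.inr (i, i))) hθ.continuous
      (θ₂ := 0) continuous_const hθ.continuous fun k => by
        have := hU.wint_second (contDiff_sn (a := a) (b := b) k) hθ i fun x hx => sn_eq_zero hab k hx
        simpa [hi, wint, smoothJet] using this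
    have e : wint a b (U (some (.inl i))) (U none) 0 = 0 := by simp [wint]
    linarith

/-- Formally, ∂_j is moved away from ∂_j²u, which leaves −∂_j u ∂_0∂_j u = −∂_0(∂_j u)²/2, and then
∂_0 is moved to the weight. There is no boundary term because ∂_0 u is tangential on the j-faces and
∂_j u on the 0-faces. -/
theorem Adm.wint_second_first {U : JIdx n → Pt n → ℝ} (hU : Adm a b U)
    {θ : ℝ → ℝ} (hθ : ContDiff ℝ ∞ θ) {j : Fin n} (hj : 0 ≠ j) :
    2 * wint a b (U (some (.inr (j, j)))) (U (some (.inl 0))) θ =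
      wint a b (U (some (.inl j))) (U (some (.inl j))) (deriv θ) := by
  have hneg : ∀ u v : Pt n → ℝ, wint a b u v (fun t => -deriv θ t) = -wint a b u v (deriv θ) := by
    intro u v; unfold wint; rw [← integral_neg]; congr 1; ext x; ring
  have := hU.wint_three_term hab (some (.inr (j, j))) (some (.inl 0)) (some (.inl j))
    (some (.inl 0)) (some (.inr (j, j))) (some (.inl j)) hθ.continuous hθ.continuous
    (θ₃ := fun t => -deriv θ t) (contDiff_deriv_of hθ).continuous.neg fun k => by
      have hs := contDiff_sn (a := a) (b := b) k
      have h1 := hU.wint_second (contDiff_pderiv hs 0) hθ j fun x hx => pderiv_sn_eq_zero hab k hj hx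
      have h2 := hU.wint_mixed (contDiff_pderiv hs j) hθ hj.symm
      have h3 := hU.wint_mixed (contDiff_pderiv hs j) hθ hj
      rw [wint_congr_left (hU.mixed_symm hj)] at h3
      rw [pderiv_comm hs j 0] at h1
      simp only [hj, if_false, if_true] at h1 h2 h3
      rw [hneg]
      simp only [smoothJet]
      linarith
  rw [hneg, wint_comm (U (some (.inl 0)))] at this
  linarith

/-- Two integrations by parts exchange the derivatives. With zero Dirichlet data on flat faces no
boundary term arises, and the weight is differentiated only when `i` is the direction on which it
depends. -/
theorem Adm.wint_second_second {U : JIdx n → Pt n → ℝ} (hU : Adm a b U)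
    {θ : ℝ → ℝ} (hθ : ContDiff ℝ ∞ θ) {i j : Fin n} (hij : i ≠ j) (hj : 0 ≠ j) :
    wint a b (U (some (.inr (i, i)))) (U (some (.inr (j, j)))) θ =
      wint a b (U (some (.inr (i, j)))) (U (some (.inr (i, j)))) θ +
      if 0 = i then wint a b (U (some (.inr (i, j)))) (U (some (.inl j))) (deriv θ) else 0 := by
  have hneg : ∀ (u v : Pt n → ℝ) (θ : ℝ → ℝ), wint a b u v (fun t => -θ t) = -wint a b u v θ := by
    intro u v θ; unfold wint; rw [← integral_neg]; congr 1; ext x; ring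
  have hθ' := contDiff_deriv_of hθ
  set η : ℝ → ℝ := fun t => if 0 = i then -deriv θ t else 0 with hη
  have hηc : Continuous η := by
    by_cases hi : 0 = i
    · simp only [hη, hi, if_true]; exact hθ'.continuous.neg
    · simp only [hη, hi, if_false]; exact continuous_const
  have hηw : ∀ u v : Pt n → ℝ, wint a b u v η = -if 0 = i then wint a b u v (deriv θ) else 0 := by
    intro u v
    by_cases hi : 0 = i
    · simp only [hη, hi, if_true]; subst hi; exact hneg u v _
    · simp [hη, hi, wint]
  have := hU.wint_three_term hab (some (.inr (j, j))) (some (.inr (i, j))) (some (.inl j))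
    (some (.inr (i, i))) (some (.inr (i, j))) (some (.inr (i, j))) hθ.continuous
    (θ₂ := fun t => -θ t) hθ.continuous.neg hηc fun k => by
      have hs := contDiff_sn (a := a) (b := b) k
      have h1 := hU.wint_second (contDiff_pderiv (contDiff_pderiv hs j) j) hθ i fun x hx => by
        rw [pderiv_pderiv_sn]; simp [sn_eq_zero hab k hx]
      have h2 := hU.wint_mixed (contDiff_pderiv (contDiff_pderiv hs j) i) hθ hij
      have h3 := hU.wint_mixed (contDiff_pderiv hs j) hθ' hij
      rw [pderiv_comm (contDiff_pderiv hs j) i j] at h1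
      rw [hneg, hηw]
      simp only [smoothJet]
      rw [pderiv_comm hs j i]
      simp only [hj, if_false] at h1 h2 h3
      by_cases hi : 0 = i
      · simp only [hi, if_true] at h1 ⊢; linarith
      · simp only [hi, if_false] at h1 ⊢; linarith
  rw [hneg, hηw] at this
  linarith

omit hab in
/-- Jets whose normal derivative vanishes on the face `x₀ = b₀`. -/
structure AdmN (a b : Fin n → ℝ) (U : JIdx n → Pt n → ℝ) : Prop extends Adm a b U where
  normal : ∀ Φ : Pt n → ℝ, ContDiff ℝ ∞ Φ → (∃ η > 0, ∀ x : Pt n, x 0 < a 0 + η → Φ x = 0) →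
    ∫ x in box a b, U (some (.inl 0)) x * pderiv 0 Φ x =
      -∫ x in box a b, U (some (.inr (0, 0))) x * Φ x

theorem AdmN.wint_second_first_eq {U : JIdx n → Pt n → ℝ} (hU : AdmN a b U)
    {θ : ℝ → ℝ} (hθ : ContDiff ℝ ∞ θ) (h0 : ∃ η > 0, ∀ t, t < a 0 + η → θ t = 0) :
    2 * wint a b (U (some (.inr (0, 0)))) (U (some (.inl 0))) θ =
      -wint a b (U (some (.inl 0))) (U (some (.inl 0))) (deriv θ) := by
  have hθ' := contDiff_deriv_of hθ
  have := hU.wint_three_term hab (some (.inr (0, 0))) (some (.inl 0)) (some (.inl 0))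
    (some (.inl 0)) (some (.inl 0)) (some (.inr (0, 0))) hθ.continuous hθ'.continuous
    hθ.continuous fun k => by
      have hs := contDiff_sn (a := a) (b := b) k
      have hs0 := contDiff_pderiv hs 0
      -- The factor ∂_0 of the sine does not vanish on the 0-faces, so `second` is not available.
      -- The condition at x₀ = b₀ is supplied by `normal`, and the weight removes the other face.
      have h1 := hU.normal _ (hs0.mul (contDiff_coord hθ 0)) (by
        obtain ⟨η, hη, h⟩ := h0
        exact ⟨η, hη, fun x hx => by simp [h _ hx]⟩)
      have h2 := integral_mul_pderiv_mul_coord (hU.mem (some (.inl 0))) hs0 hθ 0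
      have h3 : ∫ x in box a b, U (some (.inl 0)) x *
          pderiv 0 (fun x => pderiv 0 (sn a b k) x * θ (x 0)) x =
          -∫ x in box a b, U (some (.inr (0, 0))) x * (pderiv 0 (sn a b k) x * θ (x 0)) := h1
      rw [integral_mul_mul_coord] at h3
      simp only [if_true] at h2
      simp only [smoothJet]
      linarith
  rw [wint_comm (U (some (.inl 0))) (U (some (.inr (0, 0))))] at this
  linarith

/-- At x₀ = a₀ no Neumann condition is known, but the boundary term there is −θ(∂_0 u)², which has a
favourable sign. To avoid traces, θ is multiplied by an increasing cutoff away from that face: the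
extra term in the derivative is nonnegative and is dropped before passing to the limit. -/
theorem AdmN.wint_second_first_le {U : JIdx n → Pt n → ℝ} (hU : AdmN a b U)
    {θ : ℝ → ℝ} (hθ : ContDiff ℝ ∞ θ) (h0 : ∀ t, a 0 < t → 0 ≤ θ t) :
    2 * wint a b (U (some (.inr (0, 0)))) (U (some (.inl 0))) θ ≤
      -wint a b (U (some (.inl 0))) (U (some (.inl 0))) (deriv θ) := by
  set χ : ℕ → ℝ → ℝ := fun m t => Real.smoothTransition ((t - a 0) / wid m - 1) with hχ
  have hχs : ∀ m, ContDiff ℝ ∞ (χ m) := fun m => by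
    apply Real.smoothTransition.contDiff.comp; fun_prop
  have hχ1 : ∀ t, a 0 < t → ∀ᶠ m in Filter.atTop, χ m t = 1 := by
    intro t ht
    filter_upwards [eventually_wid_lt (show 0 < (t - a 0) / 2 by linarith)] with m hm
    apply Real.smoothTransition.one_of_one_le
    have := wid_pos m
    rw [le_sub_iff_add_le, le_div_iff₀ this]; linarith
  have hχ0 : ∀ m t, t < a 0 + wid m → χ m t = 0 := by
    intro m t ht
    apply Real.smoothTransition.zero_of_nonpos
    have := wid_pos m
    rw [sub_nonpos, div_le_one this]; linarith
  have hmono : ∀ m t, 0 ≤ deriv (χ m) t := by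
    intro m t
    apply Monotone.deriv_nonneg
    intro s t hst
    apply Real.smoothTransition.monotone
    have := wid_pos m
    gcongr
  have hlim : ∀ (u v : Pt n → ℝ) (τ : ℝ → ℝ), MemLp u 2 (volume.restrict (box a b)) →
      MemLp v 2 (volume.restrict (box a b)) → Continuous τ →
      Filter.Tendsto (fun m => wint a b u v (fun t => τ t * χ m t)) Filter.atTop
        (nhds (wint a b u v τ)) := by
    intro u v τ hu hv hτ
    have := tendsto_integral_mul_cut (integrable_wint hu hv hτ) (χ := fun m x => χ m (x 0)) (C := 1)
      (fun m => continuous_coord (hχs m).continuous) (fun m x => by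
        rw [abs_of_nonneg (Real.smoothTransition.nonneg _)]; exact Real.smoothTransition.le_one _)
      (r := 1) (fun x hx => hχ1 _ (hx 0).1)
    simp only [one_mul] at this
    refine this.congr fun m => ?_
    unfold wint; congr 1; ext x; ring
  have hθ' := contDiff_deriv_of hθ
  refine le_of_tendsto_of_tendsto ((hlim _ _ θ (hU.mem _) (hU.mem _) hθ.continuous).const_mul 2)
    ((hlim _ _ _ (hU.mem (some (.inl 0))) (hU.mem (some (.inl 0))) hθ'.continuous).neg)
    (Filter.Eventually.of_forall fun m => ?_)
  change 2 * wint a b _ _ (fun t => θ t * χ m t) ≤ -wint a b _ _ (fun t => deriv θ t * χ m t)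
  have e := hU.wint_second_first_eq hab (hθ.mul (hχs m)) ⟨wid m, wid_pos m, fun t ht => by
    simp [hχ0 m t ht]⟩
  have e' : 2 * wint a b (U (some (.inr (0, 0)))) (U (some (.inl 0))) (fun t => θ t * χ m t) =
      -wint a b (U (some (.inl 0))) (U (some (.inl 0))) (deriv fun t => θ t * χ m t) := e
  rw [e', neg_le_neg_iff]
  have hd : deriv (fun t => θ t * χ m t) = fun t => deriv θ t * χ m t + θ t * deriv (χ m) t := by
    ext t
    exact deriv_fun_mul ((hθ.differentiable (by simp)) t) (((hχs m).differentiable (by simp)) t)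
  unfold wint
  refine setIntegral_mono_on ?_ ?_ (measurableSet_box a b) fun x hx => ?_
  · exact integrable_wint (hU.mem _) (hU.mem _) (hθ'.continuous.mul (hχs m).continuous)
  · exact integrable_wint (hU.mem _) (hU.mem _) (contDiff_deriv_of (hθ.mul (hχs m))).continuous
  · rw [hd]
    have h1 := h0 _ (hx 0).1
    have h2 := hmono m (x 0)
    have h3 := mul_self_nonneg (U (some (.inl 0)) x)
    nlinarith [mul_nonneg h3 (mul_nonneg h1 h2)]

end Energy


/-! ### The Carleman estimate for the Laplacian. -/

section Carleman

/-- The Carleman weight multiplied by a power. -/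
noncomputable def mon (lam : ℝ) (m : ℕ) (t : ℝ) : ℝ := t ^ m * Real.exp (2 * lam * t ^ 2)

theorem contDiff_mon (lam : ℝ) (m : ℕ) : ContDiff ℝ ∞ (mon lam m) := by
  unfold mon; fun_prop

theorem deriv_mon_zero (lam : ℝ) : deriv (mon lam 0) = fun t => 4 * lam * mon lam 1 t := by
  ext t
  have h : HasDerivAt (mon lam 0) (0 * Real.exp (2 * lam * t ^ 2) +
      1 * (Real.exp (2 * lam * t ^ 2) * (2 * lam * (2 * t)))) t := by
    have := ((hasDerivAt_const t (1 : ℝ))).mul (((hasDerivAt_pow 2 t).const_mul (2 * lam)).exp)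
    refine (this.congr_deriv ?_).congr_of_eventuallyEq ?_
    · simp
    · filter_upwards with s; simp [mon]
  rw [h.deriv]; simp [mon]; ring

theorem deriv_mon_succ (lam : ℝ) (m : ℕ) : deriv (mon lam (m + 1)) =
    fun t => (m + 1) * mon lam m t + 4 * lam * mon lam (m + 2) t := by
  ext t
  have h : HasDerivAt (mon lam (m + 1)) (((m + 1 : ℕ) * t ^ m) * Real.exp (2 * lam * t ^ 2) +
      t ^ (m + 1) * (Real.exp (2 * lam * t ^ 2) * (2 * lam * (2 * t)))) t := by
    have := ((hasDerivAt_pow (m + 1) t)).mul (((hasDerivAt_pow 2 t).const_mul (2 * lam)).exp)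
    refine this.congr_deriv ?_
    simp
  rw [h.deriv]; simp [mon]; ring

theorem mon_nonneg (lam : ℝ) (m : ℕ) {t : ℝ} (ht : 0 ≤ t) : 0 ≤ mon lam m t := by
  unfold mon; positivity

variable {n : ℕ} {a b : Fin n → ℝ} [NeZero n]

theorem wint_comb {u v : Pt n → ℝ} (hu : MemLp u 2 (volume.restrict (box a b)))
    (hv : MemLp v 2 (volume.restrict (box a b))) {θ η : ℝ → ℝ} (hθ : Continuous θ) (hη : Continuous η)
    (r s : ℝ) : wint a b u v (fun t => r * θ t + s * η t) = r * wint a b u v θ + s * wint a b u v η := by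
  unfold wint
  rw [← integral_const_mul, ← integral_const_mul, ← integral_add]
  · congr 1; ext x; ring
  · exact (integrable_wint hu hv hθ).const_mul r
  · exact (integrable_wint hu hv hη).const_mul s

theorem wint_const_mul (u v : Pt n → ℝ) (θ : ℝ → ℝ) (r : ℝ) :
    wint a b u v (fun t => r * θ t) = r * wint a b u v θ := by
  unfold wint
  rw [← integral_const_mul]
  congr 1; ext x; ring

theorem wint_sum_left {ι : Type*} (s : Finset ι) {u : ι → Pt n → ℝ} {v : Pt n → ℝ}
    (hu : ∀ i, MemLp (u i) 2 (volume.restrict (box a b)))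
    (hv : MemLp v 2 (volume.restrict (box a b))) {θ : ℝ → ℝ} (hθ : Continuous θ) :
    wint a b (fun x => ∑ i ∈ s, u i x) v θ = ∑ i ∈ s, wint a b (u i) v θ := by
  unfold wint
  rw [← integral_finsetSum _ fun i _ => integrable_wint (hu i) hv hθ]
  congr 1; ext x; rw [Finset.sum_mul, Finset.sum_mul]

theorem wint_self_nonneg (u : Pt n → ℝ) {θ : ℝ → ℝ} (h : ∀ x ∈ box a b, 0 ≤ θ (x 0)) :
    0 ≤ wint a b u u θ :=
  setIntegral_nonneg (measurableSet_box a b) fun x hx => mul_nonneg (mul_self_nonneg _) (h x hx)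

theorem wint_self_mono {u : Pt n → ℝ} (hu : MemLp u 2 (volume.restrict (box a b))) {θ η : ℝ → ℝ}
    (hθ : Continuous θ) (hη : Continuous η) (h : ∀ x ∈ box a b, θ (x 0) ≤ η (x 0)) :
    wint a b u u θ ≤ wint a b u u η :=
  setIntegral_mono_on (integrable_wint hu hu hθ) (integrable_wint hu hu hη) (measurableSet_box a b)
    fun x hx => mul_le_mul_of_nonneg_left (h x hx) (mul_self_nonneg _)

/-- Turns the expansion of a sum of squares, checked pointwise by algebra, into an inequality
between weighted integrals. -/
theorem wint_sum_nonneg {m : ℕ} (c : Fin m → ℝ) (u v : Fin m → Pt n → ℝ) (θ : Fin m → ℝ → ℝ)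
    (hu : ∀ r, MemLp (u r) 2 (volume.restrict (box a b)))
    (hv : ∀ r, MemLp (v r) 2 (volume.restrict (box a b))) (hθ : ∀ r, Continuous (θ r))
    (h : ∀ x ∈ box a b, 0 ≤ ∑ r, c r * (u r x * v r x * θ r (x 0))) :
    0 ≤ ∑ r, c r * wint a b (u r) (v r) (θ r) := by
  have : ∑ r, c r * wint a b (u r) (v r) (θ r) =
      ∫ x in box a b, ∑ r, c r * (u r x * v r x * θ r (x 0)) := by
    rw [integral_finsetSum _ fun r _ => (integrable_wint (hu r) (hv r) (hθ r)).const_mul (c r)]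
    simp_rw [integral_const_mul]; rfl
  rw [this]
  exact setIntegral_nonneg (measurableSet_box a b) h

theorem wint_young {u v : Pt n → ℝ} (hu : MemLp u 2 (volume.restrict (box a b)))
    (hv : MemLp v 2 (volume.restrict (box a b))) (lam r : ℝ) (m : ℕ) :
    0 ≤ wint a b u u (mon lam 0) + 2 * r * wint a b u v (mon lam m) +
      r ^ 2 * wint a b v v (mon lam (m + m)) := by
  have hc : ∀ m, Continuous (mon lam m) := fun m => (contDiff_mon lam m).continuous
  have := wint_sum_nonneg (a := a) (b := b) ![1, 2 * r, r ^ 2] ![u, u, v] ![u, v, v]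
    ![mon lam 0, mon lam m, mon lam (m + m)]
    (by intro r; fin_cases r <;> assumption) (by intro r; fin_cases r <;> assumption)
    (by intro r; fin_cases r <;> exact hc _) (fun x _ => by
      simp only [Fin.sum_univ_three, Matrix.cons_val, mon]
      have : 0 ≤ (u x + r * (x 0) ^ m * v x) ^ 2 * Real.exp (2 * lam * x 0 ^ 2) := by positivity
      rw [pow_add]
      nlinarith)
  simp only [Fin.sum_univ_three, Matrix.cons_val] at this
  linarith

/-- The weak Laplacian of a jet. -/
def jlap (U : JIdx n → Pt n → ℝ) : Pt n → ℝ := fun x => ∑ j, U (some (.inr (j, j))) x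

omit [NeZero n] in
theorem memLp_jlap {U : JIdx n → Pt n → ℝ} (hU : ∀ ι, MemLp (U ι) 2 (volume.restrict (box a b))) :
    MemLp (jlap U) 2 (volume.restrict (box a b)) :=
  memLp_finsetSum _ fun _ _ => hU _

/-- Put v = e^{lam x₀²}u. Conjugation turns Δ into S + A with S = Δ + 4 lam² x₀² symmetric and A =
−4 lam x₀ ∂_0 − 2 lam antisymmetric. Expressed in u, A is −P with P = 4 lam x₀ ∂_0 u + (8 lam² x₀² +
2 lam)u. Discarding S² + A², that is (Δu + P)² + P², leaves the commutator 8 lam |∂_0 v|² + 32 lam³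
x₀² |v|² and boundary terms of good sign. -/
theorem AdmN.carleman_zero (hab : ∀ l, a l < b l) (ha : 0 ≤ a 0) {lam : ℝ} (hl : 0 < lam)
    {U : JIdx n → Pt n → ℝ} (hU : AdmN a b U) :
    32 * lam ^ 3 * wint a b (U none) (U none) (mon lam 2) ≤ wint a b (jlap U) (jlap U) (mon lam 0) := by
  have hc : ∀ m, Continuous (mon lam m) := fun m => (contDiff_mon lam m).continuous
  have hm := hU.mem
  have hs := memLp_jlap hm
  have hexp := wint_sum_nonneg (a := a) (b := b)
    ![1, 8 * lam, 16 * lam ^ 2, 4 * lam, 32 * lam ^ 2, 128 * lam ^ 3, 32 * lam ^ 2, 128 * lam ^ 4,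
      64 * lam ^ 3, 8 * lam ^ 2]
    ![jlap U, jlap U, jlap U, jlap U, U (some (.inl 0)), U (some (.inl 0)), U (some (.inl 0)),
      U none, U none, U none]
    ![jlap U, U (some (.inl 0)), U none, U none, U (some (.inl 0)), U none, U none,
      U none, U none, U none]
    ![mon lam 0, mon lam 1, mon lam 2, mon lam 0, mon lam 2, mon lam 3, mon lam 1, mon lam 4,
      mon lam 2, mon lam 0]
    (by intro r; fin_cases r <;> first | exact hs | exact hm _)
    (by intro r; fin_cases r <;> first | exact hs | exact hm _)
    (by intro r; fin_cases r <;> exact hc _) (fun x _ => by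
      simp only [Fin.sum_univ_succ, Fin.sum_univ_zero, Matrix.cons_val_zero, Matrix.cons_val_succ, mon]
      have h1 : 0 ≤ ((jlap U x + (4 * lam * x 0 * U (some (.inl 0)) x +
        (8 * lam ^ 2 * x 0 ^ 2 + 2 * lam) * U none x)) ^ 2 + (4 * lam * x 0 * U (some (.inl 0)) x +
        (8 * lam ^ 2 * x 0 ^ 2 + 2 * lam) * U none x) ^ 2) * Real.exp (2 * lam * x 0 ^ 2) := by positivity
      refine h1.trans_eq ?_
      ring)
  simp only [Fin.sum_univ_succ, Fin.sum_univ_zero, Matrix.cons_val_zero, Matrix.cons_val_succ] at hexp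
  have hD0 : ∀ u v : Pt n → ℝ, MemLp u 2 (volume.restrict (box a b)) →
      MemLp v 2 (volume.restrict (box a b)) →
      wint a b u v (deriv (mon lam 0)) = 4 * lam * wint a b u v (mon lam 1) := by
    intro u v hu hv; rw [deriv_mon_zero, wint_const_mul]
  have hD : ∀ (m : ℕ) (u v : Pt n → ℝ), MemLp u 2 (volume.restrict (box a b)) →
      MemLp v 2 (volume.restrict (box a b)) → wint a b u v (deriv (mon lam (m + 1))) =
        (m + 1) * wint a b u v (mon lam m) + 4 * lam * wint a b u v (mon lam (m + 2)) := by
    intro m u v hu hv; rw [deriv_mon_succ, wint_comb hu hv (hc _) (hc _)]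
  have e1 := hU.wint_first_zero hab (contDiff_mon lam 1)
  have e3 := hU.wint_first_zero hab (contDiff_mon lam 3)
  rw [hD 0 _ _ (hm _) (hm _)] at e1
  rw [hD 2 _ _ (hm _) (hm _)] at e3
  -- With this choice the square is that of ∂_0(e^{lam x₀²}u), the discarded gradient part of the
  -- commutator.
  have hsq := wint_young (a := a) (b := b) (hm (some (.inl 0))) (hm none) lam (2 * lam) 1
  set W0 := wint a b (U none) (U none) (mon lam 0)
  set W2 := wint a b (U none) (U none) (mon lam 2)
  set W4 := wint a b (U none) (U none) (mon lam 4)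
  set X1 := wint a b (U (some (.inl 0))) (U none) (mon lam 1)
  set X3 := wint a b (U (some (.inl 0))) (U none) (mon lam 3)
  set Y0 := wint a b (U (some (.inl 0))) (U (some (.inl 0))) (mon lam 0)
  set Y2 := wint a b (U (some (.inl 0))) (U (some (.inl 0))) (mon lam 2)
  -- The tangential second derivatives commute with the antisymmetric part, so their contributions
  -- cancel exactly. For `j = 0` the estimate is one-sided because of the face x₀ = a₀.
  have hT : ∀ j : Fin n, 8 * lam * wint a b (U (some (.inr (j, j)))) (U (some (.inl 0))) (mon lam 1) +
      16 * lam ^ 2 * wint a b (U (some (.inr (j, j)))) (U none) (mon lam 2) +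
      4 * lam * wint a b (U (some (.inr (j, j)))) (U none) (mon lam 0) ≤
      if 0 = j then -4 * lam * (Y0 + 4 * lam * Y2) - 16 * lam ^ 2 * (Y2 + 2 * X1 + 4 * lam * X3) -
        4 * lam * (Y0 + 4 * lam * X1) else 0 := by
    intro j
    have s0 := hU.wint_second_none hab (contDiff_mon lam 0) j
    have s2 := hU.wint_second_none hab (contDiff_mon lam 2) j
    by_cases hj : 0 = j
    · subst hj
      simp only [if_true] at s0 s2 ⊢
      rw [hD0 _ _ (hm _) (hm _)] at s0
      rw [hD 1 _ _ (hm _) (hm _)] at s2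
      have s1 := hU.wint_second_first_le hab (contDiff_mon lam 1)
        fun t ht => mon_nonneg _ _ (ha.trans ht.le)
      rw [hD 0 _ _ (hm _) (hm _)] at s1
      norm_num at s1 s2
      have := mul_le_mul_of_nonneg_left s1 (show 0 ≤ 4 * lam by positivity)
      rw [s0, s2]
      linarith
    · simp only [hj, if_false] at s0 s2 ⊢
      have s1 := hU.wint_second_first hab (contDiff_mon lam 1) hj
      rw [hD 0 _ _ (hm _) (hm _)] at s1
      norm_num at s1
      have : 8 * lam * wint a b (U (some (.inr (j, j)))) (U (some (.inl 0))) (mon lam 1) =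
        4 * lam * (wint a b (U (some (.inl j))) (U (some (.inl j))) (mon lam 0) +
          4 * lam * wint a b (U (some (.inl j))) (U (some (.inl j))) (mon lam 2)) := by
        rw [← s1]; ring
      rw [this, s0, s2]
      linarith
  have hsum := Finset.sum_le_sum fun j (_ : j ∈ Finset.univ) => hT j
  rw [Finset.sum_ite_eq, if_pos (Finset.mem_univ _), Finset.sum_add_distrib, Finset.sum_add_distrib,
    ← Finset.mul_sum, ← Finset.mul_sum, ← Finset.mul_sum] at hsum
  rw [← wint_sum_left _ (fun j => hm (some (.inr (j, j)))) (hm _) (hc _),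
    ← wint_sum_left _ (fun j => hm (some (.inr (j, j)))) (hm _) (hc _),
    ← wint_sum_left _ (fun j => hm (some (.inr (j, j)))) (hm _) (hc _)] at hsum
  change 8 * lam * wint a b (jlap U) _ _ + 16 * lam ^ 2 * wint a b (jlap U) _ _ +
    4 * lam * wint a b (jlap U) _ _ ≤ _ at hsum
  norm_num at e1 e3 hsq
  have hsq' := mul_le_mul_of_nonneg_left hsq (show 0 ≤ 8 * lam by positivity)
  have e1' : lam ^ 2 * (2 * X1) = lam ^ 2 * -(W0 + 4 * lam * W2) := by rw [e1]; ring
  have e3' : lam ^ 3 * (2 * X3) = lam ^ 3 * -(3 * W2 + 4 * lam * W4) := by rw [e3]; ring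
  nlinarith [hexp, hsum, hsq', e1', e3']

/-- Carleman estimate for the Laplacian with the weight `exp (2 lam x₀²)`. -/
theorem exists_carleman (hab : ∀ l, a l < b l) (ha : 0 < a 0) : ∃ C : ℝ, 0 < C ∧
    ∀ lam : ℝ, 1 ≤ lam → ∀ U : JIdx n → Pt n → ℝ, AdmN a b U →
      lam ^ 3 * wint a b (U none) (U none) (mon lam 0) ≤ C * wint a b (jlap U) (jlap U) (mon lam 0) ∧
      lam * ∑ i, wint a b (U (some (.inl i))) (U (some (.inl i))) (mon lam 0) ≤
        C * wint a b (jlap U) (jlap U) (mon lam 0) ∧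
      ∑ i, ∑ j, wint a b (U (some (.inr (i, j)))) (U (some (.inr (i, j)))) (mon lam 0) ≤
        C * lam * wint a b (jlap U) (jlap U) (mon lam 0) := by
  set A := a 0
  set B := b 0
  have hB : 0 < B := ha.trans (hab 0)
  -- The three constants belong to u, to its gradient and to its second derivatives. This first one
  -- replaces the factor x₀² of `AdmN.carleman_zero` by its lower bound A², the place where `ha` is
  -- essential.
  set c0 : ℝ := 1 / (32 * A ^ 2) with hc0
  set c1 : ℝ := 1 + 5 / 2 * c0 with hc1
  set c2 : ℝ := 2 * (1 + 32 * n * B ^ 2 * c1) with hc2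
  have hc0p : 0 < c0 := by positivity
  have hc1p : 0 < c1 := by positivity
  have hc2p : 0 < c2 := by positivity
  refine ⟨c0 + c1 + c2, by positivity, fun lam hl U hU => ?_⟩
  have hl0 : 0 < lam := by linarith
  have hc : ∀ m, Continuous (mon lam m) := fun m => (contDiff_mon lam m).continuous
  have hm := hU.mem
  have hs := memLp_jlap hm
  have main := hU.carleman_zero hab ha.le hl0
  have hmn : ∀ m, ∀ x ∈ box a b, 0 ≤ mon lam m (x 0) := fun m x hx =>
    mon_nonneg _ _ (ha.le.trans (hx 0).1.le)
  set L := wint a b (jlap U) (jlap U) (mon lam 0) with hL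
  have hL0 : 0 ≤ L := wint_self_nonneg _ (hmn 0)
  set W0 := wint a b (U none) (U none) (mon lam 0) with hW0
  set W2 := wint a b (U none) (U none) (mon lam 2) with hW2
  have hW0n : 0 ≤ W0 := wint_self_nonneg _ (hmn 0)
  have hW20 : A ^ 2 * W0 ≤ W2 := by
    rw [hW0, ← wint_const_mul]
    refine wint_self_mono (hm _) (continuous_const.mul (hc 0)) (hc 2) fun x hx => ?_
    have h1 := (hx 0).1
    have : A ^ 2 ≤ x 0 ^ 2 := by gcongr
    have h2 := Real.exp_pos (2 * lam * x 0 ^ 2)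
    simp only [mon, pow_zero, one_mul]
    gcongr
  have hl3 : lam ^ 2 ≤ lam ^ 3 := by gcongr; norm_num
  have hb0 : lam ^ 3 * W0 ≤ c0 * L := by
    rw [hc0, div_mul_eq_mul_div, one_mul, le_div_iff₀ (by positivity)]
    nlinarith [mul_le_mul_of_nonneg_left hW20 (show 0 ≤ 32 * lam ^ 3 by positivity)]
  -- the gradient
  set G := ∑ i, wint a b (U (some (.inl i))) (U (some (.inl i))) (mon lam 0) with hG
  have hgrad : lam * G ≤ c1 * L := by
    have e1 := hU.wint_first_zero hab (contDiff_mon lam 1)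
    rw [deriv_mon_succ, wint_comb (hm _) (hm _) (hc _) (hc _)] at e1
    norm_num at e1
    have hsum := Finset.sum_congr rfl fun j (_ : j ∈ Finset.univ) =>
      hU.wint_second_none hab (contDiff_mon lam 0) j
    rw [Finset.sum_sub_distrib, Finset.sum_neg_distrib, Finset.sum_ite_eq, if_pos (Finset.mem_univ _),
      ← wint_sum_left _ (fun j => hm (some (.inr (j, j)))) (hm _) (hc _), deriv_mon_zero,
      wint_const_mul] at hsum
    change wint a b (jlap U) _ _ = _ at hsum
    have hy := wint_young (a := a) (b := b) hs (hm none) lam lam 0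
    norm_num at hy
    have h1 : lam ^ 2 * W0 ≤ c0 * L :=
      (mul_le_mul_of_nonneg_right hl3 hW0n).trans hb0
    -- This is Δu tested against u with the weight. Differentiating the weight twice leaves 8 lam³ ∫
    -- x₀²u², which `main` already bounds.
    have key : lam * G = -(lam * wint a b (jlap U) (U none) (mon lam 0)) +
        2 * lam ^ 2 * (W0 + 4 * lam * W2) := by
      rw [hsum]
      linear_combination (-2 * lam ^ 2) * e1
    rw [key, hc1]
    nlinarith
  -- the second derivatives
  have hWn : ∀ m u, 0 ≤ wint a b u u (mon lam m) := fun m u => wint_self_nonneg _ (hmn m)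
  -- The square of Δu is the double sum of the products of pure second derivatives, each of which
  -- becomes a squared mixed derivative plus a term with the derivative of the weight. Young's
  -- inequality gives up a quarter of the square and costs 16 lam² times the gradient, which loses
  -- one power of `lam` against the gradient estimate.
  have hpair0 : ∀ i j : Fin n, i ≠ j → 0 ≠ j →
      3 / 4 * wint a b (U (some (.inr (i, j)))) (U (some (.inr (i, j)))) (mon lam 0) -
        16 * lam ^ 2 * wint a b (U (some (.inl j))) (U (some (.inl j))) (mon lam 2) ≤
      wint a b (U (some (.inr (i, i)))) (U (some (.inr (j, j)))) (mon lam 0) := by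
    intro i j hij hj
    rw [hU.wint_second_second hab (contDiff_mon lam 0) hij hj]
    have h1 := hWn 0 (U (some (.inr (i, j))))
    have h2 := hWn 2 (U (some (.inl j)))
    have h3 : 0 ≤ lam ^ 2 * wint a b (U (some (.inl j))) (U (some (.inl j))) (mon lam 2) := by positivity
    by_cases hi : 0 = i
    · simp only [hi, if_true]
      rw [deriv_mon_zero, wint_const_mul]
      have hy := wint_young (a := a) (b := b) (hm (some (.inr (i, j)))) (hm (some (.inl j))) lam (8 * lam) 1
      norm_num at hy
      linarith
    · simp only [hi, if_false]
      linarith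
  have hpair : ∀ i j : Fin n,
      3 / 4 * wint a b (U (some (.inr (i, j)))) (U (some (.inr (i, j)))) (mon lam 0) -
        16 * lam ^ 2 * (wint a b (U (some (.inl i))) (U (some (.inl i))) (mon lam 2) +
          wint a b (U (some (.inl j))) (U (some (.inl j))) (mon lam 2)) ≤
      wint a b (U (some (.inr (i, i)))) (U (some (.inr (j, j)))) (mon lam 0) := by
    intro i j
    have h1 := hWn 0 (U (some (.inr (i, j))))
    have h2 : 0 ≤ lam ^ 2 * wint a b (U (some (.inl j))) (U (some (.inl j))) (mon lam 2) :=
      mul_nonneg (by positivity) (hWn 2 _)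
    have h3 : 0 ≤ lam ^ 2 * wint a b (U (some (.inl i))) (U (some (.inl i))) (mon lam 2) :=
      mul_nonneg (by positivity) (hWn 2 _)
    by_cases hij : i = j
    · subst hij; linarith
    · by_cases hj : 0 = j
      · have := hpair0 j i (Ne.symm hij) (by rw [hj]; exact Ne.symm hij)
        rw [wint_congr_left (hU.mixed_symm (Ne.symm hij)), wint_comm,
          wint_congr_left (hU.mixed_symm (Ne.symm hij)), wint_comm (U (some (.inr (j, j))))] at this
        linarith
      · have := hpair0 i j hij hj
        linarith
  have hG2 : ∑ i, wint a b (U (some (.inl i))) (U (some (.inl i))) (mon lam 2) ≤ B ^ 2 * G := by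
    rw [hG, Finset.mul_sum]
    refine Finset.sum_le_sum fun i _ => ?_
    rw [← wint_const_mul]
    refine wint_self_mono (hm _) (hc 2) (continuous_const.mul (hc 0)) fun x hx => ?_
    have h1 := (hx 0).2
    have h1' : 0 ≤ x 0 := ha.le.trans (hx 0).1.le
    simp only [mon, pow_zero, one_mul]
    gcongr
  have hLs : L = ∑ i, ∑ j, wint a b (U (some (.inr (i, i)))) (U (some (.inr (j, j)))) (mon lam 0) := by
    rw [hL]
    change wint a b (fun x => ∑ i, U (some (.inr (i, i))) x) _ _ = _
    rw [wint_sum_left _ (fun j => hm (some (.inr (j, j)))) hs (hc _)]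
    refine Finset.sum_congr rfl fun i _ => ?_
    rw [wint_comm]
    change wint a b (fun x => ∑ i, U (some (.inr (i, i))) x) _ _ = _
    rw [wint_sum_left _ (fun j => hm (some (.inr (j, j)))) (hm _) (hc _)]
    exact Finset.sum_congr rfl fun j _ => wint_comm _ _ _
  have hsecond : ∑ i, ∑ j, wint a b (U (some (.inr (i, j)))) (U (some (.inr (i, j)))) (mon lam 0) ≤
      c2 * lam * L := by
    have := Finset.sum_le_sum fun i (_ : i ∈ Finset.univ) =>
      Finset.sum_le_sum fun j (_ : j ∈ Finset.univ) => hpair i j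
    rw [← hLs] at this
    simp only [Finset.sum_sub_distrib, ← Finset.mul_sum, Finset.sum_add_distrib, Finset.sum_const,
      Finset.card_univ, Fintype.card_fin, nsmul_eq_mul] at this
    have h1 := mul_le_mul_of_nonneg_left hG2 (show 0 ≤ 32 * n * lam ^ 2 by positivity)
    have h2 := mul_le_mul_of_nonneg_left hgrad (show 0 ≤ 32 * n * B ^ 2 * lam by positivity)
    have h3 := mul_le_mul_of_nonneg_right hl hL0
    rw [hc2]
    nlinarith [mul_nonneg (show 0 ≤ (n : ℝ) * B ^ 2 * c1 by positivity) (mul_nonneg hl0.le hL0)]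
  refine ⟨hb0.trans ?_, hgrad.trans ?_, hsecond.trans ?_⟩
  · gcongr; linarith
  · gcongr; linarith
  · gcongr; linarith

end Carleman


/-! ### Sobolev spaces: linearity, the parallelogram law and completeness. -/

section SobolevSpace

variable {n : ℕ} {Ω : Set (Pt n)}

theorem MemSobolev.isWeakDeriv {m : ℕ} {f : Pt n → ℝ} (h : MemSobolev Ω m f) {β : Fin n → ℕ}
    (hβ : ∑ i, β i ≤ m) : IsWeakDeriv Ω β f (weakDeriv Ω β f) :=
  weakDeriv_spec (h.2 β hβ)

theorem MemSobolev.comb {m : ℕ} {f g : Pt n → ℝ} (hf : MemSobolev Ω m f) (hg : MemSobolev Ω m g)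
    (r s : ℝ) : MemSobolev Ω m (fun x => r * f x + s * g x) :=
  ⟨(hf.1.const_mul r).add (hg.1.const_mul s), fun _ hβ =>
    ⟨_, (hf.isWeakDeriv hβ).comb (hg.isWeakDeriv hβ) hf.1 hg.1 r s⟩⟩

theorem MemSobolev.weakDeriv_comb (hΩ : IsOpen Ω) {m : ℕ} {f g : Pt n → ℝ} (hf : MemSobolev Ω m f)
    (hg : MemSobolev Ω m g) (r s : ℝ) {β : Fin n → ℕ} (hβ : ∑ i, β i ≤ m) :
    weakDeriv Ω β (fun x => r * f x + s * g x) =ᵐ[volume.restrict Ω]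
      fun x => r * weakDeriv Ω β f x + s * weakDeriv Ω β g x :=
  ((hf.isWeakDeriv hβ).comb (hg.isWeakDeriv hβ) hf.1 hg.1 r s).weakDeriv_ae hΩ

theorem sub_eq_comb (f g : Pt n → ℝ) : (fun x => f x - g x) = fun x => 1 * f x + (-1) * g x := by
  ext x; ring

theorem MemSobolev.sub {m : ℕ} {f g : Pt n → ℝ} (hf : MemSobolev Ω m f) (hg : MemSobolev Ω m g) :
    MemSobolev Ω m (fun x => f x - g x) := by
  rw [sub_eq_comb]; exact hf.comb hg 1 (-1)

theorem MemSobolev.weakDeriv_sub (hΩ : IsOpen Ω) {m : ℕ} {f g : Pt n → ℝ} (hf : MemSobolev Ω m f)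
    (hg : MemSobolev Ω m g) {β : Fin n → ℕ} (hβ : ∑ i, β i ≤ m) :
    weakDeriv Ω β (fun x => f x - g x) =ᵐ[volume.restrict Ω]
      fun x => weakDeriv Ω β f x - weakDeriv Ω β g x := by
  rw [sub_eq_comb]
  filter_upwards [hf.weakDeriv_comb hΩ hg 1 (-1) hβ] with x hx
  rw [hx]; ring

theorem sum_of_mem_range_piAntidiag {m j : ℕ} {β : Fin n → ℕ} (hj : j ∈ Finset.range (m + 1))
    (hβ : β ∈ Finset.piAntidiag (Finset.univ : Finset (Fin n)) j) : ∑ i, β i ≤ m := by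
  rw [Finset.mem_piAntidiag] at hβ
  rw [Finset.mem_range] at hj
  rw [hβ.1]; omega

theorem sobolevNormSq_nonneg (Ω : Set (Pt n)) (m : ℕ) (f : Pt n → ℝ) : 0 ≤ sobolevNormSq Ω m f :=
  Finset.sum_nonneg fun _ _ => Finset.sum_nonneg fun _ _ => integral_nonneg fun _ => sq_nonneg _

theorem sq_sobolevNorm (Ω : Set (Pt n)) (m : ℕ) (f : Pt n → ℝ) :
    sobolevNorm Ω m f ^ 2 = sobolevNormSq Ω m f := Real.sq_sqrt (sobolevNormSq_nonneg Ω m f)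

theorem integral_weakDeriv_sq_le (f : Pt n → ℝ) {m : ℕ} {β : Fin n → ℕ} (hβ : ∑ i, β i ≤ m) :
    ∫ x in Ω, (weakDeriv Ω β f x) ^ 2 ≤ sobolevNormSq Ω m f := by
  unfold sobolevNormSq
  have h1 : ∑ i, β i ∈ Finset.range (m + 1) := Finset.mem_range.2 (by omega)
  refine le_trans ?_ (Finset.single_le_sum (f := fun j => ∑ β ∈ Finset.piAntidiag
    (Finset.univ : Finset (Fin n)) j, ∫ x in Ω, (weakDeriv Ω β f x) ^ 2)
    (fun _ _ => Finset.sum_nonneg fun _ _ => integral_nonneg fun _ => sq_nonneg _) h1)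
  exact Finset.single_le_sum (f := fun β => ∫ x in Ω, (weakDeriv Ω β f x) ^ 2)
    (fun _ _ => integral_nonneg fun _ => sq_nonneg _) (by simp [Finset.mem_piAntidiag])

theorem integrable_sq_of_memLp {f : Pt n → ℝ} (hf : MemLp f 2 (volume.restrict Ω)) :
    Integrable (fun x => f x ^ 2) (volume.restrict Ω) := hf.integrable_sq

theorem sobolevNormSq_comb_le (hΩ : IsOpen Ω) {m : ℕ} {f g : Pt n → ℝ} (hf : MemSobolev Ω m f)
    (hg : MemSobolev Ω m g) (r s : ℝ) :
    sobolevNormSq Ω m (fun x => r * f x + s * g x) ≤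
      2 * r ^ 2 * sobolevNormSq Ω m f + 2 * s ^ 2 * sobolevNormSq Ω m g := by
  unfold sobolevNormSq
  simp only [Finset.mul_sum, ← Finset.sum_add_distrib]
  refine Finset.sum_le_sum fun j hj => Finset.sum_le_sum fun β hβ => ?_
  have hβ' := sum_of_mem_range_piAntidiag hj hβ
  have i1 := integrable_sq_of_memLp (hf.isWeakDeriv hβ').1
  have i2 := integrable_sq_of_memLp (hg.isWeakDeriv hβ').1
  rw [← integral_const_mul, ← integral_const_mul, ← integral_add (i1.const_mul _) (i2.const_mul _)]
  refine integral_mono_ae (integrable_sq_of_memLp ((hf.comb hg r s).isWeakDeriv hβ').1)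
    ((i1.const_mul _).add (i2.const_mul _)) ?_
  filter_upwards [hf.weakDeriv_comb hΩ hg r s hβ'] with x hx
  simp only [hx]
  nlinarith [sq_nonneg (r * weakDeriv Ω β f x - s * weakDeriv Ω β g x)]

/-- The exact parallelogram law; its last term is the source of strict convexity of the regularized
functional. -/
theorem sobolevNormSq_midpoint (hΩ : IsOpen Ω) {m : ℕ} {f g : Pt n → ℝ} (hf : MemSobolev Ω m f)
    (hg : MemSobolev Ω m g) :
    sobolevNormSq Ω m (fun x => 1 / 2 * f x + 1 / 2 * g x) =
      1 / 2 * sobolevNormSq Ω m f + 1 / 2 * sobolevNormSq Ω m g -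
        1 / 4 * sobolevNormSq Ω m (fun x => f x - g x) := by
  unfold sobolevNormSq
  simp only [Finset.mul_sum, ← Finset.sum_add_distrib, ← Finset.sum_sub_distrib]
  refine Finset.sum_congr rfl fun j hj => Finset.sum_congr rfl fun β hβ => ?_
  have hβ' := sum_of_mem_range_piAntidiag hj hβ
  have i1 := integrable_sq_of_memLp (hf.isWeakDeriv hβ').1
  have i2 := integrable_sq_of_memLp (hg.isWeakDeriv hβ').1
  have i3 := integrable_sq_of_memLp ((hf.sub hg).isWeakDeriv hβ').1
  rw [← integral_const_mul, ← integral_const_mul, ← integral_const_mul,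
    ← integral_add (i1.const_mul _) (i2.const_mul _)]
  refine Eq.trans ?_ (integral_sub ((i1.const_mul _).add (i2.const_mul _)) (i3.const_mul _))
  refine integral_congr_ae ?_
  filter_upwards [hf.weakDeriv_comb hΩ hg (1 / 2) (1 / 2) hβ', hf.weakDeriv_sub hΩ hg hβ'] with x hx hx'
  simp only [hx, hx']
  ring

theorem IsWeakDeriv.weakDeriv_zero_ae (hΩ : IsOpen Ω) {f : Pt n → ℝ}
    (hf : MemLp f 2 (volume.restrict Ω)) : weakDeriv Ω 0 f =ᵐ[volume.restrict Ω] f :=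
  (isWeakDeriv_zero hf).weakDeriv_ae hΩ

theorem MemSobolev.hasWD {m : ℕ} {f : Pt n → ℝ} (h : MemSobolev Ω m f) {β : Fin n → ℕ}
    {l : Fin n} (hβ : ∑ i, β i + 1 ≤ m) :
    HasWD Ω l (weakDeriv Ω β f) (weakDeriv Ω (β + Pi.single l 1) f) :=
  HasWD.of_isWeakDeriv (h.isWeakDeriv (by omega)) (h.isWeakDeriv (by rw [sum_add_single]; exact hβ))

theorem lintegral_enorm_sq_eq {f : Pt n → ℝ} (hf : MemLp f 2 (volume.restrict Ω)) :
    ∫⁻ x in Ω, ‖f x‖ₑ ^ 2 = ENNReal.ofReal (∫ x in Ω, f x ^ 2) := by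
  rw [ofReal_integral_eq_lintegral_ofReal (integrable_sq_of_memLp hf)
    (Filter.Eventually.of_forall fun x => sq_nonneg _)]
  refine lintegral_congr fun x => ?_
  rw [← sq_abs, ENNReal.ofReal_pow (abs_nonneg _), ← Real.norm_eq_abs, ofReal_norm]

/-- Allows the embedding and form bounds to be applied to a derivative of order |β|, with the
remaining derivatives still available. -/
theorem MemSobolev.hk {m : ℕ} {f : Pt n → ℝ} (h : MemSobolev Ω m f) {N : NNReal}
    (hN : sobolevNormSq Ω m f ≤ (N : ℝ) ^ 2) (k : ℕ) (β : Fin n → ℕ) (hβ : ∑ i, β i + k ≤ m) :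
    HK Ω k (weakDeriv Ω β f) N := by
  have base : ∀ β : Fin n → ℕ, ∑ i, β i ≤ m → MemLp (weakDeriv Ω β f) 2 (volume.restrict Ω) ∧
      ∫⁻ x in Ω, ‖weakDeriv Ω β f x‖ₑ ^ 2 ≤ (N : ENNReal) ^ 2 := by
    intro β hβ
    refine ⟨(h.isWeakDeriv hβ).1, ?_⟩
    rw [lintegral_enorm_sq_eq (h.isWeakDeriv hβ).1]
    refine (ENNReal.ofReal_le_ofReal ((integral_weakDeriv_sq_le f hβ).trans hN)).trans_eq ?_
    rw [ENNReal.ofReal_pow N.coe_nonneg, ENNReal.ofReal_coe_nnreal]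
  induction k generalizing β with
  | zero => exact base β (by omega)
  | succ k ih =>
    refine ⟨base β (by omega), fun l => ⟨_, h.hasWD (by omega), ih _ ?_⟩⟩
    rw [sum_add_single]; omega

theorem norm_toLp_sq {f : Pt n → ℝ} (hf : MemLp f 2 (volume.restrict Ω)) :
    ‖hf.toLp f‖ ^ 2 = ∫ x in Ω, f x ^ 2 := by
  rw [← real_inner_self_eq_norm_sq, L2.inner_def]
  apply integral_congr_ae
  filter_upwards [hf.coeFn_toLp] with x hx
  simp [hx, sq]

theorem inner_toLp {f g : Pt n → ℝ} (hf : MemLp f 2 (volume.restrict Ω))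
    (hg : MemLp g 2 (volume.restrict Ω)) :
    inner ℝ (hf.toLp f) (hg.toLp g) = ∫ x in Ω, f x * g x := by
  rw [L2.inner_def]
  apply integral_congr_ae
  filter_upwards [hf.coeFn_toLp, hg.coeFn_toLp] with x hx hx'
  simp [hx, hx', mul_comm]

/-- Mean square convergence implies convergence of the integrals against a square integrable
function. -/
theorem tendsto_integral_mul_of_l2 {F : ℕ → Pt n → ℝ} {f Φ : Pt n → ℝ}
    (hF : ∀ p, MemLp (F p) 2 (volume.restrict Ω)) (hf : MemLp f 2 (volume.restrict Ω))
    (hΦ : MemLp Φ 2 (volume.restrict Ω))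
    (h : Filter.Tendsto (fun p => ∫ x in Ω, (F p x - f x) ^ 2) Filter.atTop (nhds 0)) :
    Filter.Tendsto (fun p => ∫ x in Ω, F p x * Φ x) Filter.atTop (nhds (∫ x in Ω, f x * Φ x)) := by
  have h1 : Filter.Tendsto (fun p => (hF p).toLp (F p)) Filter.atTop (nhds (hf.toLp f)) := by
    rw [tendsto_iff_norm_sub_tendsto_zero]
    have h2 := (Real.continuous_sqrt.tendsto 0).comp h
    rw [Real.sqrt_zero] at h2
    refine h2.congr fun p => ?_
    rw [Function.comp_apply, ← MemLp.toLp_sub, ← Real.sqrt_sq (norm_nonneg _), norm_toLp_sq]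
    rfl
  have h2 := h1.inner (tendsto_const_nhds (x := hΦ.toLp Φ)) (𝕜 := ℝ)
  simpa only [inner_toLp] using h2

/-- Completeness of the Sobolev space. -/
theorem exists_sobolev_limit (hΩ : IsOpen Ω) {m : ℕ} {V : ℕ → Pt n → ℝ}
    (hV : ∀ p, MemSobolev Ω m (V p))
    (hC : ∀ δ : ℝ, 0 < δ → ∃ P : ℕ, ∀ p q, P ≤ p → P ≤ q →
      sobolevNormSq Ω m (fun x => V p x - V q x) < δ) :
    ∃ f, MemSobolev Ω m f ∧
      Filter.Tendsto (fun p => sobolevNormSq Ω m (fun x => V p x - f x)) Filter.atTop (nhds 0) := by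
  have hlim : ∀ β : Fin n → ℕ, ∃ g : Pt n → ℝ, ∑ i, β i ≤ m → (MemLp g 2 (volume.restrict Ω) ∧
      Filter.Tendsto (fun p => ∫ x in Ω, (weakDeriv Ω β (V p) x - g x) ^ 2) Filter.atTop (nhds 0)) := by
    intro β
    by_cases hβ : ∑ i, β i ≤ m
    swap
    · exact ⟨0, fun h => absurd h hβ⟩
    have hL := fun p => ((hV p).isWeakDeriv hβ).1
    have hcs : CauchySeq fun p => (hL p).toLp (weakDeriv Ω β (V p)) := by
      rw [Metric.cauchySeq_iff]
      intro δ hδ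
      obtain ⟨P, hP⟩ := hC (δ ^ 2) (by positivity)
      refine ⟨P, fun p hp q hq => ?_⟩
      rw [dist_eq_norm, ← MemLp.toLp_sub]
      refine lt_of_pow_lt_pow_left₀ 2 hδ.le ?_
      rw [norm_toLp_sq]
      refine lt_of_le_of_lt ?_ (hP p q hp hq)
      refine le_trans (le_of_eq (integral_congr_ae ?_)) (integral_weakDeriv_sq_le _ hβ)
      filter_upwards [(hV p).weakDeriv_sub hΩ (hV q) hβ] with x hx
      simp [hx]
    obtain ⟨g, hg⟩ := cauchySeq_tendsto_of_complete hcs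
    refine ⟨g, fun _ => ⟨Lp.memLp g, ?_⟩⟩
    rw [tendsto_iff_norm_sub_tendsto_zero] at hg
    have h2 := hg.pow 2
    rw [zero_pow (by norm_num)] at h2
    refine h2.congr fun p => ?_
    rw [← Lp.toLp_coeFn g (Lp.memLp g), ← MemLp.toLp_sub, norm_toLp_sq]
    simp
  choose g hg using hlim
  have h0 : ∑ i, (0 : Fin n → ℕ) i ≤ m := by simp
  have hVt : ∀ Φ : Pt n → ℝ, MemLp Φ 2 (volume.restrict Ω) →
      Filter.Tendsto (fun p => ∫ x in Ω, V p x * Φ x) Filter.atTop (nhds (∫ x in Ω, g 0 x * Φ x)) := by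
    intro Φ hΦ
    refine (tendsto_integral_mul_of_l2 (fun p => ((hV p).isWeakDeriv h0).1) (hg 0 h0).1 hΦ
      (hg 0 h0).2).congr fun p => integral_congr_ae ?_
    filter_upwards [IsWeakDeriv.weakDeriv_zero_ae hΩ (hV p).1] with x hx
    rw [hx]
  -- The identity defining a weak derivative is continuous in L², so the limits of the derivatives
  -- are the derivatives of the limit.
  have hwd : ∀ β : Fin n → ℕ, ∑ i, β i ≤ m → IsWeakDeriv Ω β (g 0) (g β) := by
    intro β hβ
    refine ⟨(hg β hβ).1, fun φ hφ => ?_⟩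
    refine tendsto_nhds_unique (hVt _ (hφ.multiDeriv β).memLp) ?_
    refine ((tendsto_integral_mul_of_l2 (fun p => ((hV p).isWeakDeriv hβ).1) (hg β hβ).1 hφ.memLp
      (hg β hβ).2).const_mul _).congr fun p => ?_
    exact (((hV p).isWeakDeriv hβ).2 φ hφ).symm
  have hmem : MemSobolev Ω m (g 0) := ⟨(hg 0 h0).1, fun β hβ => ⟨_, hwd β hβ⟩⟩
  refine ⟨g 0, hmem, ?_⟩
  unfold sobolevNormSq
  have : (0 : ℝ) = ∑ j ∈ Finset.range (m + 1),
      ∑ β ∈ Finset.piAntidiag (Finset.univ : Finset (Fin n)) j, (0 : ℝ) := by simp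
  rw [this]
  refine tendsto_finsetSum _ fun j hj => tendsto_finsetSum _ fun β hβ => ?_
  have hβ' := sum_of_mem_range_piAntidiag hj hβ
  refine (hg β hβ').2.congr fun p => integral_congr_ae ?_
  filter_upwards [(hV p).weakDeriv_sub hΩ hmem hβ', (hwd β hβ').weakDeriv_ae hΩ] with x hx hx'
  rw [hx, hx']

end SobolevSpace


/-! ### From continuous boundary values to weak boundary conditions. -/

section Traces

variable {n : ℕ} {a b : Fin n → ℝ}

/-- The weak derivatives of order at most two. -/
noncomputable def jetOf (Ω : Set (Pt n)) (f : Pt n → ℝ) : JIdx n → Pt n → ℝ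
  | none => f
  | some (.inl i) => weakDeriv Ω (Pi.single i 1) f
  | some (.inr (i, j)) => weakDeriv Ω (Pi.single i 1 + Pi.single j 1) f

/-- The multi-index of a component of a jet. -/
def jbeta : JIdx n → Fin n → ℕ
  | none => 0
  | some (.inl i) => Pi.single i 1
  | some (.inr (i, j)) => Pi.single i 1 + Pi.single j 1

theorem sum_jbeta_le (ι : JIdx n) : ∑ l, jbeta ι l ≤ 2 := by
  rcases ι with _ | i | ⟨i, j⟩
  · simp [jbeta]
  · simp [jbeta]
  · simp only [jbeta]; rw [sum_add_single]; simp

theorem jetOf_ae {Ω : Set (Pt n)} (hΩ : IsOpen Ω) {f : Pt n → ℝ} (hf : MemLp f 2 (volume.restrict Ω))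
    (ι : JIdx n) : jetOf Ω f ι =ᵐ[volume.restrict Ω] weakDeriv Ω (jbeta ι) f := by
  rcases ι with _ | i | ⟨i, j⟩
  · exact (IsWeakDeriv.weakDeriv_zero_ae hΩ hf).symm
  · rfl
  · rfl

theorem MemSobolev.memLp_jetOf {Ω : Set (Pt n)} (hΩ : IsOpen Ω) {m : ℕ} (hm : 2 ≤ m) {f : Pt n → ℝ}
    (hf : MemSobolev Ω m f) (ι : JIdx n) : MemLp (jetOf Ω f ι) 2 (volume.restrict Ω) :=
  (hf.isWeakDeriv ((sum_jbeta_le ι).trans hm)).1.ae_eq (jetOf_ae hΩ hf.1 ι).symm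

theorem MemSobolev.jetOf_comb {Ω : Set (Pt n)} (hΩ : IsOpen Ω) {m : ℕ} (hm : 2 ≤ m) {f g : Pt n → ℝ}
    (hf : MemSobolev Ω m f) (hg : MemSobolev Ω m g) (r s : ℝ) (ι : JIdx n) :
    jetOf Ω (fun x => r * f x + s * g x) ι =ᵐ[volume.restrict Ω]
      fun x => r * jetOf Ω f ι x + s * jetOf Ω g ι x := by
  filter_upwards [jetOf_ae hΩ (hf.comb hg r s).1 ι, jetOf_ae hΩ hf.1 ι, jetOf_ae hΩ hg.1 ι,
    hf.weakDeriv_comb hΩ hg r s ((sum_jbeta_le ι).trans hm)] with x h1 h2 h3 h4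
  rw [h1, h2, h3, h4]

theorem MemSobolev.jetOf_sub {Ω : Set (Pt n)} (hΩ : IsOpen Ω) {m : ℕ} (hm : 2 ≤ m) {f g : Pt n → ℝ}
    (hf : MemSobolev Ω m f) (hg : MemSobolev Ω m g) (ι : JIdx n) :
    jetOf Ω (fun x => f x - g x) ι =ᵐ[volume.restrict Ω] fun x => jetOf Ω f ι x - jetOf Ω g ι x := by
  rw [sub_eq_comb]
  filter_upwards [hf.jetOf_comb hΩ hm hg 1 (-1) ι] with x hx
  rw [hx]; ring

theorem MemSobolev.hasWD_first {Ω : Set (Pt n)} {m : ℕ} (hm : 2 ≤ m) {f : Pt n → ℝ}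
    (hf : MemSobolev Ω m f) (i : Fin n) : HasWD Ω i (jetOf Ω f none) (jetOf Ω f (some (.inl i))) :=
  (hf.isWeakDeriv (by simp; omega)).hasWD hf.1

theorem MemSobolev.hasWD_second {Ω : Set (Pt n)} {m : ℕ} (hm : 2 ≤ m) {f : Pt n → ℝ}
    (hf : MemSobolev Ω m f) (i j : Fin n) :
    HasWD Ω j (jetOf Ω f (some (.inl i))) (jetOf Ω f (some (.inr (i, j)))) :=
  hf.hasWD (by simp; omega)

theorem MemSobolev.integral_jetOf_sq_le {Ω : Set (Pt n)} (hΩ : IsOpen Ω) {m : ℕ} (hm : 2 ≤ m)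
    {f : Pt n → ℝ} (hf : MemSobolev Ω m f) (ι : JIdx n) :
    ∫ x in Ω, jetOf Ω f ι x ^ 2 ≤ sobolevNormSq Ω m f := by
  refine le_trans (le_of_eq (integral_congr_ae ?_))
    (integral_weakDeriv_sq_le f ((sum_jbeta_le ι).trans hm))
  filter_upwards [jetOf_ae hΩ hf.1 ι] with x hx
  simp only [hx]

theorem closure_box (hab : ∀ l, a l < b l) : closure (box a b) = {x | ∀ l, x l ∈ Icc (a l) (b l)} := by
  have h1 : box a b = (EuclideanSpace.equiv (Fin n) ℝ).toHomeomorph ⁻¹'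
      (Set.univ.pi fun l => Ioo (a l) (b l)) := by
    ext x; simp [box]
  rw [h1, ← Homeomorph.preimage_closure, closure_pi_set]
  ext x
  simp [closure_Ioo (hab _).ne]
  exact forall_and.symm

/-- Moving one coordinate of a point to a given value. -/
noncomputable def slide (l : Fin n) (e : ℝ) (x : Pt n) : Pt n := x + EuclideanSpace.single l (e - x l)

theorem slide_same (l : Fin n) (e : ℝ) (x : Pt n) : slide l e x l = e := by simp [slide]

theorem slide_of_ne {l j : Fin n} (h : j ≠ l) (e : ℝ) (x : Pt n) : slide l e x j = x j := by
  simp [slide, h]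

theorem dist_slide (l : Fin n) (e : ℝ) (x : Pt n) : dist x (slide l e x) = |x l - e| := by
  rw [slide, dist_eq_norm]; simp [abs_sub_comm]

theorem slide_mem_closure (hab : ∀ l, a l < b l) {l : Fin n} {e : ℝ} (he : e ∈ Icc (a l) (b l)) {x : Pt n}
    (hx : x ∈ box a b) : slide l e x ∈ closure (box a b) := by
  rw [closure_box hab]
  intro j
  by_cases h : j = l
  · subst h; rw [slide_same]; exact he
  · rw [slide_of_ne h]; exact Ioo_subset_Icc_self (hx j)

theorem slide_mem_frontier (hab : ∀ l, a l < b l) {l : Fin n} {e : ℝ} (he : e = a l ∨ e = b l) {x : Pt n}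
    (hx : x ∈ box a b) : slide l e x ∈ frontier (box a b) := by
  have hI : e ∈ Icc (a l) (b l) := by
    rcases he with rfl | rfl
    · exact left_mem_Icc.2 (hab l).le
    · exact right_mem_Icc.2 (hab l).le
  refine ⟨slide_mem_closure hab hI hx, fun h => ?_⟩
  have := interior_subset h l
  rw [slide_same] at this
  rcases he with rfl | rfl
  · exact lt_irrefl _ this.1
  · exact lt_irrefl _ this.2

/-- Uniform continuity on the compact closure, comparing each point with its projection onto the
face. -/
theorem exists_small_near_face (hab : ∀ l, a l < b l) {d : Pt n → ℝ} (hd : ContinuousOn d (closure (box a b)))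
    {l : Fin n} {e : ℝ} (he : e ∈ Icc (a l) (b l)) (h0 : ∀ x ∈ box a b, d (slide l e x) = 0) {δ : ℝ}
    (hδ : 0 < δ) : ∃ η > 0, ∀ x ∈ box a b, |x l - e| < η → |d x| ≤ δ := by
  have huc := (isBounded_box a b).isCompact_closure.uniformContinuousOn_of_continuous hd
  obtain ⟨η, hη, h⟩ := Metric.uniformContinuousOn_iff.1 huc δ hδ
  refine ⟨η, hη, fun x hx hxe => ?_⟩
  have := h x (subset_closure hx) _ (slide_mem_closure hab he hx) (by rwa [dist_slide])
  rw [h0 x hx, Real.dist_eq, sub_zero] at this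
  exact this.le

theorem faceZero_of_trace (hab : ∀ l, a l < b l) {f g β : Pt n → ℝ}
    (hf : HasTrace (box a b) (frontier (box a b)) f β) (hg : HasTrace (box a b) (frontier (box a b)) g β)
    (l : Fin n) : FaceZero a b l (fun x => f x - g x) := by
  obtain ⟨u, hu, hfu, hub⟩ := hf
  obtain ⟨v, hv, hgv, hvb⟩ := hg
  have h0 : ∀ e, (e = a l ∨ e = b l) → ∀ x ∈ box a b, (u - v) (slide l e x) = 0 := by
    intro e he x hx
    have := slide_mem_frontier hab he hx
    simp [hub _ this, hvb _ this]
  intro δ hδ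
  obtain ⟨η₁, h1, H1⟩ := exists_small_near_face hab (hu.sub hv) (left_mem_Icc.2 (hab l).le)
    (h0 _ (Or.inl rfl)) hδ
  obtain ⟨η₂, h2, H2⟩ := exists_small_near_face hab (hu.sub hv) (right_mem_Icc.2 (hab l).le)
    (h0 _ (Or.inr rfl)) hδ
  refine ⟨min η₁ η₂, lt_min h1 h2, ?_⟩
  filter_upwards [hfu, hgv, ae_restrict_mem (measurableSet_box a b)] with x e1 e2 hx hxl
  rw [e1, e2]
  have hxl' := hx l
  rcases hxl with h | h
  · refine H1 x hx ?_
    rw [abs_of_pos (by linarith [hxl'.1])]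
    linarith [min_le_left η₁ η₂]
  · refine H2 x hx ?_
    rw [abs_of_neg (by linarith [hxl'.2])]
    linarith [min_le_right η₁ η₂]

variable [NeZero n]

/-- The boundary data cancel in the difference. Neumann data are given on one face only, which
suffices for `normal`: there the test function vanishes near the opposite face, so the product tends
to zero at both. -/
theorem admN_of_trace (hab : ∀ l, a l < b l) {m : ℕ} (hm : 2 ≤ m) {f g β γ : Pt n → ℝ} {F : Set (Pt n)}
    (hF : ∀ x ∈ box a b, slide 0 (b 0) x ∈ F)
    (hf : MemSobolev (box a b) m f) (hg : MemSobolev (box a b) m g)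
    (hf0 : HasTrace (box a b) (frontier (box a b)) f β) (hg0 : HasTrace (box a b) (frontier (box a b)) g β)
    (hf1 : HasTrace (box a b) F (wpd (box a b) 0 f) γ) (hg1 : HasTrace (box a b) F (wpd (box a b) 0 g) γ) :
    AdmN a b (jetOf (box a b) fun x => f x - g x) := by
  have hfg := hf.sub hg
  refine ⟨Adm.of_hasWD (fun i => hfg.hasWD_first hm i) (fun i j => hfg.hasWD_second hm i j)
    (fun l => faceZero_of_trace hab hf0 hg0 l) hfg.1, fun Φ hΦ hΦ0 => ?_⟩
  refine (hfg.hasWD_second hm 0 0).ibp_of_faceZero hΦ ?_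
  obtain ⟨u, hu, hfu, hub⟩ := hf1
  obtain ⟨v, hv, hgv, hvb⟩ := hg1
  obtain ⟨C, hC0, hC⟩ := exists_bound_of_continuous (isBounded_box a b) hΦ.continuous
  obtain ⟨η₁, h1, H1⟩ := hΦ0
  intro δ hδ
  obtain ⟨η₂, h2, H2⟩ := exists_small_near_face hab (hu.sub hv) (right_mem_Icc.2 (hab 0).le)
    (fun x hx => by simp [hub _ (hF x hx), hvb _ (hF x hx)]) (show 0 < δ / (C + 1) by positivity)
  refine ⟨min η₁ η₂, lt_min h1 h2, ?_⟩
  filter_upwards [hfu, hgv, ae_restrict_mem (measurableSet_box a b),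
    hf.jetOf_sub (isOpen_box a b) hm hg (some (.inl 0))] with x e1 e2 hx e3 hx0
  have e4 : jetOf (box a b) (fun x => f x - g x) (some (.inl 0)) x = (u - v) x := by
    rw [e3]; exact congrArg₂ _ e1 e2
  rcases hx0 with h | h
  · rw [H1 x (by linarith [min_le_left η₁ η₂])]; simpa using hδ.le
  · have h3 := H2 x hx (by
      rw [abs_of_neg (by linarith [(hx 0).2])]
      linarith [min_le_right η₁ η₂])
    rw [e4, abs_mul]
    calc |(u - v) x| * |Φ x| ≤ δ / (C + 1) * (C + 1) :=
          mul_le_mul h3 ((hC x hx).trans (by linarith)) (abs_nonneg _) (by positivity)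
      _ = δ := by field_simp

/-- All conditions are integral identities that are continuous in L². They therefore hold for limits
of functions with prescribed boundary values, without any continuity of the trace. -/
theorem AdmN.of_tendsto {U : JIdx n → Pt n → ℝ} (hm : ∀ ι, MemLp (U ι) 2 (volume.restrict (box a b)))
    {F : ℕ → JIdx n → Pt n → ℝ} (hF : ∀ p, AdmN a b (F p))
    (h : ∀ ι, Filter.Tendsto (fun p => ∫ x in box a b, (F p ι x - U ι x) ^ 2) Filter.atTop (nhds 0)) :
    AdmN a b U := by
  have ht : ∀ (ι : JIdx n) (Φ : Pt n → ℝ), ContDiff ℝ ∞ Φ →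
      Filter.Tendsto (fun p => ∫ x in box a b, F p ι x * Φ x) Filter.atTop
        (nhds (∫ x in box a b, U ι x * Φ x)) := fun ι Φ hΦ =>
    tendsto_integral_mul_of_l2 (fun p => (hF p).mem ι) (hm ι) (memLp_of_contDiff hΦ) (h ι)
  refine ⟨⟨hm, fun i Φ hΦ => ?_, fun i j hij Φ hΦ => ?_, fun i Φ hΦ h0 => ?_⟩, fun Φ hΦ h0 => ?_⟩
  · exact tendsto_nhds_unique (ht none _ (contDiff_pderiv hΦ i))
      ((ht (some (.inl i)) _ hΦ).neg.congr fun p => ((hF p).first i Φ hΦ).symm)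
  · exact tendsto_nhds_unique (ht none _ (contDiff_pderiv (contDiff_pderiv hΦ j) i))
      ((ht (some (.inr (i, j))) _ hΦ).congr fun p => ((hF p).mixed i j hij Φ hΦ).symm)
  · exact tendsto_nhds_unique (ht (some (.inl i)) _ (contDiff_pderiv hΦ i))
      ((ht (some (.inr (i, i))) _ hΦ).neg.congr fun p => ((hF p).second i Φ hΦ h0).symm)
  · exact tendsto_nhds_unique (ht (some (.inl 0)) _ (contDiff_pderiv hΦ 0))
      ((ht (some (.inr (0, 0))) _ hΦ).neg.congr fun p => ((hF p).normal Φ hΦ h0).symm)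

end Traces

/-! ### Norms and closures for vector functions. -/

section VectorFunctions

variable {n : ℕ} {Ω : Set (Pt n)} {k : ℕ}

/-- The square of the norm of a vector function. -/
noncomputable def vecNormSq (Ω : Set (Pt n)) (m : ℕ) {k : ℕ} (V : Fin (k + 1) → Pt n → ℝ) : ℝ :=
  ∑ i, sobolevNormSq Ω m (V i)

theorem sq_vecSobolevNorm (m : ℕ) (V : Fin (k + 1) → Pt n → ℝ) :
    vecSobolevNorm Ω m V ^ 2 = vecNormSq Ω m V := by
  unfold vecSobolevNorm vecNormSq
  rw [Real.sq_sqrt (Finset.sum_nonneg fun _ _ => sq_nonneg _)]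
  exact Finset.sum_congr rfl fun i _ => sq_sobolevNorm _ _ _

theorem vecSobolevNorm_nonneg (m : ℕ) (V : Fin (k + 1) → Pt n → ℝ) : 0 ≤ vecSobolevNorm Ω m V :=
  Real.sqrt_nonneg _

theorem vecSobolevNorm_lt_iff (m : ℕ) (V : Fin (k + 1) → Pt n → ℝ) {δ : ℝ} (hδ : 0 < δ) :
    vecSobolevNorm Ω m V < δ ↔ vecNormSq Ω m V < δ ^ 2 := by
  rw [← sq_vecSobolevNorm]
  exact (pow_lt_pow_iff_left₀ (vecSobolevNorm_nonneg _ _) hδ.le (by norm_num)).symm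

theorem vecNormSq_nonneg (m : ℕ) (V : Fin (k + 1) → Pt n → ℝ) : 0 ≤ vecNormSq Ω m V :=
  Finset.sum_nonneg fun _ _ => sobolevNormSq_nonneg _ _ _

theorem sobolevNormSq_le_vecNormSq (m : ℕ) (V : Fin (k + 1) → Pt n → ℝ) (i : Fin (k + 1)) :
    sobolevNormSq Ω m (V i) ≤ vecNormSq Ω m V :=
  Finset.single_le_sum (f := fun i => sobolevNormSq Ω m (V i))
    (fun _ _ => sobolevNormSq_nonneg _ _ _) (Finset.mem_univ i)

/-- Restates the closure with squared norms, for which the parallelogram law is available and no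
triangle inequality is needed. -/
theorem mem_sobolevClosure_iff {m : ℕ} {S : Set (Fin (k + 1) → Pt n → ℝ)} {V : Fin (k + 1) → Pt n → ℝ} :
    V ∈ sobolevClosure Ω m S ↔ (∀ i, MemSobolev Ω m (V i)) ∧
      ∀ δ : ℝ, 0 < δ → ∃ W ∈ S, vecNormSq Ω m (fun i x => V i x - W i x) < δ := by
  refine and_congr_right fun _ => ⟨fun h δ hδ => ?_, fun h δ hδ => ?_⟩
  · obtain ⟨W, hW, hlt⟩ := h (Real.sqrt δ) (Real.sqrt_pos.2 hδ)
    refine ⟨W, hW, ?_⟩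
    rwa [vecSobolevNorm_lt_iff _ _ (Real.sqrt_pos.2 hδ), Real.sq_sqrt hδ.le] at hlt
  · obtain ⟨W, hW, hlt⟩ := h (δ ^ 2) (by positivity)
    exact ⟨W, hW, (vecSobolevNorm_lt_iff _ _ hδ).2 hlt⟩

theorem subset_sobolevClosure {m : ℕ} {S : Set (Fin (k + 1) → Pt n → ℝ)} {V : Fin (k + 1) → Pt n → ℝ}
    (hV : V ∈ S) (hm : ∀ i, MemSobolev Ω m (V i)) (hΩ : IsOpen Ω) : V ∈ sobolevClosure Ω m S := by
  refine mem_sobolevClosure_iff.2 ⟨hm, fun δ hδ => ⟨V, hV, ?_⟩⟩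
  have : vecNormSq Ω m (fun i x => V i x - V i x) ≤ 0 := by
    unfold vecNormSq
    refine (Finset.sum_nonpos fun i _ => ?_)
    have := sobolevNormSq_comb_le hΩ (hm i) (hm i) 0 0
    norm_num at this
    simpa using this
  linarith

theorem sobolevNormSq_sub_comm (hΩ : IsOpen Ω) {m : ℕ} {f g : Pt n → ℝ} (hf : MemSobolev Ω m f)
    (hg : MemSobolev Ω m g) :
    sobolevNormSq Ω m (fun x => f x - g x) = sobolevNormSq Ω m (fun x => g x - f x) := by
  unfold sobolevNormSq
  refine Finset.sum_congr rfl fun j hj => Finset.sum_congr rfl fun β hβ => ?_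
  have hβ' := sum_of_mem_range_piAntidiag hj hβ
  apply integral_congr_ae
  filter_upwards [hf.weakDeriv_sub hΩ hg hβ', hg.weakDeriv_sub hΩ hf hβ'] with x h1 h2
  rw [h1, h2]; ring

theorem vecNormSq_comb_le (hΩ : IsOpen Ω) {m : ℕ} {V W : Fin (k + 1) → Pt n → ℝ}
    (hV : ∀ i, MemSobolev Ω m (V i)) (hW : ∀ i, MemSobolev Ω m (W i)) (r s : ℝ) :
    vecNormSq Ω m (fun i x => r * V i x + s * W i x) ≤
      2 * r ^ 2 * vecNormSq Ω m V + 2 * s ^ 2 * vecNormSq Ω m W := by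
  unfold vecNormSq
  rw [Finset.mul_sum, Finset.mul_sum, ← Finset.sum_add_distrib]
  exact Finset.sum_le_sum fun i _ => sobolevNormSq_comb_le hΩ (hV i) (hW i) r s

theorem vecNormSq_sub_le (hΩ : IsOpen Ω) {m : ℕ} {V W X : Fin (k + 1) → Pt n → ℝ}
    (hV : ∀ i, MemSobolev Ω m (V i)) (hW : ∀ i, MemSobolev Ω m (W i)) (hX : ∀ i, MemSobolev Ω m (X i)) :
    vecNormSq Ω m (fun i x => V i x - W i x) ≤
      2 * vecNormSq Ω m (fun i x => V i x - X i x) + 2 * vecNormSq Ω m (fun i x => X i x - W i x) := by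
  have := vecNormSq_comb_le hΩ (fun i => (hV i).sub (hX i)) (fun i => (hX i).sub (hW i)) 1 1
  norm_num at this
  exact this

theorem vecNormSq_midpoint (hΩ : IsOpen Ω) {m : ℕ} {V W : Fin (k + 1) → Pt n → ℝ}
    (hV : ∀ i, MemSobolev Ω m (V i)) (hW : ∀ i, MemSobolev Ω m (W i)) :
    vecNormSq Ω m (fun i x => 1 / 2 * V i x + 1 / 2 * W i x) =
      1 / 2 * vecNormSq Ω m V + 1 / 2 * vecNormSq Ω m W -
        1 / 4 * vecNormSq Ω m (fun i x => V i x - W i x) := by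
  unfold vecNormSq
  rw [Finset.mul_sum, Finset.mul_sum, Finset.mul_sum, ← Finset.sum_add_distrib, ← Finset.sum_sub_distrib]
  exact Finset.sum_congr rfl fun i _ => sobolevNormSq_midpoint hΩ (hV i) (hW i)

end VectorFunctions


/-! ### The form bound in the presence of the Carleman weight. -/

section FormBound

variable {n : ℕ} {a b : Fin n → ℝ}

theorem exists_form_bound_real (hab : ∀ l, a l < b l) {k : ℕ} (hk : n ≤ 2 * k + 1) :
    ∃ C : ℝ, 0 ≤ C ∧ ∀ (f : Pt n → ℝ) (N : NNReal), HK (box a b) k f N →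
      ∀ (w : Pt n → ℝ) (g : Fin n → Pt n → ℝ), MemLp w 2 (volume.restrict (box a b)) →
      (∀ l, HasWD (box a b) l w (g l)) → ∀ J : ℕ,
      ∫ x in box a b, |f x| * w x ^ 2 ≤ C * N * (Real.sqrt 2 ^ J * (∫ x in box a b, w x ^ 2) +
        2⁻¹ ^ J * (2⁻¹ * Real.sqrt 2) ^ J * ∫ x in box a b, (∑ l, |g l x|) ^ 2) := by
  obtain ⟨C, hC⟩ := exists_form_bound_dyadic hab hk
  refine ⟨C, C.2, fun f N hf w g hw hg J => ?_⟩
  have h := hC f N hf w g hw hg J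
  have hfm := hf.base.1.1
  have hgs : MemLp (fun x => ∑ l, |g l x|) 2 (volume.restrict (box a b)) :=
    memLp_finsetSum _ fun l _ => (hg l).memg.abs
  have e1 : ∫⁻ x in box a b, (∑ l, ‖g l x‖ₑ) ^ 2 =
      ENNReal.ofReal (∫ x in box a b, (∑ l, |g l x|) ^ 2) := by
    rw [← lintegral_enorm_sq_eq hgs]
    refine lintegral_congr fun x => ?_
    congr 1
    rw [Real.enorm_of_nonneg (Finset.sum_nonneg fun _ _ => abs_nonneg _),
      ENNReal.ofReal_sum_of_nonneg fun _ _ => abs_nonneg _]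
    exact Finset.sum_congr rfl fun l _ => by rw [← Real.norm_eq_abs, ofReal_norm]
  rw [e1, lintegral_enorm_sq_eq hw] at h
  have e2 : ∫ x in box a b, |f x| * w x ^ 2 =
      (∫⁻ x in box a b, ‖f x‖ₑ * ‖w x‖ₑ ^ 2).toReal := by
    rw [integral_eq_lintegral_of_nonneg_ae
      (Filter.Eventually.of_forall fun x => mul_nonneg (abs_nonneg _) (sq_nonneg _))
      (hfm.norm.mul (hw.1.pow 2))]
    congr 1
    refine lintegral_congr fun x => ?_
    rw [ENNReal.ofReal_mul (abs_nonneg _), ← sq_abs (w x), ENNReal.ofReal_pow (abs_nonneg _),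
      ← Real.norm_eq_abs, ← Real.norm_eq_abs, ofReal_norm, ofReal_norm]
  have e3 : (C * N * (rt2 ^ J * ENNReal.ofReal (∫ x in box a b, w x ^ 2) +
      2⁻¹ ^ J * (2⁻¹ * rt2) ^ J * ENNReal.ofReal (∫ x in box a b, (∑ l, |g l x|) ^ 2)) : ENNReal) =
      ENNReal.ofReal (C * N * (Real.sqrt 2 ^ J * (∫ x in box a b, w x ^ 2) +
        2⁻¹ ^ J * (2⁻¹ * Real.sqrt 2) ^ J * ∫ x in box a b, (∑ l, |g l x|) ^ 2)) := by
    have p1 : 0 ≤ ∫ x in box a b, w x ^ 2 := integral_nonneg fun _ => sq_nonneg _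
    have p2 : 0 ≤ ∫ x in box a b, (∑ l, |g l x|) ^ 2 := integral_nonneg fun _ => sq_nonneg _
    have hh : (2⁻¹ : ENNReal) = ENNReal.ofReal 2⁻¹ := by
      rw [ENNReal.ofReal_inv_of_pos (by norm_num)]; simp
    rw [hh, rt2, ENNReal.ofReal_mul (by positivity), ENNReal.ofReal_add (by positivity) (by positivity),
      ENNReal.ofReal_mul (by positivity), ENNReal.ofReal_mul (by positivity),
      ENNReal.ofReal_mul (p := 2⁻¹ ^ J * (2⁻¹ * Real.sqrt 2) ^ J) (by positivity),
      ENNReal.ofReal_mul (p := 2⁻¹ ^ J) (by positivity),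
      ENNReal.ofReal_pow (by positivity), ENNReal.ofReal_pow (by positivity),
      ENNReal.ofReal_pow (by positivity), ENNReal.ofReal_mul (p := (2⁻¹ : ℝ)) (by positivity),
      ENNReal.ofReal_coe_nnreal, ENNReal.ofReal_coe_nnreal]
  rw [e3] at h
  rw [e2]
  exact ENNReal.toReal_le_of_le_ofReal (by
    have p1 : 0 ≤ ∫ x in box a b, w x ^ 2 := integral_nonneg fun _ => sq_nonneg _
    have p2 : 0 ≤ ∫ x in box a b, (∑ l, |g l x|) ^ 2 := integral_nonneg fun _ => sq_nonneg _
    positivity) h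

/-- J is chosen with 2^J ≤ lam < 2^{J+1}; then (2^{-J})^{3/2} is at most 2^{3/2} lam^{-3/2}, and
2^{3/2} ≤ 4. -/
theorem exists_dyadic_scale {lam : ℝ} (hl : 1 ≤ lam) : ∃ J : ℕ,
    Real.sqrt 2 ^ J ≤ Real.sqrt lam ∧
    lam * Real.sqrt lam * (2⁻¹ ^ J * (2⁻¹ * Real.sqrt 2) ^ J) ≤ 4 := by
  obtain ⟨J, hJ1, hJ2⟩ := exists_nat_pow_near hl (by norm_num : (1 : ℝ) < 2)
  have hs2 : Real.sqrt 2 ^ J = Real.sqrt (2 ^ J) := by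
    rw [eq_comm, Real.sqrt_eq_iff_mul_self_eq (by positivity) (by positivity), ← mul_pow,
      Real.mul_self_sqrt (by norm_num)]
  refine ⟨J, by rw [hs2]; exact Real.sqrt_le_sqrt hJ1, ?_⟩
  set s := Real.sqrt 2 ^ J with hs
  have hss : s * s = 2 ^ J := by rw [hs, ← mul_pow, Real.mul_self_sqrt (by norm_num)]
  have hsp : 0 < s := by positivity
  have e : (2⁻¹ : ℝ) ^ J * (2⁻¹ * Real.sqrt 2) ^ J = 1 / (s * s * s) := by
    rw [mul_pow, ← hs, inv_pow, ← hss]; field_simp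
  have hl2 : lam ≤ 2 * (s * s) := by rw [hss]; rw [pow_succ] at hJ2; linarith
  have h3 : Real.sqrt lam ≤ 2 * s := by
    rw [Real.sqrt_le_left (by positivity)]; nlinarith
  rw [e, mul_one_div, div_le_iff₀ (by positivity)]
  calc lam * Real.sqrt lam ≤ 2 * (s * s) * (2 * s) :=
        mul_le_mul hl2 h3 (Real.sqrt_nonneg _) (by positivity)
    _ = 4 * (s * s * s) := by ring

variable [NeZero n]

/-- Functions in `H^{[n/2]}` are controlled by the Carleman estimate. -/
theorem exists_weighted_form_bound (hab : ∀ l, a l < b l) (ha : 0 < a 0) {k : ℕ} (hk : n ≤ 2 * k + 1)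
    (N : NNReal) : ∃ C : ℝ, 0 ≤ C ∧ ∀ lam : ℝ, 1 ≤ lam → ∀ f : Pt n → ℝ, HK (box a b) k f N →
      ∀ U : JIdx n → Pt n → ℝ, AdmN a b U →
      (∀ i j, HasWD (box a b) j (U (some (.inl i))) (U (some (.inr (i, j))))) →
      Real.sqrt lam * ∑ l, ∫ x in box a b, |f x| * (U (some (.inl l)) x ^ 2 * mon lam 0 (x 0)) ≤
        C * wint a b (jlap U) (jlap U) (mon lam 0) := by
  obtain ⟨C₁, hC₁, H₁⟩ := exists_form_bound_real hab hk
  obtain ⟨C₂, hC₂, H₂⟩ := exists_carleman hab ha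
  set B := b 0
  have hB : 0 < B := ha.trans (hab 0)
  refine ⟨C₁ * N * ((1 + 32 * n * B ^ 2) * C₂ + 8 * n * C₂), by positivity, fun lam hl f hf U hU hW => ?_⟩
  have hl0 : 0 < lam := by linarith
  obtain ⟨J, hJ1, hJ2⟩ := exists_dyadic_scale hl
  obtain ⟨-, hG, hD⟩ := H₂ lam hl U hU
  set L := wint a b (jlap U) (jlap U) (mon lam 0)
  set s := Real.sqrt lam with hs
  have hsp : 0 < s := Real.sqrt_pos.2 hl0
  have hss : s * s = lam := Real.mul_self_sqrt hl0.le
  have hmn : ∀ m, ∀ x ∈ box a b, 0 ≤ mon lam m (x 0) := fun m x hx =>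
    mon_nonneg _ _ (ha.le.trans (hx 0).1.le)
  -- The square root of the weight is absorbed into the function: the unweighted form bound is
  -- applied to θ ∂_l u. Differentiating θ costs 2 lam x₀.
  set θ : ℝ → ℝ := fun t => Real.exp (lam * t ^ 2) with hθ
  have hθs : ContDiff ℝ ∞ θ := by rw [hθ]; fun_prop
  have hθd : ∀ t, deriv θ t = 2 * lam * t * θ t := by
    intro t
    have : HasDerivAt θ (θ t * (lam * (2 * t))) t := by
      simpa using ((hasDerivAt_pow 2 t).const_mul lam).exp
    rw [this.deriv]; ring
  have hθ2 : ∀ t, θ t ^ 2 = mon lam 0 t := by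
    intro t; rw [hθ, mon, sq, ← Real.exp_add]; simp; ring
  have hmem := hU.mem
  have key : ∀ l, ∫ x in box a b, |f x| * (U (some (.inl l)) x ^ 2 * mon lam 0 (x 0)) ≤
      C₁ * N * (Real.sqrt 2 ^ J * wint a b (U (some (.inl l))) (U (some (.inl l))) (mon lam 0) +
        2⁻¹ ^ J * (2⁻¹ * Real.sqrt 2) ^ J *
        (2 * n * (∑ j, wint a b (U (some (.inr (l, j)))) (U (some (.inr (l, j)))) (mon lam 0)) +
        8 * n * lam ^ 2 * B ^ 2 * wint a b (U (some (.inl l))) (U (some (.inl l))) (mon lam 0))) := by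
    intro l
    have hw := fun j => (hW l j).mul_smooth (isOpen_box a b) (isBounded_box a b) (contDiff_coord hθs 0)
    have h := H₁ f N hf _ _ (hw 0).memf hw J
    have e1 : ∫ x in box a b, |f x| * (U (some (.inl l)) x ^ 2 * mon lam 0 (x 0)) =
        ∫ x in box a b, |f x| * (θ (x 0) * U (some (.inl l)) x) ^ 2 := by
      congr 1; ext x; rw [← hθ2]; ring
    have e2 : ∫ x in box a b, (θ (x 0) * U (some (.inl l)) x) ^ 2 =
        wint a b (U (some (.inl l))) (U (some (.inl l))) (mon lam 0) := by
      unfold wint; congr 1; ext x; rw [← hθ2]; ring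
    rw [e1]
    refine h.trans ?_
    rw [e2]
    gcongr
    have hc := (contDiff_mon lam 0).continuous
    have i1 := fun j => integrable_wint (hmem (some (.inr (l, j)))) (hmem (some (.inr (l, j)))) hc
    have i2 := integrable_wint (hmem (some (.inl l))) (hmem (some (.inl l))) hc
    have e3 : 2 * n * (∑ j, wint a b (U (some (.inr (l, j)))) (U (some (.inr (l, j)))) (mon lam 0)) +
        8 * n * lam ^ 2 * B ^ 2 * wint a b (U (some (.inl l))) (U (some (.inl l))) (mon lam 0) =
        ∫ x in box a b, (2 * n * (∑ j, U (some (.inr (l, j))) x * U (some (.inr (l, j))) x * mon lam 0 (x 0)) +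
          8 * n * lam ^ 2 * B ^ 2 * (U (some (.inl l)) x * U (some (.inl l)) x * mon lam 0 (x 0))) := by
      rw [integral_add ((integrable_finsetSum _ fun j _ => i1 j).const_mul _) (i2.const_mul _),
        integral_const_mul, integral_const_mul, integral_finsetSum _ fun j _ => i1 j]
      rfl
    rw [e3]
    refine setIntegral_mono_on ?_ (((integrable_finsetSum _ fun j _ => i1 j).const_mul _).add
      (i2.const_mul _)) (measurableSet_box a b) fun x hx => ?_
    · exact (memLp_finsetSum _ fun j _ => (hw j).memg.abs).integrable_sq
    · refine (sq_sum_le_card_mul_sum_sq).trans ?_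
      simp only [Finset.card_univ, Fintype.card_fin, pderiv_coord hθs, hθd, sq_abs]
      have hx0 : 0 < x 0 := ha.trans (hx 0).1
      have hxB : x 0 ^ 2 ≤ B ^ 2 := by
        have := (hx 0).2
        gcongr
      set p := U (some (.inl l)) x
      set T := mon lam 0 (x 0) with hT
      have hT0 : 0 ≤ T := hmn 0 x hx
      have hj : ∀ j : Fin n, (θ (x 0) * U (some (.inr (l, j))) x +
          (if 0 = j then 2 * lam * x 0 * θ (x 0) else 0) * p) ^ 2 ≤
          2 * (U (some (.inr (l, j))) x * U (some (.inr (l, j))) x * T) +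
          if 0 = j then 8 * lam ^ 2 * B ^ 2 * (p * p * T) else 0 := by
        intro j
        rw [hT, ← hθ2]
        split_ifs
        · have h1 : 0 ≤ 8 * lam ^ 2 * (p * p * θ (x 0) ^ 2) * (B ^ 2 - x 0 ^ 2) :=
            mul_nonneg (mul_nonneg (by positivity)
              (mul_nonneg (mul_self_nonneg _) (sq_nonneg _))) (by linarith)
          nlinarith [sq_nonneg (θ (x 0) * U (some (.inr (l, j))) x - 2 * lam * x 0 * θ (x 0) * p)]
        · nlinarith [sq_nonneg (θ (x 0) * U (some (.inr (l, j))) x)]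
      have := Finset.sum_le_sum fun j (_ : j ∈ Finset.univ) => hj j
      rw [Finset.sum_add_distrib, Finset.sum_ite_eq, if_pos (Finset.mem_univ _), ← Finset.mul_sum] at this
      have hn : (0 : ℝ) ≤ n := Nat.cast_nonneg n
      have := mul_le_mul_of_nonneg_left this hn
      linarith
  have hsum := Finset.sum_le_sum fun l (_ : l ∈ Finset.univ) => key l
  rw [← Finset.mul_sum, Finset.sum_add_distrib, ← Finset.mul_sum, ← Finset.mul_sum,
    Finset.sum_add_distrib, ← Finset.mul_sum, ← Finset.mul_sum] at hsum
  set G := ∑ i, wint a b (U (some (.inl i))) (U (some (.inl i))) (mon lam 0) with hGdef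
  set D := ∑ i, ∑ j, wint a b (U (some (.inr (i, j)))) (U (some (.inr (i, j)))) (mon lam 0) with hDdef
  set q := (2⁻¹ : ℝ) ^ J * (2⁻¹ * Real.sqrt 2) ^ J with hq
  have hq0 : 0 ≤ q := by positivity
  have hG0 : 0 ≤ G := Finset.sum_nonneg fun i _ => wint_self_nonneg _ (hmn 0)
  have hD0 : 0 ≤ D := Finset.sum_nonneg fun i _ => Finset.sum_nonneg fun j _ => wint_self_nonneg _ (hmn 0)
  have hL0 : 0 ≤ L := wint_self_nonneg _ (hmn 0)
  refine (mul_le_mul_of_nonneg_left hsum hsp.le).trans ?_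
  have hn : (0 : ℝ) ≤ n := Nat.cast_nonneg n
  -- The powers of `lam` balance. With s = √lam, the three terms carry s · s on the gradient, s ·
  -- lam^{-3/2} on the second derivatives (themselves at most of order lam · L), and s · lam^{-3/2}
  -- · lam² = lam on the gradient again.
  have f1 : s * (Real.sqrt 2 ^ J * G) ≤ C₂ * L := by
    calc s * (Real.sqrt 2 ^ J * G) ≤ s * (s * G) := by gcongr
      _ = lam * G := by rw [← mul_assoc, hss]
      _ ≤ _ := hG
  have f2 : s * (q * D) ≤ 4 * (C₂ * L) := by
    calc s * (q * D) ≤ s * (q * (C₂ * lam * L)) := by gcongr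
      _ = (lam * s * q) * (C₂ * L) := by ring
      _ ≤ _ := by gcongr
  have f3 : s * (q * (lam ^ 2 * G)) ≤ 4 * (C₂ * L) := by
    calc s * (q * (lam ^ 2 * G)) = (lam * s * q) * (lam * G) := by ring
      _ ≤ 4 * (C₂ * L) := by gcongr
  have hCN : 0 ≤ C₁ * N := by positivity
  calc s * (C₁ * N * (Real.sqrt 2 ^ J * G + q * (2 * n * D + 8 * n * lam ^ 2 * B ^ 2 * G)))
      = C₁ * N * (s * (Real.sqrt 2 ^ J * G) + 2 * n * (s * (q * D)) +
          8 * n * B ^ 2 * (s * (q * (lam ^ 2 * G)))) := by ring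
    _ ≤ C₁ * N * (C₂ * L + 2 * n * (4 * (C₂ * L)) + 8 * n * B ^ 2 * (4 * (C₂ * L))) := by gcongr
    _ = _ := by ring

end FormBound


/-! ### Pointwise algebra of the quadratic operators. -/

section Pointwise

variable {n k : ℕ}

/-- The coefficient of the quadratic term of the operators `L_i`. -/
def tau (h : ℝ) (i : Fin (k + 1)) : ℝ := if i = 0 then 0 else 2 * h

theorem abs_tau_le {h : ℝ} (hh : 0 < h) (i : Fin (k + 1)) : |tau h i| ≤ 2 * h := by
  unfold tau; split_ifs
  · simp; exact hh.le
  · rw [abs_of_pos (by positivity)]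

/-- Trace of the second order part of a jet. -/
def lapV (p : JIdx n → ℝ) : ℝ := ∑ l, p (some (.inr (l, l)))

/-- The bilinear part of the operators `L_i`. -/
def bilV (h : ℝ) (P Q : Fin (k + 1) → JIdx n → ℝ) (i : Fin (k + 1)) : ℝ :=
  tau h i * ∑ l, P i (some (.inl l)) * ∑ j ∈ Finset.Iic i, Q j (some (.inl l))

/-- The first order linear part of the operators `L_i`. -/
noncomputable def linV (om : Fin n → ℝ) (h : ℝ) (P : Fin (k + 1) → JIdx n → ℝ) (i : Fin (k + 1)) : ℝ :=
  2 * ∑ l, P i (some (.inl l)) * om l - dt h (fun j => P j none) i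

/-- The operators `L_i` in terms of jets. -/
noncomputable def opV (om : Fin n → ℝ) (h : ℝ) (P : Fin (k + 1) → JIdx n → ℝ) (i : Fin (k + 1)) : ℝ :=
  lapV (P i) + linV om h P i + bilV h P P i

theorem dt_comb (h r s : ℝ) (y z : Fin (k + 1) → ℝ) (i : Fin (k + 1)) :
    dt h (fun j => r * y j + s * z j) i = r * dt h y i + s * dt h z i := by
  unfold dt; split_ifs <;> ring

theorem abs_dt_le {h : ℝ} (hh : 0 < h) (y : Fin (k + 1) → ℝ) (i : Fin (k + 1)) :
    |dt h y i| ≤ 2 / h * ∑ j, |y j| := by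
  have hle : ∀ j, |y j| ≤ ∑ j, |y j| := fun j =>
    Finset.single_le_sum (f := fun j => |y j|) (fun _ _ => abs_nonneg _) (Finset.mem_univ j)
  set S := ∑ j, |y j|
  have hb := fun j => abs_le.1 (hle j)
  have hS : 0 ≤ S := Finset.sum_nonneg fun _ _ => abs_nonneg _
  rw [div_mul_eq_mul_div]
  unfold dt; split_ifs with hi
  · rw [abs_div, abs_of_pos hh]
    gcongr
    rw [abs_le]
    constructor <;> linarith [hb ⟨i.val + 1, by omega⟩, hb i]
  · rw [abs_div, abs_of_pos (show 0 < 6 * h by positivity), div_le_div_iff₀ (by positivity) hh]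
    have : |3 * y ⟨k, by omega⟩ - y ⟨k - 1, by omega⟩ - y ⟨k - 2, by omega⟩ - y ⟨k - 3, by omega⟩| ≤ 12 * S := by
      rw [abs_le]
      constructor <;> linarith [hb ⟨k, by omega⟩, hb ⟨k - 1, by omega⟩, hb ⟨k - 2, by omega⟩, hb ⟨k - 3, by omega⟩]
    calc _ ≤ 12 * S * h := by gcongr
      _ = _ := by ring

theorem lapV_comb (r s : ℝ) (p q : JIdx n → ℝ) :
    lapV (fun ι => r * p ι + s * q ι) = r * lapV p + s * lapV q := by
  simp only [lapV, Finset.mul_sum, ← Finset.sum_add_distrib]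

theorem linV_comb (om : Fin n → ℝ) (h r s : ℝ) (P Q : Fin (k + 1) → JIdx n → ℝ) (i : Fin (k + 1)) :
    linV om h (fun i ι => r * P i ι + s * Q i ι) i = r * linV om h P i + s * linV om h Q i := by
  simp only [linV, dt_comb]
  have : ∑ l, (r * P i (some (.inl l)) + s * Q i (some (.inl l))) * om l =
      r * ∑ l, P i (some (.inl l)) * om l + s * ∑ l, Q i (some (.inl l)) * om l := by
    rw [Finset.mul_sum, Finset.mul_sum, ← Finset.sum_add_distrib]
    exact Finset.sum_congr rfl fun l _ => by ring
  rw [this]; ring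

theorem bilV_comb_left (h r s : ℝ) (P Q T : Fin (k + 1) → JIdx n → ℝ) (i : Fin (k + 1)) :
    bilV h (fun i ι => r * P i ι + s * Q i ι) T i = r * bilV h P T i + s * bilV h Q T i := by
  simp only [bilV]
  have : ∑ l, (r * P i (some (.inl l)) + s * Q i (some (.inl l))) * ∑ j ∈ Finset.Iic i, T j (some (.inl l)) =
      r * ∑ l, P i (some (.inl l)) * ∑ j ∈ Finset.Iic i, T j (some (.inl l)) +
      s * ∑ l, Q i (some (.inl l)) * ∑ j ∈ Finset.Iic i, T j (some (.inl l)) := by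
    rw [Finset.mul_sum, Finset.mul_sum, ← Finset.sum_add_distrib]
    exact Finset.sum_congr rfl fun l _ => by ring
  rw [this]; ring

theorem bilV_comb_right (h r s : ℝ) (P Q T : Fin (k + 1) → JIdx n → ℝ) (i : Fin (k + 1)) :
    bilV h T (fun i ι => r * P i ι + s * Q i ι) i = r * bilV h T P i + s * bilV h T Q i := by
  simp only [bilV]
  have : ∑ l, T i (some (.inl l)) * ∑ j ∈ Finset.Iic i, (r * P j (some (.inl l)) + s * Q j (some (.inl l))) =
      r * ∑ l, T i (some (.inl l)) * ∑ j ∈ Finset.Iic i, P j (some (.inl l)) +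
      s * ∑ l, T i (some (.inl l)) * ∑ j ∈ Finset.Iic i, Q j (some (.inl l)) := by
    rw [Finset.mul_sum, Finset.mul_sum, ← Finset.sum_add_distrib]
    refine Finset.sum_congr rfl fun l _ => ?_
    rw [Finset.sum_add_distrib, ← Finset.mul_sum, ← Finset.mul_sum]; ring
  rw [this]; ring

/-- The bilinear term is telescoped as b(P,P) − b(Q,Q) = b(P−Q,P) + b(Q,P−Q). The remainder is of
first order in the difference, with coefficients of first order in P and Q. -/
theorem opV_sub (om : Fin n → ℝ) (h : ℝ) (P Q : Fin (k + 1) → JIdx n → ℝ) (i : Fin (k + 1)) :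
    opV om h P i - opV om h Q i = lapV (fun ι => P i ι - Q i ι) +
      (linV om h (fun i ι => P i ι - Q i ι) i + bilV h (fun i ι => P i ι - Q i ι) P i +
        bilV h Q (fun i ι => P i ι - Q i ι) i) := by
  have e1 : (fun i ι => P i ι - Q i ι) = fun i ι => 1 * P i ι + (-1) * Q i ι := by
    ext i ι; ring
  have e2 : (fun ι => P i ι - Q i ι) = fun ι => 1 * P i ι + (-1) * Q i ι := by
    ext ι; ring
  rw [e1, e2, lapV_comb, linV_comb, bilV_comb_left, bilV_comb_right]
  unfold opV; ring

/-- A quadratic map satisfies L(M ± U/2) = L(M) + b(U,U)/4 ± L'(M)U/2, and the mean of the squares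
of x + y and x − y is x² + y². The last bracket is L'(M)U. -/
theorem opV_midpoint (om : Fin n → ℝ) (h : ℝ) (P Q M U : Fin (k + 1) → JIdx n → ℝ)
    (hM : ∀ i ι, M i ι = 1 / 2 * P i ι + 1 / 2 * Q i ι) (hU : ∀ i ι, U i ι = P i ι - Q i ι)
    (i : Fin (k + 1)) :
    1 / 2 * opV om h P i ^ 2 + 1 / 2 * opV om h Q i ^ 2 =
      (opV om h M i + 1 / 4 * bilV h U U i) ^ 2 +
      1 / 4 * (lapV (U i) + (linV om h U i + bilV h U M i + bilV h M U i)) ^ 2 := by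
  have e1 : M = fun i ι => 1 / 2 * P i ι + 1 / 2 * Q i ι := by ext i ι; exact hM i ι
  have e2 : U = fun i ι => 1 * P i ι + (-1) * Q i ι := by ext i ι; rw [hU]; ring
  have e3 : M i = fun ι => 1 / 2 * P i ι + 1 / 2 * Q i ι := by ext ι; exact hM i ι
  have e4 : U i = fun ι => 1 * P i ι + (-1) * Q i ι := by ext ι; rw [hU]; ring
  simp only [opV]
  rw [e3, e4, lapV_comb, lapV_comb, e1, e2]
  simp only [linV_comb, bilV_comb_left, bilV_comb_right]
  ring

/-- Sum of the absolute values of the components of order at most one. -/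
def absV (P : Fin (k + 1) → JIdx n → ℝ) : ℝ := ∑ j, (|P j none| + ∑ l, |P j (some (.inl l))|)

/-- Sum of the squares of the components of order one. -/
def gradV (P : Fin (k + 1) → JIdx n → ℝ) : ℝ := ∑ j, ∑ l, P j (some (.inl l)) ^ 2

/-- Sum of the squares of the components of order at most one. -/
def lowV (P : Fin (k + 1) → JIdx n → ℝ) : ℝ := ∑ j, P j none ^ 2 + gradV P

theorem sum_abs_first_le (P : Fin (k + 1) → JIdx n → ℝ) (i : Fin (k + 1)) :
    ∑ l, |P i (some (.inl l))| ≤ absV P := by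
  refine le_trans ?_ (Finset.single_le_sum (f := fun j => |P j none| + ∑ l, |P j (some (.inl l))|)
    (fun j _ => add_nonneg (abs_nonneg _) (Finset.sum_nonneg fun _ _ => abs_nonneg _)) (Finset.mem_univ i))
  simp

theorem sum_abs_none_le (P : Fin (k + 1) → JIdx n → ℝ) : ∑ j, |P j none| ≤ absV P :=
  Finset.sum_le_sum fun j _ => by
    have : 0 ≤ ∑ l, |P j (some (.inl l))| := Finset.sum_nonneg fun _ _ => abs_nonneg _
    linarith

theorem sum_sum_abs_first_le (P : Fin (k + 1) → JIdx n → ℝ) :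
    ∑ l, ∑ j, |P j (some (.inl l))| ≤ absV P := by
  rw [Finset.sum_comm]
  exact Finset.sum_le_sum fun j _ => by linarith [abs_nonneg (P j none)]

theorem abs_sum_Iic_le (y : Fin (k + 1) → ℝ) (i : Fin (k + 1)) :
    |∑ j ∈ Finset.Iic i, y j| ≤ ∑ j, |y j| :=
  (Finset.abs_sum_le_sum_abs _ _).trans
    (Finset.sum_le_sum_of_subset_of_nonneg (Finset.subset_univ _) fun _ _ _ => abs_nonneg _)

theorem absV_sq_le (P : Fin (k + 1) → JIdx n → ℝ) :
    absV P ^ 2 ≤ 2 * ((k + 1) * (n + 1)) * lowV P := by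
  refine (sq_sum_le_card_mul_sum_sq).trans ?_
  simp only [Finset.card_univ, Fintype.card_fin]
  have h : ∀ j, (|P j none| + ∑ l, |P j (some (.inl l))|) ^ 2 ≤
      2 * (n + 1) * (P j none ^ 2 + ∑ l, P j (some (.inl l)) ^ 2) := by
    intro j
    have h1 : (∑ l, |P j (some (.inl l))|) ^ 2 ≤ n * ∑ l, P j (some (.inl l)) ^ 2 := by
      refine (sq_sum_le_card_mul_sum_sq).trans ?_
      simp
    have h2 : 0 ≤ ∑ l, P j (some (.inl l)) ^ 2 := Finset.sum_nonneg fun _ _ => sq_nonneg _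
    have hn : (0 : ℝ) ≤ n := Nat.cast_nonneg n
    nlinarith [sq_nonneg (|P j none| - ∑ l, |P j (some (.inl l))|), sq_abs (P j none),
      mul_nonneg hn (sq_nonneg (P j none))]
  have h3 := Finset.sum_le_sum fun j (_ : j ∈ Finset.univ) => h j
  rw [← Finset.mul_sum, Finset.sum_add_distrib] at h3
  unfold lowV gradV
  have hk : (0 : ℝ) ≤ k + 1 := by positivity
  push_cast
  calc _ ≤ ((k : ℝ) + 1) * _ := mul_le_mul_of_nonneg_left h3 hk
    _ = _ := by ring

theorem abs_linV_le {om : Fin n → ℝ} {h K : ℝ} (hh : 0 < h) (hK : 0 ≤ K) (hom : ∀ l, |om l| ≤ K)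
    (P : Fin (k + 1) → JIdx n → ℝ) (i : Fin (k + 1)) :
    |linV om h P i| ≤ (2 * K + 2 / h) * absV P := by
  have h1 : |∑ l, P i (some (.inl l)) * om l| ≤ K * absV P := by
    refine (Finset.abs_sum_le_sum_abs _ _).trans ?_
    calc ∑ l, |P i (some (.inl l)) * om l| ≤ ∑ l, K * |P i (some (.inl l))| :=
          Finset.sum_le_sum fun l _ => by
            rw [abs_mul, mul_comm]; exact mul_le_mul_of_nonneg_right (hom l) (abs_nonneg _)
      _ = K * ∑ l, |P i (some (.inl l))| := by rw [Finset.mul_sum]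
      _ ≤ K * absV P := mul_le_mul_of_nonneg_left (sum_abs_first_le P i) hK
  have h2 := (abs_dt_le hh (fun j => P j none) i).trans
    (mul_le_mul_of_nonneg_left (sum_abs_none_le P) (by positivity))
  unfold linV
  refine (abs_sub _ _).trans ?_
  rw [abs_mul, abs_two]
  linarith

theorem abs_bilV_le_left {h K : ℝ} (hh : 0 < h) (hK : 0 ≤ K) (P Q : Fin (k + 1) → JIdx n → ℝ)
    (hQ : ∀ j l, |Q j (some (.inl l))| ≤ K) (i : Fin (k + 1)) :
    |bilV h P Q i| ≤ 2 * h * (k + 1) * K * absV P := by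
  unfold bilV
  rw [abs_mul]
  have h1 : |∑ l, P i (some (.inl l)) * ∑ j ∈ Finset.Iic i, Q j (some (.inl l))| ≤
      (k + 1) * K * absV P := by
    refine (Finset.abs_sum_le_sum_abs _ _).trans ?_
    calc _ ≤ ∑ l, (k + 1) * K * |P i (some (.inl l))| := Finset.sum_le_sum fun l _ => by
            rw [abs_mul, mul_comm]
            refine mul_le_mul_of_nonneg_right ?_ (abs_nonneg _)
            refine (abs_sum_Iic_le _ i).trans ((Finset.sum_le_sum fun j _ => hQ j l).trans_eq ?_)
            simp
      _ = (k + 1) * K * ∑ l, |P i (some (.inl l))| := by rw [Finset.mul_sum]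
      _ ≤ _ := mul_le_mul_of_nonneg_left (sum_abs_first_le P i) (by positivity)
  calc _ ≤ 2 * h * ((k + 1) * K * absV P) :=
        mul_le_mul (abs_tau_le hh i) h1 (abs_nonneg _) (by positivity)
    _ = _ := by ring

theorem abs_bilV_le_right {h K : ℝ} (hh : 0 < h) (hK : 0 ≤ K) (P Q : Fin (k + 1) → JIdx n → ℝ)
    (hP : ∀ j l, |P j (some (.inl l))| ≤ K) (i : Fin (k + 1)) :
    |bilV h P Q i| ≤ 2 * h * K * absV Q := by
  unfold bilV
  rw [abs_mul]
  have h1 : |∑ l, P i (some (.inl l)) * ∑ j ∈ Finset.Iic i, Q j (some (.inl l))| ≤ K * absV Q := by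
    refine (Finset.abs_sum_le_sum_abs _ _).trans ?_
    calc _ ≤ ∑ l, K * ∑ j, |Q j (some (.inl l))| := Finset.sum_le_sum fun l _ => by
            rw [abs_mul]
            exact mul_le_mul (hP i l) (abs_sum_Iic_le _ i) (abs_nonneg _) hK
      _ = K * ∑ l, ∑ j, |Q j (some (.inl l))| := by rw [Finset.mul_sum]
      _ ≤ _ := mul_le_mul_of_nonneg_left (sum_sum_abs_first_le Q) hK
  calc _ ≤ 2 * h * (K * absV Q) := mul_le_mul (abs_tau_le hh i) h1 (abs_nonneg _) (by positivity)
    _ = _ := by ring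

/-- Bounded by the gradient alone: in the convexity argument this term is multiplied by the possibly
unbounded Laplacian of the midpoint, and the form bound is applied to first derivatives only. -/
theorem abs_bilV_self_le {h : ℝ} (hh : 0 < h) (P : Fin (k + 1) → JIdx n → ℝ) (i : Fin (k + 1)) :
    |bilV h P P i| ≤ 2 * h * (k + 1) * gradV P := by
  unfold bilV
  rw [abs_mul]
  have h1 : |∑ l, P i (some (.inl l)) * ∑ j ∈ Finset.Iic i, P j (some (.inl l))| ≤ (k + 1) * gradV P := by
    refine (Finset.abs_sum_le_sum_abs _ _).trans ?_
    unfold gradV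
    rw [Finset.sum_comm, Finset.mul_sum]
    refine Finset.sum_le_sum fun l _ => ?_
    rw [abs_mul]
    have h2 : |P i (some (.inl l))| ≤ ∑ j, |P j (some (.inl l))| :=
      Finset.single_le_sum (f := fun j => |P j (some (.inl l))|) (fun _ _ => abs_nonneg _) (Finset.mem_univ i)
    refine (mul_le_mul h2 (abs_sum_Iic_le _ i) (abs_nonneg _) ((abs_nonneg _).trans h2)).trans ?_
    rw [← sq]
    refine (sq_sum_le_card_mul_sum_sq).trans ?_
    simp
  calc _ ≤ 2 * h * ((k + 1) * gradV P) := mul_le_mul (abs_tau_le hh i) h1 (abs_nonneg _) (by positivity)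
    _ = _ := by ring

/-- The constant in the bound of the first order terms. -/
noncomputable def remC (k : ℕ) (h K : ℝ) : ℝ := 2 * K + 2 / h + 2 * h * (k + 1) * K + 2 * h * K

theorem abs_rem_le {om : Fin n → ℝ} {h K : ℝ} (hh : 0 < h) (hK : 0 ≤ K) (hom : ∀ l, |om l| ≤ K)
    (U P Q : Fin (k + 1) → JIdx n → ℝ) (hP : ∀ j l, |P j (some (.inl l))| ≤ K)
    (hQ : ∀ j l, |Q j (some (.inl l))| ≤ K) (i : Fin (k + 1)) :
    |linV om h U i + bilV h U P i + bilV h Q U i| ≤ remC k h K * absV U := by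
  refine (abs_add_three _ _ _).trans ?_
  have h1 := abs_linV_le hh hK hom U i
  have h2 := abs_bilV_le_left hh hK U P hP i
  have h3 := abs_bilV_le_right hh hK Q U hQ i
  unfold remC
  linarith

theorem remC_nonneg (k : ℕ) {h K : ℝ} (hh : 0 < h) (hK : 0 ≤ K) : 0 ≤ remC k h K := by
  unfold remC; positivity

theorem rem_sq_le {om : Fin n → ℝ} {h K : ℝ} (hh : 0 < h) (hK : 0 ≤ K) (hom : ∀ l, |om l| ≤ K)
    (U P Q : Fin (k + 1) → JIdx n → ℝ) (hP : ∀ j l, |P j (some (.inl l))| ≤ K)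
    (hQ : ∀ j l, |Q j (some (.inl l))| ≤ K) (i : Fin (k + 1)) :
    (linV om h U i + bilV h U P i + bilV h Q U i) ^ 2 ≤
      remC k h K ^ 2 * (2 * ((k + 1) * (n + 1))) * lowV U := by
  have h1 := abs_rem_le hh hK hom U P Q hP hQ i
  rw [← sq_abs]
  calc _ ≤ (remC k h K * absV U) ^ 2 := by gcongr
    _ = remC k h K ^ 2 * absV U ^ 2 := by ring
    _ ≤ remC k h K ^ 2 * (2 * ((k + 1) * (n + 1)) * lowV U) :=
        mul_le_mul_of_nonneg_left (absV_sq_le U) (sq_nonneg _)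
    _ = _ := by ring

theorem absV_le {K : ℝ} (P : Fin (k + 1) → JIdx n → ℝ) (h0 : ∀ j, |P j none| ≤ K)
    (h1 : ∀ j l, |P j (some (.inl l))| ≤ K) : absV P ≤ (k + 1) * ((n + 1) * K) := by
  unfold absV
  refine (Finset.sum_le_sum fun j _ => add_le_add (h0 j) (Finset.sum_le_sum fun l _ => h1 j l)).trans_eq ?_
  simp; ring

/-- Apart from the Laplacian all terms of the operator are bounded; this isolates its only unbounded
part. -/
theorem abs_opV_le {om : Fin n → ℝ} {h K : ℝ} (hh : 0 < h) (hK : 0 ≤ K) (hom : ∀ l, |om l| ≤ K)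
    (P : Fin (k + 1) → JIdx n → ℝ) (h0 : ∀ j, |P j none| ≤ K)
    (h1 : ∀ j l, |P j (some (.inl l))| ≤ K) (i : Fin (k + 1)) :
    |opV om h P i| ≤ |lapV (P i)| + remC k h K * ((k + 1) * ((n + 1) * K)) := by
  have e := opV_sub om h P 0 i
  have e0 : opV om h (0 : Fin (k + 1) → JIdx n → ℝ) i = 0 := by
    simp [opV, lapV, linV, bilV, dt]
  simp only [e0, Pi.zero_apply, sub_zero] at e
  rw [e]
  refine (abs_add_le _ _).trans (add_le_add le_rfl ?_)
  refine (abs_rem_le hh hK hom P P 0 h1 (fun _ _ => by simpa using hK) i).trans ?_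
  exact mul_le_mul_of_nonneg_left (absV_le P h0 h1) (remC_nonneg k hh hK)

/-- Lower bound behind the convexity of the functional. -/
theorem opV_convex_bound {om : Fin n → ℝ} {h K : ℝ} (hh : 0 < h) (hK : 0 ≤ K) (hom : ∀ l, |om l| ≤ K)
    (P Q M U : Fin (k + 1) → JIdx n → ℝ)
    (hM : ∀ i ι, M i ι = 1 / 2 * P i ι + 1 / 2 * Q i ι) (hU : ∀ i ι, U i ι = P i ι - Q i ι)
    (h0 : ∀ j, |M j none| ≤ K) (h1 : ∀ j l, |M j (some (.inl l))| ≤ K) (i : Fin (k + 1)) :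
    opV om h M i ^ 2 + 1 / 8 * lapV (U i) ^ 2 -
      (1 / 4 * (remC k h K ^ 2 * (2 * ((k + 1) * (n + 1)))) +
        h * (k + 1) * (remC k h K * ((k + 1) * ((n + 1) * K)))) * lowV U -
      h * (k + 1) * (|lapV (M i)| * gradV U) ≤
    1 / 2 * opV om h P i ^ 2 + 1 / 2 * opV om h Q i ^ 2 := by
  rw [opV_midpoint om h P Q M U hM hU i]
  set L := opV om h M i
  set q := bilV h U U i
  set r := linV om h U i + bilV h U M i + bilV h M U i with hr
  have hrem := rem_sq_le hh hK hom U M M h1 h1 i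
  have hL := abs_opV_le hh hK hom M h0 h1 i
  have hq := abs_bilV_self_le hh U i
  have hg : 0 ≤ gradV U := Finset.sum_nonneg fun _ _ => Finset.sum_nonneg fun _ _ => sq_nonneg _
  have hlow : gradV U ≤ lowV U := by
    unfold lowV
    have : 0 ≤ ∑ j, U j none ^ 2 := Finset.sum_nonneg fun _ _ => sq_nonneg _
    linarith
  set X := remC k h K * ((k + 1) * ((n + 1) * K))
  have hX : 0 ≤ X := mul_nonneg (remC_nonneg k hh hK) (by positivity)
  have h2 : |L * q| ≤ (|lapV (M i)| + X) * (2 * h * (k + 1) * gradV U) := by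
    rw [abs_mul]
    exact mul_le_mul hL hq (abs_nonneg _) (by positivity)
  have h3 := (abs_le.1 h2).1
  have h4 : h * (k + 1) * X * gradV U ≤ h * (k + 1) * X * lowV U :=
    mul_le_mul_of_nonneg_left hlow (by positivity)
  -- The square of q/4 is dropped, and (ΔU + r)² is at least half of (ΔU)² minus r².
  nlinarith [sq_nonneg (1 / 4 * q), sq_nonneg (lapV (U i) + 2 * r)]

/-- The bound behind the stability estimate. -/
theorem lapV_sq_le {om : Fin n → ℝ} {h K : ℝ} (hh : 0 < h) (hK : 0 ≤ K) (hom : ∀ l, |om l| ≤ K)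
    (P Q U : Fin (k + 1) → JIdx n → ℝ) (hU : ∀ i ι, U i ι = P i ι - Q i ι)
    (hP : ∀ j l, |P j (some (.inl l))| ≤ K) (hQ : ∀ j l, |Q j (some (.inl l))| ≤ K) (i : Fin (k + 1)) :
    lapV (U i) ^ 2 ≤ 2 * (opV om h P i - opV om h Q i) ^ 2 +
      2 * (remC k h K ^ 2 * (2 * ((k + 1) * (n + 1)))) * lowV U ∧
    (opV om h P i - opV om h Q i) ^ 2 ≤ 2 * lapV (U i) ^ 2 +
      2 * (remC k h K ^ 2 * (2 * ((k + 1) * (n + 1)))) * lowV U := by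
  have e2 : U = fun i ι => P i ι - Q i ι := by ext i ι; exact hU i ι
  have e := opV_sub om h P Q i
  rw [← e2] at e
  change _ = lapV (fun ι => P i ι - Q i ι) + _ at e
  rw [show (fun ι => P i ι - Q i ι) = U i from by ext ι; exact (hU i ι).symm] at e
  have hrem := rem_sq_le hh hK hom U P Q hP hQ i
  set r := linV om h U i + bilV h U P i + bilV h Q U i
  rw [e]
  constructor
  · nlinarith [sq_nonneg (lapV (U i) + 2 * r)]
  · nlinarith [sq_nonneg (lapV (U i) - r)]

end Pointwise


/-! ### The operators in Sobolev spaces and the vector Carleman estimate. -/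

section Operators

variable {n k : ℕ} {a b : Fin n → ℝ}

/-- The jets of the components of a vector function at a point. -/
noncomputable def jets (Ω : Set (Pt n)) (V : Fin (k + 1) → Pt n → ℝ) (x : Pt n) :
    Fin (k + 1) → JIdx n → ℝ := fun i ι => jetOf Ω (V i) ι x

theorem single_two (i : Fin n) : (Pi.single i 2 : Fin n → ℕ) = Pi.single i 1 + Pi.single i 1 := by
  rw [← Pi.single_add]

theorem wlap_eq (Ω : Set (Pt n)) (f : Pt n → ℝ) : wlap Ω f = jlap (jetOf Ω f) := by
  ext x
  simp only [wlap, jlap, single_two, jetOf]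

theorem Lop_eq (Ω : Set (Pt n)) (ε h : ℝ) (V : Fin (k + 1) → Pt n → ℝ) (i : Fin (k + 1)) (x : Pt n) :
    Lop Ω ε h V i x = opV (fun l => pderiv l (wEps ε) x) h (jets Ω V x) i := by
  unfold Lop opV
  rw [wlap_eq]
  simp only [lapV, linV, bilV, jets, jetOf, tau, jlap, wpd]
  split_ifs <;> ring

theorem contDiff_wEps (ε : ℝ) : ContDiff ℝ ∞ (wEps ε : Pt n → ℝ) := by
  unfold wEps
  exact ((contDiff_norm_sq ℝ).div_const _).neg.sub contDiff_const

theorem exists_bound_pderiv_wEps (ε : ℝ) (a b : Fin n → ℝ) : ∃ K : ℝ, 0 ≤ K ∧ ∀ x ∈ box a b, ∀ l,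
    |pderiv l (wEps ε) x| ≤ K := by
  choose C hC0 hC using fun l : Fin n => exists_bound_of_continuous (isBounded_box a b)
    (contDiff_pderiv (contDiff_wEps ε) l).continuous
  refine ⟨∑ l, C l, Finset.sum_nonneg fun l _ => hC0 l, fun x hx l => (hC l x hx).trans ?_⟩
  exact Finset.single_le_sum (f := C) (fun l _ => hC0 l) (Finset.mem_univ l)

/-- Vector functions bounded by `N` in `H^{m_n}`. -/
structure Reg (a b : Fin n → ℝ) (N : NNReal) (V : Fin (k + 1) → Pt n → ℝ) : Prop where
  mem : ∀ i, MemSobolev (box a b) (mInd n) (V i)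
  bound : ∀ i, sobolevNormSq (box a b) (mInd n) (V i) ≤ (N : ℝ) ^ 2

theorem two_le_mInd (n : ℕ) : 2 ≤ mInd n := by unfold mInd; omega

/-- After one derivative, [n/2] + 1 derivatives remain, which is what `exists_sup_bound` requires in
order to bound the function and its gradient. -/
theorem exists_reg_bound (hab : ∀ l, a l < b l) (N : NNReal) : ∃ K : ℝ, 0 ≤ K ∧
    ∀ V : Fin (k + 1) → Pt n → ℝ, Reg a b N V → ∀ᵐ x ∂(volume.restrict (box a b)),
      (∀ i, |jets (box a b) V x i none| ≤ K) ∧ ∀ i l, |jets (box a b) V x i (some (.inl l))| ≤ K := by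
  obtain ⟨C, hC⟩ := exists_sup_bound hab (k := n / 2) (by omega)
  refine ⟨C * N, by positivity, fun V hV => ?_⟩
  have key : ∀ i ι, ∑ l, jbeta (n := n) ι l ≤ 1 → ∀ᵐ x ∂(volume.restrict (box a b)),
      |jets (box a b) V x i ι| ≤ C * N := by
    intro i ι hι
    have h1 := hC _ N ((hV.mem i).hk (hV.bound i) (n / 2 + 1) (jbeta ι) (by unfold mInd; omega))
    filter_upwards [h1, jetOf_ae (isOpen_box a b) (hV.mem i).1 ι] with x hx hx'
    rw [jets, hx']
    have : ENNReal.ofReal |weakDeriv (box a b) (jbeta ι) (V i) x| ≤ ENNReal.ofReal (C * N) := by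
      rw [← Real.norm_eq_abs, ofReal_norm, ENNReal.ofReal_mul C.coe_nonneg, ENNReal.ofReal_coe_nnreal,
        ENNReal.ofReal_coe_nnreal]
      exact hx
    exact (ENNReal.ofReal_le_ofReal_iff (by positivity)).1 this
  have h0 := ae_all_iff.2 fun i => key i none (by simp [jbeta])
  have h1 := ae_all_iff.2 fun i => ae_all_iff.2 fun l => key i (some (.inl l)) (by simp [jbeta])
  filter_upwards [h0, h1] with x hx hx'
  exact ⟨hx, hx'⟩

theorem memLp_jets {V : Fin (k + 1) → Pt n → ℝ} (hV : ∀ i, MemSobolev (box a b) (mInd n) (V i))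
    (i : Fin (k + 1)) (ι : JIdx n) :
    MemLp (fun x => jets (box a b) V x i ι) 2 (volume.restrict (box a b)) :=
  (hV i).memLp_jetOf (isOpen_box a b) (two_le_mInd n) ι

theorem jets_sub_ae {V W : Fin (k + 1) → Pt n → ℝ} (hV : ∀ i, MemSobolev (box a b) (mInd n) (V i))
    (hW : ∀ i, MemSobolev (box a b) (mInd n) (W i)) : ∀ᵐ x ∂(volume.restrict (box a b)), ∀ i ι,
      jets (box a b) (fun i x => V i x - W i x) x i ι = jets (box a b) V x i ι - jets (box a b) W x i ι :=
  ae_all_iff.2 fun i => ae_all_iff.2 fun ι =>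
    (hV i).jetOf_sub (isOpen_box a b) (two_le_mInd n) (hW i) ι

theorem jets_midpoint_ae {V W : Fin (k + 1) → Pt n → ℝ} (hV : ∀ i, MemSobolev (box a b) (mInd n) (V i))
    (hW : ∀ i, MemSobolev (box a b) (mInd n) (W i)) : ∀ᵐ x ∂(volume.restrict (box a b)), ∀ i ι,
      jets (box a b) (fun i x => 1 / 2 * V i x + 1 / 2 * W i x) x i ι =
        1 / 2 * jets (box a b) V x i ι + 1 / 2 * jets (box a b) W x i ι :=
  ae_all_iff.2 fun i => ae_all_iff.2 fun ι =>
    (hV i).jetOf_comb (isOpen_box a b) (two_le_mInd n) (hW i) _ _ ι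

theorem aestronglyMeasurable_Lop (ε h : ℝ) {V : Fin (k + 1) → Pt n → ℝ}
    (hV : ∀ i, MemSobolev (box a b) (mInd n) (V i)) (i : Fin (k + 1)) :
    AEStronglyMeasurable (Lop (box a b) ε h V i) (volume.restrict (box a b)) := by
  have hj : ∀ i ι, AEStronglyMeasurable (fun x => jets (box a b) V x i ι) (volume.restrict (box a b)) :=
    fun i ι => (memLp_jets hV i ι).1
  have ho : ∀ l : Fin n, AEStronglyMeasurable (pderiv l (wEps ε)) (volume.restrict (box a b)) :=
    fun l => (contDiff_pderiv (contDiff_wEps ε) l).continuous.aestronglyMeasurable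
  have e : Lop (box a b) ε h V i = fun x => opV (fun l => pderiv l (wEps ε) x) h (jets (box a b) V x) i := by
    ext x; exact Lop_eq _ _ _ _ _ _
  rw [e]
  unfold opV lapV linV bilV
  refine AEStronglyMeasurable.add (.add ?_ (.sub ?_ ?_)) ?_
  · exact Finset.aestronglyMeasurable_fun_sum _ fun l _ => hj i _
  · exact (Finset.aestronglyMeasurable_fun_sum _ fun l _ => (hj i _).mul (ho l)).const_mul _
  · unfold dt
    simp only [div_eq_mul_inv]
    split_ifs
    · exact AEStronglyMeasurable.mul_const ((hj _ _).sub (hj _ _)) _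
    · exact AEStronglyMeasurable.mul_const
        (((((hj _ _).const_mul _).sub (hj _ _)).sub (hj _ _)).sub (hj _ _)) _
  · exact (Finset.aestronglyMeasurable_fun_sum _ fun l _ => (hj i _).mul
      (Finset.aestronglyMeasurable_fun_sum _ fun j _ => hj j _)).const_mul _

/-- The quadratic gradient term is bounded, so the operator differs from a square integrable
Laplacian by a bounded function. -/
theorem memLp_Lop (hab : ∀ l, a l < b l) {ε h : ℝ} (hh : 0 < h) {N : NNReal} {V : Fin (k + 1) → Pt n → ℝ}
    (hV : Reg a b N V) (i : Fin (k + 1)) :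
    MemLp (Lop (box a b) ε h V i) 2 (volume.restrict (box a b)) := by
  obtain ⟨K₁, hK₁, H₁⟩ := exists_reg_bound (k := k) hab N
  obtain ⟨K₂, hK₂, H₂⟩ := exists_bound_pderiv_wEps ε a b
  set K := max K₁ K₂
  have hK : 0 ≤ K := hK₁.trans (le_max_left _ _)
  have hlap : MemLp (fun x => |lapV (jets (box a b) V x i)| +
      remC k h K * ((k + 1) * ((n + 1) * K))) 2 (volume.restrict (box a b)) :=
    (memLp_finsetSum _ fun l _ => memLp_jets hV.mem i _).abs.add (memLp_const _)
  refine hlap.mono' (aestronglyMeasurable_Lop ε h hV.mem i) ?_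
  filter_upwards [H₁ V hV, ae_restrict_mem (measurableSet_box a b)] with x hx hxb
  rw [Lop_eq, Real.norm_eq_abs]
  exact abs_opV_le hh hK (fun l => (H₂ x hxb l).trans (le_max_right _ _)) _
    (fun j => (hx.1 j).trans (le_max_left _ _)) (fun j l => (hx.2 j l).trans (le_max_left _ _)) i

variable [NeZero n]

/-- The weighted residual functional. -/
noncomputable def resF (a b : Fin n → ℝ) (ε h lam : ℝ) (V : Fin (k + 1) → Pt n → ℝ) : ℝ :=
  ∑ i, wint a b (Lop (box a b) ε h V i) (Lop (box a b) ε h V i) (mon lam 0)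

/-- The weighted norm of the Laplacian. -/
noncomputable def lapF (a b : Fin n → ℝ) (lam : ℝ) (U : Fin (k + 1) → Pt n → ℝ) : ℝ :=
  ∑ i, wint a b (jlap (jetOf (box a b) (U i))) (jlap (jetOf (box a b) (U i))) (mon lam 0)

theorem mon_zero_nonneg (lam t : ℝ) : 0 ≤ mon lam 0 t := by
  unfold mon; positivity

theorem lapF_nonneg (lam : ℝ) (U : Fin (k + 1) → Pt n → ℝ) : 0 ≤ lapF a b lam U :=
  Finset.sum_nonneg fun _ _ => wint_self_nonneg _ fun _ _ => mon_zero_nonneg _ _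

theorem integrable_low {U : Fin (k + 1) → Pt n → ℝ} (hU : ∀ i, MemSobolev (box a b) (mInd n) (U i))
    (lam : ℝ) : Integrable (fun x => lowV (jets (box a b) U x) * mon lam 0 (x 0))
      (volume.restrict (box a b)) := by
  have hc := (contDiff_mon lam 0).continuous
  have e : (fun x : Pt n => lowV (jets (box a b) U x) * mon lam 0 (x 0)) = fun x =>
      ∑ j, jets (box a b) U x j none * jets (box a b) U x j none * mon lam 0 (x 0) +
      ∑ j, ∑ l, jets (box a b) U x j (some (.inl l)) * jets (box a b) U x j (some (.inl l)) * mon lam 0 (x 0) := by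
    ext x; simp only [lowV, gradV, add_mul, Finset.sum_mul, sq]
  rw [e]
  exact (integrable_finsetSum _ fun j _ => integrable_wint (memLp_jets hU j _) (memLp_jets hU j _) hc).add
    (integrable_finsetSum _ fun j _ => integrable_finsetSum _ fun l _ =>
      integrable_wint (memLp_jets hU j _) (memLp_jets hU j _) hc)

theorem integral_low_eq {U : Fin (k + 1) → Pt n → ℝ} (hU : ∀ i, MemSobolev (box a b) (mInd n) (U i))
    (lam : ℝ) : ∫ x in box a b, lowV (jets (box a b) U x) * mon lam 0 (x 0) =
      ∑ j, wint a b (jetOf (box a b) (U j) none) (jetOf (box a b) (U j) none) (mon lam 0) +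
      ∑ j, ∑ l, wint a b (jetOf (box a b) (U j) (some (.inl l))) (jetOf (box a b) (U j) (some (.inl l)))
        (mon lam 0) := by
  have hc := (contDiff_mon lam 0).continuous
  have e : (fun x : Pt n => lowV (jets (box a b) U x) * mon lam 0 (x 0)) = fun x =>
      ∑ j, jets (box a b) U x j none * jets (box a b) U x j none * mon lam 0 (x 0) +
      ∑ j, ∑ l, jets (box a b) U x j (some (.inl l)) * jets (box a b) U x j (some (.inl l)) * mon lam 0 (x 0) := by
    ext x; simp only [lowV, gradV, add_mul, Finset.sum_mul, sq]
  have i1 : ∀ j ι, Integrable (fun x => jets (box a b) U x j ι * jets (box a b) U x j ι * mon lam 0 (x 0))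
      (volume.restrict (box a b)) := fun j ι =>
    integrable_wint (memLp_jets hU j ι) (memLp_jets hU j ι) hc
  rw [e, integral_add (integrable_finsetSum _ fun j _ => i1 j _)
    (integrable_finsetSum _ fun j _ => integrable_finsetSum _ fun l _ => i1 j _),
    integral_finsetSum _ fun j _ => i1 j _,
    integral_finsetSum _ fun j _ => integrable_finsetSum _ fun l _ => i1 j _]
  congr 1
  exact Finset.sum_congr rfl fun j _ => integral_finsetSum _ fun l _ => i1 j _

/-- The Carleman estimate for vector functions. -/
theorem exists_carleman_vec (hab : ∀ l, a l < b l) (ha : 0 < a 0) (k : ℕ) : ∃ C : ℝ, 0 < C ∧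
    ∀ lam : ℝ, 1 ≤ lam → ∀ U : Fin (k + 1) → Pt n → ℝ,
      (∀ i, MemSobolev (box a b) (mInd n) (U i)) → (∀ i, AdmN a b (jetOf (box a b) (U i))) →
      lam * (∫ x in box a b, lowV (jets (box a b) U x) * mon lam 0 (x 0)) ≤ C * lapF a b lam U ∧
      ∀ i, ∀ ι, wint a b (jetOf (box a b) (U i) ι) (jetOf (box a b) (U i) ι) (mon lam 0) ≤
        C * lam * lapF a b lam U := by
  obtain ⟨C, hC, H⟩ := exists_carleman hab ha
  refine ⟨2 * C, by positivity, fun lam hl U hm hU => ?_⟩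
  have hnn : ∀ f : Pt n → ℝ, 0 ≤ wint a b f f (mon lam 0) := fun f =>
    wint_self_nonneg _ fun _ _ => mon_zero_nonneg _ _
  have hl0 : 0 < lam := by linarith
  have hl1 : 1 ≤ lam ^ 2 := one_le_pow₀ hl
  have hL0 := lapF_nonneg (a := a) (b := b) lam U
  have hnone : ∀ i, lam * wint a b (jetOf (box a b) (U i) none) (jetOf (box a b) (U i) none) (mon lam 0) ≤
      C * wint a b (jlap (jetOf (box a b) (U i))) (jlap (jetOf (box a b) (U i))) (mon lam 0) := by
    intro i
    refine le_trans ?_ (H lam hl _ (hU i)).1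
    have := hnn (jetOf (box a b) (U i) none)
    calc _ = lam * 1 * wint a b (jetOf (box a b) (U i) none) (jetOf (box a b) (U i) none) (mon lam 0) := by ring
      _ ≤ lam * lam ^ 2 * wint a b (jetOf (box a b) (U i) none) (jetOf (box a b) (U i) none) (mon lam 0) := by
        gcongr
      _ = _ := by ring
  constructor
  · rw [integral_low_eq hm, mul_add]
    have h1 := Finset.sum_le_sum fun i (_ : i ∈ Finset.univ) => hnone i
    have h2 := Finset.sum_le_sum fun i (_ : i ∈ Finset.univ) => (H lam hl _ (hU i)).2.1
    rw [← Finset.mul_sum, ← Finset.mul_sum] at h1 h2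
    unfold lapF
    linarith
  · intro i ι
    have hi : wint a b (jlap (jetOf (box a b) (U i))) (jlap (jetOf (box a b) (U i))) (mon lam 0) ≤
        lapF a b lam U := Finset.single_le_sum
      (f := fun i => wint a b (jlap (jetOf (box a b) (U i))) (jlap (jetOf (box a b) (U i))) (mon lam 0))
      (fun _ _ => hnn _) (Finset.mem_univ i)
    have hCL : C * wint a b (jlap (jetOf (box a b) (U i))) (jlap (jetOf (box a b) (U i))) (mon lam 0) ≤
        C * lapF a b lam U := mul_le_mul_of_nonneg_left hi hC.le
    have hCl : C * lapF a b lam U ≤ 2 * C * lam * lapF a b lam U := by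
      have : 0 ≤ C * lapF a b lam U := by positivity
      nlinarith
    have hlow : ∀ f : Pt n → ℝ, lam * wint a b f f (mon lam 0) ≤ C * lapF a b lam U →
        wint a b f f (mon lam 0) ≤ 2 * C * lam * lapF a b lam U := by
      intro f hf
      have := hnn f
      nlinarith
    rcases ι with _ | l | ⟨l, j⟩
    · exact hlow _ ((hnone i).trans hCL)
    · refine hlow _ (le_trans ?_ (((H lam hl _ (hU i)).2.1).trans hCL))
      exact mul_le_mul_of_nonneg_left (Finset.single_le_sum
        (f := fun l => wint a b (jetOf (box a b) (U i) (some (.inl l)))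
          (jetOf (box a b) (U i) (some (.inl l))) (mon lam 0)) (fun _ _ => hnn _) (Finset.mem_univ l)) hl0.le
    · have h3 := (H lam hl _ (hU i)).2.2
      have h4 : wint a b (jetOf (box a b) (U i) (some (.inr (l, j))))
          (jetOf (box a b) (U i) (some (.inr (l, j)))) (mon lam 0) ≤
          ∑ l, ∑ j, wint a b (jetOf (box a b) (U i) (some (.inr (l, j))))
            (jetOf (box a b) (U i) (some (.inr (l, j)))) (mon lam 0) :=
        (Finset.single_le_sum (f := fun j => wint a b (jetOf (box a b) (U i) (some (.inr (l, j))))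
            (jetOf (box a b) (U i) (some (.inr (l, j)))) (mon lam 0)) (fun _ _ => hnn _)
            (Finset.mem_univ j)).trans
          (Finset.single_le_sum (f := fun l => ∑ j, wint a b (jetOf (box a b) (U i) (some (.inr (l, j))))
            (jetOf (box a b) (U i) (some (.inr (l, j)))) (mon lam 0))
            (fun _ _ => Finset.sum_nonneg fun _ _ => hnn _) (Finset.mem_univ l))
      refine h4.trans (h3.trans ?_)
      have : C * lam * wint a b (jlap (jetOf (box a b) (U i))) (jlap (jetOf (box a b) (U i))) (mon lam 0) ≤
        C * lam * lapF a b lam U := mul_le_mul_of_nonneg_left hi (by positivity)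
      have h5 : 0 ≤ C * lam * lapF a b lam U := by positivity
      linarith

end Operators


/-! ### Convexity of the weighted residual and its control of the error. -/

section Convexity

variable {n k : ℕ} {a b : Fin n → ℝ}

theorem Reg.midpoint {N : NNReal} {V W : Fin (k + 1) → Pt n → ℝ} (hV : Reg a b N V) (hW : Reg a b N W) :
    Reg a b N (fun i x => 1 / 2 * V i x + 1 / 2 * W i x) := by
  refine ⟨fun i => (hV.mem i).comb (hW.mem i) _ _, fun i => ?_⟩
  rw [sobolevNormSq_midpoint (isOpen_box a b) (hV.mem i) (hW.mem i)]
  have := hV.bound i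
  have := hW.bound i
  have := sobolevNormSq_nonneg (box a b) (mInd n) (fun x => V i x - W i x)
  linarith

theorem abs_lapV_le (p : JIdx n → ℝ) : |lapV p| ≤ ∑ l, |p (some (.inr (l, l)))| :=
  Finset.abs_sum_le_sum_abs _ _

theorem integral_comb_le {α : Type*} [MeasurableSpace α] {μ : Measure α} {f₁ f₂ f₃ f₄ f₅ f₆ : α → ℝ}
    (h₁ : Integrable f₁ μ) (h₂ : Integrable f₂ μ) (h₃ : Integrable f₃ μ) (h₄ : Integrable f₄ μ)
    (h₅ : Integrable f₅ μ) (h₆ : Integrable f₆ μ) (r s t u v : ℝ)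
    (h : ∀ᵐ x ∂μ, f₁ x + r * f₂ x - s * f₃ x - t * f₄ x ≤ u * f₅ x + v * f₆ x) :
    ∫ x, f₁ x ∂μ + r * (∫ x, f₂ x ∂μ) - s * (∫ x, f₃ x ∂μ) - t * (∫ x, f₄ x ∂μ) ≤
      u * (∫ x, f₅ x ∂μ) + v * (∫ x, f₆ x ∂μ) := by
  have i1 : Integrable (fun x => f₁ x + r * f₂ x) μ := h₁.add (h₂.const_mul r)
  have i2 : Integrable (fun x => f₁ x + r * f₂ x - s * f₃ x) μ := i1.sub (h₃.const_mul s)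
  have i3 : Integrable (fun x => f₁ x + r * f₂ x - s * f₃ x - t * f₄ x) μ := i2.sub (h₄.const_mul t)
  have i4 : Integrable (fun x => u * f₅ x + v * f₆ x) μ := (h₅.const_mul u).add (h₆.const_mul v)
  have := integral_mono_ae i3 i4 h
  rwa [integral_sub i2 (h₄.const_mul t), integral_sub i1 (h₃.const_mul s),
    integral_add h₁ (h₂.const_mul r), integral_add (h₅.const_mul u) (h₆.const_mul v),
    integral_const_mul, integral_const_mul, integral_const_mul, integral_const_mul,
    integral_const_mul] at this

variable [NeZero n]

set_option maxHeartbeats 1000000 in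
/-- Convexity of the weighted residual functional for a large parameter. -/
theorem exists_resF_midpoint_le (hab : ∀ l, a l < b l) (ha : 0 < a 0) (ε : ℝ) {h : ℝ} (hh : 0 < h)
    (k : ℕ) (N : NNReal) : ∃ lam₁ : ℝ, 1 ≤ lam₁ ∧ ∀ lam : ℝ, lam₁ ≤ lam →
    ∀ V W : Fin (k + 1) → Pt n → ℝ, Reg a b N V → Reg a b N W →
      (∀ i, AdmN a b (jetOf (box a b) fun x => V i x - W i x)) →
      resF a b ε h lam (fun i x => 1 / 2 * V i x + 1 / 2 * W i x) ≤
        1 / 2 * resF a b ε h lam V + 1 / 2 * resF a b ε h lam W := by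
  obtain ⟨K₁, hK₁, H₁⟩ := exists_reg_bound (k := k) hab N
  obtain ⟨K₂, hK₂, H₂⟩ := exists_bound_pderiv_wEps ε a b
  obtain ⟨C₁, hC₁, HC⟩ := exists_carleman_vec hab ha k
  obtain ⟨C₂, hC₂, HF⟩ := exists_weighted_form_bound hab ha (k := n / 2) (by omega) N
  set K := max K₁ K₂
  have hK : 0 ≤ K := hK₁.trans (le_max_left _ _)
  set c₁ : ℝ := 1 / 4 * (remC k h K ^ 2 * (2 * ((k + 1) * (n + 1)))) +
    h * (k + 1) * (remC k h K * ((k + 1) * ((n + 1) * K))) with hc₁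
  have hc₁0 : 0 ≤ c₁ := by
    have := remC_nonneg k hh hK
    positivity
  set c₂ : ℝ := h * (k + 1) with hc₂
  have hc₂0 : 0 ≤ c₂ := by positivity
  set E : ℝ := (k + 1) * c₁ * C₁ + c₂ * ((k + 1) * n * C₂) with hE
  have hE0 : 0 ≤ E := by positivity
  -- All error terms together are at most E/√lam times the main term, which has coefficient 1/8;
  -- this threshold ensures √lam ≥ 1 + 8E.
  refine ⟨(1 + 8 * E) ^ 2, one_le_pow₀ (by linarith), fun lam hlam V W hV hW hU => ?_⟩
  have hl1 : 1 ≤ lam := (one_le_pow₀ (by linarith)).trans hlam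
  have hl0 : 0 < lam := by linarith
  set s := Real.sqrt lam with hs
  have hs1 : 1 + 8 * E ≤ s := Real.le_sqrt_of_sq_le hlam
  have hsp : 0 < s := by linarith
  have hss : s * s = lam := Real.mul_self_sqrt hl0.le
  set U : Fin (k + 1) → Pt n → ℝ := fun i x => V i x - W i x with hUdef
  set M : Fin (k + 1) → Pt n → ℝ := fun i x => 1 / 2 * V i x + 1 / 2 * W i x with hMdef
  have hM : Reg a b N M := hV.midpoint hW
  have hUm : ∀ i, MemSobolev (box a b) (mInd n) (U i) := fun i => (hV.mem i).sub (hW.mem i)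
  have hc := (contDiff_mon lam 0).continuous
  have hT0 : ∀ t, 0 ≤ mon lam 0 t := mon_zero_nonneg lam
  have hae := jets_sub_ae hV.mem hW.mem
  have hae' := jets_midpoint_ae hV.mem hW.mem
  -- integrability of the cubic terms
  have hsq : ∀ j l, MemLp (fun x => jets (box a b) U x j (some (.inl l)) ^ 2 * mon lam 0 (x 0)) 2
      (volume.restrict (box a b)) := by
    intro j l
    refine memLp_mul_coord (u := fun x => jets (box a b) U x j (some (.inl l)) ^ 2) ?_ hc
    have hj := memLp_jets hUm j (some (.inl l))
    refine MemLp.of_le_mul (c := 2 * K) hj (hj.1.pow 2) ?_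
    filter_upwards [H₁ V hV, H₁ W hW, hae] with x h1 h2 h3
    rw [Real.norm_eq_abs, Real.norm_eq_abs, abs_pow, sq]
    refine mul_le_mul_of_nonneg_right ?_ (abs_nonneg _)
    rw [h3]
    refine (abs_sub _ _).trans ?_
    linarith [h1.2 j l, h2.2 j l, le_max_left K₁ K₂]
  have hcub : ∀ i l' j l, Integrable (fun x => |jets (box a b) M x i (some (.inr (l', l')))| *
      (jets (box a b) U x j (some (.inl l)) ^ 2 * mon lam 0 (x 0))) (volume.restrict (box a b)) :=
    fun i l' j l => integrable_mul_of_memLp (memLp_jets hM.mem i _).abs (hsq j l)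
  set Tr : Fin (k + 1) → ℝ := fun i => ∑ l', ∑ j, ∑ l, ∫ x in box a b,
    |jets (box a b) M x i (some (.inr (l', l')))| *
      (jets (box a b) U x j (some (.inl l)) ^ 2 * mon lam 0 (x 0)) with hTr
  set Low := ∫ x in box a b, lowV (jets (box a b) U x) * mon lam 0 (x 0) with hLow
  have hi : ∀ i, wint a b (Lop (box a b) ε h M i) (Lop (box a b) ε h M i) (mon lam 0) +
      1 / 8 * wint a b (jlap (jetOf (box a b) (U i))) (jlap (jetOf (box a b) (U i))) (mon lam 0) -
      c₁ * Low - c₂ * Tr i ≤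
      1 / 2 * wint a b (Lop (box a b) ε h V i) (Lop (box a b) ε h V i) (mon lam 0) +
      1 / 2 * wint a b (Lop (box a b) ε h W i) (Lop (box a b) ε h W i) (mon lam 0) := by
    intro i
    have iM := integrable_wint (memLp_Lop (ε := ε) hab hh hM i) (memLp_Lop (ε := ε) hab hh hM i) hc
    have iV := integrable_wint (memLp_Lop (ε := ε) hab hh hV i) (memLp_Lop (ε := ε) hab hh hV i) hc
    have iW := integrable_wint (memLp_Lop (ε := ε) hab hh hW i) (memLp_Lop (ε := ε) hab hh hW i) hc
    have hjl : MemLp (jlap (jetOf (box a b) (U i))) 2 (volume.restrict (box a b)) :=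
      memLp_jlap fun ι => memLp_jets hUm i ι
    have iL := integrable_wint hjl hjl hc
    have iLow := integrable_low hUm lam
    have iT : Integrable (fun x => ∑ l', ∑ j, ∑ l, |jets (box a b) M x i (some (.inr (l', l')))| *
        (jets (box a b) U x j (some (.inl l)) ^ 2 * mon lam 0 (x 0))) (volume.restrict (box a b)) :=
      integrable_finsetSum _ fun l' _ => integrable_finsetSum _ fun j _ =>
        integrable_finsetSum _ fun l _ => hcub i l' j l
    have eT : Tr i = ∫ x in box a b, ∑ l', ∑ j, ∑ l, |jets (box a b) M x i (some (.inr (l', l')))| *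
        (jets (box a b) U x j (some (.inl l)) ^ 2 * mon lam 0 (x 0)) := by
      rw [integral_finsetSum _ fun l' _ => integrable_finsetSum _ fun j _ =>
        integrable_finsetSum _ fun l _ => hcub i l' j l]
      refine Finset.sum_congr rfl fun l' _ => ?_
      rw [integral_finsetSum _ fun j _ => integrable_finsetSum _ fun l _ => hcub i l' j l]
      refine Finset.sum_congr rfl fun j _ => ?_
      rw [integral_finsetSum _ fun l _ => hcub i l' j l]
    rw [eT, hLow]
    refine integral_comb_le iM iL iLow iT iV iW _ _ _ _ _ ?_
    filter_upwards [H₁ M hM, hae, hae', ae_restrict_mem (measurableSet_box a b)] with x h1 h3 h4 hx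
    have hb := opV_convex_bound hh hK (fun l => (H₂ x hx l).trans (le_max_right _ _))
      (jets (box a b) V x) (jets (box a b) W x) (jets (box a b) M x) (jets (box a b) U x) h4 h3
      (fun j => (h1.1 j).trans (le_max_left _ _)) (fun j l => (h1.2 j l).trans (le_max_left _ _)) i
    rw [← Lop_eq, ← Lop_eq, ← Lop_eq] at hb
    have hT := hT0 (x 0)
    have hg : 0 ≤ gradV (jets (box a b) U x) :=
      Finset.sum_nonneg fun _ _ => Finset.sum_nonneg fun _ _ => sq_nonneg _
    have hlap : |lapV (jets (box a b) M x i)| * gradV (jets (box a b) U x) * mon lam 0 (x 0) ≤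
        ∑ l', ∑ j, ∑ l, |jets (box a b) M x i (some (.inr (l', l')))| *
        (jets (box a b) U x j (some (.inl l)) ^ 2 * mon lam 0 (x 0)) := by
      refine (mul_le_mul_of_nonneg_right (mul_le_mul_of_nonneg_right
        (abs_lapV_le (jets (box a b) M x i)) hg) hT).trans_eq ?_
      rw [Finset.sum_mul, Finset.sum_mul]
      refine Finset.sum_congr rfl fun l' _ => ?_
      rw [gradV, Finset.mul_sum, Finset.sum_mul]
      refine Finset.sum_congr rfl fun j _ => ?_
      rw [Finset.mul_sum, Finset.sum_mul]
      exact Finset.sum_congr rfl fun l _ => by ring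
    have hb2 := mul_le_mul_of_nonneg_right hb hT
    have hlap2 := mul_le_mul_of_nonneg_left hlap hc₂0
    change _ + 1 / 8 * (lapV (jets (box a b) U x i) * lapV (jets (box a b) U x i) * mon lam 0 (x 0)) - _ - _ ≤ _
    simp only [← hc₁, ← hc₂] at hb2
    linarith only [hb2, hlap2]
  have hsum := Finset.sum_le_sum fun i (_ : i ∈ Finset.univ) => hi i
  simp only [Finset.sum_sub_distrib, Finset.sum_add_distrib, ← Finset.mul_sum, Finset.sum_const,
    Finset.card_univ, Fintype.card_fin, nsmul_eq_mul] at hsum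
  change resF a b ε h lam M + 1 / 8 * lapF a b lam U - _ - _ ≤ 1 / 2 * resF a b ε h lam V +
    1 / 2 * resF a b ε h lam W at hsum
  have hL0 := lapF_nonneg (a := a) (b := b) lam U
  set L := lapF a b lam U with hL
  have hlow := (HC lam hl1 U hUm hU).1
  -- Each second derivative of the midpoint lies in H^{[n/2]} with norm controlled by N, since m_n −
  -- 2 = [n/2]. The weighted form bound applies and gains the factor `s`.
  have hTrb : s * ∑ i, Tr i ≤ (k + 1) * n * C₂ * L := by
    have h1 : ∀ i l' j, s * ∑ l, ∫ x in box a b, |jets (box a b) M x i (some (.inr (l', l')))| *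
        (jets (box a b) U x j (some (.inl l)) ^ 2 * mon lam 0 (x 0)) ≤
        C₂ * wint a b (jlap (jetOf (box a b) (U j))) (jlap (jetOf (box a b) (U j))) (mon lam 0) := by
      intro i l' j
      exact HF lam hl1 (weakDeriv (box a b) (Pi.single l' 1 + Pi.single l' 1) (M i)) ((hM.mem i).hk (hM.bound i) (n / 2) (Pi.single l' 1 + Pi.single l' 1) (by
        rw [sum_add_single]; simp [mInd]; omega)) _ (hU j) fun i' j' =>
          (hUm j).hasWD_second (two_le_mInd n) i' j'
    rw [hTr, Finset.mul_sum]
    have h2 : ∀ i, s * (∑ l', ∑ j, ∑ l, ∫ x in box a b, |jets (box a b) M x i (some (.inr (l', l')))| *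
        (jets (box a b) U x j (some (.inl l)) ^ 2 * mon lam 0 (x 0))) ≤ n * (C₂ * L) := by
      intro i
      rw [Finset.mul_sum]
      refine (Finset.sum_le_sum (g := fun _ => C₂ * L) fun l' _ => ?_).trans_eq (by simp)
      rw [Finset.mul_sum, hL, lapF, Finset.mul_sum]
      exact Finset.sum_le_sum fun j _ => h1 i l' j
    refine (Finset.sum_le_sum fun i _ => h2 i).trans_eq ?_
    simp; ring
  have hLow0 : 0 ≤ Low := setIntegral_nonneg (measurableSet_box a b) fun x _ =>
    mul_nonneg (add_nonneg (Finset.sum_nonneg fun _ _ => sq_nonneg _)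
      (Finset.sum_nonneg fun _ _ => Finset.sum_nonneg fun _ _ => sq_nonneg _)) (hT0 _)
  have hsl : s ≤ lam := by rw [← hss]; exact le_mul_of_one_le_left hsp.le (by linarith)
  have h1 : s * Low ≤ C₁ * L := (mul_le_mul_of_nonneg_right hsl hLow0).trans hlow
  have h2 : s * ((k + 1) * c₁ * Low + c₂ * ∑ i, Tr i) ≤ E * L := by
    have e1 := mul_le_mul_of_nonneg_left h1 (show 0 ≤ (k + 1) * c₁ by positivity)
    have e2 := mul_le_mul_of_nonneg_left hTrb hc₂0
    rw [hE]; linarith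
  -- The errors are absorbed by the Laplacian term.
  have h3 : (k + 1) * c₁ * Low + c₂ * ∑ i, Tr i ≤ 1 / 8 * L := by
    have h4 : E * L ≤ s * (1 / 8 * L) := by
      have := mul_le_mul_of_nonneg_right (show E ≤ s * (1 / 8) by linarith) hL0
      linarith only [this]
    exact le_of_mul_le_mul_left (h2.trans h4) hsp
  push_cast at hsum
  linarith

/-- Lipschitz dependence of the operators on the vector function. -/
theorem exists_integral_Lop_sub_le (hab : ∀ l, a l < b l) (ε : ℝ) {h : ℝ} (hh : 0 < h) (k : ℕ)
    (N : NNReal) : ∃ C : ℝ, 0 ≤ C ∧ ∀ V W : Fin (k + 1) → Pt n → ℝ, Reg a b N V → Reg a b N W →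
      ∀ i, ∫ x in box a b, (Lop (box a b) ε h V i x - Lop (box a b) ε h W i x) ^ 2 ≤
        C * vecNormSq (box a b) (mInd n) (fun i x => V i x - W i x) := by
  obtain ⟨K₁, hK₁, H₁⟩ := exists_reg_bound (k := k) hab N
  obtain ⟨K₂, hK₂, H₂⟩ := exists_bound_pderiv_wEps ε a b
  set K := max K₁ K₂
  have hK : 0 ≤ K := hK₁.trans (le_max_left _ _)
  set c := 2 * (remC k h K ^ 2 * (2 * (((k : ℝ) + 1) * (n + 1)))) with hc
  have hc0 : 0 ≤ c := by positivity
  refine ⟨2 * (n * n) + c * ((k + 1) + (k + 1) * n), by positivity, fun V W hV hW i => ?_⟩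
  set U : Fin (k + 1) → Pt n → ℝ := fun i x => V i x - W i x with hUdef
  have hUm : ∀ i, MemSobolev (box a b) (mInd n) (U i) := fun i => (hV.mem i).sub (hW.mem i)
  set Q := vecNormSq (box a b) (mInd n) U
  have hjQ : ∀ j ι, wint a b (jetOf (box a b) (U j) ι) (jetOf (box a b) (U j) ι) (mon 0 0) ≤ Q := by
    intro j ι
    have e : wint a b (jetOf (box a b) (U j) ι) (jetOf (box a b) (U j) ι) (mon 0 0) =
        ∫ x in box a b, jetOf (box a b) (U j) ι x ^ 2 := by
      unfold wint; congr 1; ext x; simp [mon]; ring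
    rw [e]
    exact ((hUm j).integral_jetOf_sq_le (isOpen_box a b) (two_le_mInd n) ι).trans
      (sobolevNormSq_le_vecNormSq (mInd n) U j)
  have hjl : MemLp (jlap (jetOf (box a b) (U i))) 2 (volume.restrict (box a b)) :=
    memLp_jlap fun ι => memLp_jets hUm i ι
  have iL := hjl.integrable_sq
  have iLow := integrable_low hUm 0
  have iD := ((memLp_Lop (ε := ε) hab hh hV i).sub (memLp_Lop (ε := ε) hab hh hW i)).integrable_sq
  have h1 : ∫ x in box a b, (Lop (box a b) ε h V i x - Lop (box a b) ε h W i x) ^ 2 ≤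
      2 * (∫ x in box a b, jlap (jetOf (box a b) (U i)) x ^ 2) +
        c * ∫ x in box a b, lowV (jets (box a b) U x) * mon 0 0 (x 0) := by
    rw [← integral_const_mul, ← integral_const_mul, ← integral_add (iL.const_mul _) (iLow.const_mul _)]
    refine integral_mono_ae iD ((iL.const_mul _).add (iLow.const_mul _)) ?_
    filter_upwards [H₁ V hV, H₁ W hW, jets_sub_ae hV.mem hW.mem,
      ae_restrict_mem (measurableSet_box a b)] with x h1 h2 h3 hx
    have := (lapV_sq_le hh hK (fun l => (H₂ x hx l).trans (le_max_right _ _))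
      (jets (box a b) V x) (jets (box a b) W x) (jets (box a b) U x) h3
      (fun j l => (h1.2 j l).trans (le_max_left _ _))
      (fun j l => (h2.2 j l).trans (le_max_left _ _)) i).2
    rw [← Lop_eq, ← Lop_eq] at this
    have e : mon 0 0 (x 0) = 1 := by simp [mon]
    change _ ≤ 2 * lapV (jets (box a b) U x i) ^ 2 + c * (lowV (jets (box a b) U x) * mon 0 0 (x 0))
    rw [e, mul_one]
    exact this
  have h2 : ∫ x in box a b, jlap (jetOf (box a b) (U i)) x ^ 2 ≤ n * n * Q := by
    have i2 : ∀ l, Integrable (fun x => jetOf (box a b) (U i) (some (.inr (l, l))) x ^ 2)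
      (volume.restrict (box a b)) := fun l => (memLp_jets hUm i _).integrable_sq
    calc _ ≤ ∫ x in box a b, (n : ℝ) * ∑ l, jetOf (box a b) (U i) (some (.inr (l, l))) x ^ 2 := by
          refine integral_mono iL ((integrable_finsetSum _ fun l _ => i2 l).const_mul _) fun x => ?_
          refine (sq_sum_le_card_mul_sum_sq).trans_eq ?_
          simp
      _ = n * ∑ l, ∫ x in box a b, jetOf (box a b) (U i) (some (.inr (l, l))) x ^ 2 := by
          rw [integral_const_mul, integral_finsetSum _ fun l _ => i2 l]
      _ ≤ n * ∑ l : Fin n, Q := by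
          gcongr with l _
          exact ((hUm i).integral_jetOf_sq_le (isOpen_box a b) (two_le_mInd n) _).trans
            (sobolevNormSq_le_vecNormSq (mInd n) U i)
      _ = _ := by simp; ring
  have h3 : ∫ x in box a b, lowV (jets (box a b) U x) * mon 0 0 (x 0) ≤ ((k + 1) + (k + 1) * n) * Q := by
    rw [integral_low_eq hUm]
    refine (add_le_add (Finset.sum_le_sum fun j _ => hjQ j _)
      (Finset.sum_le_sum fun j _ => Finset.sum_le_sum fun l _ => hjQ j _)).trans_eq ?_
    simp; ring
  have h4 := mul_le_mul_of_nonneg_left h3 hc0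
  nlinarith

/-- The weighted residual controls the Laplacian of the distance to an exact solution. -/
theorem exists_lapF_le (hab : ∀ l, a l < b l) (ha : 0 < a 0) (ε : ℝ) {h : ℝ} (hh : 0 < h)
    (k : ℕ) (N : NNReal) : ∃ lam₁ : ℝ, 1 ≤ lam₁ ∧ ∀ lam : ℝ, lam₁ ≤ lam →
    ∀ V W : Fin (k + 1) → Pt n → ℝ, Reg a b N V → Reg a b N W →
      (∀ i, AdmN a b (jetOf (box a b) fun x => V i x - W i x)) →
      (∀ i, ∀ᵐ x ∂(volume.restrict (box a b)), Lop (box a b) ε h W i x = 0) →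
      lapF a b lam (fun i x => V i x - W i x) ≤ 4 * resF a b ε h lam V := by
  obtain ⟨K₁, hK₁, H₁⟩ := exists_reg_bound (k := k) hab N
  obtain ⟨K₂, hK₂, H₂⟩ := exists_bound_pderiv_wEps ε a b
  obtain ⟨C₁, hC₁, HC⟩ := exists_carleman_vec hab ha k
  set K := max K₁ K₂
  have hK : 0 ≤ K := hK₁.trans (le_max_left _ _)
  set c := 2 * (remC k h K ^ 2 * (2 * (((k : ℝ) + 1) * (n + 1)))) with hc
  have hc0 : 0 ≤ c := by positivity
  -- The lower order terms are at most (k+1) c C₁ / lam times the left side; the threshold makes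
  -- this at most one half. No form bound is needed, as the difference of the operators has bounded
  -- coefficients in its lower order part.
  refine ⟨1 + 2 * ((k + 1) * c * C₁), by linarith [show 0 ≤ (k + 1) * c * C₁ by positivity],
    fun lam hlam V W hV hW hU hW0 => ?_⟩
  have hl1 : 1 ≤ lam := by linarith [show 0 ≤ (k + 1) * c * C₁ by positivity]
  set U : Fin (k + 1) → Pt n → ℝ := fun i x => V i x - W i x with hUdef
  have hUm : ∀ i, MemSobolev (box a b) (mInd n) (U i) := fun i => (hV.mem i).sub (hW.mem i)
  have hcont := (contDiff_mon lam 0).continuous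
  set Low := ∫ x in box a b, lowV (jets (box a b) U x) * mon lam 0 (x 0) with hLow
  have hi : ∀ i, wint a b (jlap (jetOf (box a b) (U i))) (jlap (jetOf (box a b) (U i))) (mon lam 0) ≤
      2 * wint a b (Lop (box a b) ε h V i) (Lop (box a b) ε h V i) (mon lam 0) + c * Low := by
    intro i
    have iV := integrable_wint (memLp_Lop (ε := ε) hab hh hV i) (memLp_Lop (ε := ε) hab hh hV i) hcont
    have hjl : MemLp (jlap (jetOf (box a b) (U i))) 2 (volume.restrict (box a b)) :=
      memLp_jlap fun ι => memLp_jets hUm i ι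
    have iL := integrable_wint hjl hjl hcont
    have iLow := integrable_low hUm lam
    unfold wint
    rw [hLow, ← integral_const_mul, ← integral_const_mul, ← integral_add (iV.const_mul _) (iLow.const_mul _)]
    refine integral_mono_ae iL ((iV.const_mul _).add (iLow.const_mul _)) ?_
    filter_upwards [H₁ V hV, H₁ W hW, jets_sub_ae hV.mem hW.mem, hW0 i,
      ae_restrict_mem (measurableSet_box a b)] with x h1 h2 h3 h4 hx
    have := (lapV_sq_le hh hK (fun l => (H₂ x hx l).trans (le_max_right _ _))
      (jets (box a b) V x) (jets (box a b) W x) (jets (box a b) U x) h3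
      (fun j l => (h1.2 j l).trans (le_max_left _ _))
      (fun j l => (h2.2 j l).trans (le_max_left _ _)) i).1
    rw [← Lop_eq, ← Lop_eq, h4, sub_zero] at this
    have h5 := mul_le_mul_of_nonneg_right this (mon_zero_nonneg lam (x 0))
    change lapV (jets (box a b) U x i) * lapV (jets (box a b) U x i) * mon lam 0 (x 0) ≤ _
    rw [← hc] at h5
    nlinarith
  have hsum := Finset.sum_le_sum fun i (_ : i ∈ Finset.univ) => hi i
  simp only [Finset.sum_add_distrib, ← Finset.mul_sum, Finset.sum_const,
    Finset.card_univ, Fintype.card_fin, nsmul_eq_mul] at hsum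
  change lapF a b lam U ≤ 2 * resF a b ε h lam V + _ at hsum
  have hlow := (HC lam hl1 U hUm hU).1
  rw [← hLow] at hlow
  have hL0 := lapF_nonneg (a := a) (b := b) lam U
  set L := lapF a b lam U
  push_cast at hsum
  have h1 : lam * ((k + 1) * (c * Low)) ≤ (k + 1) * c * C₁ * L := by
    have := mul_le_mul_of_nonneg_left hlow (show 0 ≤ ((k : ℝ) + 1) * c by positivity)
    linarith
  have h2 : (k + 1) * c * C₁ * L ≤ lam * (1 / 2 * L) := by
    have := mul_le_mul_of_nonneg_right (show (k + 1) * c * C₁ ≤ lam * (1 / 2) by linarith) hL0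
    linarith only [this]
  have h3 : ((k : ℝ) + 1) * (c * Low) ≤ 1 / 2 * L :=
    le_of_mul_le_mul_left (h1.trans h2) (by linarith)
  linarith

end Convexity


/-! ### Existence and uniqueness of the minimizer. -/

section Minimization

variable {n k : ℕ} {a b : Fin n → ℝ}

theorem vecNormSq_sub_comm {Ω : Set (Pt n)} (hΩ : IsOpen Ω) {m : ℕ} {V W : Fin (k + 1) → Pt n → ℝ}
    (hV : ∀ i, MemSobolev Ω m (V i)) (hW : ∀ i, MemSobolev Ω m (W i)) :
    vecNormSq Ω m (fun i x => V i x - W i x) = vecNormSq Ω m (fun i x => W i x - V i x) :=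
  Finset.sum_congr rfl fun i _ => sobolevNormSq_sub_comm hΩ (hV i) (hW i)

variable [NeZero n]

/-- The square of F_p is expanded about the limit: the quadratic remainder tends to zero because the
weight is bounded on the box, and the cross term by convergence against a fixed function. -/
theorem tendsto_wint_self {F : ℕ → Pt n → ℝ} {f : Pt n → ℝ}
    (hF : ∀ p, MemLp (F p) 2 (volume.restrict (box a b))) (hf : MemLp f 2 (volume.restrict (box a b)))
    (h : Filter.Tendsto (fun p => ∫ x in box a b, (F p x - f x) ^ 2) Filter.atTop (nhds 0))
    (lam : ℝ) :
    Filter.Tendsto (fun p => wint a b (F p) (F p) (mon lam 0)) Filter.atTop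
      (nhds (wint a b f f (mon lam 0))) := by
  have hc := (contDiff_mon lam 0).continuous
  obtain ⟨C, hC0, hC⟩ := exists_bound_of_continuous (isBounded_box a b) (continuous_coord (n := n) hc)
  have hd := fun p => (hF p).sub hf
  have h1 : Filter.Tendsto (fun p => wint a b (fun x => F p x - f x) (fun x => F p x - f x) (mon lam 0))
      Filter.atTop (nhds 0) := by
    have h2 := h.const_mul C
    rw [mul_zero] at h2
    refine tendsto_of_tendsto_of_tendsto_of_le_of_le tendsto_const_nhds h2
      (fun p => wint_self_nonneg _ fun _ _ => mon_zero_nonneg _ _) fun p => ?_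
    change wint a b (fun x => F p x - f x) (fun x => F p x - f x) (mon lam 0) ≤
      C * ∫ x in box a b, (F p x - f x) ^ 2
    rw [← integral_const_mul]
    refine setIntegral_mono_on (integrable_wint (hd p) (hd p) hc) ((hd p).integrable_sq.const_mul C)
      (measurableSet_box a b) fun x hx => ?_
    have := (abs_le.1 (hC x hx)).2
    change (F p x - f x) * (F p x - f x) * _ ≤ C * (F p x - f x) ^ 2
    nlinarith [sq_nonneg (F p x - f x)]
  have h2 := tendsto_integral_mul_of_l2 hF hf (memLp_mul_coord hf hc) h
  have h3 := (h1.add (h2.const_mul 2)).sub (tendsto_const_nhds (x := wint a b f f (mon lam 0)))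
  have e : ∀ g : Pt n → ℝ, ∫ x in box a b, g x * (f x * mon lam 0 (x 0)) = wint a b g f (mon lam 0) := by
    intro g; unfold wint; congr 1; ext x; ring
  simp only [e] at h3
  rw [show 0 + 2 * wint a b f f (mon lam 0) - wint a b f f (mon lam 0) = wint a b f f (mon lam 0) by ring] at h3
  refine h3.congr fun p => ?_
  have i1 := integrable_wint (hF p) (hF p) hc
  have i2 := integrable_wint (hF p) hf hc
  have i3 := integrable_wint hf hf hc
  have e2 : wint a b (fun x => F p x - f x) (fun x => F p x - f x) (mon lam 0) =
      wint a b (F p) (F p) (mon lam 0) - 2 * wint a b (F p) f (mon lam 0) + wint a b f f (mon lam 0) := by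
    have i4 : Integrable (fun x => F p x * F p x * mon lam 0 (x 0) -
      2 * (F p x * f x * mon lam 0 (x 0))) (volume.restrict (box a b)) := i1.sub (i2.const_mul 2)
    unfold wint
    rw [← integral_const_mul, ← integral_sub i1 (i2.const_mul 2), ← integral_add i4 i3]
    congr 1; ext x; ring
  rw [e2]; ring

theorem tendsto_sobolevNormSq {m : ℕ} {F : ℕ → Pt n → ℝ} {f : Pt n → ℝ}
    (hF : ∀ p, MemSobolev (box a b) m (F p)) (hf : MemSobolev (box a b) m f)
    (h : Filter.Tendsto (fun p => sobolevNormSq (box a b) m (fun x => F p x - f x)) Filter.atTop (nhds 0)) :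
    Filter.Tendsto (fun p => sobolevNormSq (box a b) m (F p)) Filter.atTop
      (nhds (sobolevNormSq (box a b) m f)) := by
  unfold sobolevNormSq
  refine tendsto_finsetSum _ fun j hj => tendsto_finsetSum _ fun β hβ => ?_
  have hβ' := sum_of_mem_range_piAntidiag hj hβ
  have e : ∀ g : Pt n → ℝ, wint a b g g (mon 0 0) = ∫ x in box a b, g x ^ 2 := by
    intro g; unfold wint; congr 1; ext x; simp [mon]; ring
  have := tendsto_wint_self (fun p => ((hF p).isWeakDeriv hβ').1) (hf.isWeakDeriv hβ').1 ?_ 0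
  · simpa only [e] using this
  · refine tendsto_of_tendsto_of_tendsto_of_le_of_le tendsto_const_nhds h
      (fun p => integral_nonneg fun _ => sq_nonneg _) fun p => ?_
    refine le_trans (le_of_eq (integral_congr_ae ?_)) (integral_weakDeriv_sq_le _ hβ')
    filter_upwards [(hF p).weakDeriv_sub (isOpen_box a b) hf hβ'] with x hx
    rw [hx]

/-- Bounded convex sets of vector functions with prescribed boundary data. -/
structure Feasible (a b : Fin n → ℝ) (N : NNReal) (S : Set (Fin (k + 1) → Pt n → ℝ)) : Prop where
  reg : ∀ V ∈ S, Reg a b N V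
  midpoint : ∀ V ∈ S, ∀ W ∈ S, (fun i x => 1 / 2 * V i x + 1 / 2 * W i x) ∈ S
  adm : ∀ V ∈ S, ∀ W ∈ S, ∀ i, AdmN a b (jetOf (box a b) fun x => V i x - W i x)

/-- The closure inherits midpoints and, by passage to L² limits, the weak boundary conditions. Only
a bound depending on N is needed, so the radius is allowed to grow. -/
theorem Feasible.closure {N : NNReal} {S : Set (Fin (k + 1) → Pt n → ℝ)} (hS : Feasible a b N S) :
    Feasible a b (2 * N + 1) (sobolevClosure (box a b) (mInd n) S) := by
  have hΩ := isOpen_box a b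
  refine ⟨fun V hV => ?_, fun V hV W hW => ?_, fun V hV W hW i => ?_⟩
  · obtain ⟨hm, hV⟩ := mem_sobolevClosure_iff.1 hV
    refine ⟨hm, fun i => ?_⟩
    -- The squared norm is then at most 2 · (1/2) + 2N², which is below (2N + 1)².
    obtain ⟨W, hW, hlt⟩ := hV (1 / 2) (by norm_num)
    have hWr := hS.reg W hW
    have h1 := sobolevNormSq_comb_le hΩ ((hm i).sub (hWr.mem i)) (hWr.mem i) 1 1
    have e : (fun x => 1 * (V i x - W i x) + 1 * W i x) = V i := by ext x; ring
    rw [e] at h1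
    have h2 := sobolevNormSq_le_vecNormSq (Ω := box a b) (mInd n) (fun i x => V i x - W i x) i
    have h3 := hWr.bound i
    push_cast
    have hN : (0 : ℝ) ≤ N := N.coe_nonneg
    nlinarith
  · obtain ⟨hVm, hV⟩ := mem_sobolevClosure_iff.1 hV
    obtain ⟨hWm, hW⟩ := mem_sobolevClosure_iff.1 hW
    refine mem_sobolevClosure_iff.2 ⟨fun i => (hVm i).comb (hWm i) _ _, fun δ hδ => ?_⟩
    obtain ⟨V', hV', h1⟩ := hV δ hδ
    obtain ⟨W', hW', h2⟩ := hW δ hδ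
    refine ⟨_, hS.midpoint V' hV' W' hW', ?_⟩
    have h3 := vecNormSq_comb_le hΩ (fun i => (hVm i).sub ((hS.reg V' hV').mem i))
      (fun i => (hWm i).sub ((hS.reg W' hW').mem i)) (1 / 2) (1 / 2)
    have e : (fun i x => 1 / 2 * V i x + 1 / 2 * W i x - (1 / 2 * V' i x + 1 / 2 * W' i x)) =
        fun i x => 1 / 2 * (V i x - V' i x) + 1 / 2 * (W i x - W' i x) := by ext i x; ring
    rw [e]
    linarith
  · obtain ⟨hVm, hV⟩ := mem_sobolevClosure_iff.1 hV
    obtain ⟨hWm, hW⟩ := mem_sobolevClosure_iff.1 hW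
    choose Vp hVp hVlt using fun p : ℕ => hV (1 / ((p : ℝ) + 1)) (by positivity)
    choose Wp hWp hWlt using fun p : ℕ => hW (1 / ((p : ℝ) + 1)) (by positivity)
    have hVpm := fun p => (hS.reg _ (hVp p)).mem
    have hWpm := fun p => (hS.reg _ (hWp p)).mem
    refine AdmN.of_tendsto (fun ι => ((hVm i).sub (hWm i)).memLp_jetOf hΩ (two_le_mInd n) ι)
      (F := fun p => jetOf (box a b) fun x => Vp p i x - Wp p i x)
      (fun p => hS.adm _ (hVp p) _ (hWp p) i) fun ι => ?_
    have hlim : Filter.Tendsto (fun p : ℕ => 4 * (1 / ((p : ℝ) + 1))) Filter.atTop (nhds 0) := by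
      simpa using (tendsto_one_div_add_atTop_nhds_zero_nat (𝕜 := ℝ)).const_mul 4
    refine tendsto_of_tendsto_of_tendsto_of_le_of_le tendsto_const_nhds hlim
      (fun p => integral_nonneg fun _ => sq_nonneg _) fun p => ?_
    have hd := ((hVpm p i).sub (hWpm p i)).jetOf_sub hΩ (two_le_mInd n) ((hVm i).sub (hWm i)) ι
    have hdm := ((hVpm p i).sub (hWpm p i)).sub ((hVm i).sub (hWm i))
    have h1 : ∫ x in box a b, (jetOf (box a b) (fun x => Vp p i x - Wp p i x) ι x -
        jetOf (box a b) (fun x => V i x - W i x) ι x) ^ 2 ≤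
        sobolevNormSq (box a b) (mInd n) (fun x => (Vp p i x - Wp p i x) - (V i x - W i x)) := by
      refine le_trans (le_of_eq (integral_congr_ae ?_)) (hdm.integral_jetOf_sq_le hΩ (two_le_mInd n) ι)
      filter_upwards [hd] with x hx
      rw [hx]
    have h2 := sobolevNormSq_comb_le hΩ ((hVm i).sub (hVpm p i)) ((hWm i).sub (hWpm p i)) (-1) 1
    have e : (fun x => -1 * (V i x - Vp p i x) + 1 * (W i x - Wp p i x)) =
        fun x => (Vp p i x - Wp p i x) - (V i x - W i x) := by ext x; ring
    rw [e] at h2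
    have h3 := sobolevNormSq_le_vecNormSq (Ω := box a b) (mInd n) (fun i x => V i x - Vp p i x) i
    have h4 := sobolevNormSq_le_vecNormSq (Ω := box a b) (mInd n) (fun i x => W i x - Wp p i x) i
    have h5 := hVlt p
    have h6 := hWlt p
    refine h1.trans (h2.trans ?_)
    linarith

/-- The Tikhonov functional in terms of squared norms. -/
noncomputable def tikF (a b : Fin n → ℝ) (ε h lam E α : ℝ) (V : Fin (k + 1) → Pt n → ℝ) : ℝ :=
  E * resF a b ε h lam V + α * vecNormSq (box a b) (mInd n) V

theorem resF_nonneg (ε h lam : ℝ) (V : Fin (k + 1) → Pt n → ℝ) : 0 ≤ resF a b ε h lam V :=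
  Finset.sum_nonneg fun _ _ => wint_self_nonneg _ fun _ _ => mon_zero_nonneg _ _

/-- Convexity of the residual combined with the parallelogram law for the regularization; the second
summand is the gain that yields Cauchy sequences and uniqueness. -/
theorem tikF_midpoint_le {ε h lam E α : ℝ} (hE : 0 ≤ E) {V W : Fin (k + 1) → Pt n → ℝ} {N : NNReal}
    (hV : Reg a b N V) (hW : Reg a b N W)
    (hmid : resF a b ε h lam (fun i x => 1 / 2 * V i x + 1 / 2 * W i x) ≤
        1 / 2 * resF a b ε h lam V + 1 / 2 * resF a b ε h lam W) :
    tikF a b ε h lam E α (fun i x => 1 / 2 * V i x + 1 / 2 * W i x) +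
      α / 4 * vecNormSq (box a b) (mInd n) (fun i x => V i x - W i x) ≤
      1 / 2 * tikF a b ε h lam E α V + 1 / 2 * tikF a b ε h lam E α W := by
  unfold tikF
  rw [vecNormSq_midpoint (isOpen_box a b) hV.mem hW.mem]
  have := mul_le_mul_of_nonneg_left hmid hE
  linarith

omit [NeZero n] in
theorem ae_eq_of_vecNormSq_le_zero {m : ℕ} {V W : Fin (k + 1) → Pt n → ℝ}
    (hV : ∀ i, MemSobolev (box a b) m (V i)) (hW : ∀ i, MemSobolev (box a b) m (W i))
    (h : vecNormSq (box a b) m (fun i x => V i x - W i x) ≤ 0) (i : Fin (k + 1)) :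
    V i =ᵐ[volume.restrict (box a b)] W i := by
  have h1 := (sobolevNormSq_le_vecNormSq (Ω := box a b) m (fun i x => V i x - W i x) i).trans h
  have hd := (hV i).sub (hW i)
  have h2 := (integral_weakDeriv_sq_le (Ω := box a b) (fun x => V i x - W i x) (m := m) (β := 0) (by simp)).trans h1
  have h3 : ∫ x in box a b, (V i x - W i x) ^ 2 = 0 := by
    refine le_antisymm (le_trans (le_of_eq (integral_congr_ae ?_)) h2) (integral_nonneg fun _ => sq_nonneg _)
    filter_upwards [IsWeakDeriv.weakDeriv_zero_ae (isOpen_box a b) hd.1] with x hx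
    rw [hx]
  rw [integral_eq_zero_iff_of_nonneg (fun _ => sq_nonneg _) hd.1.integrable_sq] at h3
  filter_upwards [h3] with x hx
  have : V i x - W i x = 0 := by simpa using hx
  linarith

/-- Existence and uniqueness of the minimizer. -/
theorem Feasible.exists_minimizer (hab : ∀ l, a l < b l) {N : NNReal}
    {S : Set (Fin (k + 1) → Pt n → ℝ)} (hS₀ : ∀ V ∈ S, ∀ i, MemSobolev (box a b) (mInd n) (V i))
    (hS : Feasible a b N (sobolevClosure (box a b) (mInd n) S)) {ε h lam E α : ℝ} (hh : 0 < h) (hE : 0 ≤ E) (hα : 0 < α)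
    (hmid : ∀ V W : Fin (k + 1) → Pt n → ℝ, Reg a b N V → Reg a b N W →
      (∀ i, AdmN a b (jetOf (box a b) fun x => V i x - W i x)) →
      resF a b ε h lam (fun i x => 1 / 2 * V i x + 1 / 2 * W i x) ≤
        1 / 2 * resF a b ε h lam V + 1 / 2 * resF a b ε h lam W)
    (hne : (sobolevClosure (box a b) (mInd n) S).Nonempty) :
    ∃ V ∈ sobolevClosure (box a b) (mInd n) S, ∀ W ∈ sobolevClosure (box a b) (mInd n) S,
      tikF a b ε h lam E α V ≤ tikF a b ε h lam E α W := by
  set T := sobolevClosure (box a b) (mInd n) S with hT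
  set J : (Fin (k + 1) → Pt n → ℝ) → ℝ := tikF a b ε h lam E α with hJ
  have hJ0 : ∀ V, 0 ≤ J V := fun V => add_nonneg (mul_nonneg hE (resF_nonneg _ _ _ _))
    (mul_nonneg hα.le (vecNormSq_nonneg _ _))
  have hbdd : BddBelow (J '' T) := ⟨0, by rintro _ ⟨V, -, rfl⟩; exact hJ0 V⟩
  have hI : ∀ V ∈ T, sInf (J '' T) ≤ J V := fun V hV => csInf_le hbdd ⟨V, hV, rfl⟩
  set I := sInf (J '' T)
  have hseq : ∀ p : ℕ, ∃ V ∈ T, J V < I + 1 / ((p : ℝ) + 1) := by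
    intro p
    obtain ⟨_, ⟨V, hV, rfl⟩, hlt⟩ := exists_lt_of_csInf_lt (hne.image J)
      (show sInf (J '' T) < I + 1 / ((p : ℝ) + 1) from lt_add_of_pos_right _ (by positivity))
    exact ⟨V, hV, hlt⟩
  choose Vp hVp hlt using hseq
  have hreg := fun p => hS.reg _ (hVp p)
  -- The midpoint of two almost minimizers has value at least the infimum, so the gain term is
  -- bounded by their excesses.
  have hcauchy : ∀ p q, α / 4 * vecNormSq (box a b) (mInd n) (fun i x => Vp p i x - Vp q i x) ≤
      1 / 2 * (1 / ((p : ℝ) + 1)) + 1 / 2 * (1 / ((q : ℝ) + 1)) := by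
    intro p q
    have h1 := tikF_midpoint_le (α := α) hE (hreg p) (hreg q) (hmid _ _ (hreg p) (hreg q)
      (hS.adm _ (hVp p) _ (hVp q)))
    have h2 := hI _ (hS.midpoint _ (hVp p) _ (hVp q))
    have h3 := (hlt p).le
    have h4 := (hlt q).le
    simp only [hJ] at h2 h3 h4
    linarith
  have hC : ∀ i, ∀ δ : ℝ, 0 < δ → ∃ P : ℕ, ∀ p q, P ≤ p → P ≤ q →
      sobolevNormSq (box a b) (mInd n) (fun x => Vp p i x - Vp q i x) < δ := by
    intro i δ hδ
    obtain ⟨P, hP⟩ := exists_nat_one_div_lt (show 0 < α / 4 * δ by positivity)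
    refine ⟨P, fun p q hp hq => ?_⟩
    have h1 := hcauchy p q
    have h2 : 1 / ((p : ℝ) + 1) ≤ 1 / ((P : ℝ) + 1) := Nat.one_div_le_one_div hp
    have h3 : 1 / ((q : ℝ) + 1) ≤ 1 / ((P : ℝ) + 1) := Nat.one_div_le_one_div hq
    have h4 := sobolevNormSq_le_vecNormSq (Ω := box a b) (mInd n) (fun i x => Vp p i x - Vp q i x) i
    have h5 : α / 4 * vecNormSq (box a b) (mInd n) (fun i x => Vp p i x - Vp q i x) < α / 4 * δ := by linarith
    exact h4.trans_lt (lt_of_mul_lt_mul_left h5 (by positivity))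
  choose V hVm hVt using fun i => exists_sobolev_limit (isOpen_box a b) (fun p => (hreg p).mem i) (hC i)
  have hvt : Filter.Tendsto (fun p => vecNormSq (box a b) (mInd n) (fun i x => Vp p i x - V i x))
      Filter.atTop (nhds 0) := by
    have := tendsto_finsetSum (Finset.univ : Finset (Fin (k + 1))) fun i _ => hVt i
    simpa [vecNormSq] using this
  have hVT : V ∈ T := by
    refine mem_sobolevClosure_iff.2 ⟨hVm, fun δ hδ => ?_⟩
    -- Closedness is checked through approximants of approximants; quarters compensate the factor
    -- two in `vecNormSq_sub_le`.
    obtain ⟨p, hp⟩ := (hvt.eventually (gt_mem_nhds (show 0 < δ / 4 by positivity))).exists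
    have h1 := hVp p
    rw [hT] at h1
    obtain ⟨h2, h3⟩ := mem_sobolevClosure_iff.1 h1
    obtain ⟨W, hW, hWlt⟩ := h3 (δ / 4) (by positivity)
    refine ⟨W, hW, ?_⟩
    have hWm := hS₀ W hW
    have h4 := vecNormSq_sub_le (isOpen_box a b) hVm hWm h2
    rw [vecNormSq_sub_comm (isOpen_box a b) hVm h2] at h4
    linarith
  refine ⟨V, hVT, fun W hW => ?_⟩
  have hVr := hS.reg V hVT
  -- The sequence converges strongly, so continuity of the functional suffices; lower semicontinuity
  -- plays no role.
  have hres : Filter.Tendsto (fun p => resF a b ε h lam (Vp p)) Filter.atTop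
      (nhds (resF a b ε h lam V)) := by
    obtain ⟨C, hC0, hCL⟩ := exists_integral_Lop_sub_le hab ε hh k N
    refine tendsto_finsetSum _ fun i _ => tendsto_wint_self (fun p => memLp_Lop hab hh (hreg p) i)
      (memLp_Lop hab hh hVr i) ?_ lam
    have h2 := hvt.const_mul C
    rw [mul_zero] at h2
    exact tendsto_of_tendsto_of_tendsto_of_le_of_le tendsto_const_nhds h2
      (fun p => integral_nonneg fun _ => sq_nonneg _) fun p => hCL _ _ (hreg p) hVr i
  have hnrm : Filter.Tendsto (fun p => vecNormSq (box a b) (mInd n) (Vp p)) Filter.atTop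
      (nhds (vecNormSq (box a b) (mInd n) V)) :=
    tendsto_finsetSum _ fun i _ => tendsto_sobolevNormSq (fun p => (hreg p).mem i) (hVm i) (hVt i)
  have hJt : Filter.Tendsto (fun p => J (Vp p)) Filter.atTop (nhds (J V)) :=
    (hres.const_mul E).add (hnrm.const_mul α)
  have hIt : Filter.Tendsto (fun p : ℕ => I + 1 / ((p : ℝ) + 1)) Filter.atTop (nhds I) := by
    simpa using tendsto_one_div_add_atTop_nhds_zero_nat.const_add I
  exact (le_of_tendsto_of_tendsto' hJt hIt fun p => (hlt p).le).trans (hI W hW)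

theorem Feasible.minimizer_unique {N : NNReal} {T : Set (Fin (k + 1) → Pt n → ℝ)} (hS : Feasible a b N T)
    {ε h lam E α : ℝ} (hE : 0 ≤ E) (hα : 0 < α)
    (hmid : ∀ V W : Fin (k + 1) → Pt n → ℝ, Reg a b N V → Reg a b N W →
      (∀ i, AdmN a b (jetOf (box a b) fun x => V i x - W i x)) →
      resF a b ε h lam (fun i x => 1 / 2 * V i x + 1 / 2 * W i x) ≤
        1 / 2 * resF a b ε h lam V + 1 / 2 * resF a b ε h lam W)
    {V W : Fin (k + 1) → Pt n → ℝ} (hV : V ∈ T) (hW : W ∈ T)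
    (hVmin : ∀ X ∈ T, tikF a b ε h lam E α V ≤ tikF a b ε h lam E α X)
    (hWmin : ∀ X ∈ T, tikF a b ε h lam E α W ≤ tikF a b ε h lam E α X) (i : Fin (k + 1)) :
    V i =ᵐ[volume.restrict (box a b)] W i := by
  have h1 := tikF_midpoint_le (α := α) hE (hS.reg V hV) (hS.reg W hW) (hmid V W (hS.reg V hV) (hS.reg W hW)
    (hS.adm V hV W hW))
  have h2 := hVmin _ (hS.midpoint V hV W hW)
  have h3 := hWmin V hV
  refine ae_eq_of_vecNormSq_le_zero (hS.reg V hV).mem (hS.reg W hW).mem ?_ i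
  have h4 : α / 4 * vecNormSq (box a b) (mInd n) (fun i x => V i x - W i x) ≤ α / 4 * 0 := by linarith
  exact le_of_mul_le_mul_left h4 (by positivity)

end Minimization


/-! ### Lipschitz dependence of the reconstructed coefficient. -/

section Reconstruction

variable {n k : ℕ} {Ω : Set (Pt n)}

theorem exists_eq_add_single {β : Fin n → ℕ} {j : ℕ} (h : ∑ i, β i = j + 1) :
    ∃ (l : Fin n) (γ : Fin n → ℕ), β = γ + Pi.single l 1 ∧ ∑ i, γ i = j := by
  obtain ⟨l, hl⟩ : ∃ l, β l ≠ 0 := by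
    by_contra! hc
    simp [hc] at h
  have e : β = (β - Pi.single l 1) + Pi.single l 1 := by
    ext i
    by_cases hi : i = l
    · subst hi; simp; omega
    · simp [hi]
  refine ⟨l, _, e, ?_⟩
  have := sum_add_single (β - Pi.single l 1) l
  rw [← e, h] at this
  omega

/-- Estimates are proved for jets, while the H² norm sums over multi-indices; this shows that the
jets miss none of them. -/
theorem exists_jbeta_eq {β : Fin n → ℕ} (h : ∑ i, β i ≤ 2) : ∃ ι : JIdx n, jbeta ι = β := by
  have h0 : ∀ γ : Fin n → ℕ, ∑ i, γ i = 0 → γ = 0 := by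
    intro γ hγ; ext i
    exact (Finset.sum_eq_zero_iff.1 hγ) i (Finset.mem_univ i)
  obtain h1 | h1 | h1 : ∑ i, β i = 0 ∨ ∑ i, β i = 1 ∨ ∑ i, β i = 2 := by omega
  · exact ⟨none, (h0 β h1).symm⟩
  · obtain ⟨l, γ, rfl, hγ⟩ := exists_eq_add_single h1
    exact ⟨some (.inl l), by rw [h0 γ hγ]; simp [jbeta]⟩
  · obtain ⟨l, γ, rfl, hγ⟩ := exists_eq_add_single h1
    obtain ⟨l', γ', rfl, hγ'⟩ := exists_eq_add_single hγ
    exact ⟨some (.inr (l', l)), by rw [h0 γ' hγ']; simp [jbeta]⟩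

/-- The number of multi-indices of order at most two. -/
def numIdx (n : ℕ) : ℕ :=
  ∑ j ∈ Finset.range 3, (Finset.piAntidiag (Finset.univ : Finset (Fin n)) j).card

theorem sobolevNormSq_two_le (hΩ : IsOpen Ω) {f : Pt n → ℝ} (hf : MemLp f 2 (volume.restrict Ω)) {Y : ℝ}
    (h : ∀ ι, ∫ x in Ω, jetOf Ω f ι x ^ 2 ≤ Y) : sobolevNormSq Ω 2 f ≤ numIdx n * Y := by
  unfold sobolevNormSq numIdx
  push_cast
  rw [Finset.sum_mul]
  refine Finset.sum_le_sum fun j hj => ?_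
  rw [← nsmul_eq_mul]
  refine Finset.sum_le_card_nsmul _ _ _ fun β hβ => ?_
  obtain ⟨ι, rfl⟩ := exists_jbeta_eq (sum_of_mem_range_piAntidiag hj hβ)
  refine le_trans (le_of_eq (integral_congr_ae ?_)) (h ι)
  filter_upwards [jetOf_ae hΩ hf ι] with x hx
  rw [hx]

theorem isWeakDeriv_smoothJet (hΩ : IsOpen Ω) (hb : Bornology.IsBounded Ω) {Φ : Pt n → ℝ}
    (hΦ : ContDiff ℝ ∞ Φ) (ι : JIdx n) : IsWeakDeriv Ω (jbeta ι) Φ (smoothJet Φ ι) := by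
  have h0 := hasWD_smooth hΩ hb (ψ := Φ)
  rcases ι with _ | i | ⟨i, j⟩
  · exact isWeakDeriv_zero (memLp_continuous hΩ hb hΦ.continuous)
  · exact (h0 i hΦ).isWeakDeriv
  · exact (h0 i hΦ).isWeakDeriv.succ (hasWD_smooth hΩ hb j (contDiff_pderiv hΦ i))

theorem isWeakDeriv_sum {β : Fin n → ℕ} {ι : Type*} (s : Finset ι) {f g : ι → Pt n → ℝ}
    (h : ∀ i, IsWeakDeriv Ω β (f i) (g i)) (hf : ∀ i, MemLp (f i) 2 (volume.restrict Ω)) :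
    IsWeakDeriv Ω β (fun x => ∑ i ∈ s, f i x) (fun x => ∑ i ∈ s, g i x) := by
  classical
  induction s using Finset.induction with
  | empty => simp only [Finset.sum_empty]; exact ⟨MemLp.zero', fun φ _ => by simp⟩
  | insert i s hi ih =>
    have := (h i).comb ih (hf i) (memLp_finsetSum _ fun i _ => hf i) 1 1
    simpa [Finset.sum_insert hi] using this

theorem isWeakDeriv_wRec (hΩ : IsOpen Ω) (hb : Bornology.IsBounded Ω) (ε h : ℝ) {m : ℕ} (hm : 2 ≤ m)
    {V : Fin (k + 1) → Pt n → ℝ} (hV : ∀ i, MemSobolev Ω m (V i)) (i : Fin (k + 1)) (ι : JIdx n) :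
    IsWeakDeriv Ω (jbeta ι) (wRec ε h V i)
      (fun x => h * ∑ j ∈ Finset.Iic i, weakDeriv Ω (jbeta ι) (V j) x + smoothJet (wEps ε) ι x) := by
  have h1 := isWeakDeriv_sum (Finset.Iic i) (fun j => (hV j).isWeakDeriv ((sum_jbeta_le ι).trans hm))
    fun j => (hV j).1
  have h2 := isWeakDeriv_smoothJet hΩ hb (contDiff_wEps ε) ι
  have h3 := h1.comb h2 (memLp_finsetSum _ fun j _ => (hV j).1)
    (memLp_continuous hΩ hb (contDiff_wEps ε).continuous) h 1
  simp only [one_mul] at h3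
  exact h3

theorem memSobolev_wRec (hΩ : IsOpen Ω) (hb : Bornology.IsBounded Ω) (ε h : ℝ) {m : ℕ} (hm : 2 ≤ m)
    {V : Fin (k + 1) → Pt n → ℝ} (hV : ∀ i, MemSobolev Ω m (V i)) (i : Fin (k + 1)) :
    MemSobolev Ω 2 (wRec ε h V i) := by
  refine ⟨?_, fun β hβ => ?_⟩
  · exact ((memLp_finsetSum _ fun j _ => (hV j).1).const_mul h).add
      (memLp_continuous hΩ hb (contDiff_wEps ε).continuous)
  · obtain ⟨ι, rfl⟩ := exists_jbeta_eq hβ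
    exact ⟨_, isWeakDeriv_wRec hΩ hb ε h hm hV i ι⟩

/-- The derivatives of the reconstructed functions are computed by linearity. The heat kernel part
is common to all V and cancels in differences. -/
theorem jets_wRec_ae (hΩ : IsOpen Ω) (hb : Bornology.IsBounded Ω) (ε h : ℝ) {m : ℕ} (hm : 2 ≤ m)
    {V : Fin (k + 1) → Pt n → ℝ} (hV : ∀ i, MemSobolev Ω m (V i)) :
    ∀ᵐ x ∂(volume.restrict Ω), ∀ i ι, jets Ω (wRec ε h V) x i ι =
      h * ∑ j ∈ Finset.Iic i, jets Ω V x j ι + smoothJet (wEps ε) ι x := by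
  refine ae_all_iff.2 fun i => ae_all_iff.2 fun ι => ?_
  have h1 := ae_all_iff.2 fun j => jetOf_ae hΩ (hV j).1 ι
  filter_upwards [jetOf_ae hΩ (memSobolev_wRec hΩ hb ε h hm hV i).1 ι,
    (isWeakDeriv_wRec hΩ hb ε h hm hV i ι).weakDeriv_ae hΩ, h1] with x e1 e2 e3
  simp only [jets, e1, e2, e3]

/-- Sum of the absolute values of all the components. -/
def sumV (P : Fin (k + 1) → JIdx n → ℝ) : ℝ := ∑ j, ∑ ι, |P j ι|

theorem sumV_nonneg (P : Fin (k + 1) → JIdx n → ℝ) : 0 ≤ sumV P :=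
  Finset.sum_nonneg fun _ _ => Finset.sum_nonneg fun _ _ => abs_nonneg _

theorem sum_abs_le_sumV (P : Fin (k + 1) → JIdx n → ℝ) (ι : JIdx n) : ∑ j, |P j ι| ≤ sumV P :=
  Finset.sum_le_sum fun j _ => Finset.single_le_sum (f := fun ι => |P j ι|)
    (fun _ _ => abs_nonneg _) (Finset.mem_univ ι)

theorem sum_sum_abs_second_le (P : Fin (k + 1) → JIdx n → ℝ) :
    ∑ l, ∑ j, |P j (some (.inr (l, l)))| ≤ sumV P := by
  rw [Finset.sum_comm]
  refine Finset.sum_le_sum fun j _ => ?_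
  have hinj : Function.Injective fun l : Fin n => (some (.inr (l, l)) : JIdx n) := by
    intro l l' h; simpa using h
  rw [← Finset.sum_image (f := fun ι => |P j ι|) (s := Finset.univ) fun l _ l' _ h => hinj h]
  exact Finset.sum_le_sum_of_subset_of_nonneg (Finset.subset_univ _) fun _ _ _ => abs_nonneg _

/-- Pointwise Lipschitz bound of the reconstruction. -/
theorem abs_recon_sub_le {h K c₀ : ℝ} (hh : 0 < h) (hc₀ : 0 ≤ c₀) {om : JIdx n → ℝ}
    (hom : ∀ l, |om (some (.inl l))| ≤ K) (P Q U : Fin (k + 1) → JIdx n → ℝ)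
    (hU : ∀ i ι, U i ι = P i ι - Q i ι)
    (hP : ∀ j l, |P j (some (.inl l))| ≤ K) (hQ : ∀ j l, |Q j (some (.inl l))| ≤ K)
    (PW QW : Fin (k + 1) → JIdx n → ℝ)
    (hPW : ∀ i ι, PW i ι = h * ∑ j ∈ Finset.Iic i, P j ι + om ι)
    (hQW : ∀ i ι, QW i ι = h * ∑ j ∈ Finset.Iic i, Q j ι + om ι) :
    |(c₀ * (PW (Fin.last k) none - om none) -
        c₀ * ∑ i, (lapV (PW i) + ∑ l, PW i (some (.inl l)) ^ 2)) -
      (c₀ * (QW (Fin.last k) none - om none) -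
        c₀ * ∑ i, (lapV (QW i) + ∑ l, QW i (some (.inl l)) ^ 2))| ≤
      c₀ * (h + (k + 1) * (h + n * (h * (2 * (h * ((k + 1) * K) + K))))) * sumV U := by
  have hdiff : ∀ i ι, PW i ι - QW i ι = h * ∑ j ∈ Finset.Iic i, U j ι := by
    intro i ι
    rw [hPW, hQW]
    simp only [hU, Finset.sum_sub_distrib]
    ring
  have habs : ∀ i ι, |PW i ι - QW i ι| ≤ h * ∑ j, |U j ι| := by
    intro i ι
    rw [hdiff, abs_mul, abs_of_pos hh]
    exact mul_le_mul_of_nonneg_left (abs_sum_Iic_le _ i) hh.le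
  have hsum : ∀ (X : Fin (k + 1) → JIdx n → ℝ) i l, (∀ j l, |X j (some (.inl l))| ≤ K) →
      |h * ∑ j ∈ Finset.Iic i, X j (some (.inl l)) + om (some (.inl l))| ≤ h * ((k + 1) * K) + K := by
    intro X i l hX
    refine (abs_add_le _ _).trans (add_le_add ?_ (hom l))
    rw [abs_mul, abs_of_pos hh]
    refine mul_le_mul_of_nonneg_left ((abs_sum_Iic_le _ i).trans
      ((Finset.sum_le_sum fun j _ => hX j l).trans_eq (by simp))) hh.le
  have hS0 := sumV_nonneg U
  have h1 : |PW (Fin.last k) none - QW (Fin.last k) none| ≤ h * sumV U :=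
    (habs _ _).trans (mul_le_mul_of_nonneg_left (sum_abs_le_sumV U none) hh.le)
  have h2 : ∀ i, |lapV (PW i) - lapV (QW i)| ≤ h * sumV U := by
    intro i
    unfold lapV
    rw [← Finset.sum_sub_distrib]
    refine (Finset.abs_sum_le_sum_abs _ _).trans ((Finset.sum_le_sum fun l _ => habs i _).trans ?_)
    rw [← Finset.mul_sum]
    exact mul_le_mul_of_nonneg_left (sum_sum_abs_second_le U) hh.le
  have h3 : ∀ i, |∑ l, PW i (some (.inl l)) ^ 2 - ∑ l, QW i (some (.inl l)) ^ 2| ≤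
      n * (h * (2 * (h * ((k + 1) * K) + K))) * sumV U := by
    intro i
    rw [← Finset.sum_sub_distrib]
    refine (Finset.abs_sum_le_sum_abs _ _).trans ?_
    refine (Finset.sum_le_sum (g := fun _ => h * sumV U * (2 * (h * ((k + 1) * K) + K))) fun l _ => ?_).trans_eq
      (by simp; ring)
    -- The squared gradients are differenced as a product; the factor with the sum is bounded
    -- because first derivatives are.
    rw [sq_sub_sq, mul_comm, abs_mul]
    refine mul_le_mul ((habs i _).trans (mul_le_mul_of_nonneg_left (sum_abs_le_sumV U _) hh.le)) ?_
      (abs_nonneg _) (by positivity)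
    refine (abs_add_le _ _).trans ?_
    have e1 := hsum P i l hP
    have e2 := hsum Q i l hQ
    rw [← hPW] at e1
    rw [← hQW] at e2
    linarith
  have h4 : |∑ i, (lapV (PW i) + ∑ l, PW i (some (.inl l)) ^ 2) -
      ∑ i, (lapV (QW i) + ∑ l, QW i (some (.inl l)) ^ 2)| ≤
      (k + 1) * (h + n * (h * (2 * (h * ((k + 1) * K) + K)))) * sumV U := by
    rw [← Finset.sum_sub_distrib]
    refine (Finset.abs_sum_le_sum_abs _ _).trans ?_
    refine (Finset.sum_le_sum (g := fun _ => (h + n * (h * (2 * (h * ((k + 1) * K) + K)))) * sumV U)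
      fun i _ => ?_).trans_eq (by simp; ring)
    rw [add_sub_add_comm]
    refine (abs_add_le _ _).trans ?_
    linarith [h2 i, h3 i]
  have e : (c₀ * (PW (Fin.last k) none - om none) -
        c₀ * ∑ i, (lapV (PW i) + ∑ l, PW i (some (.inl l)) ^ 2)) -
      (c₀ * (QW (Fin.last k) none - om none) -
        c₀ * ∑ i, (lapV (QW i) + ∑ l, QW i (some (.inl l)) ^ 2)) =
      c₀ * ((PW (Fin.last k) none - QW (Fin.last k) none) -
        (∑ i, (lapV (PW i) + ∑ l, PW i (some (.inl l)) ^ 2) -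
          ∑ i, (lapV (QW i) + ∑ l, QW i (some (.inl l)) ^ 2))) := by ring
  rw [e, abs_mul, abs_of_nonneg hc₀, mul_assoc]
  refine mul_le_mul_of_nonneg_left ((abs_sub _ _).trans ?_) hc₀
  linarith

theorem aRec_eq (ε T h : ℝ) (V : Fin (k + 1) → Pt n → ℝ) (x : Pt n) :
    aRec Ω ε T h V x = 1 / (T - ε) * (jets Ω (wRec ε h V) x (Fin.last k) none - smoothJet (wEps ε) none x) -
      1 / (T - ε) * ∑ i, (lapV (jets Ω (wRec ε h V) x i) + ∑ l, jets Ω (wRec ε h V) x i (some (.inl l)) ^ 2) := by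
  unfold aRec
  simp only [wlap_eq]
  rfl

variable {a b : Fin n → ℝ}

theorem aestronglyMeasurable_aRec (ε T h : ℝ) {m : ℕ} (hm : 2 ≤ m) {V : Fin (k + 1) → Pt n → ℝ}
    (hV : ∀ i, MemSobolev (box a b) m (V i)) :
    AEStronglyMeasurable (aRec (box a b) ε T h V) (volume.restrict (box a b)) := by
  have hj : ∀ i ι, AEStronglyMeasurable (fun x => jets (box a b) (wRec ε h V) x i ι)
      (volume.restrict (box a b)) := fun i ι =>
    ((memSobolev_wRec (isOpen_box a b) (isBounded_box a b) ε h hm hV i).memLp_jetOf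
      (isOpen_box a b) le_rfl ι).1
  have e : aRec (box a b) ε T h V = fun x => 1 / (T - ε) *
      (jets (box a b) (wRec ε h V) x (Fin.last k) none - smoothJet (wEps ε) none x) -
      1 / (T - ε) * ∑ i, (lapV (jets (box a b) (wRec ε h V) x i) +
        ∑ l, jets (box a b) (wRec ε h V) x i (some (.inl l)) ^ 2) := by
    ext x; exact aRec_eq _ _ _ _ _
  rw [e]
  unfold lapV
  refine AEStronglyMeasurable.sub (((hj _ _).sub
    (contDiff_smoothJet (contDiff_wEps ε) none).continuous.aestronglyMeasurable).const_mul _)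
    (AEStronglyMeasurable.const_mul (Finset.aestronglyMeasurable_fun_sum _ fun i _ => .add ?_ ?_) _)
  · exact Finset.aestronglyMeasurable_fun_sum _ fun l _ => hj i _
  · exact Finset.aestronglyMeasurable_fun_sum _ fun l _ => (hj i _).pow 2

/-- Lipschitz dependence of the reconstructed coefficient on the vector function. -/
theorem exists_aRec_sub_le (hab : ∀ l, a l < b l) {ε T h : ℝ} (hh : 0 < h) (hT : ε < T) (k : ℕ)
    (N : NNReal) : ∃ C : ℝ, 0 ≤ C ∧ ∀ V W : Fin (k + 1) → Pt n → ℝ, Reg a b N V → Reg a b N W →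
      MemLp (fun x => aRec (box a b) ε T h V x - aRec (box a b) ε T h W x) 2 (volume.restrict (box a b)) ∧
      ∀ Y : ℝ, (∀ i ι, ∫ x in box a b, jetOf (box a b) (fun x => V i x - W i x) ι x ^ 2 ≤ Y) →
        ∫ x in box a b, (aRec (box a b) ε T h V x - aRec (box a b) ε T h W x) ^ 2 ≤ C * Y := by
  obtain ⟨K₁, hK₁, H₁⟩ := exists_reg_bound (k := k) hab N
  obtain ⟨K₂, hK₂, H₂⟩ := exists_bound_pderiv_wEps ε a b
  set K := max K₁ K₂
  have hK : 0 ≤ K := hK₁.trans (le_max_left _ _)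
  have hc₀ : 0 ≤ 1 / (T - ε) := by
    have : 0 < T - ε := by linarith
    positivity
  set c := 1 / (T - ε) * (h + (k + 1) * (h + n * (h * (2 * (h * ((k + 1) * K) + K))))) with hc
  have hc0 : 0 ≤ c := by positivity
  set q : ℝ := (k + 1) * Fintype.card (JIdx n) with hq
  refine ⟨c ^ 2 * (q * q), by positivity, fun V W hV hW => ?_⟩
  set U : Fin (k + 1) → Pt n → ℝ := fun i x => V i x - W i x with hUdef
  have hUm : ∀ i, MemSobolev (box a b) (mInd n) (U i) := fun i => (hV.mem i).sub (hW.mem i)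
  have hS : MemLp (fun x => sumV (jets (box a b) U x)) 2 (volume.restrict (box a b)) :=
    memLp_finsetSum _ fun j _ => memLp_finsetSum _ fun ι _ => (memLp_jets hUm j ι).abs
  -- The pointwise Lipschitz bound gives both square integrability of the difference and its norm,
  -- so membership of the separate coefficients in L² is not needed.
  have hle : ∀ᵐ x ∂(volume.restrict (box a b)),
      |aRec (box a b) ε T h V x - aRec (box a b) ε T h W x| ≤ c * sumV (jets (box a b) U x) := by
    filter_upwards [H₁ V hV, H₁ W hW, jets_sub_ae hV.mem hW.mem,
      jets_wRec_ae (isOpen_box a b) (isBounded_box a b) ε h (two_le_mInd n) hV.mem,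
      jets_wRec_ae (isOpen_box a b) (isBounded_box a b) ε h (two_le_mInd n) hW.mem,
      ae_restrict_mem (measurableSet_box a b)] with x h1 h2 h3 h4 h5 hx
    rw [aRec_eq, aRec_eq]
    exact abs_recon_sub_le (om := fun ι => smoothJet (wEps ε) ι x) hh hc₀
      (fun l => (H₂ x hx l).trans (le_max_right _ _))
      (jets (box a b) V x) (jets (box a b) W x) (jets (box a b) U x) h3
      (fun j l => (h1.2 j l).trans (le_max_left _ _))
      (fun j l => (h2.2 j l).trans (le_max_left _ _)) _ _ h4 h5
  have hmem : MemLp (fun x => aRec (box a b) ε T h V x - aRec (box a b) ε T h W x) 2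
      (volume.restrict (box a b)) := by
    refine MemLp.of_le_mul (c := c) hS ((aestronglyMeasurable_aRec ε T h (two_le_mInd n) hV.mem).sub
      (aestronglyMeasurable_aRec ε T h (two_le_mInd n) hW.mem)) ?_
    filter_upwards [hle] with x hx
    rw [Real.norm_eq_abs, Real.norm_eq_abs, abs_of_nonneg (sumV_nonneg (jets (box a b) U x))]
    exact hx
  refine ⟨hmem, fun Y hY => ?_⟩
  have i1 : ∀ j ι, Integrable (fun x => jets (box a b) U x j ι ^ 2) (volume.restrict (box a b)) :=
    fun j ι => (memLp_jets hUm j ι).integrable_sq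
  have i2 : Integrable (fun x => q * ∑ j, ∑ ι, jets (box a b) U x j ι ^ 2) (volume.restrict (box a b)) :=
    (integrable_finsetSum _ fun j _ => integrable_finsetSum _ fun ι _ => i1 j ι).const_mul q
  have hsq : ∀ x, sumV (jets (box a b) U x) ^ 2 ≤ q * ∑ j, ∑ ι, jets (box a b) U x j ι ^ 2 := by
    intro x
    unfold sumV
    rw [← Finset.sum_product' (f := fun j ι => |jets (box a b) U x j ι|),
      ← Finset.sum_product' (f := fun j ι => jets (box a b) U x j ι ^ 2)]
    refine (sq_sum_le_card_mul_sum_sq).trans_eq ?_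
    simp [hq]
  calc ∫ x in box a b, (aRec (box a b) ε T h V x - aRec (box a b) ε T h W x) ^ 2
      ≤ ∫ x in box a b, c ^ 2 * (q * ∑ j, ∑ ι, jets (box a b) U x j ι ^ 2) := by
        refine integral_mono_ae hmem.integrable_sq (i2.const_mul _) ?_
        filter_upwards [hle] with x hx
        rw [← sq_abs]
        calc _ ≤ (c * sumV (jets (box a b) U x)) ^ 2 := by gcongr
          _ = c ^ 2 * sumV (jets (box a b) U x) ^ 2 := by ring
          _ ≤ _ := mul_le_mul_of_nonneg_left (hsq x) (sq_nonneg _)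
    _ = c ^ 2 * (q * ∑ j, ∑ ι, ∫ x in box a b, jets (box a b) U x j ι ^ 2) := by
        rw [integral_const_mul, integral_const_mul,
          integral_finsetSum _ fun j _ => integrable_finsetSum _ fun ι _ => i1 j ι]
        congr 2
        exact Finset.sum_congr rfl fun j _ => integral_finsetSum _ fun ι _ => i1 j ι
    _ ≤ c ^ 2 * (q * ∑ j : Fin (k + 1), ∑ ι : JIdx n, Y) := by
        gcongr with j _ ι _
        exact hY j ι
    _ = c ^ 2 * (q * q) * Y := by
        simp only [Finset.sum_const, Finset.card_univ, Fintype.card_fin, nsmul_eq_mul, hq]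
        push_cast; ring

end Reconstruction


/-! ### The prism as a box, and B(R) as a feasible set. -/

section Prism

variable {n k : ℕ} [NeZero n]

/-- The lower corner of the prism. -/
def prismLo (n : ℕ) [NeZero n] (A D : ℝ) : Fin n → ℝ := fun j => if j = 0 then A else -D

/-- The upper corner of the prism. -/
def prismHi (n : ℕ) [NeZero n] (B D : ℝ) : Fin n → ℝ := fun j => if j = 0 then B else D

@[simp] theorem prismLo_zero (A D : ℝ) : prismLo n A D 0 = A := by simp [prismLo]

@[simp] theorem prismHi_zero (B D : ℝ) : prismHi n B D 0 = B := by simp [prismHi]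

theorem prism_eq_box (A B D : ℝ) : prism n A B D = box (prismLo n A D) (prismHi n B D) := by
  ext x
  constructor
  · rintro ⟨h0, h1⟩ j
    by_cases hj : j = 0
    · subst hj; simpa using h0
    · simpa [prismLo, prismHi, hj, abs_lt] using h1 j hj
  · intro h
    refine ⟨by simpa using h 0, fun j hj => ?_⟩
    simpa [prismLo, prismHi, hj, abs_lt] using h j

theorem prismLo_lt_prismHi {A B D : ℝ} (hAB : A < B) (hD : 0 < D) (j : Fin n) :
    prismLo n A D j < prismHi n B D j := by
  unfold prismLo prismHi
  split_ifs
  · exact hAB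
  · linarith

/-- Γ₀ contains the projections of all interior points of the prism, which is all that
`admN_of_trace` uses of the Neumann data. -/
theorem slide_mem_face {A B D : ℝ} {x : Pt n} (hx : x ∈ box (prismLo n A D) (prismHi n B D)) :
    slide 0 (prismHi n B D 0) x ∈ face n B D := by
  rw [← prism_eq_box] at hx
  refine ⟨by rw [slide_same, prismHi_zero], fun j hj => ?_⟩
  rw [slide_of_ne hj]
  exact hx.2 j hj

omit [NeZero n] in
theorem HasTrace.midpoint {Ω S : Set (Pt n)} {f g F β : Pt n → ℝ} (hf : HasTrace Ω S f β)
    (hg : HasTrace Ω S g β) (hF : F =ᵐ[volume.restrict Ω] fun x => 1 / 2 * f x + 1 / 2 * g x) :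
    HasTrace Ω S F β := by
  obtain ⟨u, hu, hfu, hub⟩ := hf
  obtain ⟨v, hv, hgv, hvb⟩ := hg
  refine ⟨fun x => 1 / 2 * u x + 1 / 2 * v x,
    (continuousOn_const.mul hu).add (continuousOn_const.mul hv), ?_, fun x hx => ?_⟩
  · filter_upwards [hF, hfu, hgv] with x h1 h2 h3
    rw [h1, h2, h3]
  · simp only [hub x hx, hvb x hx]
    ring

/-- Boundary conditions are affine, so midpoints keep the same data and differences have homogeneous
ones; the norm of a midpoint stays below R by the parallelogram law. -/
theorem feasible_ballB {A B D : ℝ} (hAB : A < B) (hD : 0 < D) (h : ℝ)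
    (g₀ g₁ : Fin (k + 1) → Pt n → ℝ) {R : ℝ} (hR : 0 < R) :
    Feasible (prismLo n A D) (prismHi n B D) R.toNNReal (ballB A B D h g₀ g₁ R) := by
  have hΩ := isOpen_box (prismLo n A D) (prismHi n B D)
  have hsq : ∀ f : Pt n → ℝ, sobolevNorm (box (prismLo n A D) (prismHi n B D)) (mInd n) f < R ↔
      sobolevNormSq (box (prismLo n A D) (prismHi n B D)) (mInd n) f < R ^ 2 := fun f =>
    Real.sqrt_lt' hR
  refine ⟨fun V hV => ⟨fun i => ?_, fun i => ?_⟩, fun V hV W hW i => ?_, fun V hV W hW i => ?_⟩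
  · rw [← prism_eq_box]; exact (hV i).1
  · have h1 := (hV i).2.1
    rw [prism_eq_box, hsq] at h1
    rw [Real.coe_toNNReal R hR.le]
    exact h1.le
  · have hVi := hV i
    have hWi := hW i
    rw [prism_eq_box, hsq] at hVi hWi ⊢
    obtain ⟨hVm, hVR, hV0, hV1⟩ := hVi
    obtain ⟨hWm, hWR, hW0, hW1⟩ := hWi
    refine ⟨hVm.comb hWm _ _, ?_, hV0.midpoint hW0 Filter.EventuallyEq.rfl,
      hV1.midpoint hW1 (hVm.weakDeriv_comb hΩ hWm _ _ ?_)⟩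
    · rw [sobolevNormSq_midpoint hΩ hVm hWm]
      have := sobolevNormSq_nonneg (box (prismLo n A D) (prismHi n B D)) (mInd n) fun x => V i x - W i x
      linarith
    · have := two_le_mInd n
      rw [Finset.sum_pi_single']
      simp only [Finset.mem_univ, if_true]
      omega
  · have hVi := hV i
    have hWi := hW i
    rw [prism_eq_box] at hVi hWi
    exact admN_of_trace (prismLo_lt_prismHi hAB hD) (two_le_mInd n) (fun x hx => slide_mem_face hx)
      hVi.1 hWi.1 hVi.2.2.1 hWi.2.2.1 hVi.2.2.2 hWi.2.2.2

theorem Jfun_eq_tikF (A B D ε h c lam α : ℝ) (V : Fin (k + 1) → Pt n → ℝ) :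
    Jfun A B D ε h c lam α V =
      tikF (prismLo n A D) (prismHi n B D) ε h lam (Real.exp (-2 * lam * c)) α V := by
  unfold Jfun tikF resF wint mon
  rw [sq_vecSobolevNorm, prism_eq_box]
  simp only [pow_zero, one_mul, sq (Lop _ _ _ _ _ _)]

end Prism

/-! ### Distance of the minimizer to the exact solution, and the theorem. -/

section Stability

variable {n k : ℕ} [NeZero n] {a b : Fin n → ℝ}

/-- The weight increases in x₀ > 0, so its infimum over the box is its value at the left face; this
is the origin of A² in the exponent. -/
theorem exp_mul_integral_sq_le_wint (ha : 0 ≤ a 0) {lam : ℝ} (hl : 0 ≤ lam) {f : Pt n → ℝ}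
    (hf : MemLp f 2 (volume.restrict (box a b))) :
    Real.exp (2 * lam * a 0 ^ 2) * ∫ x in box a b, f x ^ 2 ≤ wint a b f f (mon lam 0) := by
  rw [← integral_const_mul]
  refine setIntegral_mono_on (hf.integrable_sq.const_mul _)
    (integrable_wint hf hf (contDiff_mon lam 0).continuous) (measurableSet_box a b) fun x hx => ?_
  have h1 : Real.exp (2 * lam * a 0 ^ 2) ≤ mon lam 0 (x 0) := by
    rw [mon, pow_zero, one_mul]
    have := (hx 0).1.le
    gcongr
  calc _ ≤ mon lam 0 (x 0) * f x ^ 2 := mul_le_mul_of_nonneg_right h1 (sq_nonneg _)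
    _ = _ := by ring

/-- A competitor that does no worse than a solution `W` of the system is close to `W`. -/
theorem exists_jet_stability (hab : ∀ l, a l < b l) (ha : 0 < a 0) (ε : ℝ) {h : ℝ} (hh : 0 < h)
    (k : ℕ) (N : NNReal) : ∃ lam₁ C : ℝ, 1 ≤ lam₁ ∧ 0 ≤ C ∧ ∀ lam : ℝ, lam₁ ≤ lam →
    ∀ V W : Fin (k + 1) → Pt n → ℝ, Reg a b N V → Reg a b N W →
      (∀ i, AdmN a b (jetOf (box a b) fun x => V i x - W i x)) →
      (∀ i, ∀ᵐ x ∂(volume.restrict (box a b)), Lop (box a b) ε h W i x = 0) →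
      ∀ c α : ℝ, 0 ≤ α →
      tikF a b ε h lam (Real.exp (-2 * lam * c)) α V ≤ tikF a b ε h lam (Real.exp (-2 * lam * c)) α W →
      ∀ i ι, ∫ x in box a b, jetOf (box a b) (fun x => V i x - W i x) ι x ^ 2 ≤
        C * (Real.sqrt (lam * α) * Real.exp (-lam * (a 0 ^ 2 - c))) ^ 2 := by
  obtain ⟨lam₁, hl₁, H₁⟩ := exists_lapF_le hab ha ε hh k N
  obtain ⟨C₂, hC₂, H₂⟩ := exists_carleman_vec hab ha k
  refine ⟨lam₁, C₂ * (4 * ((k + 1) * (N : ℝ) ^ 2)), hl₁, by positivity,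
    fun lam hl V W hV hW hadm hL c α hα hJ i ι => ?_⟩
  have hl0 : 0 ≤ lam := by linarith
  have hd := fun i => (hV.mem i).sub (hW.mem i)
  have h1 := H₁ lam hl V W hV hW hadm hL
  have h2 := (H₂ lam (hl₁.trans hl) (fun i x => V i x - W i x) hd hadm).2 i ι
  have h3 := exp_mul_integral_sq_le_wint ha.le hl0 ((hd i).memLp_jetOf (isOpen_box a b) (two_le_mInd n) ι)
  have hW0 : resF a b ε h lam W = 0 := by
    refine Finset.sum_eq_zero fun i _ => ?_
    refine integral_eq_zero_of_ae ?_
    filter_upwards [hL i] with x hx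
    simp [hx]
  have hWN : vecNormSq (box a b) (mInd n) W ≤ (k + 1) * (N : ℝ) ^ 2 := by
    unfold vecNormSq
    refine (Finset.sum_le_sum fun i _ => hW.bound i).trans_eq ?_
    simp
  -- The exact solution has zero residual, so its functional value is the regularization alone, of
  -- size α.
  have h4 : Real.exp (-2 * lam * c) * resF a b ε h lam V ≤ α * ((k + 1) * (N : ℝ) ^ 2) := by
    unfold tikF at hJ
    rw [hW0] at hJ
    have h5 := mul_le_mul_of_nonneg_left hWN hα
    have h6 := mul_nonneg hα (vecNormSq_nonneg (Ω := box a b) (mInd n) V)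
    linarith
  set I := ∫ x in box a b, jetOf (box a b) (fun x => V i x - W i x) ι x ^ 2
  set Q := resF a b ε h lam V
  have h5 : Real.exp (2 * lam * a 0 ^ 2) * I ≤ C₂ * lam * (4 * Q) :=
    h3.trans (h2.trans (mul_le_mul_of_nonneg_left h1 (by positivity)))
  -- Dividing by the lower bound of the weight and by the prefactor of the residual yields exactly
  -- the square of the claimed rate.
  have hexp : Real.exp (-lam * (a 0 ^ 2 - c)) ^ 2 * (Real.exp (2 * lam * a 0 ^ 2) *
      Real.exp (-2 * lam * c)) = 1 := by
    rw [← Real.exp_nat_mul, ← Real.exp_add, ← Real.exp_add, Real.exp_eq_one_iff]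
    push_cast; ring
  have h6 : (Real.exp (2 * lam * a 0 ^ 2) * Real.exp (-2 * lam * c)) * I ≤
      C₂ * (4 * ((k + 1) * (N : ℝ) ^ 2)) * (lam * α) := by
    calc _ = Real.exp (-2 * lam * c) * (Real.exp (2 * lam * a 0 ^ 2) * I) := by ring
      _ ≤ Real.exp (-2 * lam * c) * (C₂ * lam * (4 * Q)) := by gcongr
      _ = 4 * C₂ * lam * (Real.exp (-2 * lam * c) * Q) := by ring
      _ ≤ 4 * C₂ * lam * (α * ((k + 1) * (N : ℝ) ^ 2)) := by gcongr
      _ = _ := by ring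
  rw [mul_pow, Real.sq_sqrt (by positivity)]
  calc I = Real.exp (-lam * (a 0 ^ 2 - c)) ^ 2 * ((Real.exp (2 * lam * a 0 ^ 2) *
      Real.exp (-2 * lam * c)) * I) := by rw [← mul_assoc, hexp, one_mul]
    _ ≤ Real.exp (-lam * (a 0 ^ 2 - c)) ^ 2 * (C₂ * (4 * ((k + 1) * (N : ℝ) ^ 2)) * (lam * α)) := by
      gcongr
    _ = _ := by ring

end Stability

end Cip

theorem theorem5p3 (n : ℕ) [NeZero n] (A B D : ℝ) (hA : 0 < A) (hAB : A < B) (hD : 0 < D)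
    (ε T h : ℝ) (k : ℕ) (hε : 0 < ε) (hh : 0 < h) (hk : 3 ≤ k) (hT : T = ε + k * h)
    (R α : ℝ) (hR : 0 < R) (hα0 : 0 < α) (hα1 : α < 1) :
    ∃ lam₁ C₁ : ℝ, 1 ≤ lam₁ ∧ 0 < C₁ ∧
      ∀ c : ℝ, 0 < c →
      ∀ (g₀ g₁ Vstar : Fin (k + 1) → Cip.Pt n → ℝ),
        Vstar ∈ Cip.ballB A B D h g₀ g₁ R →
        (∀ i, ∀ᵐ x ∂(volume.restrict (Cip.prism n A B D)),
          Cip.Lop (Cip.prism n A B D) ε h Vstar i x = 0) →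
        ∀ lam : ℝ, lam₁ ≤ lam →
          (∃ V, Cip.IsMinimizer A B D ε h c lam α g₀ g₁ R V) ∧
          (∀ V W, Cip.IsMinimizer A B D ε h c lam α g₀ g₁ R V →
            Cip.IsMinimizer A B D ε h c lam α g₀ g₁ R W →
            ∀ i, V i =ᵐ[volume.restrict (Cip.prism n A B D)] W i) ∧
          (∀ Vmin, Cip.IsMinimizer A B D ε h c lam α g₀ g₁ R Vmin →
            Cip.vecSobolevNorm (Cip.prism n A B D) 2 (fun i x => Vmin i x - Vstar i x)
              ≤ C₁ * Real.sqrt (lam * α) * Real.exp (-lam * (A ^ 2 - c)) ∧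
            MemLp (fun x => Cip.aRec (Cip.prism n A B D) ε T h Vmin x
              - Cip.aRec (Cip.prism n A B D) ε T h Vstar x) 2
              (volume.restrict (Cip.prism n A B D)) ∧
            Cip.l2Norm (Cip.prism n A B D) (fun x => Cip.aRec (Cip.prism n A B D) ε T h Vmin x
              - Cip.aRec (Cip.prism n A B D) ε T h Vstar x)
              ≤ C₁ * Real.sqrt (lam * α) * Real.exp (-lam * (A ^ 2 - c))) := by
  have hab : ∀ j, Cip.prismLo n A D j < Cip.prismHi n B D j := Cip.prismLo_lt_prismHi hAB hD
  have ha : 0 < Cip.prismLo n A D 0 := by simpa using hA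
  have hεT : ε < T := by
    rw [hT]
    have : (0 : ℝ) < k := by exact_mod_cast (show 0 < k by omega)
    linarith [mul_pos this hh]
  -- The bound that `Feasible.closure` provides on the closure of B(R). All thresholds and constants
  -- are taken for it, before `c` and the data are introduced, and so do not depend on them.
  set N : NNReal := 2 * R.toNNReal + 1
  obtain ⟨l₁, hl₁, H₁⟩ := Cip.exists_resF_midpoint_le hab ha ε hh k N
  obtain ⟨l₂, C₂, -, hC₂, H₂⟩ := Cip.exists_jet_stability hab ha ε hh k N
  obtain ⟨C₃, hC₃, H₃⟩ := Cip.exists_aRec_sub_le hab hh hεT k N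
  set K : ℝ := (k + 1) * Cip.numIdx n + C₃ with hK
  have hK0 : 0 ≤ K := by positivity
  -- K collects the number of derivatives in the H² norm and the Lipschitz constant of the
  -- coefficient, so one constant serves both estimates. The added 1 makes it positive.
  refine ⟨max l₁ l₂, Real.sqrt (K * C₂) + 1, hl₁.trans (le_max_left _ _), by positivity, ?_⟩
  intro c _ g₀ g₁ Vstar hVs hLs lam hlam
  have hfeas := Cip.feasible_ballB hAB hD h g₀ g₁ hR
  have hcl := hfeas.closure
  have hmem := fun V hV => (hfeas.reg V hV).mem
  have hΩ := Cip.isOpen_box (Cip.prismLo n A D) (Cip.prismHi n B D)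
  -- The exact solution makes the closure nonempty and is the competitor in the stability estimate.
  have hs := Cip.subset_sobolevClosure hVs (hmem _ hVs) hΩ
  have hmid := H₁ lam ((le_max_left _ _).trans hlam)
  have hE := (Real.exp_pos (-2 * lam * c)).le
  simp only [Cip.IsMinimizer, Cip.Jfun_eq_tikF]
  rw [Cip.prism_eq_box] at hLs ⊢
  refine ⟨?_, fun V W hV hW => hcl.minimizer_unique hE hα0 hmid hV.1 hW.1 hV.2 hW.2, fun V hV => ?_⟩
  · exact hcl.exists_minimizer hab hmem hh hE hα0 hmid ⟨_, hs⟩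
  have hreg := hcl.reg V hV.1
  have hregs := hcl.reg _ hs
  have hjet := H₂ lam ((le_max_right _ _).trans hlam) V Vstar hreg hregs (hcl.adm V hV.1 _ hs) hLs c α
    hα0.le (hV.2 _ hs)
  rw [Cip.prismLo_zero] at hjet
  set r := Real.sqrt (lam * α) * Real.exp (-lam * (A ^ 2 - c)) with hr
  have hr0 : 0 ≤ r := by positivity
  have key : ∀ X : ℝ, X ≤ K * (C₂ * r ^ 2) →
      Real.sqrt X ≤ (Real.sqrt (K * C₂) + 1) * Real.sqrt (lam * α) * Real.exp (-lam * (A ^ 2 - c)) := by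
    intro X hX
    rw [mul_assoc, ← hr]
    refine Real.sqrt_le_iff.2 ⟨by positivity, hX.trans ?_⟩
    have h1 := Real.sq_sqrt (mul_nonneg hK0 hC₂)
    have h2 : K * (C₂ * r ^ 2) = (Real.sqrt (K * C₂) * r) ^ 2 := by rw [mul_pow _ r, h1]; ring
    rw [h2]
    gcongr
    linarith
  have hY : 0 ≤ C₂ * r ^ 2 := by positivity
  obtain ⟨hmemLp, hint⟩ := H₃ V Vstar hreg hregs
  refine ⟨?_, hmemLp, key _ ((hint _ hjet).trans ?_)⟩
  · rw [← Real.sqrt_sq (Cip.vecSobolevNorm_nonneg _ _), Cip.sq_vecSobolevNorm]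
    refine key _ ?_
    unfold Cip.vecNormSq
    refine (Finset.sum_le_sum fun i _ => Cip.sobolevNormSq_two_le hΩ ((hreg.mem i).sub (hregs.mem i)).1
      (hjet i)).trans ?_
    rw [Finset.sum_const, Finset.card_univ, Fintype.card_fin, nsmul_eq_mul, hK]
    push_cast
    nlinarith [mul_nonneg hC₃ hY]
  · rw [hK]
    refine mul_le_mul_of_nonneg_right ?_ hY
    have : (0 : ℝ) ≤ (k + 1) * Cip.numIdx n := by positivity
    linarith
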